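/- **Generic generalized regular representations of $TL_\infty$.** Let $q\in\mathbb C^\times$ not be a root of unity and suppose that $\delta=q+q^{-1}$ is real and $\delta\ge 0$. For $n\in\mathbb N\cup\{\infty\}$ let $TL_n=TL_n(\delta)$ be the complex unital algebra with generators $e_i$, $1\le i<n$, and relations $e_i^2=\delta e_i$, $e_ie_{i\pm1}e_i=e_i$, $e_ie_j=e_je_i$ for $|i-j|>1$. Let $\dagger$ be the linear anti-automorphism that fixes every $e_i$ (reflection of diagrams), and let $*$ be its conjugate-linear version. *Trace.* Let $V_{n,p}$ be the standard representation of $TL_n$ on link states with $n$ points and $p$ cups, and $t_{n,p}$ its (unnormalised) matrix trace. For real $\gamma>0$ let $c_{0,0}=c_{1,0}=1$, $c_{n,0}=c_{n-1,0}-\gamma c_{n-2,0}$, $c_{n,p}=\gamma^pc_{n-2p,0}$, and put $t_\gamma=\sum_pc_{n,p}t_{n,p}$ and $\langle a,b\rangle_\gamma=t_\gamma(ab^*)$ on $TL_n$. *Representation.* An infinite planar diagram is a noncrossing perfect matching of the top points $1,2,3,\dots$ and the bottom points $1,2,3,\dots$ of a half-infinite strip. Let $w$ be a generalized infinite TL diagram,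 that is, one with finitely many through strands (strands joining top to bottom), and let $n$ be their number. Let $\mathcal V(w)$ be the space of finite linear combinations of diagrams generated from $w$ by $TL_\infty\otimes TL_\infty$ acting by $(x\otimes y)v=xvy^\dagger$ (concatenation, a closed loop being replaced by $\delta$). For $0\le k\le n$, $k\equiv n\bmod 2$, let $\mathcal I_k(w)\subseteq\mathcal V(w)$ be the invariant subspace spanned by the diagrams in $\mathcal V(w)$ with at most $k$ through strands ($\mathcal I_k(w)=0$ for $k<0$), and $\mathcal V_k(w)=\mathcal I_k(w)/\mathcal I_{k-2}(w)$. *Inner product.* For a diagram $x$, its restriction ${\downarrow_m}x$ to the first $m$ top and the first $m$ bottom points keeps the strands that stay among these points, and cuts those that leave; it is defined if the numbers of cut ends at the top and at the bottom agree, and these ends are then joined, top to bottom in the planar way, so that ${\downarrow_m}x$ is a diagram in $TL_m$. Let $c({\downarrow_m}w)$ be the number of cups on the top side of ${\downarrow_m}w$. For diagrams $x,y\in\mathcal V(w)$ put $$\langle x,y\rangle_{w,\gamma}=\lim_{m\to\infty}\frac{\langle{\downarrow_m}x,{\downarrow_m}y\rangle_\gamma}{(\delta^2\gamma)^{c({\downarrow_m}w)}},$$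 the limit being taken over those $m$ for which ${\downarrow_m}w$ is defined, and extend sesquilinearly to $\mathcal V(w)$. Then: 1. There are infinitely many such $m$; for all diagrams $x,y\in\mathcal V(w)$, ${\downarrow_m}x$ and ${\downarrow_m}y$ are defined for all large such $m$, and the limit exists. 2. If $\delta>2$, and moreover $\gamma<\frac14\sec^2\!\big(\frac{\pi}{n+1}\big)$ in case $n\ge2$, then $\langle\cdot,\cdot\rangle_{w,\gamma}$ is a positive definite Hermitian form on $\mathcal V(w)$. (For $n=0,1$ every $\gamma>0$ is allowed.) 3. Whenever $\langle\cdot,\cdot\rangle_{w,\gamma}$ is a positive definite Hermitian form, let $\mathcal H(w)$ be the Hilbert space completion of $\mathcal V(w)$. Then the action of $TL_\infty\otimes TL_\infty$ on $\mathcal V(w)$ extends to an action on $\mathcal H(w)$ by bounded operators, and there are pairwise orthogonal closed invariant subspaces $\mathcal H_k(w)$ with $$\mathcal H(w)=\bigoplus_{\substack{0\le k\le n\\ k\equiv n\bmod 2}}\mathcal H_k(w).$$ For each such $k$ the module $\mathcal V_k(w)$ is irreducible, and $\mathcal H_k(w)$ is the closure of a copy of it: there is a $TL_\infty\otimes TL_\infty$-equivariant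 linear section $\iota_k:\mathcal V_k(w)\to\mathcal I_k(w)$ of the quotient map, and $\mathcal H_k(w)=\overline{\iota_k(\mathcal V_k(w))}$. -/

import Mathlib

open scoped TensorProduct

/-- A planar (Temperley-Lieb) diagram in a half-infinite strip. It has top points `0, 1, 2, …` and
bottom points `0, 1, 2, …`, matched in pairs by strands without crossings. The integer `p ≥ 0` is the
top point `p`, and the integer `p < 0` is the bottom point `-1 - p`; so `ℤ` lists all the points in
their order along the boundary of the strip (from the far bottom, through the left edge, to the far
top), and `partner` sends a point to the other end of its strand. -/
structure PlanarDiagram where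
  partner : ℤ → ℤ
  partner_partner : ∀ p, partner (partner p) = p
  partner_ne : ∀ p, partner p ≠ p
  noncrossing : ∀ a b, ¬ (a < b ∧ b < partner a ∧ partner a < partner b)

namespace PlanarDiagram

@[ext] theorem ext' {d e : PlanarDiagram} (h : ∀ p, d.partner p = e.partner p) : d = e := by
  cases d; cases e; congr; exact funext h

theorem inside_iff (d : PlanarDiagram) (x y : ℤ) (h1 : y ≠ x) (h2 : y ≠ d.partner x) :
    (x < y ∧ y < d.partner x) ↔ (x < d.partner y ∧ d.partner y < d.partner x) := by
  have e1 := d.partner_partner x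
  have e2 := d.partner_partner y
  have a1 := d.noncrossing x y
  have a2 := d.noncrossing x (d.partner y)
  have a3 := d.noncrossing (d.partner y) x
  have a4 := d.noncrossing y x
  have h3 : d.partner y ≠ x := fun h => h2 (by rw [← h, e2])
  have h4 : d.partner y ≠ d.partner x := fun h => h1 (by rw [← e1, ← h, e2])
  rw [e2] at a2 a3
  omega

/-- The identity diagram: every strand is vertical. -/
def one : PlanarDiagram where
  partner p := -1 - p
  partner_partner p := by ring
  partner_ne p := by omega
  noncrossing a b := by omega

/-- The matching after a generator is attached at the boundary points `j, j + 1`: the points `j` and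
`j + 1` become partners, and so do their former partners. -/
def hookFun (f : ℤ → ℤ) (j p : ℤ) : ℤ :=
  if p = j then j + 1
  else if p = j + 1 then j
  else if p = f j then f (j + 1)
  else if p = f (j + 1) then f j
  else f p

/-- The diagram obtained from `d` by attaching a Temperley-Lieb generator at the neighbouring points
`j` and `j + 1` (and removing the closed loop, if there is one). -/
def hook (d : PlanarDiagram) (j : ℤ) : PlanarDiagram where
  partner := hookFun d.partner j
  partner_partner p := by
    have := d.partner_partner
    have := d.partner_ne
    grind [hookFun]
  partner_ne p := by
    have := d.partner_partner
    have := d.partner_ne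
    grind [hookFun]
  noncrossing x y := by
    have e0 := d.partner_partner
    have n0 := d.partner_ne
    have i1 := d.noncrossing x y
    have i2 := d.inside_iff x j
    have i3 := d.inside_iff x (j+1)
    have i4 := d.inside_iff y j
    have i5 := d.inside_iff y (j+1)
    have ex := e0 x
    have ey := e0 y
    have ej := e0 j
    have ej1 := e0 (j + 1)
    have i6 := d.inside_iff (d.partner y) j
    have i7 := d.inside_iff (d.partner y) (j+1)
    rw [ey] at i6 i7
    unfold hookFun
    by_cases x1 : x = j
    · subst x1; simp only [if_true]; omega
    by_cases x2 : x = j + 1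
    · subst x2; simp only [if_true]; split_ifs <;> omega
    by_cases y1 : y = j
    · subst y1; simp only [if_true]; omega
    by_cases y2 : y = j + 1
    · subst y2; simp only [if_true, x1, x2, if_false]; split_ifs <;> omega
    by_cases x3 : x = d.partner j <;> by_cases x4 : x = d.partner (j+1) <;>
    by_cases y3 : y = d.partner j <;> by_cases y4 : y = d.partner (j+1) <;>
    simp only [if_true, x1, x2, x3, x4, y1, y2, y3, y4, if_false] <;> grind (splits := 30)

theorem hook_hook (d : PlanarDiagram) (j : ℤ) : (d.hook j).hook j = d.hook j := by
  have e0 := d.partner_partner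
  have n0 := d.partner_ne
  ext p
  simp only [hook, hookFun]
  grind (splits := 30)

theorem hook_of_eq (d : PlanarDiagram) (j : ℤ) (h : d.partner j = j + 1) : d.hook j = d := by
  have e0 := d.partner_partner
  ext p
  simp only [hook, hookFun]
  grind (splits := 30)

theorem hook_zigzag (d : PlanarDiagram) (j k : ℤ) (hk : k = j + 1 ∨ j = k + 1) :
    ((d.hook j).hook k).hook j = d.hook j := by
  have e0 := d.partner_partner
  have n0 := d.partner_ne
  ext p
  simp only [hook, hookFun]
  rcases hk with rfl | rfl <;> grind (splits := 40)

theorem hook_comm (d : PlanarDiagram) (j k : ℤ) (hk : j + 1 < k) :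
    (d.hook j).hook k = (d.hook k).hook j := by
  have e0 := d.partner_partner
  have n0 := d.partner_ne
  ext p
  simp only [hook, hookFun]
  grind (splits := 40)


/-- The top end points of the through strands (strands that join the top to the bottom). -/
def throughStrands (d : PlanarDiagram) : Set ℤ := {p | 0 ≤ p ∧ d.partner p < 0}

/-- The number of through strands, possibly infinite. A generalized infinite Temperley-Lieb diagram is
a diagram for which this is finite. -/
noncomputable def numThrough (d : PlanarDiagram) : ℕ∞ := d.throughStrands.encard

theorem numThrough_eq (d : PlanarDiagram) :
    d.numThrough = {p : ℤ | p < 0 ∧ 0 ≤ d.partner p}.encard := by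
  have e0 := d.partner_partner
  have hinj : Set.InjOn d.partner d.throughStrands := fun a _ b _ h => by
    rw [← e0 a, h, e0 b]
  rw [numThrough, ← hinj.encard_image]
  congr 1
  ext p
  constructor
  · rintro ⟨a, ⟨h1, h2⟩, rfl⟩
    exact ⟨h2, by rw [e0]; exact h1⟩
  · rintro ⟨h1, h2⟩
    exact ⟨d.partner p, ⟨h2, by rw [e0]; exact h1⟩, e0 p⟩

theorem numThrough_hook_le (d : PlanarDiagram) (j : ℤ) (hj : j ≠ -1) :
    (d.hook j).numThrough ≤ d.numThrough := by
  have e0 := d.partner_partner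
  have n0 := d.partner_ne
  by_cases h : 0 ≤ j
  · rw [numThrough_eq, numThrough_eq]
    apply Set.encard_le_encard
    rintro p ⟨h1, h2⟩
    refine ⟨h1, ?_⟩
    simp only [hook, hookFun] at h2
    grind
  · apply Set.encard_le_encard
    rintro p ⟨h1, h2⟩
    refine ⟨h1, ?_⟩
    simp only [hook, hookFun] at h2
    grind

end PlanarDiagram

noncomputable section

open PlanarDiagram



/-- Indices of the generators of the Temperley-Lieb algebra on `n` strands, `n ≤ ∞`. The strands are
numbered from `0`, so the index `i` (with `i + 1 < n`) stands for the generator that is usually written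
`e_{i+1}` and acts on the strands `i` and `i + 1`. -/
abbrev TLIndex (n : ℕ∞) : Type := {i : ℕ // ((i + 1 : ℕ) : ℕ∞) < n}

/-- The relations `e_i² = δ e_i`, `e_i e_k e_i = e_i` for `|i - k| = 1`, and `e_i e_k = e_k e_i` for
`|i - k| > 1`. -/
inductive TLRel (δ : ℂ) (n : ℕ∞) :
    FreeAlgebra ℂ (TLIndex n) → FreeAlgebra ℂ (TLIndex n) → Prop
  | square (i : TLIndex n) :
      TLRel δ n (FreeAlgebra.ι ℂ i * FreeAlgebra.ι ℂ i) (δ • FreeAlgebra.ι ℂ i)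
  | zigzag (i k : TLIndex n) (h : k.1 = i.1 + 1 ∨ i.1 = k.1 + 1) :
      TLRel δ n (FreeAlgebra.ι ℂ i * FreeAlgebra.ι ℂ k * FreeAlgebra.ι ℂ i) (FreeAlgebra.ι ℂ i)
  | comm (i k : TLIndex n) (h : i.1 + 1 < k.1) :
      TLRel δ n (FreeAlgebra.ι ℂ i * FreeAlgebra.ι ℂ k) (FreeAlgebra.ι ℂ k * FreeAlgebra.ι ℂ i)

/-- The Temperley-Lieb algebra over `ℂ` with loop parameter `δ` on `n` strands (`n = ⊤`: infinitely
many strands, that is, the union of the finite ones). -/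
def TL (δ : ℂ) (n : ℕ∞) : Type := RingQuot (TLRel δ n)

namespace TL

variable {δ : ℂ} {n : ℕ∞}

instance : Ring (TL δ n) := inferInstanceAs (Ring (RingQuot (TLRel δ n)))
instance : Algebra ℂ (TL δ n) := inferInstanceAs (Algebra ℂ (RingQuot (TLRel δ n)))

/-- The quotient map from the free algebra. -/
def mk (δ : ℂ) (n : ℕ∞) : FreeAlgebra ℂ (TLIndex n) →ₐ[ℂ] TL δ n :=
  RingQuot.mkAlgHom ℂ (TLRel δ n)

theorem mk_surjective : Function.Surjective (mk δ n) := RingQuot.mkAlgHom_surjective ℂ (TLRel δ n)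

theorem mk_rel {a b : FreeAlgebra ℂ (TLIndex n)} (h : TLRel δ n a b) : mk δ n a = mk δ n b :=
  RingQuot.mkAlgHom_rel ℂ h

/-- The generators. -/
def gen (δ : ℂ) (i : TLIndex n) : TL δ n := mk δ n (FreeAlgebra.ι ℂ i)

/-- The universal property. -/
def lift {B : Type*} [Ring B] [Algebra ℂ B] (f : TLIndex n → B)
    (hsq : ∀ i, f i * f i = δ • f i)
    (hzz : ∀ i k : TLIndex n, (k.1 = i.1 + 1 ∨ i.1 = k.1 + 1) → f i * f k * f i = f i)
    (hcm : ∀ i k : TLIndex n, i.1 + 1 < k.1 → f i * f k = f k * f i) : TL δ n →ₐ[ℂ] B :=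
  RingQuot.liftAlgHom ℂ ⟨FreeAlgebra.lift ℂ f, by
    intro x y h
    cases h with
    | square i => simpa using hsq i
    | zigzag i k h => simpa using hzz i k h
    | comm i k h => simpa using hcm i k h⟩

theorem gen_sq (i : TLIndex n) : gen δ i * gen δ i = δ • gen δ i := by
  simpa [gen] using mk_rel (TLRel.square (δ := δ) i)

theorem gen_zigzag (i k : TLIndex n) (h : k.1 = i.1 + 1 ∨ i.1 = k.1 + 1) :
    gen δ i * gen δ k * gen δ i = gen δ i := by
  simpa [gen] using mk_rel (TLRel.zigzag (δ := δ) i k h)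

theorem gen_comm (i k : TLIndex n) (h : i.1 + 1 < k.1) :
    gen δ i * gen δ k = gen δ k * gen δ i := by
  simpa [gen] using mk_rel (TLRel.comm (δ := δ) i k h)

theorem lift_gen {B : Type*} [Ring B] [Algebra ℂ B] (f : TLIndex n → B) (hsq : ∀ i, f i * f i = δ • f i)
    (hzz) (hcm) (i : TLIndex n) : lift (δ := δ) f hsq hzz hcm (gen δ i) = f i :=
  (RingQuot.liftAlgHom_mkAlgHom_apply ℂ _ _ _).trans (FreeAlgebra.lift_ι_apply _ _)

theorem induction {C : TL δ n → Prop} (hs : ∀ c : ℂ, C (algebraMap ℂ _ c)) (hg : ∀ i, C (gen δ i))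
    (hm : ∀ a b, C a → C b → C (a * b)) (ha : ∀ a b, C a → C b → C (a + b)) (x : TL δ n) : C x := by
  obtain ⟨y, rfl⟩ := mk_surjective x
  induction y using FreeAlgebra.induction with
  | grade0 r => simpa using hs r
  | grade1 i => exact hg i
  | mul a b h1 h2 => simpa using hm _ _ h1 h2
  | add a b h1 h2 => simpa using ha _ _ h1 h2

/-- The linear anti-automorphism that fixes every generator; on diagrams it is the reflection that
exchanges top and bottom. -/
def dagger : TL δ n →ₐ[ℂ] (TL δ n)ᵐᵒᵖ :=
  lift (fun i => MulOpposite.op (gen δ i))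
    (fun i => by rw [← MulOpposite.op_mul, gen_sq, MulOpposite.op_smul])
    (fun i k h => by
      rw [← MulOpposite.op_mul, ← MulOpposite.op_mul, ← mul_assoc, gen_zigzag i k h])
    (fun i k h => by rw [← MulOpposite.op_mul, ← MulOpposite.op_mul, gen_comm i k h])

end TL

/-- Finite linear combinations of planar diagrams. -/
def DiagramSpace : Type := PlanarDiagram →₀ ℂ

instance : AddCommGroup DiagramSpace := inferInstanceAs (AddCommGroup (PlanarDiagram →₀ ℂ))
instance : Module ℂ DiagramSpace := inferInstanceAs (Module ℂ (PlanarDiagram →₀ ℂ))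

/-- The coefficients of a linear combination of diagrams. -/
def DiagramSpace.coord : DiagramSpace ≃ₗ[ℂ] (PlanarDiagram →₀ ℂ) := LinearEquiv.refl ℂ _

/-- A diagram as a vector. -/
def basisDiagram (d : PlanarDiagram) : DiagramSpace := Finsupp.single d 1

/-- Multiplication of diagrams by the generator at the boundary points `j, j + 1`; a closed loop is
replaced by the factor `δ`. -/
def hookOp (δ : ℂ) (j : ℤ) : Module.End ℂ (DiagramSpace) :=
  Finsupp.linearCombination ℂ (M := DiagramSpace) fun d : PlanarDiagram =>
    (if d.partner j = j + 1 then δ else 1) • basisDiagram (d.hook j)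

theorem hookOp_basis (δ : ℂ) (j : ℤ) (d : PlanarDiagram) :
    hookOp δ j (basisDiagram d) =
      (if d.partner j = j + 1 then δ else 1) • basisDiagram (d.hook j) :=
  (Finsupp.linearCombination_single ℂ (M := DiagramSpace) _ _).trans (one_smul ℂ _)

theorem DiagramSpace.hom_ext {f g : Module.End ℂ (DiagramSpace)}
    (h : ∀ d, f (basisDiagram d) = g (basisDiagram d)) : f = g :=
  Finsupp.lhom_ext' fun d => LinearMap.ext_ring (h d)

theorem ite_mul_ite_congr {P Q R S : Prop} [Decidable P] [Decidable Q] [Decidable R] [Decidable S]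
    (δ : ℂ) (h1 : P ∧ Q ↔ R ∧ S) (h2 : P ∨ Q ↔ R ∨ S) :
    (if P then δ else 1) * (if Q then δ else 1) = (if R then δ else 1) * (if S then δ else 1) := by
  by_cases hP : P <;> by_cases hQ : Q <;> by_cases hR : R <;> by_cases hS : S <;> simp_all

theorem hookOp_sq (δ : ℂ) (j : ℤ) : hookOp δ j * hookOp δ j = δ • hookOp δ j := by
  apply DiagramSpace.hom_ext
  intro d
  have h : (d.hook j).partner j = j + 1 := by simp [hook, hookFun]
  simp only [Module.End.mul_apply, LinearMap.smul_apply, hookOp_basis, map_smul, h, hook_hook, if_true]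
  exact smul_comm _ _ _

theorem hookOp_zigzag (δ : ℂ) (j k : ℤ) (hk : k = j + 1 ∨ j = k + 1) :
    hookOp δ j * hookOp δ k * hookOp δ j = hookOp δ j := by
  apply DiagramSpace.hom_ext
  intro d
  have e0 := d.partner_partner
  have n0 := d.partner_ne
  have h1 : (d.hook j).partner k ≠ k + 1 := by
    simp only [hook, hookFun]; grind
  have h2 : ((d.hook j).hook k).partner j ≠ j + 1 := by
    simp only [hook, hookFun]; grind
  simp only [Module.End.mul_apply, hookOp_basis, map_smul, h1, h2, hook_zigzag d j k hk,
    if_false, one_smul]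

theorem hookOp_comm (δ : ℂ) (j k : ℤ) (hk : j + 1 < k) :
    hookOp δ j * hookOp δ k = hookOp δ k * hookOp δ j := by
  apply DiagramSpace.hom_ext
  intro d
  have e0 := d.partner_partner
  have n0 := d.partner_ne
  have h1 : ((d.partner k = k + 1) ∧ ((d.hook k).partner j = j + 1) ↔
    (d.partner j = j + 1) ∧ ((d.hook j).partner k = k + 1)) := by
    simp only [hook, hookFun]; grind
  have h2 : ((d.partner k = k + 1) ∨ ((d.hook k).partner j = j + 1) ↔
    (d.partner j = j + 1) ∨ ((d.hook j).partner k = k + 1)) := by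
    simp only [hook, hookFun]; grind
  simp only [Module.End.mul_apply, hookOp_basis, map_smul, hook_comm d j k hk, smul_smul]
  congr 1
  exact ite_mul_ite_congr δ h1 h2

/-- Multiplication `x ↦ a x` on top: the generator with index `i` acts at the top points `i, i + 1`. -/
def leftRep (δ : ℂ) (n : ℕ∞) : TL δ n →ₐ[ℂ] Module.End ℂ (DiagramSpace) :=
  TL.lift (fun i => hookOp δ i.1) (fun _ => hookOp_sq _ _)
    (fun i k h => hookOp_zigzag _ _ _ (by omega)) (fun i k h => hookOp_comm _ _ _ (by omega))

/-- The action of the second factor, `x ↦ x aᵗ`, where `aᵗ` is the reflection of `a`: the generator with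
index `i` acts at the bottom points `i, i + 1`, which are the integers `-1 - i` and `-2 - i`. -/
def rightRep (δ : ℂ) (n : ℕ∞) : TL δ n →ₐ[ℂ] Module.End ℂ (DiagramSpace) :=
  TL.lift (fun i => hookOp δ (-(i.1 : ℤ) - 2)) (fun _ => hookOp_sq _ _)
    (fun i k h => hookOp_zigzag _ _ _ (by omega))
    (fun i k h => (hookOp_comm _ _ _ (by omega)).symm)

theorem leftRep_gen (δ : ℂ) (n : ℕ∞) (i : TLIndex n) :
    leftRep δ n (TL.gen δ i) = hookOp δ i.1 := TL.lift_gen ..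

theorem rightRep_gen (δ : ℂ) (n : ℕ∞) (i : TLIndex n) :
    rightRep δ n (TL.gen δ i) = hookOp δ (-(i.1 : ℤ) - 2) := TL.lift_gen ..

theorem leftRep_commute_rightRep (δ : ℂ) (m n : ℕ∞) (x : TL δ m) (y : TL δ n) :
    Commute (leftRep δ m x) (rightRep δ n y) := by
  induction x using TL.induction with
  | hs c => rw [AlgHom.commutes]; exact Algebra.commutes _ _
  | hm a b h1 h2 => rw [map_mul]; exact h1.mul_left h2
  | ha a b h1 h2 => rw [map_add]; exact h1.add_left h2
  | hg i =>
    induction y using TL.induction with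
    | hs c => rw [AlgHom.commutes]; exact (Algebra.commutes _ _).symm
    | hm a b h1 h2 => rw [map_mul]; exact h1.mul_right h2
    | ha a b h1 h2 => rw [map_add]; exact h1.add_right h2
    | hg k =>
      rw [leftRep_gen, rightRep_gen]
      exact (hookOp_comm _ _ _ (by omega)).symm

/-- The algebra `TL_∞ ⊗ TL_∞`. -/
abbrev TLTwoSided (δ : ℂ) : Type := TL δ ⊤ ⊗[ℂ] TL δ ⊤

/-- The two-sided action of `TL_∞ ⊗ TL_∞` on diagrams, `(a ⊗ b) x = a x bᵗ`. -/
def twoSidedRep (δ : ℂ) : TLTwoSided δ →ₐ[ℂ] Module.End ℂ (DiagramSpace) :=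
  Algebra.TensorProduct.lift (leftRep δ ⊤) (rightRep δ ⊤) (leftRep_commute_rightRep δ ⊤ ⊤)

instance (δ : ℂ) : Module (TLTwoSided δ) (DiagramSpace) :=
  Module.compHom _ (twoSidedRep δ).toRingHom

theorem twoSided_smul_def (δ : ℂ) (a : TLTwoSided δ) (v : DiagramSpace) :
    a • v = twoSidedRep δ a v := rfl

instance (δ : ℂ) : IsScalarTower ℂ (TLTwoSided δ) (DiagramSpace) :=
  ⟨fun c a v => by simp only [twoSided_smul_def, map_smul, LinearMap.smul_apply]⟩

/-- The generalized regular representation `V(w)`: the `TL_∞ ⊗ TL_∞`-module generated by `w`. -/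
def regularRep (δ : ℂ) (w : PlanarDiagram) : Submodule (TLTwoSided δ) (DiagramSpace) :=
  Submodule.span (TLTwoSided δ) {basisDiagram w}

/-- The span of the diagrams with at most `k` through strands (zero for `k < 0`). -/
def atMostStrands (k : ℤ) : Submodule ℂ (DiagramSpace) :=
  Submodule.span ℂ (basisDiagram '' {d | ∃ m : ℕ, d.numThrough = m ∧ (m : ℤ) ≤ k})

theorem hookOp_mem_atMostStrands (δ : ℂ) (k : ℤ) (j : ℤ) (hj : j ≠ -1) (v : DiagramSpace)
    (hv : v ∈ atMostStrands k) : hookOp δ j v ∈ atMostStrands k := by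
  unfold atMostStrands at hv ⊢
  induction hv using Submodule.span_induction with
  | zero => simp
  | add x y _ _ h1 h2 => rw [map_add]; exact add_mem h1 h2
  | smul c x _ h => rw [map_smul]; exact Submodule.smul_mem _ _ h
  | mem x h =>
    obtain ⟨d, ⟨m, hm, hk⟩, rfl⟩ := h
    rw [hookOp_basis]
    apply Submodule.smul_mem
    apply Submodule.subset_span
    refine ⟨d.hook j, ?_, rfl⟩
    have h1 := d.numThrough_hook_le j hj
    rw [hm] at h1
    obtain ⟨r, hr⟩ := ENat.ne_top_iff_exists.mp (ne_top_of_le_ne_top (ENat.natCast_ne_top m) h1)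
    rw [← hr] at h1
    exact ⟨r, hr.symm, by have : r ≤ m := by exact_mod_cast h1
                          omega⟩

theorem rep_mem_atMostStrands (δ : ℂ) (n : ℕ∞) (k : ℤ) (ρ : TL δ n →ₐ[ℂ] Module.End ℂ (DiagramSpace))
    (hρ : ∀ i, ∀ v ∈ atMostStrands k, ρ (TL.gen δ i) v ∈ atMostStrands k) (x : TL δ n) :
    ∀ v ∈ atMostStrands k, ρ x v ∈ atMostStrands k := by
  induction x using TL.induction with
  | hs c => intro v hv; rw [AlgHom.commutes]; exact Submodule.smul_mem _ _ hv
  | hg i => exact hρ i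
  | hm a b h1 h2 => intro v hv; rw [map_mul]; exact h1 _ (h2 _ hv)
  | ha a b h1 h2 => intro v hv; rw [map_add]; exact add_mem (h1 _ hv) (h2 _ hv)

theorem twoSided_smul_mem_atMostStrands (δ : ℂ) (k : ℤ) (a : TLTwoSided δ) (v : DiagramSpace)
    (hv : v ∈ atMostStrands k) : a • v ∈ atMostStrands k := by
  rw [twoSided_smul_def]
  induction a using TensorProduct.induction_on with
  | zero => simp
  | add a b h1 h2 => rw [map_add]; exact add_mem h1 h2
  | tmul x y =>
    rw [twoSidedRep, Algebra.TensorProduct.lift_tmul]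
    apply rep_mem_atMostStrands _ _ _ _ _ x _ (rep_mem_atMostStrands _ _ _ _ _ y _ hv)
    · intro i v hv
      rw [leftRep_gen]; exact hookOp_mem_atMostStrands _ _ _ (by omega) _ hv
    · intro i v hv
      rw [rightRep_gen]; exact hookOp_mem_atMostStrands _ _ _ (by omega) _ hv

/-- The invariant subspace `I_k(w)` of `V(w)` of combinations of diagrams with at most `k` through
strands. -/
def strandIdeal (δ : ℂ) (w : PlanarDiagram) (k : ℤ) : Submodule (TLTwoSided δ) DiagramSpace :=
  regularRep δ w ⊓
    { carrier := atMostStrands k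
      zero_mem' := (atMostStrands k).zero_mem
      add_mem' := (atMostStrands k).add_mem
      smul_mem' := fun a v hv => twoSided_smul_mem_atMostStrands δ k a v hv }

/-- The subquotient `V_k(w) = I_k(w) / I_{k-2}(w)`. -/
abbrev strandQuotient (δ : ℂ) (w : PlanarDiagram) (k : ℤ) : Type :=
  ↥(strandIdeal δ w k) ⧸ (strandIdeal δ w (k - 2)).submoduleOf (strandIdeal δ w k)

/-- Link states (half diagrams) on the points `0, …, n - 1` with `p` cups: a noncrossing involution
whose fixed points are the ends of the `n - 2 p` through strands, none of which lies below a cup. -/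
@[ext] structure LinkState (n p : ℕ) where
  partner : ℕ → ℕ
  partner_partner : ∀ a, partner (partner a) = a
  partner_of_le : ∀ a, n ≤ a → partner a = a
  noncrossing : ∀ a b, a < b → b < partner a → a < partner b ∧ partner b < partner a ∧ partner b ≠ b
  card_through : ((Finset.range n).filter fun a => partner a = a).card + 2 * p = n

namespace LinkState

variable {n p : ℕ}

theorem ext_partner {u v : LinkState n p} (h : ∀ a, u.partner a = v.partner a) : u = v :=
  LinkState.ext (funext h)

/-- The link state after the generator is attached at `i, i + 1`; the partner of a point that used to be
joined to the end of a through strand becomes the end of that through strand. -/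
def hookFun (f : ℕ → ℕ) (i a : ℕ) : ℕ :=
  if a = i then i + 1
  else if a = i + 1 then i
  else if a = f i then (if f (i + 1) = i + 1 then a else f (i + 1))
  else if a = f (i + 1) then (if f i = i then a else f i)
  else f a

theorem partner_lt (u : LinkState n p) (a : ℕ) (h : a < n) : u.partner a < n := by
  have := u.partner_of_le (u.partner a)
  rw [u.partner_partner] at this
  omega

theorem hook_card (u : LinkState n p) (i : ℕ) (hi : i + 1 < n)
    (h : ¬ (u.partner i = i ∧ u.partner (i + 1) = i + 1)) :
    ((Finset.range n).filter fun a => hookFun u.partner i a = a).card =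
    ((Finset.range n).filter fun a => u.partner a = a).card := by
  have e0 := u.partner_partner
  have l0 := u.partner_lt
  by_cases h1 : u.partner i = i
  · have : ((Finset.range n).filter fun a => hookFun u.partner i a = a) =
        insert (u.partner (i + 1)) (((Finset.range n).filter fun a => u.partner a = a).erase i) := by
      ext a
      simp only [Finset.mem_filter, Finset.mem_range, Finset.mem_insert, Finset.mem_erase, hookFun]
      grind
    rw [this, Finset.card_insert_of_notMem, Finset.card_erase_of_mem, Nat.sub_add_cancel]
    · exact Finset.card_pos.2 ⟨i, by simp [h1]; omega⟩
    · simp [h1]; omega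
    · simp only [Finset.mem_filter, Finset.mem_range, Finset.mem_erase]
      grind
  by_cases h2 : u.partner (i + 1) = i + 1
  · have : ((Finset.range n).filter fun a => hookFun u.partner i a = a) =
        insert (u.partner i) (((Finset.range n).filter fun a => u.partner a = a).erase (i + 1)) := by
      ext a
      simp only [Finset.mem_filter, Finset.mem_range, Finset.mem_insert, Finset.mem_erase, hookFun]
      grind
    rw [this, Finset.card_insert_of_notMem, Finset.card_erase_of_mem, Nat.sub_add_cancel]
    · exact Finset.card_pos.2 ⟨i + 1, by simp [h2]; omega⟩
    · simp [h2]; omega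
    · simp only [Finset.mem_filter, Finset.mem_range, Finset.mem_erase]
      grind
  · congr 1
    ext a
    simp only [Finset.mem_filter, Finset.mem_range, hookFun]
    grind

theorem inside_iff (u : LinkState n p) (x y : ℕ) :
    (x < y ∧ y < u.partner x) ↔ (x < u.partner y ∧ u.partner y < u.partner x) := by
  have a1 := u.noncrossing x y
  have a2 := u.noncrossing x (u.partner y)
  rw [u.partner_partner] at a2
  omega

theorem hook_noncrossing (u : LinkState n p) (i x y : ℕ) (hxy : x < y)
    (hy : y < hookFun u.partner i x) :
    x < hookFun u.partner i y ∧ hookFun u.partner i y < hookFun u.partner i x ∧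
      hookFun u.partner i y ≠ y := by
  have e0 := u.partner_partner
  have i2 := u.inside_iff x i
  have i3 := u.inside_iff x (i + 1)
  have i4 := u.inside_iff y i
  have i5 := u.inside_iff y (i + 1)
  have j1 := u.inside_iff (u.partner x) i
  have j2 := u.inside_iff (u.partner x) (i + 1)
  have i6 := u.inside_iff (u.partner y) i
  have i7 := u.inside_iff (u.partner y) (i + 1)
  have n0 := u.noncrossing x y
  have n1 := u.noncrossing x i
  have n2 := u.noncrossing x (i + 1)
  have n3 := u.noncrossing i y
  have n4 := u.noncrossing (i + 1) y
  have n5 := u.noncrossing (u.partner i) y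
  have n6 := u.noncrossing (u.partner (i + 1)) y
  have n7 := u.noncrossing (u.partner (i + 1)) i
  have m1 : x = u.partner i ↔ u.partner x = i := by grind
  have m2 : x = u.partner (i + 1) ↔ u.partner x = i + 1 := by grind
  have m3 : y = u.partner i ↔ u.partner y = i := by grind
  have m4 : y = u.partner (i + 1) ↔ u.partner y = i + 1 := by grind
  have m5 : x = u.partner y ↔ u.partner x = y := by grind
  have m6 : i = u.partner (i + 1) ↔ u.partner i = i + 1 := by grind
  have m7 : u.partner x = u.partner i ↔ x = i := by grind
  have m8 : u.partner x = u.partner (i + 1) ↔ x = i + 1 := by grind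
  have m9 : u.partner y = u.partner i ↔ y = i := by grind
  have m10 : u.partner y = u.partner (i + 1) ↔ y = i + 1 := by grind
  rw [e0] at j1 j2 i6 i7 n5 n6 n7
  clear e0
  unfold hookFun at hy ⊢
  generalize u.partner i = a at *
  generalize u.partner (i + 1) = b at *
  generalize u.partner x = c at *
  generalize u.partner y = d at *
  by_cases x1 : x = i
  · rw [if_pos x1] at hy; omega
  by_cases x2 : x = i + 1
  · rw [if_neg x1, if_pos x2] at hy; omega
  rw [if_neg x1, if_neg x2] at hy ⊢
  by_cases x3 : x = a
  · rw [if_pos x3] at hy ⊢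
    clear i2 i3 j1 i4 i5 i6 i7 n1 n2 n3 n5 n6 m2 m5 m6
    split_ifs at hy ⊢ <;> omega
  by_cases x4 : x = b
  · rw [if_neg x3, if_pos x4] at hy ⊢
    clear i2 i3 j2 n2 n5 n6 m1 m5 m6
    split_ifs at hy ⊢ <;> omega
  rw [if_neg x3, if_neg x4] at hy ⊢
  clear j1 j2 i4 i5 i6 i7 n3 n4 n5 n6 n7 m1 m5 m6 m7 m8
  split_ifs at hy ⊢ <;> omega

/-- Attach the generator at `i, i + 1`, when `i` and `i + 1` are not both ends of through strands. -/
def hook (u : LinkState n p) (i : ℕ) (hi : i + 1 < n)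
    (h : ¬ (u.partner i = i ∧ u.partner (i + 1) = i + 1)) : LinkState n p where
  partner := hookFun u.partner i
  partner_partner a := by
    have := u.partner_partner
    grind [hookFun]
  partner_of_le a ha := by
    have := u.partner_partner
    have := u.partner_of_le
    have l0 := u.partner_lt
    have l1 := l0 i
    have l2 := l0 (i + 1)
    simp only [hookFun]
    grind
  noncrossing x y hxy hy := by
    exact u.hook_noncrossing i x y hxy hy
  card_through := by rw [hook_card u i hi h]; exact u.card_through


theorem hookFun_comm (f : ℕ → ℕ) (e0 : ∀ a, f (f a) = a) (i k a : ℕ) (hik : i + 1 < k)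
    (hA : ¬ (f i = i ∧ f (i + 1) = i + 1)) (hB : ¬ (f k = k ∧ f (k + 1) = k + 1))
    (hC : ¬ (hookFun f i k = k ∧ hookFun f i (k + 1) = k + 1))
    (hD : ¬ (hookFun f k i = i ∧ hookFun f k (i + 1) = i + 1)) :
    hookFun (hookFun f i) k a = hookFun (hookFun f k) i a := by
  simp only [hookFun] at hC hD ⊢; grind (splits := 40)

theorem hookFun_through_iff (f : ℕ → ℕ) (e0 : ∀ a, f (f a) = a) (i k : ℕ) (hik : i + 1 < k)
    (hA : ¬ (f i = i ∧ f (i + 1) = i + 1)) (hB : ¬ (f k = k ∧ f (k + 1) = k + 1))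
    (hn : ∀ a b, a < b → b < f a → a < f b ∧ f b < f a ∧ f b ≠ b) :
    (hookFun f i k = k ∧ hookFun f i (k + 1) = k + 1) ↔
      (hookFun f k i = i ∧ hookFun f k (i + 1) = i + 1) := by
  have n1 := hn i (i + 1)
  have n2 := hn i k
  have n3 := hn (i + 1) k
  clear hn
  constructor
  · intro h
    simp only [hookFun] at h ⊢; grind (splits := 30)
  · intro h
    simp only [hookFun] at h ⊢; grind (splits := 30)

theorem hookFun_loop_iff (f : ℕ → ℕ) (e0 : ∀ a, f (f a) = a) (i k : ℕ) (hik : i + 1 < k) :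
    ((f k = k + 1 ∧ hookFun f k i = i + 1) ↔ (f i = i + 1 ∧ hookFun f i k = k + 1)) ∧
    ((f k = k + 1 ∨ hookFun f k i = i + 1) ↔ (f i = i + 1 ∨ hookFun f i k = k + 1)) := by
  simp only [hookFun]; grind

/-- The generator with index `i` on link states: it gives zero when two through strands are joined, and
replaces a closed loop by `δ`. -/
noncomputable def hookOp (δ : ℂ) (i : ℕ) (hi : i + 1 < n) : Module.End ℂ (LinkState n p →₀ ℂ) :=
  Finsupp.linearCombination ℂ fun u : LinkState n p =>
    open Classical in
    if h : u.partner i = i ∧ u.partner (i + 1) = i + 1 then 0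
    else (if u.partner i = i + 1 then δ else 1) • Finsupp.single (u.hook i hi h) 1

theorem hookOp_of_through (δ : ℂ) (i : ℕ) (hi : i + 1 < n) (u : LinkState n p)
    (h : u.partner i = i ∧ u.partner (i + 1) = i + 1) :
    hookOp δ i hi (Finsupp.single u 1) = 0 := by
  rw [hookOp, Finsupp.linearCombination_single, dif_pos h, smul_zero]

theorem hookOp_of_not_through (δ : ℂ) (i : ℕ) (hi : i + 1 < n) (u : LinkState n p)
    (h : ¬ (u.partner i = i ∧ u.partner (i + 1) = i + 1)) :
    hookOp δ i hi (Finsupp.single u 1) =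
      (if u.partner i = i + 1 then δ else 1) • Finsupp.single (u.hook i hi h) 1 := by
  rw [hookOp, Finsupp.linearCombination_single, dif_neg h, one_smul]

theorem hookOp_sq (δ : ℂ) (i : ℕ) (hi : i + 1 < n) :
    hookOp (p := p) δ i hi * hookOp δ i hi = δ • hookOp δ i hi := by
  refine Finsupp.lhom_ext' fun u => LinearMap.ext_ring ?_
  simp only [LinearMap.comp_apply, Finsupp.lsingle_apply, Module.End.mul_apply,
    LinearMap.smul_apply]
  by_cases h : u.partner i = i ∧ u.partner (i + 1) = i + 1
  · rw [hookOp_of_through _ _ _ _ h, map_zero, smul_zero]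
  · have h1 : (u.hook i hi h).partner i = i + 1 := by simp [hook, hookFun]
    have h2 : ¬ ((u.hook i hi h).partner i = i ∧ (u.hook i hi h).partner (i + 1) = i + 1) := by
      omega
    have h3 : (u.hook i hi h).hook i hi h2 = u.hook i hi h := by
      have e0 := u.partner_partner
      apply ext_partner
      intro a
      simp only [hook, hookFun]
      grind (splits := 30)
    rw [hookOp_of_not_through _ _ _ _ h, map_smul, hookOp_of_not_through _ _ _ _ h2, h3, if_pos h1]
    exact smul_comm _ _ _

theorem hookOp_zigzag (δ : ℂ) (i k : ℕ) (hi : i + 1 < n) (hk : k + 1 < n)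
    (hik : k = i + 1 ∨ i = k + 1) :
    hookOp (p := p) δ i hi * hookOp δ k hk * hookOp δ i hi = hookOp δ i hi := by
  refine Finsupp.lhom_ext' fun u => LinearMap.ext_ring ?_
  simp only [LinearMap.comp_apply, Finsupp.lsingle_apply, Module.End.mul_apply]
  by_cases h : u.partner i = i ∧ u.partner (i + 1) = i + 1
  · rw [hookOp_of_through _ _ _ _ h, map_zero, map_zero]
  · have e0 := u.partner_partner
    have h1 : ¬ ((u.hook i hi h).partner k = k ∧ (u.hook i hi h).partner (k + 1) = k + 1) := by
      simp only [hook, hookFun]; grind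
    have h2 : ¬ (((u.hook i hi h).hook k hk h1).partner i = i ∧
        ((u.hook i hi h).hook k hk h1).partner (i + 1) = i + 1) := by
      simp only [hook, hookFun]; grind
    have h3 : ((u.hook i hi h).hook k hk h1).hook i hi h2 = u.hook i hi h := by
      apply ext_partner
      intro a
      simp only [hook, hookFun]
      rcases hik with rfl | rfl <;> grind (splits := 40)
    have h4 : (u.hook i hi h).partner k ≠ k + 1 := by
      simp only [hook, hookFun]; grind
    have h5 : ((u.hook i hi h).hook k hk h1).partner i ≠ i + 1 := by
      simp only [hook, hookFun]; grind
    rw [hookOp_of_not_through _ _ _ _ h, map_smul, map_smul, hookOp_of_not_through _ _ _ _ h1,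
      map_smul, hookOp_of_not_through _ _ _ _ h2, h3, if_neg h4, if_neg h5, one_smul, one_smul]

theorem hookOp_comm (δ : ℂ) (i k : ℕ) (hi : i + 1 < n) (hk : k + 1 < n) (hik : i + 1 < k) :
    hookOp (p := p) δ i hi * hookOp δ k hk = hookOp δ k hk * hookOp δ i hi := by
  refine Finsupp.lhom_ext' fun u => LinearMap.ext_ring ?_
  simp only [LinearMap.comp_apply, Finsupp.lsingle_apply, Module.End.mul_apply]
  have e0 := u.partner_partner
  by_cases hA : u.partner i = i ∧ u.partner (i + 1) = i + 1
  · rw [hookOp_of_through _ _ _ _ hA, map_zero]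
    by_cases hB : u.partner k = k ∧ u.partner (k + 1) = k + 1
    · rw [hookOp_of_through _ _ _ _ hB, map_zero]
    · have h1 : (u.hook k hk hB).partner i = i ∧ (u.hook k hk hB).partner (i + 1) = i + 1 := by
        simp only [hook, hookFun]; grind
      rw [hookOp_of_not_through _ _ _ _ hB, map_smul, hookOp_of_through _ _ _ _ h1, smul_zero]
  by_cases hB : u.partner k = k ∧ u.partner (k + 1) = k + 1
  · have h1 : (u.hook i hi hA).partner k = k ∧ (u.hook i hi hA).partner (k + 1) = k + 1 := by
      simp only [hook, hookFun]; grind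
    rw [hookOp_of_through _ _ _ _ hB, map_zero, hookOp_of_not_through _ _ _ _ hA, map_smul,
      hookOp_of_through _ _ _ _ h1, smul_zero]
  have hCD := hookFun_through_iff u.partner e0 i k hik hA hB u.noncrossing
  rw [hookOp_of_not_through _ _ _ _ hA, hookOp_of_not_through _ _ _ _ hB, map_smul, map_smul]
  by_cases hC : (u.hook i hi hA).partner k = k ∧ (u.hook i hi hA).partner (k + 1) = k + 1
  · rw [hookOp_of_through _ _ _ _ hC, hookOp_of_through _ _ _ _ (hCD.1 hC), smul_zero, smul_zero]
  have hD : ¬ ((u.hook k hk hB).partner i = i ∧ (u.hook k hk hB).partner (i + 1) = i + 1) :=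
    fun hD => hC (hCD.2 hD)
  have h3 : (u.hook i hi hA).hook k hk hC = (u.hook k hk hB).hook i hi hD :=
    ext_partner fun a => hookFun_comm u.partner e0 i k a hik hA hB hC hD
  obtain ⟨h1, h2⟩ := hookFun_loop_iff u.partner e0 i k hik
  rw [hookOp_of_not_through _ _ _ _ hC, hookOp_of_not_through _ _ _ _ hD, h3, smul_smul, smul_smul]
  congr 1
  exact ite_mul_ite_congr δ h1 h2

end LinkState

/-- The standard representation of the Temperley-Lieb algebra on `n` strands, on link states with `p`
cups. -/
def standardRep (δ : ℂ) (n p : ℕ) : TL δ (n : ℕ∞) →ₐ[ℂ] Module.End ℂ (LinkState n p →₀ ℂ) :=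
  TL.lift (fun i => LinkState.hookOp δ i.1 (by exact_mod_cast i.2))
    (fun _ => LinkState.hookOp_sq _ _ _)
    (fun _ _ h => LinkState.hookOp_zigzag _ _ _ _ _ h)
    (fun _ _ h => LinkState.hookOp_comm _ _ _ _ _ h)

/-- The matrix trace (not normalized) of the standard representation. -/
def matrixTrace (δ : ℂ) (n p : ℕ) (a : TL δ n) : ℂ :=
  LinearMap.trace ℂ (LinkState n p →₀ ℂ) (standardRep δ n p a)

/-- `c_{n,0}`, where `c_{0,0} = c_{1,0} = 1` and `c_{n,0} = c_{n-1,0} - γ c_{n-2,0}`. -/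
def coeffZero (γ : ℝ) : ℕ → ℝ
  | 0 => 1
  | 1 => 1
  | n + 2 => coeffZero γ (n + 1) - γ * coeffZero γ n

/-- `c_{n,p} = γ^p c_{n-2p,0}`. -/
def coeff (γ : ℝ) (n p : ℕ) : ℝ := γ ^ p * coeffZero γ (n - 2 * p)

/-- The extremal trace with parameter `γ` on `n` strands, `∑_p c_{n,p} t_{n,p}`. -/
def extremalTrace (δ : ℂ) (γ : ℝ) (n : ℕ) (a : TL δ n) : ℂ :=
  ∑ p ∈ Finset.range (n / 2 + 1), (coeff γ n p : ℂ) * matrixTrace δ n p a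

/-- The element of the Temperley-Lieb algebra on `n` strands that is given by a diagram whose strands
outside of the first `n` points are vertical: the element that takes the identity diagram to it. -/
def ofDiagram (δ : ℂ) (n : ℕ) (d : PlanarDiagram) : TL δ n :=
  Classical.epsilon fun a => leftRep δ n a (basisDiagram PlanarDiagram.one) = basisDiagram d

/-- `y` is the restriction of the diagram `x` to the first `n` top and the first `n` bottom points.
The strands of `x` inside this window are kept, and outside the window `y` is the identity. The strands
of `x` that leave the window are cut, and their end points inside the window are joined, top to bottom
(in the only planar way), to through strands. This needs as many cut points at the top as at the
bottom. -/
structure IsRestriction (n : ℕ) (x y : PlanarDiagram) : Prop where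
  outside : ∀ p : ℤ, (p < -n ∨ n ≤ p) → y.partner p = -1 - p
  inside : ∀ p : ℤ, -n ≤ p → p < n → -n ≤ x.partner p → x.partner p < n →
    y.partner p = x.partner p
  cut : ∀ p : ℤ, -n ≤ p → p < n → (x.partner p < -n ∨ n ≤ x.partner p) →
    (p < 0 ↔ 0 ≤ y.partner p)

open Classical in
/-- The restriction `↓_n x` (a default value if there is none). -/
def restriction (n : ℕ) (x : PlanarDiagram) : PlanarDiagram :=
  if h : ∃ y, IsRestriction n x y then h.choose else PlanarDiagram.one

/-- `⟨↓_n x, ↓_n y⟩_γ = t(↓_n x (↓_n y)*)`, with the extremal trace `t` with parameter `γ`. -/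
def truncatedPairing (δ : ℂ) (γ : ℝ) (n : ℕ) (x y : PlanarDiagram) : ℂ :=
  extremalTrace δ γ n
    (ofDiagram δ n (restriction n x) * (TL.dagger (ofDiagram δ n (restriction n y))).unop)

/-- The number of cups on the top side. -/
def cupNumber (d : PlanarDiagram) : ℕ := {p : ℤ | 0 ≤ p ∧ p < d.partner p}.ncard

/-- `n → ∞` along the levels `n` for which `w` has a restriction `↓_n w`. -/
def levels (w : PlanarDiagram) : Filter ℕ :=
  Filter.atTop ⊓ Filter.principal {n | ∃ y, IsRestriction n w y}

/-- `⟨↓_n x, ↓_n y⟩_γ / (δ² γ)^{c(↓_n w)}`; with this normalization `w` becomes a vector of norm of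
order one, because every pair of a cup and a cap contributes `δ² γ`. -/
def renormalizedPairing (δ : ℂ) (γ : ℝ) (w x y : PlanarDiagram) (n : ℕ) : ℂ :=
  truncatedPairing δ γ n x y / (δ ^ 2 * γ) ^ cupNumber (restriction n w)

/-- `⟨x, y⟩_{w,γ}` for two diagrams `x, y` of `V(w)`. -/
def limitPairing (δ : ℂ) (γ : ℝ) (w x y : PlanarDiagram) : ℂ :=
  Filter.limUnder (levels w) (renormalizedPairing δ γ w x y)

open scoped ComplexConjugate in
/-- The sesquilinear extension of `⟨x, y⟩_{w,γ}`, linear in `x`. -/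
def traceForm (δ : ℂ) (γ : ℝ) (w : PlanarDiagram) (x y : DiagramSpace) : ℂ :=
  (DiagramSpace.coord x).sum fun d a => (DiagramSpace.coord y).sum fun e b => a * conj b * limitPairing δ γ w d e

open scoped ComplexConjugate

/-- `⟨·, ·⟩_{w,γ}` is a positive definite Hermitian form on `V(w)`. -/
structure IsPositiveDefinite (δ : ℂ) (γ : ℝ) (w : PlanarDiagram) : Prop where
  conj_symm : ∀ x ∈ regularRep δ w, ∀ y ∈ regularRep δ w,
    traceForm δ γ w y x = conj (traceForm δ γ w x y)
  pos : ∀ x ∈ regularRep δ w, x ≠ 0 → 0 < (traceForm δ γ w x x).re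

theorem traceForm_add_left (δ : ℂ) (γ : ℝ) (w : PlanarDiagram) (x y z : DiagramSpace) :
    traceForm δ γ w (x + y) z = traceForm δ γ w x z + traceForm δ γ w y z := by
  unfold traceForm
  rw [map_add, Finsupp.sum_add_index' (by simp)]
  intro d a b
  rw [← Finsupp.sum_add]
  exact Finsupp.sum_congr fun _ _ => by ring

theorem traceForm_smul_left (δ : ℂ) (γ : ℝ) (w : PlanarDiagram) (c : ℂ) (x z : DiagramSpace) :
    traceForm δ γ w (c • x) z = c * traceForm δ γ w x z := by
  unfold traceForm
  rw [map_smul, Finsupp.sum_smul_index' (by simp), Finsupp.mul_sum]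
  refine Finsupp.sum_congr fun _ _ => ?_
  rw [Finsupp.mul_sum]
  exact Finsupp.sum_congr fun _ _ => by rw [smul_eq_mul]; ring

theorem traceForm_zero_left (δ : ℂ) (γ : ℝ) (w : PlanarDiagram) (z : DiagramSpace) :
    traceForm δ γ w 0 z = 0 := by
  unfold traceForm
  rw [map_zero, Finsupp.sum_zero_index]

section HilbertSpace

variable {δ : ℂ} {γ : ℝ} {w : PlanarDiagram}

/-- `V(w)` as a pre-Hilbert space, when the form is positive definite. -/
def PreHilbert (_h : IsPositiveDefinite δ γ w) : Type := ↥(regularRep δ w)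

namespace PreHilbert

variable (h : IsPositiveDefinite δ γ w)

instance : AddCommGroup (PreHilbert h) := inferInstanceAs (AddCommGroup ↥(regularRep δ w))
instance : Module ℂ (PreHilbert h) := inferInstanceAs (Module ℂ ↥(regularRep δ w))
instance : Module (TLTwoSided δ) (PreHilbert h) :=
  inferInstanceAs (Module (TLTwoSided δ) ↥(regularRep δ w))

/-- The identity map from `V(w)` to the pre-Hilbert space. -/
def of : ↥(regularRep δ w) ≃ₗ[TLTwoSided δ] PreHilbert h := LinearEquiv.refl _ _

/-- The inner product; in Mathlib it is conjugate linear in the first variable. -/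
@[reducible] def core : InnerProductSpace.Core ℂ (PreHilbert h) where
  inner x y := traceForm δ γ w ((of h).symm y : DiagramSpace) ((of h).symm x : DiagramSpace)
  conj_inner_symm x y := (h.conj_symm _ ((of h).symm x).2 _ ((of h).symm y).2).symm
  re_inner_nonneg x := by
    by_cases hx : ((of h).symm x : DiagramSpace) = 0
    · rw [hx, traceForm_zero_left]; simp
    · exact (h.pos _ ((of h).symm x).2 hx).le
  add_left x y z := by
    refine Eq.trans ?_ (?_ : traceForm δ γ w ((of h).symm z : DiagramSpace)
      ((of h).symm x + (of h).symm y : DiagramSpace) = _)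
    · rfl
    · rw [h.conj_symm _ (add_mem ((of h).symm x).2 ((of h).symm y).2) _ ((of h).symm z).2,
        traceForm_add_left, map_add,
        ← h.conj_symm _ ((of h).symm x).2 _ ((of h).symm z).2,
        ← h.conj_symm _ ((of h).symm y).2 _ ((of h).symm z).2]
  smul_left x y c := by
    refine Eq.trans ?_ (?_ : traceForm δ γ w ((of h).symm y : DiagramSpace)
      (c • ((of h).symm x : DiagramSpace)) = _)
    · rfl
    · rw [h.conj_symm _ ((regularRep δ w).smul_of_tower_mem c ((of h).symm x).2) _
        ((of h).symm y).2, traceForm_smul_left, map_mul,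
        ← h.conj_symm _ ((of h).symm x).2 _ ((of h).symm y).2]
  definite x hx := by
    by_contra h0
    have h1 : ((of h).symm x : DiagramSpace) ≠ 0 := by
      simpa using h0
    have := h.pos _ ((of h).symm x).2 h1
    rw [hx] at this
    simp at this

instance : NormedAddCommGroup (PreHilbert h) := (core h).toNormedAddCommGroup
instance : InnerProductSpace ℂ (PreHilbert h) := InnerProductSpace.ofCore (core h).toCore

end PreHilbert

/-- The Hilbert space `H(w)`. -/
abbrev HilbertCompletion (h : IsPositiveDefinite δ γ w) : Type :=
  UniformSpace.Completion (PreHilbert h)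

/-- The embedding of `V(w)` into `H(w)`. -/
def toHilbert (h : IsPositiveDefinite δ γ w) (v : ↥(regularRep δ w)) : HilbertCompletion h :=
  ((PreHilbert.of h v : PreHilbert h) : UniformSpace.Completion (PreHilbert h))

/-- The embedding of `I_k(w)` into `H(w)`. -/
def idealToHilbert (h : IsPositiveDefinite δ γ w) (k : ℤ) (v : ↥(strandIdeal δ w k)) :
    HilbertCompletion h :=
  toHilbert h (Submodule.inclusion inf_le_left v)

end HilbertSpace

end

/-! Everything is computed in a spin chain. If `a ^ 2 + a⁻¹ ^ 2 = δ`, the generators act on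
functions of spin configurations by the symmetric operator v vᵗ with v = a|+-⟩ + a⁻¹|-+⟩ at two
neighbouring points. A link state whose first κ through strands carry `+` and whose other through
strands carry `-` gives a vector in this space. These vectors form a basis, by triangularity for the
lexicographic order, and the generators respect the filtration by the number of cups. The graded
pieces are standard representations, V_{n,p} occurring n - 2p + 1 times, once for each κ. If
moreover z + z⁻¹ = γ^{-1/2}, then c_{k,0} = γ^{k/2} (z^k + z^{k-2} + ... + z^{-k}), so the extremal
trace is γ^{n/2} times the spin trace weighted by z to the power of the total spin
(`extremalTrace_eq`).

The spin matrix of a diagram is a gauge factor times a product of one local weight per strand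
(`spinMatrix_ofDiagram`). Hence ⟨d, e⟩_γ is a sum over spins at the boundary points (`spinPairing`),
and it factorizes along every partition of the points that is respected by both diagrams
(`spinPairing_union`). A diagram paired with itself gives a closed curve for each strand, worth δ
for a cup at the top or bottom and γ^{-1/2} for a through strand; this explains the normalization by
δ²γ. A diagram with finitely many through strands has arbitrarily large windows that no strand
leaves, and two diagrams of V(w) agree with w outside a common window. The outside factor cancels
against the normalization, so the sequence that defines the inner product is eventually constant
(`renormalizedPairing_eq`). Infinitely many levels exist by a discrete intermediate value argument
(`exists_openTop_eq`).

Positivity: for δ > 2 the parameter a can be real, and then * becomes the adjoint of matrices. The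
vectors whose through strands all carry `+` embed V_{m,p} in the spin chain, so t_{m,p}(A A*) ≥ 0.
If A is a combination of diagrams with at most n through strands, the terms with m - 2p > n vanish,
and the others have the factor c_{m-2p,0}, which is positive in the given range of γ
(`coeffZero_pos`). Strictness comes from the linear independence of diagrams, unfolded to link
states on 2m points (`eq_zero_of_sum_planarWeight`).

Decomposition: the generators are self-adjoint, hence bounded by |δ|, and the orthogonal complement
of I_{k-2}(w) in I_k(w) is invariant. That it is a complement already before completion rests on
`exists_spinPairing_eq`: on a fixed window, the functional given by a diagram of a larger window is
a multiple of the functional given by a diagram of the small window with no more through strands, so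
orthogonal projection is a finite-dimensional matter. For irreducibility
(`IsSpinModel.strandIdeal_le`), a vector of I_k orthogonal to I_{k-2} is turned by self-adjoint
generators into a nonzero multiple of a standard diagram with k through strands, modulo I_{k-2}, and
that diagram generates I_k. -/

noncomputable section

/-! ### Temperley-Lieb generators on spin configurations -/

/-- The weight of a strand whose ends carry the spins `x` (left) and `y` (right). -/
def cupWeight (a : ℂ) (x y : Bool) : ℂ := if x = y then 0 else if x then a else a⁻¹

section SpinHook

variable {ι : Type*} [DecidableEq ι]

/-- The spin configuration `s` with the spins at `j` and `k` replaced by `r` and `!r`. -/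
def setPair (s : ι → Bool) (j k : ι) (r : Bool) : ι → Bool :=
  Function.update (Function.update s j r) k (!r)

theorem setPair_apply (s : ι → Bool) (j k : ι) (r : Bool) (p : ι) :
    setPair s j k r p = if p = k then !r else if p = j then r else s p := by
  simp only [setPair, Function.update_apply]

/-- The Temperley-Lieb generator at the points `j`, `k` on functions of spin configurations. -/
def spinHook (a : ℂ) (j k : ι) : Module.End ℂ ((ι → Bool) → ℂ) where
  toFun f s := cupWeight a (s j) (s k) *
    (a * f (setPair s j k true) + a⁻¹ * f (setPair s j k false))
  map_add' f g := by ext s; simp only [Pi.add_apply]; ring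
  map_smul' c f := by ext s; simp only [Pi.smul_apply, smul_eq_mul, RingHom.id_apply]; ring

theorem spinHook_apply (a : ℂ) (j k : ι) (f : (ι → Bool) → ℂ) (s : ι → Bool) :
    spinHook a j k f s = cupWeight a (s j) (s k) *
      (a * f (setPair s j k true) + a⁻¹ * f (setPair s j k false)) := rfl

/-- At the two points the operator is v vᵗ with v = a|+-⟩ + a⁻¹|-+⟩, and vᵗ v = a² + a⁻². -/
theorem spinHook_sq (a : ℂ) {j k : ι} (hjk : j ≠ k) :
    spinHook a j k * spinHook a j k = (a ^ 2 + a⁻¹ ^ 2) • spinHook a j k := by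
  ext f s
  have h : ∀ r r', setPair (setPair s j k r) j k r' = setPair s j k r' := by
    intro r r'; funext p; simp only [setPair_apply]; grind
  simp only [Module.End.mul_apply, LinearMap.smul_apply, Pi.smul_apply, smul_eq_mul,
    spinHook_apply, h]
  simp only [setPair_apply, hjk, if_false, if_true, cupWeight]
  simp
  ring_nf

/-- A strand that bends twice is straight: its bends carry the weights `a` and `a⁻¹`. Since the
weight of a strand distinguishes its left end, the mirror image is treated separately in
`spinHook_zigzag'`. -/
theorem spinHook_zigzag {a : ℂ} (ha : a ≠ 0) {j k l : ι} (hjk : j ≠ k) (hkl : k ≠ l) (hjl : j ≠ l) :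
    spinHook a j k * spinHook a k l * spinHook a j k = spinHook a j k := by
  ext f s
  -- Cup weights vanish on equal spins, which leaves only `r' = !s l` in the middle sum; for this
  -- value the spin at `l` is restored.
  have h : ∀ r r' r'', s l = !r' → setPair (setPair (setPair s j k r) k l r') j k r'' =
      setPair s j k r'' := by
    intro r r' r'' h; funext p; simp only [setPair_apply]; grind
  have h1 := h true; have h2 := h false
  simp only [Module.End.mul_apply, spinHook_apply]
  simp only [setPair_apply, hjk, hkl, hjl, hjk.symm, hkl.symm, hjl.symm, if_false, if_true,
    cupWeight]
  cases hs : s l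
  · have e1 := h true true true (by simp [hs])
    have e2 := h true true false (by simp [hs])
    have e3 := h false true true (by simp [hs])
    have e4 := h false true false (by simp [hs])
    simp [e1, e2, e3, e4]
    field_simp
  · have e1 := h true false true (by simp [hs])
    have e2 := h true false false (by simp [hs])
    have e3 := h false false true (by simp [hs])
    have e4 := h false false false (by simp [hs])
    simp [e1, e2, e3, e4]
    field_simp

theorem spinHook_zigzag' {a : ℂ} (ha : a ≠ 0) {j k l : ι} (hjk : j ≠ k) (hkl : k ≠ l)
    (hjl : j ≠ l) :
    spinHook a k l * spinHook a j k * spinHook a k l = spinHook a k l := by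
  ext f s
  have h : ∀ r r' r'', s j = r' → setPair (setPair (setPair s k l r) j k r') k l r'' =
      setPair s k l r'' := by
    intro r r' r'' h; funext p; simp only [setPair_apply]; grind
  simp only [Module.End.mul_apply, spinHook_apply]
  simp only [setPair_apply, hjk, hkl, hjl, hjk.symm, hkl.symm, hjl.symm, if_false, if_true,
    cupWeight]
  cases hs : s j
  · have e1 := h true false true (by simp [hs])
    have e2 := h true false false (by simp [hs])
    have e3 := h false false true (by simp [hs])
    have e4 := h false false false (by simp [hs])
    simp [e1, e2, e3, e4]
    field_simp
  · have e1 := h true true true (by simp [hs])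
    have e2 := h true true false (by simp [hs])
    have e3 := h false true true (by simp [hs])
    have e4 := h false true false (by simp [hs])
    simp [e1, e2, e3, e4]
    field_simp

theorem spinHook_comm (a : ℂ) {j k l m : ι} (h1 : j ≠ l) (h2 : j ≠ m) (h3 : k ≠ l) (h4 : k ≠ m) :
    spinHook a j k * spinHook a l m = spinHook a l m * spinHook a j k := by
  ext f s
  have h : ∀ r r', setPair (setPair s j k r) l m r' = setPair (setPair s l m r') j k r := by
    intro r r'; funext p; simp only [setPair_apply]; grind
  simp only [Module.End.mul_apply, spinHook_apply, h]
  simp only [setPair_apply, h1, h2, h3, h4, h1.symm, h2.symm, h3.symm, h4.symm, if_false]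
  ring

end SpinHook

/-! ### Generators acting on products of strand weights -/

section MatchWeight

variable {ι : Type*} [LinearOrder ι]

/-- The factor of the point `p` in the weight of a matching `f`: strands are weighted at their left
ends, and a fixed point `p` has the weight `η p`. -/
def pointWeight (a : ℂ) (f : ι → ι) (η : ι → Bool → ℂ) (s : ι → Bool) (p : ι) : ℂ :=
  if p < f p then cupWeight a (s p) (s (f p)) else if f p = p then η p (s p) else 1

/-- The weight of a spin configuration with respect to a matching of the points of `P`. -/
def matchWeight (a : ℂ) (P : Finset ι) (f : ι → ι) (η : ι → Bool → ℂ) (s : ι → Bool) : ℂ :=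
  ∏ p ∈ P, pointWeight a f η s p

theorem pointWeight_congr {a : ℂ} {f f' : ι → ι} {η η' : ι → Bool → ℂ} {s s' : ι → Bool} {p : ι}
    (h0 : f p = f' p) (h1 : s p = s' p) (h2 : s (f p) = s' (f p)) (h3 : f p = p → η p = η' p) :
    pointWeight a f η s p = pointWeight a f' η' s' p := by
  unfold pointWeight
  rw [← h0, ← h1, ← h2]
  split_ifs with h4 h5
  · rfl
  · rw [h3 h5]
  · rfl

theorem prod_eq_of_agree {P Q : Finset ι} {F G : ι → ℂ} (hQ : Q ⊆ P)
    (h : ∀ p ∈ P, p ∉ Q → F p = G p) :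
    ∏ p ∈ P, F p = (∏ p ∈ P \ Q, G p) * ∏ p ∈ Q, F p := by
  rw [← Finset.prod_sdiff hQ]
  congr 1
  refine Finset.prod_congr rfl fun p hp => ?_
  rw [Finset.mem_sdiff] at hp
  exact h p hp.1 hp.2

variable {a : ℂ} {P : Finset ι} {f f' : ι → ι} {η η' : ι → Bool → ℂ} {j k : ι}

theorem spinHook_matchWeight_loop (hinv : ∀ p, f (f p) = p)
    (hj : j ∈ P) (hk : k ∈ P) (hjk : j < k) (h : f j = k) :
    spinHook a j k (matchWeight a P f η) = (a ^ 2 + a⁻¹ ^ 2) • matchWeight a P f η := by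
  ext s
  have hkj : f k = j := by rw [← h, hinv]
  have hQ : ({j, k} : Finset ι) ⊆ P := by
    intro p; simp only [Finset.mem_insert, Finset.mem_singleton]; rintro (rfl | rfl) <;> assumption
  have key : ∀ s', (∀ p, p ≠ j → p ≠ k → s' p = s p) → matchWeight a P f η s' =
      (∏ p ∈ P \ {j, k}, pointWeight a f η s p) * cupWeight a (s' j) (s' k) := by
    intro s' hs'
    rw [matchWeight, prod_eq_of_agree hQ (G := pointWeight a f η s), Finset.prod_pair hjk.ne]
    · congr 1
      simp only [pointWeight, h, hkj, hjk, hjk.not_gt, hjk.ne, if_true, if_false, mul_one]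
    · intro p _ hp
      simp only [Finset.mem_insert, Finset.mem_singleton, not_or] at hp
      apply pointWeight_congr rfl (hs' p hp.1 hp.2) (hs' _ _ _) (fun _ => rfl)
      · intro e; apply hp.2; rw [← hinv p, e, h]
      · intro e; apply hp.1; rw [← hinv p, e, hkj]
  rw [spinHook_apply, Pi.smul_apply, key s (fun _ _ _ => rfl), key (setPair s j k true),
    key (setPair s j k false)]
  · simp only [setPair_apply, hjk.ne, if_true, if_false, cupWeight, smul_eq_mul]
    simp only [reduceCtorEq, Bool.not_true, Bool.not_false, Bool.true_eq_false,
      Bool.false_eq_true, if_false, if_true]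
    ring
  all_goals intro p h1 h2; simp [setPair_apply, h1, h2]

/-- Summing over the spins at `j` and `k` joins two strands end to end. The joined strand has the
right weight only because of `hnc`: weights depend on which end is on the left, and in each of the
three noncrossing positions the surplus powers of `a` cancel. -/
theorem spinHook_matchWeight_strands (ha : a ≠ 0) (hinv : ∀ p, f (f p) = p)
    (hP : ∀ p ∈ P, f p ∈ P) (hj : j ∈ P) (hk : k ∈ P) (hjk : j < k)
    (hfj : f j ≠ j) (hfk : f k ≠ k) (h : f j ≠ k) 
    (hnc : (f j < j ∧ k < f k) ∨ (f k < f j ∧ f j < j) ∨ (k < f k ∧ f k < f j))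
    (h1 : f' j = k) (h2 : f' k = j) (h3 : f' (f j) = f k) (h4 : f' (f k) = f j)
    (h5 : ∀ p, p ≠ j → p ≠ k → p ≠ f j → p ≠ f k → f' p = f p) :
    spinHook a j k (matchWeight a P f η) = matchWeight a P f' η := by
  ext s
  obtain ⟨u, hu⟩ : ∃ u, f j = u := ⟨_, rfl⟩
  obtain ⟨v, hv⟩ : ∃ v, f k = v := ⟨_, rfl⟩
  have hfu : f u = j := by rw [← hu, hinv]
  have hfv : f v = k := by rw [← hv, hinv]
  rw [hu] at hfj h hnc h3 h5 h4
  rw [hv] at hfk hnc h3 h5 h4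
  have hvj : v ≠ j := by rintro rfl; exact h (by rw [← hu, hfv])
  have huv : u ≠ v := by rintro rfl; exact hjk.ne (by rw [← hfu, ← hfv])
  have hQ : ({j, k, u, v} : Finset ι) ⊆ P := by
    intro p; simp only [Finset.mem_insert, Finset.mem_singleton]
    rintro (rfl | rfl | rfl | rfl)
    exacts [hj, hk, hu ▸ hP j hj, hv ▸ hP k hk]
  have prodQ : ∀ F : ι → ℂ, ∏ p ∈ ({j, k, u, v} : Finset ι), F p = F j * (F k * (F u * F v)) := by
    intro F
    rw [Finset.prod_insert, Finset.prod_insert, Finset.prod_pair huv]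
    · simp [hfk.symm, h.symm]
    · simp [hjk.ne, hfj.symm, hvj.symm]
  have hne : ∀ p, p ∉ ({j, k, u, v} : Finset ι) → f p ≠ j ∧ f p ≠ k := by
    intro p hp
    simp only [Finset.mem_insert, Finset.mem_singleton, not_or] at hp
    constructor
    · intro e; apply hp.2.2.1; rw [← hinv p, e, hu]
    · intro e; apply hp.2.2.2; rw [← hinv p, e, hv]
  have key : ∀ s', (∀ p, p ≠ j → p ≠ k → s' p = s p) → matchWeight a P f η s' =
      (∏ p ∈ P \ {j, k, u, v}, pointWeight a f η s p) * (pointWeight a f η s' j *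
        (pointWeight a f η s' k * (pointWeight a f η s' u * pointWeight a f η s' v))) := by
    intro s' hs'
    rw [matchWeight, prod_eq_of_agree hQ (G := pointWeight a f η s), prodQ]
    intro p _ hp
    obtain ⟨e1, e2⟩ := hne p hp
    simp only [Finset.mem_insert, Finset.mem_singleton, not_or] at hp
    exact pointWeight_congr rfl (hs' p hp.1 hp.2.1) (hs' _ e1 e2) (fun _ => rfl)
  have key' : matchWeight a P f' η s =
      (∏ p ∈ P \ {j, k, u, v}, pointWeight a f η s p) * (pointWeight a f' η s j *
        (pointWeight a f' η s k * (pointWeight a f' η s u * pointWeight a f' η s v))) := by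
    rw [matchWeight, prod_eq_of_agree hQ (G := pointWeight a f η s), prodQ]
    intro p _ hp
    simp only [Finset.mem_insert, Finset.mem_singleton, not_or] at hp
    exact pointWeight_congr (h5 p hp.1 hp.2.1 hp.2.2.1 hp.2.2.2) rfl rfl (fun _ => rfl)
  rw [spinHook_apply, key', key (setPair s j k true), key (setPair s j k false)]
  · generalize (∏ p ∈ P \ {j, k, u, v}, pointWeight a f η s p) = R
    simp only [pointWeight, hu, hv, hfu, hfv, h1, h2, h3, h4, setPair_apply, hjk, hjk.ne, hjk.not_gt,
      hfj, hfk, h, hvj, huv, huv.symm, hjk.ne', hfj.symm, hfk.symm, h.symm, hvj.symm, if_true,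
      if_false]
    generalize s u = x
    generalize s v = y
    rcases hnc with ⟨a1, b1⟩ | ⟨b1, a1⟩ | ⟨b1, a1⟩
    · have d1 : u < v := a1.trans (hjk.trans b1)
      simp only [a1, b1, d1, if_true, if_false, d1.not_gt, a1.not_gt, b1.not_gt]
      cases x <;> cases y <;> simp [cupWeight, ha] <;> field_simp
    · have c1 : v < k := b1.trans (a1.trans hjk)
      simp only [a1, b1, c1, if_true, if_false, a1.not_gt, b1.not_gt, c1.not_gt]
      cases x <;> cases y <;> simp [cupWeight, ha] <;> field_simp
    · have c1 : j < u := hjk.trans (b1.trans a1)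
      simp only [a1, b1, c1, if_true, if_false, a1.not_gt, b1.not_gt, c1.not_gt]
      cases x <;> cases y <;> simp [cupWeight, ha] <;> field_simp
  all_goals intro p h1 h2; simp [setPair_apply, h1, h2]

/-- The open end at `j` is continued by the strand from `k` to `f k`; summing over the spins at `j`
and `k` transports the function `η j` to the new open end `f k`. -/
theorem spinHook_matchWeight_defect_left (ha : a ≠ 0) (hinv : ∀ p, f (f p) = p)
    (hP : ∀ p ∈ P, f p ∈ P) (hj : j ∈ P) (hk : k ∈ P) (hjk : j < k)
    (hfj : f j = j) (hfk : k < f k) (h1 : f' j = k) (h2 : f' k = j) (h3 : f' (f k) = f k)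
    (h5 : ∀ p, p ≠ j → p ≠ k → p ≠ f k → f' p = f p)
    (h6 : η' (f k) = η j) (h7 : ∀ p ∈ P, f p = p → p ≠ j → η' p = η p) :
    spinHook a j k (matchWeight a P f η) = matchWeight a P f' η' := by
  ext s
  obtain ⟨v, hv⟩ : ∃ v, f k = v := ⟨_, rfl⟩
  have hfv : f v = k := by rw [← hv, hinv]
  rw [hv] at hfk h3 h5 h6
  have hvj : j < v := hjk.trans hfk
  have hQ : ({j, k, v} : Finset ι) ⊆ P := by
    intro p; simp only [Finset.mem_insert, Finset.mem_singleton]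
    rintro (rfl | rfl | rfl)
    exacts [hj, hk, hv ▸ hP k hk]
  have prodQ : ∀ F : ι → ℂ, ∏ p ∈ ({j, k, v} : Finset ι), F p = F j * (F k * F v) := by
    intro F
    rw [Finset.prod_insert, Finset.prod_pair hfk.ne]
    simp [hjk.ne, hvj.ne]
  have key : ∀ s', (∀ p, p ≠ j → p ≠ k → s' p = s p) → matchWeight a P f η s' =
      (∏ p ∈ P \ {j, k, v}, pointWeight a f η s p) * (pointWeight a f η s' j *
        (pointWeight a f η s' k * pointWeight a f η s' v)) := by
    intro s' hs'
    rw [matchWeight, prod_eq_of_agree hQ (G := pointWeight a f η s), prodQ]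
    intro p _ hp
    simp only [Finset.mem_insert, Finset.mem_singleton, not_or] at hp
    refine pointWeight_congr rfl (hs' p hp.1 hp.2.1) (hs' _ ?_ ?_) (fun _ => rfl)
    · intro e; apply hp.1; rw [← hinv p, e, hfj]
    · intro e; apply hp.2.2; rw [← hinv p, e, hv]
  have key' : matchWeight a P f' η' s =
      (∏ p ∈ P \ {j, k, v}, pointWeight a f η s p) * (pointWeight a f' η' s j *
        (pointWeight a f' η' s k * pointWeight a f' η' s v)) := by
    rw [matchWeight, prod_eq_of_agree hQ (G := pointWeight a f η s), prodQ]
    intro p hp' hp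
    simp only [Finset.mem_insert, Finset.mem_singleton, not_or] at hp
    have h8 := h5 p hp.1 hp.2.1 hp.2.2
    exact pointWeight_congr h8 rfl rfl (fun e => h7 p hp' (by rw [← h8, e]) hp.1)
  rw [spinHook_apply, key', key (setPair s j k true), key (setPair s j k false)]
  · generalize (∏ p ∈ P \ {j, k, v}, pointWeight a f η s p) = R
    simp only [pointWeight, hv, hfv, hfj, h1, h2, h3, h6, setPair_apply, hjk, hjk.ne, hjk.not_gt, hfk,
      hvj, hjk.ne', hfk.ne', hfk.not_gt, hvj.ne', hfk.ne, lt_irrefl, if_true, if_false]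
    cases s v <;> simp [cupWeight, ha] <;> field_simp
  all_goals intro p h1 h2; simp [setPair_apply, h1, h2]

theorem spinHook_matchWeight_defect_right (ha : a ≠ 0) (hinv : ∀ p, f (f p) = p)
    (hP : ∀ p ∈ P, f p ∈ P) (hj : j ∈ P) (hk : k ∈ P) (hjk : j < k)
    (hfj : f j < j) (hfk : f k = k) (h1 : f' j = k) (h2 : f' k = j) (h3 : f' (f j) = f j)
    (h5 : ∀ p, p ≠ j → p ≠ k → p ≠ f j → f' p = f p)
    (h6 : η' (f j) = η k) (h7 : ∀ p ∈ P, f p = p → p ≠ k → η' p = η p) :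
    spinHook a j k (matchWeight a P f η) = matchWeight a P f' η' := by
  ext s
  obtain ⟨u, hu⟩ : ∃ u, f j = u := ⟨_, rfl⟩
  have hfu : f u = j := by rw [← hu, hinv]
  rw [hu] at hfj h3 h5 h6
  have huk : u < k := hfj.trans hjk
  have hQ : ({j, k, u} : Finset ι) ⊆ P := by
    intro p; simp only [Finset.mem_insert, Finset.mem_singleton]
    rintro (rfl | rfl | rfl)
    exacts [hj, hk, hu ▸ hP j hj]
  have prodQ : ∀ F : ι → ℂ, ∏ p ∈ ({j, k, u} : Finset ι), F p = F j * (F k * F u) := by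
    intro F
    rw [Finset.prod_insert, Finset.prod_pair huk.ne']
    simp [hjk.ne, hfj.ne']
  have key : ∀ s', (∀ p, p ≠ j → p ≠ k → s' p = s p) → matchWeight a P f η s' =
      (∏ p ∈ P \ {j, k, u}, pointWeight a f η s p) * (pointWeight a f η s' j *
        (pointWeight a f η s' k * pointWeight a f η s' u)) := by
    intro s' hs'
    rw [matchWeight, prod_eq_of_agree hQ (G := pointWeight a f η s), prodQ]
    intro p _ hp
    simp only [Finset.mem_insert, Finset.mem_singleton, not_or] at hp
    refine pointWeight_congr rfl (hs' p hp.1 hp.2.1) (hs' _ ?_ ?_) (fun _ => rfl)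
    · intro e; apply hp.2.2; rw [← hinv p, e, hu]
    · intro e; apply hp.2.1; rw [← hinv p, e, hfk]
  have key' : matchWeight a P f' η' s =
      (∏ p ∈ P \ {j, k, u}, pointWeight a f η s p) * (pointWeight a f' η' s j *
        (pointWeight a f' η' s k * pointWeight a f' η' s u)) := by
    rw [matchWeight, prod_eq_of_agree hQ (G := pointWeight a f η s), prodQ]
    intro p hp' hp
    simp only [Finset.mem_insert, Finset.mem_singleton, not_or] at hp
    have h8 := h5 p hp.1 hp.2.1 hp.2.2
    exact pointWeight_congr h8 rfl rfl (fun e => h7 p hp' (by rw [← h8, e]) hp.2.1)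
  rw [spinHook_apply, key', key (setPair s j k true), key (setPair s j k false)]
  · generalize (∏ p ∈ P \ {j, k, u}, pointWeight a f η s p) = R
    simp only [pointWeight, hu, hfu, hfk, h1, h2, h3, h6, setPair_apply, hjk, hjk.ne, hjk.not_gt, hfj,
      hjk.ne', hfj.ne', hfj.not_gt, huk.ne, huk.ne', huk.not_gt, hfj.ne, lt_irrefl, if_true,
      if_false]
    cases s u <;> simp [cupWeight, ha] <;> field_simp
  all_goals intro p h1 h2; simp [setPair_apply, h1, h2]

/-- Two open ends are closed off, so a number splits off: the pairing of `η j` and `η k` with a|+-⟩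
+ a⁻¹|-+⟩. It decides which joinings of through strands vanish. -/
theorem spinHook_matchWeight_defects (hinv : ∀ p, f (f p) = p)
    (hj : j ∈ P) (hk : k ∈ P) (hjk : j < k)
    (hfj : f j = j) (hfk : f k = k) (h1 : f' j = k) (h2 : f' k = j)
    (h5 : ∀ p, p ≠ j → p ≠ k → f' p = f p) :
    spinHook a j k (matchWeight a P f η) =
      (a * (η j true * η k false) + a⁻¹ * (η j false * η k true)) • matchWeight a P f' η := by
  ext s
  have hQ : ({j, k} : Finset ι) ⊆ P := by
    intro p; simp only [Finset.mem_insert, Finset.mem_singleton]; rintro (rfl | rfl) <;> assumption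
  have key : ∀ s', (∀ p, p ≠ j → p ≠ k → s' p = s p) → matchWeight a P f η s' =
      (∏ p ∈ P \ {j, k}, pointWeight a f η s p) *
        (pointWeight a f η s' j * pointWeight a f η s' k) := by
    intro s' hs'
    rw [matchWeight, prod_eq_of_agree hQ (G := pointWeight a f η s), Finset.prod_pair hjk.ne]
    intro p _ hp
    simp only [Finset.mem_insert, Finset.mem_singleton, not_or] at hp
    refine pointWeight_congr rfl (hs' p hp.1 hp.2) (hs' _ ?_ ?_) (fun _ => rfl)
    · intro e; apply hp.1; rw [← hinv p, e, hfj]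
    · intro e; apply hp.2; rw [← hinv p, e, hfk]
  have key' : matchWeight a P f' η s =
      (∏ p ∈ P \ {j, k}, pointWeight a f η s p) *
        (pointWeight a f' η s j * pointWeight a f' η s k) := by
    rw [matchWeight, prod_eq_of_agree hQ (G := pointWeight a f η s), Finset.prod_pair hjk.ne]
    intro p hp' hp
    simp only [Finset.mem_insert, Finset.mem_singleton, not_or] at hp
    exact pointWeight_congr (h5 p hp.1 hp.2) rfl rfl (fun e => rfl)
  rw [spinHook_apply, Pi.smul_apply, key', key (setPair s j k true), key (setPair s j k false)]
  · simp only [pointWeight, hfj, hfk, h1, h2, setPair_apply, hjk, hjk.ne, hjk.not_gt, lt_irrefl,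
      if_true, if_false, smul_eq_mul, Bool.not_true, Bool.not_false]
    ring
  all_goals intro p h1 h2; simp [setPair_apply, h1, h2]

end MatchWeight

end

/-! ### The spin chain representation -/

noncomputable section

section SpinRep

variable {δ a : ℂ} {m : ℕ}

theorem TLIndex.succ_lt (i : TLIndex (m : ℕ∞)) : i.1 + 1 < m := by
  have := i.2
  exact_mod_cast this

/-- The spin chain representation of the Temperley-Lieb algebra on `m` strands. -/
def spinRep (ha : a ≠ 0) (hδ : a ^ 2 + a⁻¹ ^ 2 = δ) (m : ℕ) :
    TL δ (m : ℕ∞) →ₐ[ℂ] Module.End ℂ ((Fin m → Bool) → ℂ) :=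
  TL.lift (fun i => spinHook a (⟨i.1, by have := i.succ_lt; omega⟩ : Fin m) ⟨i.1 + 1, i.succ_lt⟩)
    (fun i => by rw [← hδ]; exact spinHook_sq a (by simp))
    (fun i k h => by
      rcases h with h | h
      · have : (⟨k.1, by have := k.succ_lt; omega⟩ : Fin m) = ⟨i.1 + 1, i.succ_lt⟩ :=
          Fin.ext h
        rw [this]
        apply spinHook_zigzag ha <;> simp [h] <;> omega
      · have : (⟨i.1, by have := i.succ_lt; omega⟩ : Fin m) = ⟨k.1 + 1, k.succ_lt⟩ :=
          Fin.ext h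
        rw [this]
        apply spinHook_zigzag' ha <;> simp [h] <;> omega)
    (fun i k h => by apply spinHook_comm <;> simp <;> omega)

theorem spinRep_gen (ha : a ≠ 0) (hδ : a ^ 2 + a⁻¹ ^ 2 = δ) (i : TLIndex (m : ℕ∞)) :
    spinRep ha hδ m (TL.gen δ i) =
      spinHook a (⟨i.1, by have := i.succ_lt; omega⟩ : Fin m) ⟨i.1 + 1, i.succ_lt⟩ := TL.lift_gen ..

/-- A spin configuration on `m` points, extended by the value `false`. -/
def extendSpin (s : Fin m → Bool) (p : ℕ) : Bool := if h : p < m then s ⟨p, h⟩ else false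

theorem setPair_extendSpin (s : Fin m → Bool) (i : ℕ) (hi : i + 1 < m) (r : Bool) :
    setPair (extendSpin s) i (i + 1) r =
      extendSpin (setPair s (⟨i, by omega⟩ : Fin m) ⟨i + 1, hi⟩ r) := by
  funext p
  simp only [setPair_apply, extendSpin]
  split_ifs <;> simp_all <;> omega

theorem spinHook_extendSpin (a : ℂ) (i : ℕ) (hi : i + 1 < m) (F : (ℕ → Bool) → ℂ) :
    spinHook a (⟨i, by omega⟩ : Fin m) ⟨i + 1, hi⟩ (fun s => F (extendSpin s)) =
      fun s => spinHook a i (i + 1) F (extendSpin s) := by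
  funext s
  have : i < m := by omega
  simp only [spinHook_apply, setPair_extendSpin s i hi]
  simp [extendSpin, hi, this]

end SpinRep

/-! ### Link states as vectors of the spin chain -/

namespace LinkState

variable {n p : ℕ}

theorem two_mul_le (u : LinkState n p) : 2 * p ≤ n := by
  have := u.card_through; omega

instance : Finite (LinkState n p) :=
  Finite.of_injective
    (fun u : LinkState n p => fun a : Fin n => (⟨u.partner a, u.partner_lt a a.2⟩ : Fin n))
    fun u v h => by
      apply ext_partner
      intro a
      by_cases ha : a < n
      · exact congrArg Fin.val (congrFun h ⟨a, ha⟩)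
      · rw [u.partner_of_le a (by omega), v.partner_of_le a (by omega)]

instance : Fintype (LinkState n p) := Fintype.ofFinite _

/-- The number of through strands that end to the left of `a`. -/
def rank (u : LinkState n p) (a : ℕ) : ℕ := ((Finset.range a).filter fun b => u.partner b = b).card

theorem rank_succ (u : LinkState n p) {a : ℕ} (ha : u.partner a = a) :
    u.rank (a + 1) = u.rank a + 1 := by
  rw [rank, Finset.range_add_one, Finset.filter_insert, if_pos ha, Finset.card_insert_of_notMem, rank]
  simp

theorem rank_mono (u : LinkState n p) {a b : ℕ} (h : a ≤ b) : u.rank a ≤ u.rank b :=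
  Finset.card_le_card (Finset.filter_subset_filter _ (Finset.range_subset_range.2 h))

theorem rank_lt (u : LinkState n p) {a b : ℕ} (ha : u.partner a = a) (h : a < b) :
    u.rank a < u.rank b := by
  have := u.rank_mono (show a + 1 ≤ b from h)
  rw [u.rank_succ ha] at this
  omega

theorem rank_card (u : LinkState n p) : u.rank n + 2 * p = n := u.card_through

/-- Two neighbouring through strands are joined by a cup. -/
def addCup (u : LinkState n p) (i : ℕ) (hi : i + 1 < n)
    (h : u.partner i = i ∧ u.partner (i + 1) = i + 1) : LinkState n (p + 1) where
  partner b := if b = i then i + 1 else if b = i + 1 then i else u.partner b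
  partner_partner b := by
    have := u.partner_partner
    grind
  partner_of_le b hb := by
    have := u.partner_of_le b hb
    grind
  noncrossing x y h1 h2 := by
    have e0 := u.partner_partner
    have n0 := u.noncrossing x y
    have n1 := u.noncrossing x i
    have n2 := u.noncrossing x (i + 1)
    have e1 := e0 x
    have e2 := e0 y
    split_ifs at h2 ⊢ <;> grind
  card_through := by
    have h1 := u.card_through
    have : ((Finset.range n).filter fun b => u.partner b = b) =
        insert i (insert (i + 1) ((Finset.range n).filter fun b =>
          (if b = i then i + 1 else if b = i + 1 then i else u.partner b) = b)) := by
      ext b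
      simp only [Finset.mem_filter, Finset.mem_range, Finset.mem_insert]
      grind
    rw [this, Finset.card_insert_of_notMem, Finset.card_insert_of_notMem] at h1
    · omega
    · simp
    · simp

/-- The spin `r` is allowed at the end `b` of a through strand if it is `+` for the first `κ` through
strands, and `-` for the others. -/
def defectWeight (u : LinkState n p) (κ b : ℕ) (r : Bool) : ℂ :=
  if r = decide (u.rank b < κ) then 1 else 0

/-- The vector of a link state, where the first `κ` through strands carry the spin `+`, and the others
the spin `-`. -/
def weight (a : ℂ) (u : LinkState n p) (κ : ℕ) (s : ℕ → Bool) : ℂ :=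
  matchWeight a (Finset.range n) u.partner (u.defectWeight κ) s

/-- No through strand ends below a cup. So the end that moves from `i` to `partner (i + 1)`, or from
`i + 1` to `partner i`, does not jump over `b`, and the order of the through strands is unchanged.
-/
theorem rank_hook_of_ne (u : LinkState n p) (i : ℕ) (hi : i + 1 < n) (h) {b : ℕ}
    (hb : u.partner b = b) (hbi : b ≠ i) (hbi' : b ≠ i + 1) :
    (u.hook i hi h).rank b = u.rank b := by
  have e0 := u.partner_partner
  have n0 := u.noncrossing (i + 1) b
  have n1 := u.noncrossing (u.partner i) b
  have n2 := u.noncrossing (u.partner (i + 1)) i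
  have n3 := u.noncrossing i (i + 1)
  have n4 := u.noncrossing i b
  have n5 := u.noncrossing (u.partner (i + 1)) b
  rw [e0] at n1 n2 n5
  have lt0 := Nat.lt_irrefl
  by_cases h1 : u.partner i = i
  · by_cases hlt : b < i
    · unfold rank
      congr 1
      ext c
      simp only [Finset.mem_filter, Finset.mem_range, hook, hookFun]
      grind
    · have : ((Finset.range b).filter fun c => hookFun u.partner i c = c) =
          insert (u.partner (i + 1)) (((Finset.range b).filter fun c => u.partner c = c).erase i) := by
        ext c
        simp only [Finset.mem_filter, Finset.mem_range, Finset.mem_insert, Finset.mem_erase, hookFun]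
        grind
      rw [rank, hook, this, Finset.card_insert_of_notMem, Finset.card_erase_of_mem,
        Nat.sub_add_cancel, rank]
      · exact Finset.card_pos.2 ⟨i, by simp [h1]; omega⟩
      · simp [h1]; omega
      · simp only [Finset.mem_filter, Finset.mem_range, Finset.mem_erase]
        grind
  by_cases h2 : u.partner (i + 1) = i + 1
  · by_cases hlt : b < i
    · unfold rank
      congr 1
      ext c
      simp only [Finset.mem_filter, Finset.mem_range, hook, hookFun]
      grind
    · have : ((Finset.range b).filter fun c => hookFun u.partner i c = c) =
          insert (u.partner i) (((Finset.range b).filter fun c => u.partner c = c).erase (i + 1)) := by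
        ext c
        simp only [Finset.mem_filter, Finset.mem_range, Finset.mem_insert, Finset.mem_erase, hookFun]
        grind
      rw [rank, hook, this, Finset.card_insert_of_notMem, Finset.card_erase_of_mem,
        Nat.sub_add_cancel, rank]
      · exact Finset.card_pos.2 ⟨i + 1, by simp [h2]; omega⟩
      · simp [h2]; omega
      · simp only [Finset.mem_filter, Finset.mem_range, Finset.mem_erase]
        grind
  · unfold rank
    congr 1
    ext c
    simp only [Finset.mem_filter, Finset.mem_range, hook, hookFun]
    grind

/-- The points strictly between `i + 1` and its partner lie below a cup, so none of them is the end
of a through strand that the moving end could overtake. -/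
theorem rank_hook_left (u : LinkState n p) (i : ℕ) (hi : i + 1 < n) (h) (h1 : u.partner i = i)
    (h2 : i + 1 < u.partner (i + 1)) :
    (u.hook i hi h).rank (u.partner (i + 1)) = u.rank i := by
  have e0 := u.partner_partner
  have n0 := u.noncrossing (i + 1)
  unfold rank
  congr 1
  ext c
  simp only [Finset.mem_filter, Finset.mem_range, hook, hookFun]
  grind

theorem rank_hook_right (u : LinkState n p) (i : ℕ) (hi : i + 1 < n) (h)
    (h1 : u.partner (i + 1) = i + 1) (h2 : u.partner i < i) :
    (u.hook i hi h).rank (u.partner i) = u.rank (i + 1) := by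
  have e0 := u.partner_partner
  have n0 := u.noncrossing (u.partner i)
  rw [e0] at n0
  unfold rank
  congr 1
  ext c
  simp only [Finset.mem_filter, Finset.mem_range, hook, hookFun]
  grind

theorem rank_addCup (u : LinkState n p) (i : ℕ) (hi : i + 1 < n) (h) {b : ℕ}
    (hbi : b ≠ i) (hbi' : b ≠ i + 1) :
    u.rank b = (u.addCup i hi h).rank b + if b < i then 0 else 2 := by
  split_ifs with hb
  · unfold rank addCup
    rw [add_zero]
    congr 1
    ext c
    simp only [Finset.mem_filter, Finset.mem_range]
    grind
  · have : ((Finset.range b).filter fun c => u.partner c = c) =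
        insert i (insert (i + 1) ((Finset.range b).filter fun c =>
          (u.addCup i hi h).partner c = c)) := by
      ext c
      simp only [Finset.mem_filter, Finset.mem_range, Finset.mem_insert, addCup]
      grind
    rw [rank, this, Finset.card_insert_of_notMem, Finset.card_insert_of_notMem, rank]
    · simp only [Finset.mem_filter, addCup]; grind
    · simp only [Finset.mem_filter, Finset.mem_insert, addCup]; grind

variable {a δ : ℂ}

/-- The signs on the through strands depend only on their order, which the hook preserves. Hence the
local rules for a loop, for two strands and for one open end on either side apply with `κ`
unchanged. -/
theorem spinHook_weight_of_not_through (ha : a ≠ 0) (hδ : a ^ 2 + a⁻¹ ^ 2 = δ) (u : LinkState n p)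
    (κ i : ℕ) (hi : i + 1 < n) (h : ¬ (u.partner i = i ∧ u.partner (i + 1) = i + 1)) :
    spinHook a i (i + 1) (weight a u κ) =
      (if u.partner i = i + 1 then δ else 1) • weight a (u.hook i hi h) κ := by
  have hiP : i ∈ Finset.range n := Finset.mem_range.2 (by omega)
  have hiP' : i + 1 ∈ Finset.range n := Finset.mem_range.2 hi
  have e0 := u.partner_partner
  have hP : ∀ b ∈ Finset.range n, u.partner b ∈ Finset.range n := by
    intro b hb; rw [Finset.mem_range] at hb ⊢; exact u.partner_lt b hb
  have n1 := u.noncrossing i (i + 1)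
  have n2 := u.noncrossing (u.partner (i + 1)) i
  have n3 := u.noncrossing (u.partner i) (u.partner (i + 1))
  have n4 := u.noncrossing (i + 1) (u.partner i)
  rw [e0] at n2
  rw [e0, e0] at n3
  rw [e0] at n4
  have d1 := e0 i
  have d2 := e0 (i + 1)
  unfold weight
  split_ifs with h0
  · have h3 : u.hook i hi h = u := by
      apply ext_partner
      intro b
      simp only [hook, hookFun]
      grind (splits := 30)
    rw [h3, ← hδ]
    exact spinHook_matchWeight_loop e0 hiP hiP' (by omega) h0
  rw [one_smul]
  have h4 : u.partner (i + 1) ≠ i := fun e => by rw [e] at d2; omega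
  have hF : (u.hook i hi h).partner = hookFun u.partner i := rfl
  by_cases h1 : u.partner i = i
  · have h2 : u.partner (i + 1) ≠ i + 1 := fun e => h ⟨h1, e⟩
    have h2 : i + 1 < u.partner (i + 1) := by omega
    refine spinHook_matchWeight_defect_left ha e0 hP hiP hiP' (by omega) h1 h2 ?_ ?_ ?_ ?_ ?_ ?_
    · rw [hF]; simp [hookFun]
    · rw [hF]; simp [hookFun]
    · rw [hF]; simp only [hookFun]; grind
    · intro b _ _ _; rw [hF]; simp only [hookFun]; grind
    · funext r; simp only [defectWeight, rank_hook_left u i hi h h1 h2]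
    · intro b _ hb hbi; funext r
      simp only [defectWeight, rank_hook_of_ne u i hi h hb hbi (by rintro rfl; omega)]
  by_cases h2 : u.partner (i + 1) = i + 1
  · have h3 : u.partner i < i := by
      by_contra hc
      have := n1 (by omega) (by omega)
      omega
    refine spinHook_matchWeight_defect_right ha e0 hP hiP hiP' (by omega) h3 h2 ?_ ?_ ?_ ?_ ?_ ?_
    · rw [hF]; simp [hookFun]
    · rw [hF]; simp [hookFun]
    · rw [hF]; simp only [hookFun]; grind
    · intro b _ _ _; rw [hF]; simp only [hookFun]; grind
    · funext r; simp only [defectWeight, rank_hook_right u i hi h h2 h3]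
    · intro b _ hb hbi; funext r
      simp only [defectWeight, rank_hook_of_ne u i hi h hb (by rintro rfl; omega) hbi]
  · have : matchWeight a (Finset.range n) (u.hook i hi h).partner ((u.hook i hi h).defectWeight κ) =
        matchWeight a (Finset.range n) (u.hook i hi h).partner (u.defectWeight κ) := by
      funext s
      refine Finset.prod_congr rfl fun b _ => pointWeight_congr rfl rfl rfl fun hb => ?_
      rw [hF] at hb
      simp only [hookFun] at hb
      funext r
      simp only [defectWeight]
      rw [rank_hook_of_ne u i hi h] <;> grind
    rw [this]
    have p1 : u.partner i ≠ u.partner (i + 1) := fun e => by rw [e] at d1; omega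
    refine spinHook_matchWeight_strands ha e0 hP hiP hiP' (by omega) h1 h2 h0 (by omega) ?_ ?_ ?_ ?_ ?_
    · rw [hF]; simp [hookFun]
    · rw [hF]; simp [hookFun]
    · rw [hF]; simp only [hookFun]; grind
    · rw [hF]; simp only [hookFun]; grind
    · intro b _ _ _ _; rw [hF]; simp only [hookFun]; grind

/-- Joining two through strands requires opposite spins. Since all signs `+` come first, this
happens only at the place where the signs switch, that is for `κ = rank i + 1`, and it uses up one
`+`. The standard representation gives zero here, while the spin chain gives a vector with one more
cup: the number of cups is a filtration and not a grading. -/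
theorem spinHook_weight_of_through (u : LinkState n p)
    (κ i : ℕ) (hi : i + 1 < n) (h : u.partner i = i ∧ u.partner (i + 1) = i + 1) :
    spinHook a i (i + 1) (weight a u κ) =
      if κ = u.rank i + 1 then a • weight a (u.addCup i hi h) (κ - 1) else 0 := by
  have hiP : i ∈ Finset.range n := Finset.mem_range.2 (by omega)
  have hiP' : i + 1 ∈ Finset.range n := Finset.mem_range.2 hi
  unfold weight
  rw [spinHook_matchWeight_defects u.partner_partner hiP hiP' (by omega) h.1 h.2
    (f' := (u.addCup i hi h).partner) (by simp [addCup]) (by simp [addCup])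
    (by intro b h1 h2; simp [addCup, h1, h2])]
  have h1 := u.rank_succ h.1
  split_ifs with hκ
  · have h2 : matchWeight a (Finset.range n) (u.addCup i hi h).partner (u.defectWeight κ) =
      matchWeight a (Finset.range n) (u.addCup i hi h).partner
        ((u.addCup i hi h).defectWeight (κ - 1)) := by
      funext s
      refine Finset.prod_congr rfl fun b _ => pointWeight_congr rfl rfl rfl fun hb => ?_
      have hbi : b ≠ i := by rintro rfl; simp [addCup] at hb
      have hbi' : b ≠ i + 1 := by rintro rfl; simp [addCup] at hb
      have hub : u.partner b = b := by simpa [addCup, hbi, hbi'] using hb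
      funext r
      have h3 := u.rank_addCup i hi h hbi hbi'
      have h4 := u.rank_lt (b := i) hub
      have h5 := u.rank_lt (a := i + 1) (b := b) h.2
      have : (u.rank b < κ) ↔ ((u.addCup i hi h).rank b < κ - 1) := by
        split_ifs at h3 with h6
        · have := h4 h6; omega
        · have := h5 (by omega); omega
      simp only [defectWeight, this]
    rw [h2]
    congr 1
    have h6 : u.rank i < κ := by omega
    have h7 : ¬ u.rank (i + 1) < κ := by omega
    simp [defectWeight, h6, h7]
  · convert zero_smul ℂ _
    simp only [defectWeight]
    by_cases h6 : u.rank i < κ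
    · have h7 : u.rank (i + 1) < κ := by omega
      simp [h6, h7]
    · have h7 : ¬ u.rank (i + 1) < κ := by omega
      simp [h6, h7]

end LinkState
end

/-! ### Leading configurations of link state vectors -/

noncomputable section

namespace LinkState

variable {n p : ℕ} {a : ℂ}

/-- The configuration of a link state in which the left ends of cups carry the spin `-`. -/
def lead (u : LinkState n p) (κ b : ℕ) : Bool :=
  if b < u.partner b then false else if u.partner b = b then decide (u.rank b < κ) else true

theorem spin_of_weight_ne_zero {u : LinkState n p} {κ : ℕ} {s : ℕ → Bool} (h : weight a u κ s ≠ 0)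
    {b : ℕ} (hb : b < n) :
    (u.partner b = b → s b = decide (u.rank b < κ)) ∧ (u.partner b ≠ b → s (u.partner b) = !s b) := by
  unfold weight matchWeight at h
  have key : ∀ c < n, pointWeight a u.partner (u.defectWeight κ) s c ≠ 0 := fun c hc =>
    Finset.prod_ne_zero_iff.1 h c (Finset.mem_range.2 hc)
  constructor
  · intro e
    have := key b hb
    rw [pointWeight, if_neg (by omega), if_pos e, defectWeight] at this
    by_contra hc
    rw [if_neg hc] at this
    exact this rfl
  · intro e
    rcases lt_or_gt_of_ne e with e | e
    · have := key _ (u.partner_lt b hb)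
      rw [pointWeight, u.partner_partner, if_pos e, cupWeight] at this
      revert this
      cases s b <;> cases s (u.partner b) <;> simp
    · have := key b hb
      rw [pointWeight, if_pos e, cupWeight] at this
      revert this
      cases s b <;> cases s (u.partner b) <;> simp

theorem weight_lead_ne_zero (ha : a ≠ 0) (u : LinkState n p) (κ : ℕ) {s : ℕ → Bool}
    (h : ∀ b < n, s b = u.lead κ b) : weight a u κ s ≠ 0 := by
  unfold weight matchWeight
  refine Finset.prod_ne_zero_iff.2 fun b hb => ?_
  rw [Finset.mem_range] at hb
  have hb' := u.partner_lt b hb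
  rw [pointWeight]
  split_ifs with h1 h2
  · rw [h b hb, h _ hb', lead, lead, if_pos h1, u.partner_partner, if_neg (by omega),
      if_neg (by omega)]
    simpa [cupWeight] using ha
  · rw [defectWeight, h b hb, lead, if_neg h1, if_pos h2, if_pos rfl]
    exact one_ne_zero
  · exact one_ne_zero

/-- The first place where `s` deviates from the leading configuration is not the end of a through
strand, whose spin is prescribed, nor the right end of a cup, since then the left end would have
deviated before. So it is a left end, where the leading spin is `-`: the leading configuration is
lexicographically least in the support. -/
theorem lead_lt_of_weight_ne_zero {u : LinkState n p} {κ : ℕ} {s : ℕ → Bool}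
    (h : weight a u κ s ≠ 0) (hs : ∃ b < n, s b ≠ u.lead κ b) :
    ∃ b < n, (∀ c < b, s c = u.lead κ c) ∧ u.lead κ b = false ∧ s b = true := by
  classical
  obtain ⟨b, ⟨hb, hne⟩, hmin⟩ : ∃ b, (b < n ∧ s b ≠ u.lead κ b) ∧
      ∀ c < b, ¬ (c < n ∧ s c ≠ u.lead κ c) :=
    ⟨Nat.find hs, Nat.find_spec hs, fun c hc => Nat.find_min hs hc⟩
  refine ⟨b, hb, fun c hc => by by_contra h'; exact hmin c hc ⟨by omega, h'⟩, ?_⟩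
  have h1 := spin_of_weight_ne_zero h hb
  have h2 := hmin (u.partner b)
  have h3 := u.partner_lt b hb
  have h4 := u.partner_partner b
  simp only [lead] at hne h2 ⊢
  rw [h4] at h2
  by_cases e : u.partner b = b
  · rw [if_neg (by omega), if_pos e] at hne
    exact absurd (h1.1 e) hne
  · have h5 := h1.2 e
    by_cases e' : b < u.partner b
    · rw [if_pos e'] at hne ⊢
      exact ⟨rfl, by simpa using hne⟩
    · exfalso
      rw [if_neg e', if_neg e] at hne
      apply h2 (by omega)
      refine ⟨h3, ?_⟩
      rw [if_pos (by omega), h5]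
      revert hne
      cases s b <;> simp

theorem exists_rank_eq (u : LinkState n p) {r : ℕ} (hr : r < u.rank n) :
    ∃ b < n, u.partner b = b ∧ u.rank b = r := by
  classical
  have hex : ∃ b, r < u.rank b := ⟨n, hr⟩
  obtain ⟨b, hb, hmin⟩ : ∃ b, r < u.rank b ∧ ∀ c < b, ¬ r < u.rank c :=
    ⟨Nat.find hex, Nat.find_spec hex, fun c hc => Nat.find_min hex hc⟩
  have hbn : b ≤ n := by by_contra h; exact hmin n (by omega) hr
  cases b with
  | zero => simp [rank] at hb
  | succ c =>
    have h1 := hmin c (by omega)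
    by_cases hc : u.partner c = c
    · have := u.rank_succ hc
      exact ⟨c, by omega, hc, by omega⟩
    · exfalso
      rw [rank, Finset.range_add_one, Finset.filter_insert, if_neg hc] at hb
      exact h1 hb

/-- Read `-` and `+` as opening and closing brackets. By induction on its length, the inside of a
cup of `u` is matched by `v` in the same way, so the `v`-partners of the two ends of the cup are not
inside. The ends carry `-` and `+`; noncrossing and the rule that `+` precedes `-` on the through
strands force `v` to join them. -/
theorem partner_eq_of_lead_eq {p' : ℕ} {u : LinkState n p} {v : LinkState n p'} {κ κ' : ℕ}
    (h : ∀ b < n, u.lead κ b = v.lead κ' b) :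
    ∀ d b, b < u.partner b → u.partner b - b = d → v.partner b = u.partner b := by
  intro d
  induction d using Nat.strong_induction_on with
  | _ d ih =>
  intro b hb hd
  have hbn : b < n := by
    by_contra hc; rw [u.partner_of_le b (by omega)] at hb; omega
  have hen := u.partner_lt b hbn
  have e0 := u.partner_partner
  have e1 := v.partner_partner
  have inside : ∀ c, b < c → c < u.partner b → v.partner c = u.partner c := by
    intro c h1 h2
    obtain ⟨h3, h4, h5⟩ := u.noncrossing b c h1 h2
    rcases lt_or_gt_of_ne h5 with h6 | h6
    · have := ih (c - u.partner c) (by omega) (u.partner c) (by rw [e0]; exact h6) (by rw [e0])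
      rw [e0] at this
      rw [← this, e1]
      rw [this]
    · exact ih _ (by omega) c h6 rfl
  have inside' : ∀ c, b < c → c < u.partner b → b < v.partner c ∧ v.partner c < u.partner b := by
    intro c h1 h2
    rw [inside c h1 h2]
    obtain ⟨h3, h4, h5⟩ := u.noncrossing b c h1 h2
    exact ⟨h3, h4⟩
  have l1 := h b hbn
  have l2 := h _ hen
  rw [lead, if_pos hb, lead] at l1
  rw [lead, e0, if_neg (by omega), if_neg (by omega), lead] at l2
  have f1 := e1 b
  have f2 := e1 (u.partner b)
  by_contra hne
  have f3 := inside' (v.partner b)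
  have f4 := inside' (v.partner (u.partner b))
  rw [f1] at f3
  rw [f2] at f4
  have n1 := v.noncrossing b (u.partner b) hb
  have n2 := v.noncrossing (v.partner (u.partner b)) b
  rw [f2] at n2
  have f5 : v.partner (u.partner b) ≠ b := fun hc => hne (by rw [hc] at f2; exact f2)
  have r1 := v.rank_lt (a := b) (b := u.partner b)
  split_ifs at l1 l2 <;> simp at l1 l2 <;> grind

/-- Bracket matching recovers the cups, hence the through strands, their number and their order. If
`κ` and `κ'` differed, the through strand whose rank is the smaller of them would carry both signs.
-/
theorem eq_of_lead_eq {p' : ℕ} {u : LinkState n p} {v : LinkState n p'} {κ κ' : ℕ}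
    (hκ : κ ≤ n - 2 * p) (hκ' : κ' ≤ n - 2 * p')
    (h : ∀ b < n, u.lead κ b = v.lead κ' b) :
    (∀ b, u.partner b = v.partner b) ∧ p = p' ∧ κ = κ' := by
  have h1 := partner_eq_of_lead_eq h
  have h2 := partner_eq_of_lead_eq fun b hb => (h b hb).symm
  have e0 := u.partner_partner
  have e1 := v.partner_partner
  have H : ∀ b, u.partner b = v.partner b := by
    intro b
    rcases lt_trichotomy b (u.partner b) with h3 | h3 | h3
    · exact (h1 _ b h3 rfl).symm
    · rcases lt_trichotomy b (v.partner b) with h4 | h4 | h4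
      · exact h2 _ b h4 rfl
      · rw [← h3, ← h4]
      · have := h2 _ (v.partner b) (by rw [e1]; exact h4) rfl
        rw [e1] at this
        have := congrArg u.partner this
        rw [e0] at this
        exact this.symm
    · have := h1 _ (u.partner b) (by rw [e0]; exact h3) rfl
      rw [e0] at this
      have := congrArg v.partner this
      rw [e1] at this
      exact this
  have R : ∀ b, u.rank b = v.rank b := by
    intro b; unfold rank; simp only [H]
  have hp : p = p' := by
    have := u.rank_card; have := v.rank_card; have := R n; omega
  refine ⟨H, hp, ?_⟩
  have hn := u.rank_card
  by_contra hne
  rcases lt_or_gt_of_ne hne with hlt | hlt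
  · obtain ⟨b, hb, h3, h4⟩ := u.exists_rank_eq (r := κ) (by omega)
    have := h b hb
    simp [lead, ← H, h3, ← R, h4, hlt] at this
  · obtain ⟨b, hb, h3, h4⟩ := u.exists_rank_eq (r := κ') (by omega)
    have := h b hb
    simp [lead, ← H, h3, ← R, h4, hlt] at this

/-- Each cup carries exactly one `+`, and the first `κ` through strands carry the others. -/
theorem card_true_of_weight_ne_zero {u : LinkState n p} {κ : ℕ} (hκ : κ ≤ n - 2 * p) {s : ℕ → Bool}
    (h : weight a u κ s ≠ 0) : ((Finset.range n).filter fun b => s b = true).card = p + κ := by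
  have hs := fun b hb => spin_of_weight_ne_zero h (b := b) hb
  have e0 := u.partner_partner
  have hn := u.rank_card
  have hl := u.partner_lt
  set A := (Finset.range n).filter fun b => u.partner b ≠ b ∧ s b = true with hA
  set B := (Finset.range n).filter fun b => u.partner b ≠ b ∧ s b = false with hB
  set C := (Finset.range n).filter fun b => u.partner b = b ∧ s b = true with hC
  have hAB : A.card = B.card := by
    apply Finset.card_nbij' u.partner u.partner
    · intro b hb
      simp only [hA, hB, Finset.coe_filter, Finset.mem_range, Set.mem_ofPred_eq] at hb ⊢
      have := (hs b hb.1).2 hb.2.1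
      exact ⟨hl b hb.1, by rw [e0]; exact hb.2.1.symm, by rw [this, hb.2.2]; rfl⟩
    · intro b hb
      simp only [hA, hB, Finset.coe_filter, Finset.mem_range, Set.mem_ofPred_eq] at hb ⊢
      have := (hs b hb.1).2 hb.2.1
      exact ⟨hl b hb.1, by rw [e0]; exact hb.2.1.symm, by rw [this, hb.2.2]; rfl⟩
    · intro b _; exact e0 b
    · intro b _; exact e0 b
  have hCκ : C.card = κ := by
    rw [← Finset.card_range κ]
    refine Finset.card_nbij u.rank ?_ ?_ ?_
    · intro b hb
      simp only [hC, Finset.mem_filter, Finset.mem_range, Finset.coe_filter,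
        Set.mem_ofPred_eq] at hb ⊢
      have := (hs b hb.1).1 hb.2.1
      rw [hb.2.2] at this
      simpa using this.symm
    · intro b hb c hc hbc
      simp only [hC, Finset.coe_filter, Finset.mem_range, Set.mem_ofPred_eq] at hb hc
      by_contra hne
      rcases lt_or_gt_of_ne hne with h1 | h1
      · have := u.rank_lt hb.2.1 h1; omega
      · have := u.rank_lt hc.2.1 h1; omega
    · intro r hr
      simp only [Finset.coe_range, Set.mem_Iio] at hr
      obtain ⟨b, hb, h3, h4⟩ := u.exists_rank_eq (r := r) (by omega)
      refine ⟨b, ?_, h4⟩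
      simp only [hC, Finset.coe_filter, Finset.mem_range, Set.mem_ofPred_eq]
      exact ⟨hb, h3, by rw [(hs b hb).1 h3]; simp; omega⟩
  have h1 : ((Finset.range n).filter fun b => s b = true) = A ∪ C := by
    ext b; simp only [hA, hC, Finset.mem_filter, Finset.mem_union]; tauto
  have h2 : Disjoint A C := by
    rw [Finset.disjoint_left]; intro b; simp only [hA, hC, Finset.mem_filter]; tauto
  have h3 : ((Finset.range n).filter fun b => ¬ u.partner b = b) = A ∪ B := by
    ext b; simp only [hA, hB, Finset.mem_filter, Finset.mem_union]
    cases s b <;> simp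
  have h4 : Disjoint A B := by
    rw [Finset.disjoint_left]; intro b; simp only [hA, hB, Finset.mem_filter]
    cases s b <;> simp
  have h5 := Finset.card_filter_add_card_filter_not (s := Finset.range n) (fun b => u.partner b = b)
  rw [h3, Finset.card_union_of_disjoint h4, Finset.card_range] at h5
  rw [h1, Finset.card_union_of_disjoint h2]
  unfold rank at hn
  omega

end LinkState
end

/-! ### The filtration of the spin chain by the number of cups -/

noncomputable section

-- Evaluate a linear relation at the leading point of its term of least order: by `h1` every other
-- term vanishes there.
open scoped Classical in
theorem linearIndependent_of_lead {T S L : Type*} [LinearOrder L] (F : T → S → ℂ) (lead : T → S)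
    (ord : S → L) (h0 : ∀ τ, F τ (lead τ) ≠ 0)
    (h1 : ∀ τ τ', τ ≠ τ' → F τ (lead τ') ≠ 0 → ord (lead τ) < ord (lead τ')) :
    LinearIndependent ℂ F := by
  rw [linearIndependent_iff']
  intro A c hc
  by_contra! hne
  obtain ⟨τ, hτA, hτ⟩ := hne
  obtain ⟨τ0, h2, hmin⟩ := (A.filter fun τ => c τ ≠ 0).exists_min_image (fun τ => ord (lead τ))
    ⟨τ, Finset.mem_filter.2 ⟨hτA, hτ⟩⟩
  rw [Finset.mem_filter] at h2
  have h3 := congrFun hc (lead τ0)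
  rw [Finset.sum_apply, Finset.sum_eq_single τ0] at h3
  · simp only [Pi.smul_apply, smul_eq_mul, Pi.zero_apply, mul_eq_zero] at h3
    exact h3.elim h2.2 (h0 τ0)
  · intro τ1 hA hne
    by_contra h4
    simp only [Pi.smul_apply, smul_eq_mul, mul_eq_zero, not_or] at h4
    exact absurd (h1 τ1 τ0 hne h4.2) (hmin τ1 (Finset.mem_filter.2 ⟨hA, h4.1⟩)).not_gt
  · intro h; exact absurd h2.1 h

theorem standardRep_gen (δ : ℂ) (n p : ℕ) (i : TLIndex (n : ℕ∞)) :
    standardRep δ n p (TL.gen δ i) = LinkState.hookOp δ i.1 i.succ_lt := TL.lift_gen ..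

namespace LinkState

variable {n p : ℕ} {a δ : ℂ}

/-- The vector of a link state in the spin chain. -/
def vec (a : ℂ) (u : LinkState n p) (κ : ℕ) (s : Fin n → Bool) : ℂ := weight a u κ (extendSpin s)

/-- The index set of the basis of link state vectors: the number of cups, a link state, and the number
of its through strands with spin `+`. -/
abbrev SpinIndex (n : ℕ) : Type := Σ p : Fin (n / 2 + 1), LinkState n p × Fin (n - 2 * p + 1)

/-- The basis vectors. -/
def spinVec (a : ℂ) (τ : SpinIndex n) : (Fin n → Bool) → ℂ := vec a τ.2.1 τ.2.2

theorem extendSpin_of_lt (s : Fin n → Bool) {b : ℕ} (hb : b < n) : extendSpin s b = s ⟨b, hb⟩ :=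
  dif_pos hb

theorem linearIndependent_spinVec (ha : a ≠ 0) : LinearIndependent ℂ (spinVec (n := n) a) := by
  refine linearIndependent_of_lead (spinVec a)
    (fun τ b => τ.2.1.lead τ.2.2 b) (fun s => toLex s) ?_ ?_
  · intro τ
    exact weight_lead_ne_zero ha _ _ fun b hb => extendSpin_of_lt _ hb
  · intro τ τ' hne h
    have h1 : ∃ b < n, extendSpin (fun b : Fin n => τ'.2.1.lead τ'.2.2 b) b ≠
        τ.2.1.lead τ.2.2 b := by
      by_contra! hc
      apply hne
      obtain ⟨⟨p, hp⟩, u, κ, hκ⟩ := τ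
      obtain ⟨⟨p', hp'⟩, u', κ', hκ'⟩ := τ'
      obtain ⟨h2, h3, h4⟩ := eq_of_lead_eq (u := u) (v := u') (κ := κ) (κ' := κ')
        (by simpa [Nat.lt_succ_iff] using hκ) (by simpa [Nat.lt_succ_iff] using hκ')
        (fun b hb => by rw [← hc b hb, extendSpin_of_lt _ hb])
      subst h3
      subst h4
      rw [ext_partner h2]
    obtain ⟨b, hb, h2, h3, h4⟩ := lead_lt_of_weight_ne_zero h h1
    refine ⟨⟨b, hb⟩, fun c hc => ?_, ?_⟩
    · have := h2 c.1 hc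
      rw [extendSpin_of_lt _ c.2] at this
      exact this.symm
    · rw [extendSpin_of_lt _ hb] at h4
      change τ.2.1.lead τ.2.2 b < τ'.2.1.lead τ'.2.2 b
      rw [h3]
      simp only at h4
      rw [h4]
      decide

/-- The span of the vectors of link states with at least `q` cups. -/
def cupFiltration (a : ℂ) (n q : ℕ) : Submodule ℂ ((Fin n → Bool) → ℂ) :=
  Submodule.span ℂ (spinVec a '' {τ : SpinIndex n | q ≤ τ.1})

theorem vec_mem_cupFiltration (u : LinkState n p) {κ q : ℕ} (hκ : κ ≤ n - 2 * p) (hq : q ≤ p) :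
    vec a u κ ∈ cupFiltration a n q := by
  apply Submodule.subset_span
  have := u.two_mul_le
  exact ⟨⟨⟨p, by omega⟩, u, ⟨κ, Nat.lt_succ_of_le hκ⟩⟩, hq, rfl⟩

theorem cupFiltration_anti {q q' : ℕ} (h : q ≤ q') : cupFiltration a n q' ≤ cupFiltration a n q :=
  Submodule.span_mono (Set.image_mono fun _ h' => h.trans h')

/-- The map that takes a link state to its vector. -/
def vecMap (a : ℂ) (n p κ : ℕ) : (LinkState n p →₀ ℂ) →ₗ[ℂ] ((Fin n → Bool) → ℂ) :=
  Finsupp.linearCombination ℂ fun u => vec a u κ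

theorem vecMap_single (u : LinkState n p) (κ : ℕ) : vecMap a n p κ (Finsupp.single u 1) = vec a u κ := by
  rw [vecMap, Finsupp.linearCombination_single, one_smul]

theorem spinRep_gen_vec (ha : a ≠ 0) (hδ : a ^ 2 + a⁻¹ ^ 2 = δ) (i : TLIndex (n : ℕ∞))
    (u : LinkState n p) (κ : ℕ) :
    spinRep ha hδ n (TL.gen δ i) (vec a u κ) -
      vecMap a n p κ (standardRep δ n p (TL.gen δ i) (Finsupp.single u 1)) =
      if h : (u.partner i.1 = i.1 ∧ u.partner (i.1 + 1) = i.1 + 1) then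
        if κ = u.rank i.1 + 1 then a • vec a (u.addCup i.1 i.succ_lt h) (κ - 1) else 0
      else 0 := by
  rw [spinRep_gen, standardRep_gen]
  unfold vec
  rw [spinHook_extendSpin a i.1 i.succ_lt (weight a u κ)]
  split_ifs with h h1
  · rw [hookOp_of_through _ _ _ _ h, map_zero, sub_zero, spinHook_weight_of_through u κ _ i.succ_lt h,
      if_pos h1]
    rfl
  · rw [hookOp_of_through _ _ _ _ h, map_zero, sub_zero, spinHook_weight_of_through u κ _ i.succ_lt h,
      if_neg h1]
    rfl
  · rw [hookOp_of_not_through _ _ _ _ h, map_smul, vecMap_single,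
      spinHook_weight_of_not_through ha hδ u κ _ i.succ_lt h, sub_eq_zero]
    rfl

theorem spinRep_gen_vec_mem (ha : a ≠ 0) (hδ : a ^ 2 + a⁻¹ ^ 2 = δ) (i : TLIndex (n : ℕ∞))
    (u : LinkState n p) (κ : ℕ) :
    spinRep ha hδ n (TL.gen δ i) (vec a u κ) -
      vecMap a n p κ (standardRep δ n p (TL.gen δ i) (Finsupp.single u 1)) ∈
      cupFiltration a n (p + 1) := by
  rw [spinRep_gen_vec]
  split_ifs with h h1
  · apply Submodule.smul_mem
    apply vec_mem_cupFiltration _ _ le_rfl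
    have := u.rank_card
    have h2 := u.rank_succ h.1
    have h3 := u.rank_succ h.2
    have := u.rank_mono (show i.1 + 1 + 1 ≤ n from i.succ_lt)
    omega
  · exact zero_mem _
  · exact zero_mem _

theorem vecMap_mem (v : LinkState n p →₀ ℂ) {κ : ℕ} (hκ : κ ≤ n - 2 * p) :
    vecMap a n p κ v ∈ cupFiltration a n p := by
  rw [vecMap, Finsupp.linearCombination_apply]
  exact Submodule.sum_mem _ fun u _ => Submodule.smul_mem _ _ (vec_mem_cupFiltration u hκ le_rfl)

theorem spinRep_mem_cupFiltration (ha : a ≠ 0) (hδ : a ^ 2 + a⁻¹ ^ 2 = δ) (q : ℕ) (x : TL δ n) :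
    ∀ f ∈ cupFiltration a n q, spinRep ha hδ n x f ∈ cupFiltration a n q := by
  induction x using TL.induction with
  | hs c => intro v hv; rw [AlgHom.commutes]; exact Submodule.smul_mem _ _ hv
  | hm a b h1 h2 => intro v hv; rw [map_mul]; exact h1 _ (h2 _ hv)
  | ha a b h1 h2 => intro v hv; rw [map_add]; exact add_mem (h1 _ hv) (h2 _ hv)
  | hg i =>
    intro f hf
    unfold cupFiltration at hf
    induction hf using Submodule.span_induction with
    | zero => simp
    | add x y _ _ h1 h2 => rw [map_add]; exact add_mem h1 h2
    | smul c x _ h => rw [map_smul]; exact Submodule.smul_mem _ _ h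
    | mem f hf =>
      obtain ⟨τ, hτ, rfl⟩ := hf
      have h1 := spinRep_gen_vec_mem ha hδ i τ.2.1 τ.2.2
      have h2 := cupFiltration_anti (show q ≤ (τ.1 : ℕ) + 1 from Nat.le_succ_of_le hτ) h1
      have h3 := vecMap_mem (a := a) (standardRep δ n τ.1 (TL.gen δ i) (Finsupp.single τ.2.1 1))
        (Nat.lt_succ_iff.1 τ.2.2.2)
      have := add_mem h2 (cupFiltration_anti hτ h3)
      rwa [sub_add_cancel] at this

/-- For each fixed `κ`, the link states with `p` cups span a copy of the standard representation
modulo vectors with more cups. No bound on `κ` is required, because a correction occurs only for `κ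
= rank i + 1`. -/
theorem spinRep_vecMap_mem (ha : a ≠ 0) (hδ : a ^ 2 + a⁻¹ ^ 2 = δ) (κ : ℕ)
    (x : TL δ n) : ∀ v, spinRep ha hδ n x (vecMap a n p κ v) -
      vecMap a n p κ (standardRep δ n p x v) ∈ cupFiltration a n (p + 1) := by
  induction x using TL.induction with
  | hs c => intro v; rw [AlgHom.commutes, AlgHom.commutes]; simp [Algebra.algebraMap_eq_smul_one]
  | ha x y h1 h2 =>
    intro v
    have := add_mem (h1 v) (h2 v)
    simp only [map_add, LinearMap.add_apply]
    convert this using 1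
    abel
  | hm x y h1 h2 =>
    intro v
    have := add_mem (spinRep_mem_cupFiltration ha hδ _ x _ (h2 v)) (h1 (standardRep δ n p y v))
    simp only [map_mul, Module.End.mul_apply]
    convert this using 1
    rw [map_sub]
    abel
  | hg i =>
    intro v
    induction v using Finsupp.induction_linear with
    | zero => simp
    | add v w h1 h2 =>
      have := add_mem h1 h2
      simp only [map_add]
      convert this using 1
      abel
    | single u c =>
      have h := Submodule.smul_mem _ c (spinRep_gen_vec_mem ha hδ i u κ)
      rw [← mul_one c, ← smul_eq_mul, ← Finsupp.smul_single]
      simp only [map_smul, vecMap_single]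
      rw [smul_sub] at h
      exact h

end LinkState
end

/-! ### The link state basis, and the extremal trace as a weighted spin trace -/

noncomputable section

namespace LinkState

variable {n p : ℕ} {a δ : ℂ}

/-- The link state without cups. -/
def idle (n : ℕ) : LinkState n 0 where
  partner b := b
  partner_partner _ := rfl
  partner_of_le _ _ := rfl
  noncrossing x y h1 h2 := by omega
  card_through := by simp

theorem rank_idle (b : ℕ) : (idle n).rank b = b := by simp [rank, idle]

theorem vec_idle (a : ℂ) (κ : ℕ) :
    vec a (idle n) κ = Pi.single (fun b : Fin n => decide (b.1 < κ)) 1 := by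
  funext s
  rw [vec, weight, matchWeight]
  by_cases h : s = fun b : Fin n => decide (b.1 < κ)
  · rw [h, Pi.single_eq_same]
    refine Finset.prod_eq_one fun b hb => ?_
    rw [Finset.mem_range] at hb
    rw [pointWeight, if_neg (by simp [idle]), if_pos (by simp [idle]), defectWeight, rank_idle,
      extendSpin_of_lt _ hb, if_pos rfl]
  · rw [Pi.single_eq_of_ne h]
    obtain ⟨b, hb⟩ := Function.ne_iff.1 h
    refine Finset.prod_eq_zero (Finset.mem_range.2 b.2) ?_
    rw [pointWeight, if_neg (by simp [idle]), if_pos (by simp [idle]), defectWeight, rank_idle,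
      extendSpin_of_lt _ b.2, if_neg hb]

theorem spinHook_single (ha : a ≠ 0) {i k : Fin n} (hik : i ≠ k) (s : Fin n → Bool) :
    spinHook a i k (Pi.single (setPair s i k true) 1) =
      a ^ 2 • Pi.single (setPair s i k true) 1 + Pi.single (setPair s i k false) 1 := by
  funext t
  have e : ∀ r, setPair t i k r = setPair s i k true ↔ r = true ∧ ∀ p, p ≠ i → p ≠ k → t p = s p := by
    intro r
    constructor
    · intro h
      constructor
      · have := congrFun h i
        simpa [setPair_apply, hik] using this
      · intro p h1 h2
        have := congrFun h p
        simpa [setPair_apply, h1, h2] using this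
    · rintro ⟨rfl, h⟩
      funext p
      simp only [setPair_apply]
      split_ifs with h1 h2
      · rfl
      · rfl
      · exact h p h2 h1
  have e' : ∀ r, t = setPair s i k r ↔ t i = r ∧ t k = !r ∧ ∀ p, p ≠ i → p ≠ k → t p = s p := by
    intro r
    constructor
    · rintro h
      refine ⟨by rw [h]; simp [setPair_apply, hik], by rw [h]; simp [setPair_apply], ?_⟩
      intro p h1 h2
      rw [h]; simp [setPair_apply, h1, h2]
    · rintro ⟨h1, h2, h3⟩
      funext p
      simp only [setPair_apply]
      split_ifs with h4 h5
      · rw [h4, h2]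
      · rw [h5, h1]
      · exact h3 p h5 h4
  classical
  obtain ⟨Q, hQ⟩ : ∃ Q : Prop, (∀ p, p ≠ i → p ≠ k → t p = s p) ↔ Q := ⟨_, Iff.rfl⟩
  simp only [hQ] at e e'
  simp only [spinHook_apply, Pi.add_apply, Pi.smul_apply, Pi.single_apply, e, e', smul_eq_mul]
  by_cases h : Q
  · simp only [h, and_true]
    cases t i <;> cases t k <;> simp [cupWeight, ha] <;> ring
  · simp [h]

/-- Descending lexicographic induction. If `-+` occurs at neighbouring points, the configuration
with `+-` there is larger, and the generator turns the latter into the former modulo a multiple of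
the latter. Otherwise all `+` precede all `-`, and the configuration is the vector of the link state
without cups. -/
theorem single_mem_cupFiltration (ha : a ≠ 0) (s : Fin n → Bool) :
    Pi.single s 1 ∈ cupFiltration a n 0 := by
  induction h : toLex s using WellFoundedGT.induction generalizing s with
  | ind x ih =>
  subst h
  by_cases hs : ∃ i, ∃ hi : i + 1 < n, s ⟨i, by omega⟩ = false ∧ s ⟨i + 1, hi⟩ = true
  · obtain ⟨i, hi, h1, h2⟩ := hs
    have hne : (⟨i, by omega⟩ : Fin n) ≠ ⟨i + 1, hi⟩ := by simp
    have h3 : setPair s ⟨i, by omega⟩ ⟨i + 1, hi⟩ false = s := by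
      funext p
      rw [setPair_apply]
      split_ifs with h4 h5
      · rw [h4, h2]; rfl
      · rw [h5, h1]
      · rfl
    have h4 := ih (toLex (setPair s ⟨i, by omega⟩ ⟨i + 1, hi⟩ true)) (by
      refine ⟨⟨i, by omega⟩, fun c hc => ?_, ?_⟩
      · have hc' : c.1 < i := hc
        change s c = setPair s _ _ true c
        rw [setPair_apply, if_neg (fun e => by rw [e] at hc'; simp at hc'),
          if_neg (fun e => by rw [e] at hc'; simp at hc')]
      · change s _ < setPair s _ _ true _
        rw [setPair_apply, if_neg hne, if_pos rfl, h1]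
        decide) _ rfl
    have h5 := spinHook_single ha hne s
    rw [h3] at h5
    have h6 := spinRep_mem_cupFiltration ha rfl 0
      (TL.gen _ (⟨i, by exact_mod_cast hi⟩ : TLIndex (n : ℕ∞))) _ h4
    rw [spinRep_gen] at h6
    rw [h5] at h6
    have h7 := sub_mem h6 (Submodule.smul_mem _ (a ^ 2) h4)
    rwa [add_sub_cancel_left] at h7
  · push Not at hs
    obtain ⟨κ, hκ, h1, h2⟩ : ∃ κ ≤ n, (∀ b (hb : b < n), b < κ → s ⟨b, hb⟩ = true) ∧
        ∀ hκ : κ < n, s ⟨κ, hκ⟩ = false := by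
      classical
      by_cases hex : ∃ b, ∃ hb : b < n, s ⟨b, hb⟩ = false
      · obtain ⟨h3, h4⟩ := Nat.find_spec hex
        refine ⟨Nat.find hex, h3.le, fun b hb hlt => ?_, fun _ => h4⟩
        by_contra h5
        exact Nat.find_min hex hlt ⟨hb, by simpa using h5⟩
      · push Not at hex
        exact ⟨n, le_rfl, fun b hb _ => by simpa using hex b hb, fun h => absurd h (lt_irrefl _)⟩
    have h3 : ∀ b, κ ≤ b → ∀ hb : b < n, s ⟨b, hb⟩ = false := by
      intro b hb
      induction b, hb using Nat.le_induction with
      | base => exact h2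
      | succ b hb ih =>
        intro hb'
        have := hs b hb' (ih (by omega))
        simpa using this
    have h4 : s = fun b : Fin n => decide (b.1 < κ) := by
      funext b
      by_cases hb : b.1 < κ
      · rw [h1 b.1 b.2 hb]; simp [hb]
      · rw [h3 b.1 (by omega) b.2]; simp [hb]
    rw [h4, ← vec_idle a]
    exact vec_mem_cupFiltration _ (by omega) le_rfl

theorem cupFiltration_zero (ha : a ≠ 0) : cupFiltration a n 0 = ⊤ := by
  rw [eq_top_iff]
  intro f _
  rw [pi_eq_sum_univ f]
  refine Submodule.sum_mem _ fun s _ => Submodule.smul_mem _ _ ?_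
  convert single_mem_cupFiltration ha s using 1
  funext t
  simp [Pi.single_apply, eq_comm]

/-- The basis of link state vectors. -/
def spinBasis (ha : a ≠ 0) (n : ℕ) : Module.Basis (SpinIndex n) ℂ ((Fin n → Bool) → ℂ) :=
  Module.Basis.mk (linearIndependent_spinVec ha) (by
    rw [← cupFiltration_zero ha, cupFiltration]
    exact Submodule.span_mono (Set.image_subset_range _ _))

theorem spinBasis_apply (ha : a ≠ 0) (τ : SpinIndex n) : spinBasis ha n τ = spinVec a τ :=
  Module.Basis.mk_apply _ _ _

open scoped Classical in
theorem repr_vecMap (ha : a ≠ 0) (τ : SpinIndex n) (v : LinkState n τ.1 →₀ ℂ) :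
    (spinBasis ha n).repr (vecMap a n τ.1 τ.2.2 v) τ = v τ.2.1 := by
  induction v using Finsupp.induction_linear with
  | zero => simp
  | add v w h1 h2 => simp [h1, h2]
  | single u c =>
    have hc : Finsupp.single u c = c • Finsupp.single u (1 : ℂ) := by
      rw [Finsupp.smul_single, smul_eq_mul, mul_one]
    rw [hc, map_smul, vecMap_single, map_smul]
    have : vec a u τ.2.2 = spinBasis ha n ⟨τ.1, u, τ.2.2⟩ := by rw [spinBasis_apply]; rfl
    rw [this, Module.Basis.repr_self, Finsupp.smul_apply, Finsupp.smul_apply, Finsupp.single_apply,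
      Finsupp.single_apply]
    congr 1
    obtain ⟨p, v, κ⟩ := τ
    simp

open scoped Classical in
theorem repr_of_mem_cupFiltration (ha : a ≠ 0) (τ : SpinIndex n) {f : (Fin n → Bool) → ℂ}
    (hf : f ∈ cupFiltration a n (τ.1 + 1)) : (spinBasis ha n).repr f τ = 0 := by
  unfold cupFiltration at hf
  induction hf using Submodule.span_induction with
  | zero => simp
  | add x y _ _ h1 h2 => simp [h1, h2]
  | smul c x _ h => simp [h]
  | mem f hf =>
    obtain ⟨τ', hτ, rfl⟩ := hf
    rw [← spinBasis_apply ha, Module.Basis.repr_self, Finsupp.single_apply, if_neg]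
    rintro rfl
    simp at hτ

/-- The number of spins `+`. -/
def spinCount (s : Fin n → Bool) : ℕ := ((Finset.range n).filter fun b => extendSpin s b = true).card

/-- Both sides are the trace of `x` composed with the diagonal operator `M`. In the basis of
configurations this is the left side. In the basis of link state vectors `M` has the eigenvalues `D
(p + κ)`, and `x` is block triangular for the cup filtration with the standard representations on
the diagonal. -/
theorem sum_diagonal_spinRep (ha : a ≠ 0) (hδ : a ^ 2 + a⁻¹ ^ 2 = δ) (D : ℕ → ℂ) (x : TL δ n) :
    ∑ s : Fin n → Bool, D (spinCount s) * spinRep ha hδ n x (Pi.single s 1) s =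
      ∑ p ∈ Finset.range (n / 2 + 1), (∑ κ ∈ Finset.range (n - 2 * p + 1), D (p + κ)) *
        matrixTrace δ n p x := by
  classical
  let M : Module.End ℂ ((Fin n → Bool) → ℂ) :=
    { toFun := fun f s => D (spinCount s) * f s
      map_add' := fun f g => by funext s; simp only [Pi.add_apply]; ring
      map_smul' := fun c f => by
        funext s; simp only [Pi.smul_apply, smul_eq_mul, RingHom.id_apply]; ring }
  have h1 : LinearMap.trace ℂ _ (spinRep ha hδ n x * M) =
      ∑ s : Fin n → Bool, D (spinCount s) * spinRep ha hδ n x (Pi.single s 1) s := by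
    rw [LinearMap.trace_eq_matrix_trace ℂ (Pi.basisFun ℂ (Fin n → Bool)), Matrix.trace]
    refine Finset.sum_congr rfl fun s _ => ?_
    rw [Matrix.diag_apply, LinearMap.toMatrix_apply, Pi.basisFun_apply, Pi.basisFun_repr,
      Module.End.mul_apply]
    have : M (Pi.single s 1) = D (spinCount s) • Pi.single s 1 := by
      funext t
      by_cases h : t = s
      · subst h; simp [M]
      · simp [M, h]
    rw [this, map_smul, Pi.smul_apply, smul_eq_mul]
  rw [← h1, LinearMap.trace_eq_matrix_trace ℂ (spinBasis ha n), Matrix.trace, Fintype.sum_sigma,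
    Finset.sum_range]
  refine Finset.sum_congr rfl fun p _ => ?_
  rw [Fintype.sum_prod_type, matrixTrace, LinearMap.trace_eq_matrix_trace ℂ
    (Finsupp.basisSingleOne (R := ℂ) (ι := LinkState n p)), Matrix.trace, Finset.sum_mul_sum,
    Finset.sum_comm, Finset.sum_range]
  refine Finset.sum_congr rfl fun κ _ => ?_
  refine Finset.sum_congr rfl fun u _ => ?_
  set τ : SpinIndex n := ⟨p, u, κ⟩ with hτ
  have h2 : M (spinVec a τ) = D (p + κ) • spinVec a τ := by
    funext s
    change D (spinCount s) * spinVec a τ s = D (p + κ) * spinVec a τ s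
    by_cases h : spinVec a τ s = 0
    · rw [h, mul_zero, mul_zero]
    · have := card_true_of_weight_ne_zero (Nat.lt_succ_iff.1 κ.2) h
      rw [spinCount, this]
  rw [Matrix.diag_apply, LinearMap.toMatrix_apply, spinBasis_apply, Module.End.mul_apply, h2, map_smul,
    map_smul, Finsupp.smul_apply, smul_eq_mul]
  congr 1
  rw [Matrix.diag_apply, LinearMap.toMatrix_apply, Finsupp.coe_basisSingleOne]
  -- The correction terms have more cups than `τ`, so they do not contribute to the diagonal entry.
  have h3 := repr_of_mem_cupFiltration ha τ
    (spinRep_vecMap_mem ha hδ κ x (Finsupp.single u 1))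
  rw [map_sub, Finsupp.sub_apply, sub_eq_zero, vecMap_single] at h3
  refine h3.trans ?_
  exact repr_vecMap ha τ _

end LinkState

/-- The weight `z ^ (number of + minus number of -)`. -/
def spinPower (z : ℂ) (n k : ℕ) : ℂ := z ^ k * z⁻¹ ^ (n - k)

/-- A Chebyshev recursion: the sums S_k = z^k + z^(k-2) + ... + z^(-k) satisfy S_{k+2} = (z + z⁻¹)
S_{k+1} - S_k, and with z + z⁻¹ = g⁻¹ the products g^k S_k satisfy the recursion of `coeffZero` for
γ = g². -/
theorem coeffZero_eq_sum {γ g : ℝ} {z : ℂ} (hg : g ≠ 0) (hγ : γ = g ^ 2) (hz0 : z ≠ 0)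
    (hz : z + z⁻¹ = (g : ℂ)⁻¹) (k : ℕ) :
    (coeffZero γ k : ℂ) = (g : ℂ) ^ k * ∑ κ ∈ Finset.range (k + 1), spinPower z k κ := by
  have hg' : (g : ℂ) ≠ 0 := by exact_mod_cast hg
  have S : ∀ k, ∑ κ ∈ Finset.range (k + 2), spinPower z (k + 1) κ =
      z⁻¹ * ∑ κ ∈ Finset.range (k + 1), spinPower z k κ + z ^ (k + 1) := by
    intro k
    rw [Finset.sum_range_succ, Finset.mul_sum]
    congr 1
    · refine Finset.sum_congr rfl fun κ hκ => ?_
      rw [Finset.mem_range] at hκ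
      rw [spinPower, spinPower, show k + 1 - κ = (k - κ) + 1 by omega, pow_succ]
      ring
    · simp [spinPower]
  induction k using Nat.strong_induction_on with
  | _ k ih =>
  match k with
  | 0 => simp [coeffZero, spinPower]
  | 1 =>
    rw [Finset.sum_range_succ, Finset.sum_range_one]
    simp only [coeffZero, spinPower]
    have : (g : ℂ) * (z⁻¹ + z) = 1 := by rw [add_comm, hz]; field_simp
    simpa using this.symm
  | k + 2 =>
    rw [coeffZero]
    push_cast
    rw [ih k (by omega), ih (k + 1) (by omega), S (k + 1), S k, hγ]
    push_cast
    have h1 : (g : ℂ) = (g : ℂ) ^ 2 * (z + z⁻¹) := by rw [hz]; field_simp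
    set T := ∑ κ ∈ Finset.range (k + 1), spinPower z k κ
    have h2 : (g : ℂ) ^ (k + 1) = (g : ℂ) ^ (k + 2) * (z + z⁻¹) := by
      rw [pow_succ, pow_add]; nth_rewrite 2 [h1]; ring
    rw [h2, pow_add]
    field_simp
    ring

/-- Each cup carries opposite spins, whose powers of `z` cancel, so only the `n - 2 * p` through
strands contribute to the weight. Summing over `κ` gives the value of `coeffZero`, and `g ^ n`
splits as `γ ^ p * g ^ (n - 2 * p)`. -/
theorem extremalTrace_eq {a δ : ℂ} (ha : a ≠ 0) (hδ : a ^ 2 + a⁻¹ ^ 2 = δ) {γ g : ℝ} {z : ℂ}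
    (hg : g ≠ 0) (hγ : γ = g ^ 2) (hz0 : z ≠ 0) (hz : z + z⁻¹ = (g : ℂ)⁻¹) (n : ℕ) (x : TL δ n) :
    extremalTrace δ γ n x = (g : ℂ) ^ n * ∑ s : Fin n → Bool,
      spinPower z n (LinkState.spinCount s) * spinRep ha hδ n x (Pi.single s 1) s := by
  rw [LinkState.sum_diagonal_spinRep, extremalTrace, Finset.mul_sum]
  refine Finset.sum_congr rfl fun p hp => ?_
  rw [Finset.mem_range] at hp
  rw [← mul_assoc]
  congr 1
  rw [coeff]
  push_cast
  rw [coeffZero_eq_sum hg hγ hz0 hz, hγ]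
  push_cast
  rw [← mul_assoc, ← pow_mul, ← pow_add, show 2 * p + (n - 2 * p) = n by omega]
  congr 1
  refine Finset.sum_congr rfl fun κ hκ => ?_
  rw [Finset.mem_range] at hκ
  rw [spinPower, spinPower, show n - (p + κ) = p + (n - 2 * p - κ) by omega, pow_add, pow_add]
  have : z ^ p * z⁻¹ ^ p = 1 := by rw [← mul_pow, mul_inv_cancel₀ hz0, one_pow]
  linear_combination (-(z ^ κ * z⁻¹ ^ (n - 2 * p - κ))) * this
end

/-! ### Normal forms of planar diagrams under attaching generators -/

section

namespace PlanarDiagram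

/-- `e` arises from `d` by attaching generators at positions in `A`. -/
def Reach (A : Set ℤ) : PlanarDiagram → PlanarDiagram → Prop :=
  Relation.ReflTransGen fun d e => ∃ i ∈ A, e = d.hook i

theorem Reach.refl {A : Set ℤ} (d : PlanarDiagram) : Reach A d d := Relation.ReflTransGen.refl

theorem Reach.trans {A : Set ℤ} {d e f : PlanarDiagram} (h1 : Reach A d e) (h2 : Reach A e f) :
    Reach A d f := Relation.ReflTransGen.trans h1 h2

theorem Reach.mono {A B : Set ℤ} (hAB : A ⊆ B) {d e : PlanarDiagram} (h : Reach A d e) :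
    Reach B d e := by
  refine Relation.ReflTransGen.mono ?_ _ _ h
  rintro d e ⟨i, hi, rfl⟩
  exact ⟨i, hAB hi, rfl⟩

theorem Reach.hook {A : Set ℤ} (d : PlanarDiagram) {i : ℤ} (hi : i ∈ A) : Reach A d (d.hook i) :=
  Relation.ReflTransGen.single ⟨i, hi, rfl⟩

theorem hook_partner (d : PlanarDiagram) (j p : ℤ) :
    (d.hook j).partner p = hookFun d.partner j p := rfl

theorem hook_partner_self (d : PlanarDiagram) (j : ℤ) : (d.hook j).partner j = j + 1 := by
  simp [hook_partner, hookFun]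

theorem hook_partner_of_ne (d : PlanarDiagram) (j : ℤ) {p q : ℤ} (h : d.partner p = q)
    (h1 : p ≠ j) (h2 : p ≠ j + 1) (h3 : q ≠ j) (h4 : q ≠ j + 1) : (d.hook j).partner p = q := by
  have e0 := d.partner_partner
  rw [hook_partner]
  grind [hookFun]

theorem Reach.partner {A : Set ℤ} {d e : PlanarDiagram} (h : Reach A d e) {p q : ℤ}
    (hd : d.partner p = q) (hA : ∀ i ∈ A, p ≠ i ∧ p ≠ i + 1 ∧ q ≠ i ∧ q ≠ i + 1) :
    e.partner p = q := by
  induction h with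
  | refl => exact hd
  | tail _ h ih =>
    obtain ⟨i, hi, rfl⟩ := h
    obtain ⟨h1, h2, h3, h4⟩ := hA i hi
    exact hook_partner_of_ne _ _ ih h1 h2 h3 h4

theorem Reach.numThrough_le {A : Set ℤ} {d e : PlanarDiagram} (h : Reach A d e) (hA : -1 ∉ A) :
    e.numThrough ≤ d.numThrough := by
  induction h with
  | refl => exact le_rfl
  | tail _ h ih =>
    obtain ⟨i, hi, rfl⟩ := h
    exact (numThrough_hook_le _ i (by rintro rfl; exact hA hi)).trans ih

/-- The points of `[-b, t)` are matched among themselves. -/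
def Preserves (d : PlanarDiagram) (b t : ℕ) : Prop :=
  ∀ p : ℤ, -b ≤ p → p < t → -b ≤ d.partner p ∧ d.partner p < t

theorem Preserves.outside {d : PlanarDiagram} {b t : ℕ} (h : d.Preserves b t) {p : ℤ}
    (hp : p < -b ∨ t ≤ p) : d.partner p < -b ∨ t ≤ d.partner p := by
  by_contra hc
  have := h (d.partner p)
  rw [d.partner_partner] at this
  omega

/-- The positions of the generators inside the window `[-b, t)` that act on one side. -/
def sideIndices (b t : ℕ) : Set ℤ := {i | (-b ≤ i ∧ i + 1 < 0) ∨ (0 ≤ i ∧ i + 1 < t)}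

theorem neg_one_notMem_sideIndices (b t : ℕ) : (-1 : ℤ) ∉ sideIndices b t := by
  simp only [sideIndices, Set.mem_ofPred_eq]; omega

theorem Preserves.hook {d : PlanarDiagram} {b t : ℕ} (h : d.Preserves b t) {i : ℤ}
    (hi : -b ≤ i ∧ i + 1 < t) : (d.hook i).Preserves b t := by
  intro p h1 h2
  have e0 := d.partner_partner
  have a1 := h i
  have a2 := h (i + 1)
  have a3 := h p
  simp only [hook_partner, hookFun]
  split_ifs <;> omega

theorem Preserves.hook_outside {d : PlanarDiagram} {b t : ℕ} (h : d.Preserves b t) {i : ℤ}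
    (hi : -b ≤ i ∧ i + 1 < t) {p : ℤ} (hp : p < -b ∨ t ≤ p) :
    (d.hook i).partner p = d.partner p := by
  have := h.outside hp
  exact hook_partner_of_ne d i rfl (by omega) (by omega) (by omega) (by omega)

theorem Reach.preserves {b t : ℕ} {d e : PlanarDiagram} (h : Reach (sideIndices b t) d e)
    (hd : d.Preserves b t) :
    e.Preserves b t ∧ ∀ p : ℤ, (p < -b ∨ t ≤ p) → e.partner p = d.partner p := by
  induction h with
  | refl => exact ⟨hd, fun _ _ => rfl⟩
  | tail _ h ih =>
    obtain ⟨i, hi, rfl⟩ := h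
    simp only [sideIndices, Set.mem_ofPred_eq] at hi
    have hi' : -b ≤ i ∧ i + 1 < t := by omega
    exact ⟨ih.1.hook hi', fun p hp => by rw [ih.1.hook_outside hi' hp, ih.2 p hp]⟩

/-- The points below a strand are matched among themselves, so one can pass to ever shorter strands;
the last one joins neighbours. -/
theorem exists_adjacent_cup (d : PlanarDiagram) {l c p : ℤ} (h1 : l ≤ p) (h2 : p < c)
    (h3 : l ≤ d.partner p) (h4 : d.partner p < c) :
    ∃ i, l ≤ i ∧ i + 1 < c ∧ d.partner i = i + 1 := by
  have key : ∀ k : ℕ, ∀ p, l ≤ p → p < d.partner p → d.partner p < c → d.partner p - p = k →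
      ∃ i, l ≤ i ∧ i + 1 < c ∧ d.partner i = i + 1 := by
    intro k
    induction k using Nat.strong_induction_on with
    | _ k ih =>
    intro p h1 h2 h3 h4
    by_cases h5 : d.partner p = p + 1
    · exact ⟨p, h1, by omega, h5⟩
    · have h6 := (d.inside_iff p (p + 1) (by omega) (by omega)).1 (by omega)
      have h7 := d.partner_ne (p + 1)
      exact ih (d.partner (p + 1) - (p + 1)).toNat (by omega) (p + 1) (by omega) (by omega) (by omega)
        (by omega)
  have h0 := d.partner_ne p
  rcases lt_or_gt_of_ne h0 with h | h
  · exact key (p - d.partner p).toNat (d.partner p) h3 (by rwa [d.partner_partner])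
      (by rwa [d.partner_partner]) (by rw [d.partner_partner]; omega)
  · exact key (d.partner p - p).toNat p h1 h h4 (by omega)

/-- A generator at `i - 1` slides the cup at `i` to the left, and a generator at `i` slides it back
because e_i e_{i-1} e_i = e_i. So the motion is reversible. -/
theorem exists_reach_cup_left {l c : ℤ} (k : ℕ) : ∀ (d : PlanarDiagram) (i : ℤ), i - l = k →
    i + 1 < c → d.partner i = i + 1 → ∃ e, Reach (Set.Ico l (c - 1)) d e ∧
      Reach (Set.Ico l (c - 1)) e d ∧ e.partner l = l + 1 := by
  induction k with
  | zero =>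
    intro d i h1 h2 h3
    obtain rfl : i = l := by omega
    exact ⟨d, Reach.refl _, Reach.refl _, h3⟩
  | succ k ih =>
    intro d i h1 h2 h3
    have h4 := d.hook_partner_self (i - 1)
    obtain ⟨e, h5, h6, h7⟩ := ih (d.hook (i - 1)) (i - 1) (by push_cast at h1; omega) (by omega) h4
    have h8 : (d.hook (i - 1)).hook i = d := by
      have := d.hook_zigzag i (i - 1) (by omega)
      rwa [d.hook_of_eq i h3] at this
    refine ⟨e, (Reach.hook d ?_).trans h5, h6.trans ?_, h7⟩
    · simp only [Set.mem_Ico]; push_cast at h1; omega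
    · have := Reach.hook (A := Set.Ico l (c - 1)) (d.hook (i - 1)) (i := i)
        (by simp only [Set.mem_Ico]; push_cast at h1; omega)
      rwa [h8] at this

theorem exists_reach_cup_right {l c : ℤ} (k : ℕ) : ∀ (d : PlanarDiagram) (i : ℤ), c - 2 - i = k →
    l ≤ i → d.partner i = i + 1 → ∃ e, Reach (Set.Ico l (c - 1)) d e ∧
      Reach (Set.Ico l (c - 1)) e d ∧ e.partner (c - 2) = c - 1 := by
  induction k with
  | zero =>
    intro d i h1 h2 h3
    obtain rfl : i = c - 2 := by omega
    exact ⟨d, Reach.refl _, Reach.refl _, by rw [h3]; ring⟩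
  | succ k ih =>
    intro d i h1 h2 h3
    have h4 := d.hook_partner_self (i + 1)
    obtain ⟨e, h5, h6, h7⟩ := ih (d.hook (i + 1)) (i + 1) (by push_cast at h1; omega) (by omega) h4
    have h8 : (d.hook (i + 1)).hook i = d := by
      have := d.hook_zigzag i (i + 1) (by omega)
      rwa [d.hook_of_eq i h3] at this
    refine ⟨e, (Reach.hook d ?_).trans h5, h6.trans ?_, h7⟩
    · simp only [Set.mem_Ico]; push_cast at h1; omega
    · have := Reach.hook (A := Set.Ico l (c - 1)) (d.hook (i + 1)) (i := i)
        (by simp only [Set.mem_Ico]; push_cast at h1; omega)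
      rwa [h8] at this

/-- The first `2 r` points of `[l, ∞)` are joined by adjacent cups. -/
def CupsFrom (d : PlanarDiagram) (l : ℤ) (r : ℕ) : Prop :=
  ∀ j : ℕ, j < r → d.partner (l + 2 * j) = l + 2 * j + 1

theorem CupsFrom.mem {d : PlanarDiagram} {l : ℤ} {r : ℕ} (h : d.CupsFrom l r) {p : ℤ} (h1 : l ≤ p)
    (h2 : p < l + 2 * r) : d.partner p = if (p - l) % 2 = 0 then p + 1 else p - 1 := by
  have h3 := h ((p - l) / 2).toNat (by omega)
  split_ifs with h4
  · rw [show l + 2 * (((p - l) / 2).toNat : ℤ) = p by omega] at h3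
    exact h3
  · rw [show l + 2 * (((p - l) / 2).toNat : ℤ) + 1 = p by omega] at h3
    rw [← h3, d.partner_partner]
    omega

theorem CupsFrom.mem_iff {d : PlanarDiagram} {l : ℤ} {r : ℕ} (h : d.CupsFrom l r) (p : ℤ) :
    (l ≤ p ∧ p < l + 2 * r) ↔ (l ≤ d.partner p ∧ d.partner p < l + 2 * r) := by
  constructor
  · rintro ⟨h1, h2⟩
    rw [h.mem h1 h2]
    split_ifs <;> omega
  · rintro ⟨h1, h2⟩
    have := h.mem h1 h2
    rw [d.partner_partner] at this
    split_ifs at this <;> omega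

/-- Slide an adjacent cup to the left boundary and continue with the remaining interval, until no
strand has both ends in it. Reachability is kept in both directions, so that the normal form can be
undone. -/
theorem exists_reach_cupsFrom (k : ℕ) : ∀ (l c : ℤ) (d : PlanarDiagram), c - l = k →
    ∃ (r : ℕ) (e : PlanarDiagram), Reach (Set.Ico l (c - 1)) d e ∧ Reach (Set.Ico l (c - 1)) e d ∧
      l + 2 * r ≤ c ∧ e.CupsFrom l r ∧
      ∀ p, l + 2 * r ≤ p → p < c → ¬ (l ≤ e.partner p ∧ e.partner p < c) := by
  induction k using Nat.strong_induction_on with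
  | _ k ih =>
  intro l c d hk
  by_cases h : ∃ p, l ≤ p ∧ p < c ∧ l ≤ d.partner p ∧ d.partner p < c
  · obtain ⟨p, h1, h2, h3, h4⟩ := h
    obtain ⟨i, h5, h6, h7⟩ := d.exists_adjacent_cup h1 h2 h3 h4
    obtain ⟨e, h8, h9, h10⟩ := exists_reach_cup_left (l := l) (c := c) (i - l).toNat d i (by omega)
      h6 h7
    obtain ⟨r, f, h11, h12, h13, h14, h15⟩ := ih (c - (l + 2)).toNat (by omega) (l + 2) c e (by omega)
    have hsub : Set.Ico (l + 2) (c - 1) ⊆ Set.Ico l (c - 1) := Set.Ico_subset_Ico_left (by omega)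
    have h16 : f.partner l = l + 1 := h11.partner h10 (by
      intro i hi; simp only [Set.mem_Ico] at hi; omega)
    have h17 : f.CupsFrom l (r + 1) := by
      intro j hj
      cases j with
      | zero => simpa using h16
      | succ j =>
        have := h14 j (by omega)
        push_cast
        rw [show l + 2 * ((j : ℤ) + 1) = l + 2 + 2 * j by ring, this]
    refine ⟨r + 1, f, h8.trans (h11.mono hsub), (h12.mono hsub).trans h9, by push_cast; omega, h17, ?_⟩
    intro p hp1 hp2 hp3
    push_cast at hp1
    have h18 := h15 p (by omega) hp2
    have h19 := h17.mem_iff p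
    push_cast at h19
    omega
  · refine ⟨0, d, Reach.refl _, Reach.refl _, by simp; omega, fun j hj => absurd hj (by omega), ?_⟩
    intro p h1 h2 h3
    exact h ⟨p, by simpa using h1, h2, h3⟩

theorem exists_reach_cupsFrom_right (k : ℕ) : ∀ (l c : ℤ) (d : PlanarDiagram), c - l = k →
    ∃ (r : ℕ) (e : PlanarDiagram), Reach (Set.Ico l (c - 1)) d e ∧ Reach (Set.Ico l (c - 1)) e d ∧
      l ≤ c - 2 * r ∧ e.CupsFrom (c - 2 * r) r ∧
      ∀ p, l ≤ p → p < c - 2 * r → ¬ (l ≤ e.partner p ∧ e.partner p < c) := by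
  induction k using Nat.strong_induction_on with
  | _ k ih =>
  intro l c d hk
  by_cases h : ∃ p, l ≤ p ∧ p < c ∧ l ≤ d.partner p ∧ d.partner p < c
  · obtain ⟨p, h1, h2, h3, h4⟩ := h
    obtain ⟨i, h5, h6, h7⟩ := d.exists_adjacent_cup h1 h2 h3 h4
    obtain ⟨e, h8, h9, h10⟩ := exists_reach_cup_right (l := l) (c := c) (c - 2 - i).toNat d i
      (by omega) h5 h7
    obtain ⟨r, f, h11, h12, h13, h14, h15⟩ := ih (c - 2 - l).toNat (by omega) l (c - 2) e (by omega)
    have hsub : Set.Ico l (c - 2 - 1) ⊆ Set.Ico l (c - 1) := Set.Ico_subset_Ico_right (by omega)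
    have h16 : f.partner (c - 2) = c - 1 := h11.partner h10 (by
      intro i hi; simp only [Set.mem_Ico] at hi; omega)
    have h17 : f.CupsFrom (c - 2 * (r + 1 : ℕ)) (r + 1) := by
      intro j hj
      by_cases hjr : j < r
      · have := h14 j hjr
        push_cast
        rw [show c - 2 * ((r : ℤ) + 1) + 2 * j = c - 2 - 2 * r + 2 * j by ring, this]
      · obtain rfl : j = r := by omega
        push_cast
        rw [show c - 2 * ((j : ℤ) + 1) + 2 * j = c - 2 by ring, h16]
        ring
    refine ⟨r + 1, f, h8.trans (h11.mono hsub), (h12.mono hsub).trans h9, by push_cast; omega, h17, ?_⟩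
    intro p hp1 hp2 hp3
    push_cast at hp2
    have h18 := h15 p hp1 (by omega)
    have h19 := h17.mem_iff p
    push_cast at h19
    omega
  · refine ⟨0, d, Reach.refl _, Reach.refl _, by simp; omega, fun j hj => absurd hj (by omega), ?_⟩
    intro p h1 h2 h3
    exact h ⟨p, h1, by simpa using h2, h3⟩

/-- The standard diagram in the window `[-b, t)` with `r` cups at the top and `r'` cups at the
bottom: the cups are adjacent and to the left of the through strands. -/
structure IsStandard (b t r r' : ℕ) (d : PlanarDiagram) : Prop where
  len : t + 2 * r' = b + 2 * r
  le : 2 * r ≤ t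
  top : d.CupsFrom 0 r
  bot : d.CupsFrom (-(2 * r' : ℕ)) r'
  mid : ∀ j : ℕ, 2 * r + j < t → d.partner (2 * r + j) = -1 - 2 * r' - j

/-- Apart from the cups, all points of the window belong to through strands. As these do not cross,
they are matched in order from the left edge outwards, which determines them and gives the relation
between the lengths. -/
theorem isStandard_of_through {b t r r' : ℕ} {d : PlanarDiagram} (hd : d.Preserves b t)
    (h1 : 2 * r ≤ t) (h2 : 2 * r' ≤ b) (top : d.CupsFrom 0 r) (bot : d.CupsFrom (-(2 * r' : ℕ)) r')
    (h3 : ∀ p : ℤ, 2 * r ≤ p → p < t → d.partner p < 0)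
    (h4 : ∀ p : ℤ, -b ≤ p → p < -(2 * r' : ℕ) → 0 ≤ d.partner p) : IsStandard b t r r' d := by
  have e0 := d.partner_partner
  have mid : ∀ j : ℕ, 2 * r + j < t → d.partner (2 * r + j) = -1 - 2 * r' - j := by
    intro j
    induction j using Nat.strong_induction_on with
    | _ j ih =>
    intro hj
    have a1 := h3 (2 * r + j) (by omega) (by omega)
    have a2 := hd (2 * r + j) (by omega) (by omega)
    have a3 := bot.mem_iff (d.partner (2 * r + j))
    rw [e0] at a3
    push_cast at a3
    obtain ⟨v, hv⟩ : ∃ v, d.partner (2 * r + j) = v := ⟨_, rfl⟩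
    have hv' : d.partner v = 2 * r + j := by rw [← hv, e0]
    rw [hv] at a1 a2 a3 ⊢
    -- If `v` lies further out, the strand from `v` encloses the expected point, whose partner is
    -- then a top point already matched elsewhere; if `v` lies further in, it is itself already
    -- matched.
    rcases lt_trichotomy v (-1 - 2 * r' - j) with h | h | h
    · exfalso
      have b1 := h4 (-1 - 2 * r' - j) (by omega) (by push_cast; omega)
      have b2 := (d.inside_iff v (-1 - 2 * r' - j) (by omega) (by omega)).1 ⟨h, by omega⟩
      have b3 := top.mem_iff (-1 - 2 * r' - j)
      have b4 := ih (d.partner (-1 - 2 * r' - j) - 2 * r).toNat (by omega) (by omega)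
      rw [show (2 * r : ℤ) + ((d.partner (-1 - 2 * r' - j) - 2 * r).toNat : ℤ) =
        d.partner (-1 - 2 * r' - j) by omega, e0] at b4
      omega
    · exact h
    · exfalso
      have b4 := ih (-1 - 2 * r' - v).toNat (by omega) (by omega)
      rw [show -1 - 2 * (r' : ℤ) - ((-1 - 2 * r' - v).toNat : ℤ) = v by omega, ← hv] at b4
      have b5 := congrArg d.partner b4
      rw [e0, e0] at b5
      omega
  refine ⟨?_, h1, top, bot, mid⟩
  by_contra hne
  rcases lt_or_gt_of_ne hne with h | h
  · have a1 := h4 (-b) (by omega) (by push_cast; omega)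
    have a2 := hd (-b) (by omega) (by omega)
    have a3 := top.mem_iff (d.partner (-b))
    rw [e0] at a3
    have a4 := mid (d.partner (-b) - 2 * r).toNat (by omega)
    rw [show (2 * r : ℤ) + ((d.partner (-b) - 2 * r).toNat : ℤ) = d.partner (-b) by omega, e0] at a4
    omega
  · have a1 := mid (t - 2 * r - 1) (by omega)
    have a2 := hd (2 * r + (t - 2 * r - 1 : ℕ)) (by omega) (by omega)
    omega

theorem IsStandard.eq {b t r r' : ℕ} {d e : PlanarDiagram} (hd : IsStandard b t r r' d)
    (he : IsStandard b t r r' e) (h : ∀ p : ℤ, (p < -b ∨ t ≤ p) → d.partner p = e.partner p) :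
    d = e := by
  have l1 := hd.len
  have l2 := hd.le
  ext p
  by_cases h1 : p < -b ∨ t ≤ p
  · exact h p h1
  by_cases h2 : 0 ≤ p
  · by_cases h3 : p < 2 * r
    · rw [hd.top.mem h2 (by omega), he.top.mem h2 (by omega)]
    · have a1 := hd.mid (p - 2 * r).toNat (by omega)
      have a2 := he.mid (p - 2 * r).toNat (by omega)
      rw [show (2 * r : ℤ) + ((p - 2 * r).toNat : ℤ) = p by omega] at a1 a2
      rw [a1, a2]
  · by_cases h3 : -(2 * r' : ℕ) ≤ p
    · rw [hd.bot.mem h3 (by push_cast; omega), he.bot.mem h3 (by push_cast; omega)]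
    · have a1 := hd.mid (-1 - 2 * r' - p).toNat (by push_cast at h3; omega)
      have a2 := he.mid (-1 - 2 * r' - p).toNat (by push_cast at h3; omega)
      rw [show -1 - 2 * (r' : ℤ) - ((-1 - 2 * r' - p).toNat : ℤ) = p by push_cast at h3; omega]
        at a1 a2
      have b1 := congrArg d.partner a1
      have b2 := congrArg e.partner a2
      rw [d.partner_partner] at b1
      rw [e.partner_partner] at b2
      rw [← b1, ← b2]

theorem exists_isStandard {b t : ℕ} {d : PlanarDiagram} (hd : d.Preserves b t) :
    ∃ (r r' : ℕ) (e : PlanarDiagram), Reach (sideIndices b t) d e ∧ Reach (sideIndices b t) e d ∧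
      IsStandard b t r r' e := by
  obtain ⟨r, e, h1, h2, h3, h4, h5⟩ := exists_reach_cupsFrom t 0 t d (by simp)
  obtain ⟨r', f, h6, h7, h8, h9, h10⟩ := exists_reach_cupsFrom_right b (-b) 0 e (by simp)
  have s1 : Set.Ico (0 : ℤ) (t - 1) ⊆ sideIndices b t := by
    intro i hi; simp only [Set.mem_Ico] at hi; simp only [sideIndices, Set.mem_ofPred_eq]; omega
  have s2 : Set.Ico (-b : ℤ) (0 - 1) ⊆ sideIndices b t := by
    intro i hi; simp only [Set.mem_Ico] at hi; simp only [sideIndices, Set.mem_ofPred_eq]; omega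
  have r1 := (h1.mono s1).trans (h6.mono s2)
  have r2 := (h7.mono s2).trans (h2.mono s1)
  have hf := (r1.preserves hd).1
  refine ⟨r, r', f, r1, r2, ?_⟩
  have top : f.CupsFrom 0 r := fun j hj => h6.partner (h4 j hj) (by
    intro i hi; simp only [Set.mem_Ico] at hi; omega)
  refine isStandard_of_through hf (by omega) (by omega) top (by simpa using h9) ?_ ?_
  · intro p hp1 hp2
    by_contra hc
    have h11 := h7.partner (p := p) (q := f.partner p) rfl (by
      intro i hi; simp only [Set.mem_Ico] at hi; omega)
    have h12 := h5 p (by omega) hp2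
    have := hf p (by omega) hp2
    omega
  · intro p hp1 hp2
    have := h10 p hp1 (by push_cast at hp2; omega)
    have := hf p hp1 (by omega)
    omega

/-- The generator at `2 * r` meets the two leftmost through strands and replaces them by one cup at
the top and one at the bottom. -/
theorem IsStandard.hook {b t r r' : ℕ} {d : PlanarDiagram} (hd : IsStandard b t r r' d)
    (h : 2 * r + 1 < t) : IsStandard b t (r + 1) (r' + 1) (d.hook (2 * r)) := by
  have l1 := hd.len
  have m0 := hd.mid 0 (by omega)
  have m1 := hd.mid 1 (by omega)
  simp only [Nat.cast_zero, Nat.cast_one, add_zero] at m0 m1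
  have e0 := d.partner_partner
  refine ⟨by omega, by omega, ?_, ?_, ?_⟩
  · intro j hj
    by_cases hjr : j < r
    · exact hook_partner_of_ne d _ (hd.top j hjr) (by omega) (by omega) (by omega) (by omega)
    · obtain rfl : j = r := by omega
      rw [zero_add]
      exact hook_partner_self d _
  · intro j hj
    cases j with
    | zero =>
      push_cast
      rw [hook_partner]
      have : hookFun d.partner (2 * r) (d.partner (2 * r + 1)) = d.partner (2 * r) := by
        have n0 := d.partner_ne
        grind [hookFun]
      rw [m1, m0] at this
      rw [show -(2 * ((r' : ℤ) + 1)) + 0 = -1 - 2 * r' - 1 by ring, this]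
      ring
    | succ j =>
      have := hd.bot j (by omega)
      push_cast at this ⊢
      rw [show -(2 * ((r' : ℤ) + 1)) + 2 * ((j : ℤ) + 1) = -(2 * r') + 2 * j by ring]
      exact hook_partner_of_ne d _ this (by omega) (by omega) (by omega) (by omega)
  · intro j hj
    have := hd.mid (j + 2) (by omega)
    push_cast at this ⊢
    rw [show 2 * ((r : ℤ) + 1) + j = 2 * r + (j + 2) by ring]
    exact hook_partner_of_ne d _ (by rw [this]; ring) (by omega) (by omega) (by omega) (by omega)

theorem one_isStandard (m : ℕ) : IsStandard m m 0 0 one :=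
  ⟨by omega, by omega, fun j hj => absurd hj (by omega), fun j hj => absurd hj (by omega),
    fun j _ => by simp [one]⟩

theorem one_preserves (m : ℕ) : one.Preserves m m := by
  intro p h1 h2; simp only [one]; omega

/-- Every diagram with vertical strands outside of a square window arises from the identity. -/
theorem reach_of_vertical {m : ℕ} {d : PlanarDiagram}
    (hd : ∀ p : ℤ, (p < -m ∨ m ≤ p) → d.partner p = -1 - p) : Reach (sideIndices m m) one d := by
  have hp : d.Preserves m m := by
    intro p h1 h2
    by_contra hc
    have := hd (d.partner p) (by omega)
    rw [d.partner_partner] at this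
    omega
  obtain ⟨r, r', e, h1, h2, h3⟩ := exists_isStandard hp
  have key : ∀ k : ℕ, 2 * k ≤ m → ∃ f, Reach (sideIndices m m) one f ∧ IsStandard m m k k f := by
    intro k
    induction k with
    | zero => intro _; exact ⟨one, Reach.refl _, one_isStandard m⟩
    | succ k ih =>
      intro hk
      obtain ⟨f, h4, h5⟩ := ih (by omega)
      refine ⟨f.hook (2 * k), h4.trans (Reach.hook f ?_), h5.hook (by omega)⟩
      simp only [sideIndices, Set.mem_ofPred_eq]; omega
  obtain ⟨f, h4, h5⟩ := key r h3.le
  have l := h3.len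
  obtain rfl : r' = r := by omega
  have : e = f := by
    apply h3.eq h5
    intro p hp'
    rw [(h1.preserves hp).2 p hp', (h4.preserves (one_preserves m)).2 p hp', hd p hp']
    rfl
  rw [← this] at h4
  exact h4.trans h2

end PlanarDiagram

end

/-! ### The spin pairing on sets of boundary points -/

noncomputable section

open PlanarDiagram

/-- The sum of `F` over the spin configurations on `J` (the spins outside of `J` are `false`). -/
def spinSum (J : Finset ℤ) (F : (ℤ → Bool) → ℂ) : ℂ :=
  ∑ A ∈ J.powerset, F fun p => decide (p ∈ A)

/-- `F` depends only on the spins on `J`. -/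
def DependsOnSpins (J : Finset ℤ) (F : (ℤ → Bool) → ℂ) : Prop :=
  ∀ s t, (∀ p ∈ J, s p = t p) → F s = F t

theorem spinSum_union {J K : Finset ℤ} (hJK : Disjoint J K) {F G : (ℤ → Bool) → ℂ}
    (hF : DependsOnSpins J F) (hG : DependsOnSpins K G) :
    spinSum (J ∪ K) (fun s => F s * G s) = spinSum J F * spinSum K G := by
  unfold spinSum
  rw [Finset.sum_mul_sum, ← Finset.sum_product']
  rw [Finset.disjoint_left] at hJK
  refine Finset.sum_nbij' (fun A => (A ∩ J, A ∩ K)) (fun B => B.1 ∪ B.2) ?_ ?_ ?_ ?_ ?_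
  · intro A _; simp [Finset.inter_subset_right]
  · intro B hB
    simp only [Finset.mem_product, Finset.mem_powerset] at hB ⊢
    exact Finset.union_subset_union hB.1 hB.2
  · intro A hA
    rw [Finset.mem_powerset] at hA
    rw [← Finset.inter_union_distrib_left, Finset.inter_eq_left.2 hA]
  · intro B hB
    simp only [Finset.mem_product, Finset.mem_powerset] at hB
    ext p
    · have := @hB.1 p; have := @hB.2 p; have := @hJK p
      simp only [Finset.mem_inter, Finset.mem_union]; tauto
    · have := @hB.1 p; have := @hB.2 p; have := @hJK p
      simp only [Finset.mem_inter, Finset.mem_union]; tauto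
  · intro A hA
    refine congrArg₂ (· * ·) ?_ ?_
    · apply hF; intro p hp; simp [hp]
    · apply hG; intro p hp; simp [hp]

/-- The weight of a spin at the point `p` in the pairing of diagrams. -/
def pointTwist (a z : ℂ) (p : ℤ) (x : Bool) : ℂ :=
  if 0 ≤ p then (if x then z else z⁻¹) else (if x then a⁻¹ ^ 2 else a ^ 2)

/-- The weight of a spin configuration in the pairing of diagrams. -/
def twist (a z : ℂ) (J : Finset ℤ) (s : ℤ → Bool) : ℂ := ∏ p ∈ J, pointTwist a z p (s p)

/-- Opposite spins on the same side of the strip have twists that cancel, so the twist is invisible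
to generators that act on one side. -/
theorem pointTwist_mul {a z : ℂ} (ha : a ≠ 0) (hz : z ≠ 0) (p : ℤ) :
    pointTwist a z p true * pointTwist a z p false = 1 := by
  unfold pointTwist
  split_ifs <;> simp_all

/-- The generator is symmetric and meets only opposite spins at `j` and `j + 1`. These points are on
the same side because `j ≠ -1`, so their twists cancel. This is the origin of the self-adjointness
of the action. -/
theorem spinSum_spinHook {a z : ℂ} (ha : a ≠ 0) (hz : z ≠ 0) {J : Finset ℤ} {j : ℤ} (hj : j ∈ J)
    (hj' : j + 1 ∈ J) (hj1 : j ≠ -1) (f g : (ℤ → Bool) → ℂ) :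
    spinSum J (fun s => spinHook a j (j + 1) f s * g s * twist a z J s) =
      spinSum J (fun s => f s * spinHook a j (j + 1) g s * twist a z J s) := by
  set K := (J.erase j).erase (j + 1) with hK
  have hJ : J = insert j (insert (j + 1) K) := by
    rw [hK, Finset.insert_erase, Finset.insert_erase hj]
    exact Finset.mem_erase.2 ⟨by omega, hj'⟩
  have k1 : j + 1 ∉ K := Finset.notMem_erase _ _
  have k2 : j ∉ insert (j + 1) K := by simp [hK]
  have hjK : j ∉ K := fun h => k2 (Finset.mem_insert_of_mem h)
  have hT : ∀ s, twist a z J s = pointTwist a z j (s j) * (pointTwist a z (j + 1) (s (j + 1)) *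
      ∏ p ∈ K, pointTwist a z p (s p)) := by
    intro s
    rw [twist, hJ, Finset.prod_insert k2, Finset.prod_insert k1]
  have hside : ∀ x, pointTwist a z (j + 1) x = pointTwist a z j x := by
    intro x
    have : (0 ≤ j + 1) ↔ 0 ≤ j := by omega
    simp only [pointTwist, this]
  unfold spinSum
  simp only [hT, hside]
  rw [hJ, Finset.sum_powerset_insert k2, Finset.sum_powerset_insert k2, Finset.sum_powerset_insert k1,
    Finset.sum_powerset_insert k1, Finset.sum_powerset_insert k1, Finset.sum_powerset_insert k1]
  simp only [← Finset.sum_add_distrib]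
  refine Finset.sum_congr rfl fun A hA => ?_
  rw [Finset.mem_powerset] at hA
  have a1 : j ∉ A := fun h => hjK (hA h)
  have a2 : j + 1 ∉ A := fun h => k1 (hA h)
  have hne : j + 1 ≠ j := by omega
  have P : ∀ B : Finset ℤ, (∀ p, p ≠ j → p ≠ j + 1 → (p ∈ B ↔ p ∈ A)) →
      (setPair (fun p => decide (p ∈ B)) j (j + 1) true = fun p => decide (p ∈ insert j A)) ∧
      (setPair (fun p => decide (p ∈ B)) j (j + 1) false =
        fun p => decide (p ∈ insert (j + 1) A)) ∧
      ∏ p ∈ K, pointTwist a z p (decide (p ∈ B)) = ∏ p ∈ K, pointTwist a z p (decide (p ∈ A)) := by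
    intro B hB
    refine ⟨?_, ?_, ?_⟩
    · funext p
      rw [setPair_apply]
      split_ifs with h1 h2
      · subst h1; simp [a2]
      · subst h2; simp
      · simp [hB p h2 h1, h2]
    · funext p
      rw [setPair_apply]
      split_ifs with h1 h2
      · subst h1; simp
      · subst h2; simp [a1]
      · simp [hB p h2 h1, h1]
    · refine Finset.prod_congr rfl fun p hp => ?_
      have h1 : p ≠ j := fun e => hjK (e ▸ hp)
      have h2 : p ≠ j + 1 := fun e => k1 (e ▸ hp)
      simp only [hB p h1 h2]
  obtain ⟨b1, b2, b3⟩ := P (insert (j + 1) A) (by intro p h1 h2; simp [h2])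
  obtain ⟨c1, c2, c3⟩ := P (insert j A) (by intro p h1 h2; simp [h1])
  simp only [spinHook_apply, b1, b2, b3, c1, c2, c3]
  simp only [Finset.mem_insert, a1, a2, hne, hne.symm, or_false, false_or, or_true, true_or, decide_true,
    decide_false, cupWeight, if_true, zero_mul, mul_zero, zero_add, add_zero, Bool.true_eq_false,
    Bool.false_eq_true, if_false, eq_self_iff_true, true_or, or_self]
  rw [mul_comm (pointTwist a z j false)]
  have := pointTwist_mul ha hz j
  ring

/-- The weight of a diagram inside `J`. -/
def planarWeight (a : ℂ) (J : Finset ℤ) (d : PlanarDiagram) : (ℤ → Bool) → ℂ :=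
  matchWeight a J d.partner fun _ _ => 1

theorem spinHook_planarWeight {a δ : ℂ} (ha : a ≠ 0) (hδ : a ^ 2 + a⁻¹ ^ 2 = δ) {J : Finset ℤ}
    {d : PlanarDiagram} (hJ : ∀ p ∈ J, d.partner p ∈ J) {j : ℤ} (hj : j ∈ J) (hj' : j + 1 ∈ J) :
    spinHook a j (j + 1) (planarWeight a J d) =
      (if d.partner j = j + 1 then δ else 1) • planarWeight a J (d.hook j) := by
  unfold planarWeight
  have e0 := d.partner_partner
  have n0 := d.partner_ne
  split_ifs with h
  · rw [d.hook_of_eq j h, ← hδ]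
    exact spinHook_matchWeight_loop e0 hj hj' (by omega) h
  · rw [one_smul]
    have i1 := d.inside_iff j (j + 1)
    have i2 := d.noncrossing j (j + 1)
    have i3 := d.noncrossing (d.partner j) (d.partner (j + 1))
    have i4 := d.noncrossing (j + 1) (d.partner j)
    have i5 := d.noncrossing (d.partner (j + 1)) j
    have n1 := n0 j
    have n2 := n0 (j + 1)
    have c1 := e0 j
    have c2 := e0 (j + 1)
    rw [e0] at i3 i4 i5
    rw [e0] at i3
    have h1 : d.partner (j + 1) ≠ j := fun e => h (by rw [e] at c2; exact c2)
    have h2 : d.partner j ≠ d.partner (j + 1) := fun e => by rw [e, c2] at c1; omega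
    refine spinHook_matchWeight_strands ha e0 hJ hj hj' (by omega) n1 n2 h (by omega) ?_ ?_ ?_ ?_ ?_ <;>
    simp only [hook, hookFun]
    · simp
    · simp
    · grind
    · grind
    · grind

/-- The pairing of two diagrams inside `J`. -/
def spinPairing (a z : ℂ) (J : Finset ℤ) (d e : PlanarDiagram) : ℂ :=
  spinSum J fun s => planarWeight a J d s * planarWeight a J e s * twist a z J s

theorem spinPairing_comm (a z : ℂ) (J : Finset ℤ) (d e : PlanarDiagram) :
    spinPairing a z J d e = spinPairing a z J e d := by
  unfold spinPairing
  congr 1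
  funext s
  ring

theorem spinPairing_hook {a z δ : ℂ} (ha : a ≠ 0) (hz : z ≠ 0) (hδ : a ^ 2 + a⁻¹ ^ 2 = δ)
    {J : Finset ℤ} {d e : PlanarDiagram} (hd : ∀ p ∈ J, d.partner p ∈ J)
    (he : ∀ p ∈ J, e.partner p ∈ J) {j : ℤ} (hj : j ∈ J) (hj' : j + 1 ∈ J) (hj1 : j ≠ -1) :
    (if d.partner j = j + 1 then δ else 1) * spinPairing a z J (d.hook j) e =
      (if e.partner j = j + 1 then δ else 1) * spinPairing a z J d (e.hook j) := by
  have h := spinSum_spinHook ha hz hj hj' hj1 (planarWeight a J d) (planarWeight a J e)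
  rw [spinHook_planarWeight ha hδ hd hj hj', spinHook_planarWeight ha hδ he hj hj'] at h
  unfold spinPairing spinSum
  rw [Finset.mul_sum, Finset.mul_sum]
  unfold spinSum at h
  refine Eq.trans ?_ (h.trans ?_)
  · refine Finset.sum_congr rfl fun A _ => ?_
    simp only [Pi.smul_apply, smul_eq_mul]
    ring
  · refine Finset.sum_congr rfl fun A _ => ?_
    simp only [Pi.smul_apply, smul_eq_mul]
    ring

theorem dependsOnSpins_planarWeight (a : ℂ) {J : Finset ℤ} {d : PlanarDiagram}
    (hJ : ∀ p ∈ J, d.partner p ∈ J) : DependsOnSpins J (planarWeight a J d) := fun s t h =>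
  Finset.prod_congr rfl fun p hp => pointWeight_congr rfl (h p hp) (h _ (hJ p hp)) fun _ => rfl

theorem dependsOnSpins_twist (a z : ℂ) (J : Finset ℤ) : DependsOnSpins J (twist a z J) :=
  fun _ _ h => Finset.prod_congr rfl fun p hp => by rw [h p hp]

theorem DependsOnSpins.mul {J : Finset ℤ} {F G : (ℤ → Bool) → ℂ} (hF : DependsOnSpins J F)
    (hG : DependsOnSpins J G) : DependsOnSpins J fun s => F s * G s := fun s t h => by
  simp only [hF s t h, hG s t h]

theorem planarWeight_union {a : ℂ} {J K : Finset ℤ} (hJK : Disjoint J K) {d e f : PlanarDiagram}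
    (hd : ∀ p ∈ J, d.partner p = e.partner p) (hf : ∀ p ∈ K, d.partner p = f.partner p)
    (s : ℤ → Bool) :
    planarWeight a (J ∪ K) d s = planarWeight a J e s * planarWeight a K f s := by
  unfold planarWeight matchWeight
  rw [Finset.prod_union hJK]
  congr 1
  · exact Finset.prod_congr rfl fun p hp => by simp only [pointWeight, hd p hp]
  · exact Finset.prod_congr rfl fun p hp => by simp only [pointWeight, hf p hp]

/-- Weights are products over strands and the twist is a product over points. Hence the spin sum
splits along sets that are closed under both matchings; this locality makes windows work. -/
theorem spinPairing_union {a z : ℂ} {J K : Finset ℤ} (hJK : Disjoint J K)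
    {d d1 d2 e e1 e2 : PlanarDiagram}
    (h1 : ∀ p ∈ J, d.partner p = d1.partner p) (h2 : ∀ p ∈ K, d.partner p = d2.partner p)
    (h3 : ∀ p ∈ J, e.partner p = e1.partner p) (h4 : ∀ p ∈ K, e.partner p = e2.partner p)
    (i1 : ∀ p ∈ J, d1.partner p ∈ J) (i2 : ∀ p ∈ K, d2.partner p ∈ K)
    (i3 : ∀ p ∈ J, e1.partner p ∈ J) (i4 : ∀ p ∈ K, e2.partner p ∈ K) :
    spinPairing a z (J ∪ K) d e = spinPairing a z J d1 e1 * spinPairing a z K d2 e2 := by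
  unfold spinPairing
  rw [← spinSum_union hJK]
  · congr 1
    funext s
    rw [planarWeight_union hJK h1 h2, planarWeight_union hJK h3 h4, twist, Finset.prod_union hJK,
      ← twist, ← twist]
    ring
  · exact ((dependsOnSpins_planarWeight a i1).mul (dependsOnSpins_planarWeight a i3)).mul
      (dependsOnSpins_twist a z J)
  · exact ((dependsOnSpins_planarWeight a i2).mul (dependsOnSpins_planarWeight a i4)).mul
      (dependsOnSpins_twist a z K)

/-- The value of the closed strand that starts at `p` when a diagram is paired with itself. -/
def strandValue (a z : ℂ) (d : PlanarDiagram) (p : ℤ) : ℂ :=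
  if p < 0 ∧ 0 ≤ d.partner p then z + z⁻¹ else a ^ 2 + a⁻¹ ^ 2

/-- The two spins are opposite. On a through strand the twist at the bottom end cancels the squared
weight and leaves `z` or `z⁻¹` from the top end. On a strand of one side the twists cancel and the
squared weights `a ^ 2` and `a⁻¹ ^ 2` remain. -/
theorem spinPairing_pair {a z : ℂ} (ha : a ≠ 0) (hz : z ≠ 0) (d : PlanarDiagram) {p : ℤ}
    (hp : p < d.partner p) : spinPairing a z {p, d.partner p} d d = strandValue a z d p := by
  obtain ⟨r, hr⟩ : ∃ r, d.partner p = r := ⟨_, rfl⟩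
  have hr' : d.partner r = p := by rw [← hr, d.partner_partner]
  rw [hr] at hp ⊢
  have h1 : p ∉ ({r} : Finset ℤ) := by simp [hp.ne]
  rw [spinPairing, spinSum, Finset.sum_powerset_insert h1, ← Finset.insert_empty,
    Finset.sum_powerset_insert (Finset.notMem_empty r), Finset.sum_powerset_insert (Finset.notMem_empty r)]
  simp only [Finset.powerset_empty, Finset.sum_singleton, planarWeight, matchWeight, twist,
    Finset.insert_empty, Finset.prod_pair hp.ne, pointWeight, hr, hr', hp, hp.not_gt, hp.ne, if_true,
    if_false, Finset.notMem_empty, Finset.mem_singleton, Finset.mem_insert, decide_true, decide_false,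
    cupWeight, hp.ne', true_or, or_true, or_false, false_or]
  simp only [strandValue, hr, pointTwist, Bool.false_eq_true, Bool.true_eq_false, if_true, if_false]
  by_cases h2 : 0 ≤ p
  · have : 0 ≤ r := by omega
    simp only [h2, this, if_true, h2.not_gt, false_and, if_false, mul_one, zero_mul, zero_add, add_zero]
    field_simp
    ring
  · by_cases h3 : 0 ≤ r
    · simp only [h2, h3, if_true, not_le.1 h2, true_and, if_false, mul_one, zero_mul, zero_add, add_zero]
      field_simp
    · simp only [h2, h3, and_false, if_false, mul_one, zero_mul, zero_add, add_zero]
      field_simp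
      ring

/-- Split off one strand at a time by `spinPairing_union`. -/
theorem spinPairing_self {a z : ℂ} (ha : a ≠ 0) (hz : z ≠ 0) (d : PlanarDiagram) (k : ℕ) :
    ∀ K : Finset ℤ, K.card = k → (∀ p ∈ K, d.partner p ∈ K) →
    spinPairing a z K d d = ∏ p ∈ K.filter (fun p => p < d.partner p), strandValue a z d p := by
  induction k using Nat.strong_induction_on with
  | _ k ih =>
  intro K hk hK
  have e0 := d.partner_partner
  rcases K.eq_empty_or_nonempty with rfl | ⟨p, hp⟩
  · simp [spinPairing, spinSum, planarWeight, matchWeight, twist]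
  obtain ⟨p, hp, hlt⟩ : ∃ p ∈ K, p < d.partner p := by
    rcases lt_or_gt_of_ne (d.partner_ne p) with h | h
    · exact ⟨d.partner p, hK p hp, by rwa [e0]⟩
    · exact ⟨p, hp, h⟩
  have hsub : ({p, d.partner p} : Finset ℤ) ⊆ K := by
    intro r; simp only [Finset.mem_insert, Finset.mem_singleton]
    rintro (rfl | rfl)
    exacts [hp, hK _ hp]
  set K' := K \ {p, d.partner p} with hK'
  have hu : K = {p, d.partner p} ∪ K' := (Finset.union_sdiff_of_subset hsub).symm
  have hcl : ∀ r ∈ K', d.partner r ∈ K' := by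
    intro r hr
    simp only [hK', Finset.mem_sdiff, Finset.mem_insert, Finset.mem_singleton, not_or] at hr ⊢
    refine ⟨hK r hr.1, fun h => hr.2.2 (by rw [← h, e0]), fun h => hr.2.1 ?_⟩
    have := congrArg d.partner h
    rwa [e0, e0] at this
  have hcard : K'.card < k := by
    rw [← hk]
    exact Finset.card_lt_card (Finset.sdiff_ssubset hsub ⟨p, by simp⟩)
  have hdis : Disjoint {p, d.partner p} K' := Finset.disjoint_sdiff
  have h1 := ih _ hcard K' rfl hcl
  have h2 : K.filter (fun p => p < d.partner p) =
      insert p (K'.filter fun p => p < d.partner p) := by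
    ext r
    simp only [hK', Finset.mem_filter, Finset.mem_insert, Finset.mem_sdiff, Finset.mem_singleton]
    constructor
    · rintro ⟨h3, h4⟩
      by_cases h5 : r = p
      · exact Or.inl h5
      · refine Or.inr ⟨⟨h3, ?_⟩, h4⟩
        rintro (h6 | h6)
        · exact h5 h6
        · rw [h6, e0] at h4; omega
    · rintro (rfl | ⟨⟨h3, h4⟩, h5⟩)
      · exact ⟨hp, hlt⟩
      · exact ⟨h3, h5⟩
  have hpair : ∀ r ∈ ({p, d.partner p} : Finset ℤ), d.partner r ∈ ({p, d.partner p} : Finset ℤ) := by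
    intro r; simp only [Finset.mem_insert, Finset.mem_singleton]
    rintro (rfl | rfl)
    · exact Or.inr rfl
    · exact Or.inl (e0 _)
  rw [h2, Finset.prod_insert, ← h1, ← spinPairing_pair ha hz d hlt]
  · conv_lhs => rw [hu]
    exact spinPairing_union hdis (fun _ _ => rfl) (fun _ _ => rfl) (fun _ _ => rfl) (fun _ _ => rfl)
      hpair hcl hpair hcl
  · simp [hK']

end

/-! ### Diagrams as matrices of the spin chain -/

noncomputable section

open PlanarDiagram


section Join

variable {m : ℕ}

/-- The spins on the top and the bottom of a diagram with `m` strands: `σ` is the configuration on the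
top, and `τ` the reversed configuration on the bottom. -/
def joinSpin (σ τ : Fin m → Bool) (p : ℤ) : Bool :=
  if 0 ≤ p then extendSpin σ p.toNat else !extendSpin τ (-1 - p).toNat

theorem joinSpin_top (σ τ : Fin m → Bool) (i : Fin m) : joinSpin σ τ (i.1 : ℤ) = σ i := by
  simp [joinSpin, extendSpin]

theorem joinSpin_bot (σ τ : Fin m → Bool) (i : Fin m) : joinSpin σ τ (-1 - (i.1 : ℤ)) = !τ i := by
  have h : ¬ (0 ≤ -1 - (i.1 : ℤ)) := by omega
  have h1 : (-1 - (-1 - (i.1 : ℤ))).toNat = i.1 := by omega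
  simp only [joinSpin, h, if_false, h1, extendSpin, i.2, dif_pos]

theorem setPair_joinSpin (σ τ : Fin m → Bool) (i : ℕ) (hi : i + 1 < m) (r : Bool) :
    setPair (joinSpin σ τ) (i : ℤ) (i + 1) r =
      joinSpin (setPair σ (⟨i, by omega⟩ : Fin m) ⟨i + 1, hi⟩ r) τ := by
  funext p
  rw [setPair_apply]
  unfold joinSpin
  rw [← setPair_extendSpin, setPair_apply]
  split_ifs <;> first | rfl | omega

theorem spinHook_joinSpin (a : ℂ) (τ : Fin m → Bool) (i : ℕ) (hi : i + 1 < m)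
    (F : (ℤ → Bool) → ℂ) :
    spinHook a (⟨i, by omega⟩ : Fin m) ⟨i + 1, hi⟩ (fun σ => F (joinSpin σ τ)) =
      fun σ => spinHook a (i : ℤ) (i + 1) F (joinSpin σ τ) := by
  funext σ
  have h1 := joinSpin_top σ τ ⟨i, by omega⟩
  have h2 := joinSpin_top σ τ ⟨i + 1, hi⟩
  push_cast at h1 h2
  simp only [spinHook_apply, setPair_joinSpin σ τ i hi, h1, h2]

theorem prod_Ico_neg (m : ℕ) (f : ℤ → ℂ) :
    ∏ p ∈ Finset.Ico (-m : ℤ) 0, f p = ∏ i : Fin m, f (-1 - (i.1 : ℤ)) := by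
  symm
  refine Finset.prod_bij (fun i _ => -1 - (i.1 : ℤ)) ?_ ?_ ?_ ?_
  · intro i _; rw [Finset.mem_Ico]; omega
  · intro i _ j _ h; ext; omega
  · intro p hp; rw [Finset.mem_Ico] at hp
    exact ⟨⟨(-1 - p).toNat, by omega⟩, Finset.mem_univ _, by simp only; omega⟩
  · intro i _; rfl

theorem prod_Ico_nat (m : ℕ) (f : ℤ → ℂ) :
    ∏ p ∈ Finset.Ico (0 : ℤ) m, f p = ∏ i : Fin m, f (i.1 : ℤ) := by
  symm
  refine Finset.prod_bij (fun i _ => (i.1 : ℤ)) ?_ ?_ ?_ ?_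
  · intro i _; rw [Finset.mem_Ico]; omega
  · intro i _ j _ h; ext; omega
  · intro p hp; rw [Finset.mem_Ico] at hp
    exact ⟨⟨p.toNat, by omega⟩, Finset.mem_univ _, by simp only; omega⟩
  · intro i _; rfl

theorem prod_window (m : ℕ) (f : ℤ → ℂ) :
    ∏ p ∈ Finset.Ico (-m : ℤ) m, f p =
      (∏ i : Fin m, f (-1 - (i.1 : ℤ))) * ∏ i : Fin m, f (i.1 : ℤ) := by
  rw [← Finset.Ico_union_Ico_eq_Ico (b := 0) (by omega) (by omega), Finset.prod_union,
    prod_Ico_neg, prod_Ico_nat]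
  exact Finset.Ico_disjoint_Ico_consecutive _ _ _

theorem sum_joinSpin (m : ℕ) {F : (ℤ → Bool) → ℂ} (hF : DependsOnSpins (Finset.Ico (-m : ℤ) m) F) :
    spinSum (Finset.Ico (-m : ℤ) m) F = ∑ σ : Fin m → Bool, ∑ τ : Fin m → Bool, F (joinSpin σ τ) := by
  rw [spinSum, ← Finset.sum_product']
  have top : ∀ (A : Finset ℤ), (∀ p : ℤ, -m ≤ p → p < m → joinSpin (m := m)
      (fun i => decide ((i.1 : ℤ) ∈ A)) (fun i => !decide (-1 - (i.1 : ℤ) ∈ A)) p =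
      decide (p ∈ A)) := by
    intro A p h1 h2
    by_cases hp : 0 ≤ p
    · obtain ⟨i, rfl⟩ := Int.eq_ofNat_of_zero_le hp
      have := joinSpin_top (m := m) (fun i => decide ((i.1 : ℤ) ∈ A))
        (fun i => !decide (-1 - (i.1 : ℤ) ∈ A)) ⟨i, by omega⟩
      simpa using this
    · obtain ⟨i, rfl⟩ : ∃ i : ℕ, p = -1 - i := ⟨(-1 - p).toNat, by omega⟩
      have := joinSpin_bot (m := m) (fun i => decide ((i.1 : ℤ) ∈ A))
        (fun i => !decide (-1 - (i.1 : ℤ) ∈ A)) ⟨i, by omega⟩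
      simpa using this
  refine Finset.sum_nbij' (fun A => (fun i => decide ((i.1 : ℤ) ∈ A),
    fun i => !decide (-1 - (i.1 : ℤ) ∈ A)))
    (fun B => (Finset.Ico (-m : ℤ) m).filter fun p => joinSpin B.1 B.2 p = true) ?_ ?_ ?_ ?_ ?_
  · intro A _; simp
  · intro B _; rw [Finset.mem_powerset]; exact Finset.filter_subset _ _
  · intro A hA
    rw [Finset.mem_powerset] at hA
    ext p
    rw [Finset.mem_filter]
    constructor
    · rintro ⟨h1, h2⟩
      rw [Finset.mem_Ico] at h1
      rw [top A p h1.1 h1.2] at h2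
      simpa using h2
    · intro h
      have h1 := hA h
      refine ⟨h1, ?_⟩
      rw [Finset.mem_Ico] at h1
      rw [top A p h1.1 h1.2]
      simpa using h
  · intro B _
    refine Prod.ext ?_ ?_ <;> funext i <;> simp only [Finset.mem_filter, Finset.mem_Ico]
    · have h : (-m : ℤ) ≤ i.1 ∧ (i.1 : ℤ) < m := by omega
      simp [h, joinSpin_top]
    · have h : (-m : ℤ) ≤ -1 - i.1 ∧ -1 - (i.1 : ℤ) < m := by omega
      simp [h, joinSpin_bot]
  · intro A _
    apply hF
    intro p hp
    rw [Finset.mem_Ico] at hp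
    exact (top A p hp.1 hp.2).symm

/-- The factor that compares the boundary weights with the matrix elements of the spin chain. -/
def spinGauge (a : ℂ) (τ : Fin m → Bool) : ℂ := ∏ i, if τ i then a else a⁻¹

/-- The columns of the spin chain matrices of diagrams. -/
def diagramColumn (a : ℂ) (τ : Fin m → Bool) : DiagramSpace →ₗ[ℂ] ((Fin m → Bool) → ℂ) :=
  Finsupp.linearCombination ℂ fun (d : PlanarDiagram) σ =>
    spinGauge a τ * planarWeight a (Finset.Ico (-m : ℤ) m) d (joinSpin σ τ)

theorem diagramColumn_basis (a : ℂ) (τ : Fin m → Bool) (d : PlanarDiagram) :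
    diagramColumn a τ (basisDiagram d) = fun σ =>
      spinGauge a τ * planarWeight a (Finset.Ico (-m : ℤ) m) d (joinSpin σ τ) :=
  (Finsupp.linearCombination_single ℂ _ _).trans (one_smul ℂ _)

/-- A vertical strand requires opposite spins at its ends; since `joinSpin` reverses the bottom
spins, this means `σ = τ`. The gauge factor then cancels the weights of the strands. -/
theorem diagramColumn_one {a : ℂ} (ha : a ≠ 0) (τ : Fin m → Bool) :
    diagramColumn a τ (basisDiagram PlanarDiagram.one) = Pi.single τ 1 := by
  rw [diagramColumn_basis]
  funext σ
  have h1 : ∀ i : Fin m, pointWeight a one.partner (fun _ _ => 1) (joinSpin σ τ) (-1 - (i.1 : ℤ)) =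
      cupWeight a (!τ i) (σ i) := by
    intro i
    have h : -1 - (i.1 : ℤ) < -1 - (-1 - (i.1 : ℤ)) := by omega
    have h' : -1 - (-1 - (i.1 : ℤ)) = i.1 := by omega
    simp only [pointWeight, PlanarDiagram.one, h, if_true]
    rw [h', joinSpin_top, joinSpin_bot]
  have h2 : ∀ i : Fin m, pointWeight a one.partner (fun _ _ => 1) (joinSpin σ τ) (i.1 : ℤ) = 1 := by
    intro i
    have h : ¬ ((i.1 : ℤ) < -1 - (i.1 : ℤ)) := by omega
    have h' : ¬ (-1 - (i.1 : ℤ) = i.1) := by omega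
    simp only [pointWeight, PlanarDiagram.one, h, h', if_false]
  rw [planarWeight, matchWeight, prod_window, Finset.prod_congr rfl fun i _ => h1 i,
    Finset.prod_congr rfl fun i _ => h2 i, Finset.prod_const_one, mul_one, spinGauge,
    ← Finset.prod_mul_distrib]
  by_cases h : σ = τ
  · subst h
    rw [Pi.single_eq_same]
    refine Finset.prod_eq_one fun i _ => ?_
    cases σ i <;> simp [cupWeight, ha]
  · rw [Pi.single_eq_of_ne h]
    obtain ⟨i, hi⟩ := Function.ne_iff.1 h
    refine Finset.prod_eq_zero (Finset.mem_univ i) ?_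
    have : (!τ i) = σ i := by
      revert hi; cases σ i <;> cases τ i <;> simp
    simp [cupWeight, this]

end Join

/-- The combinations of diagrams that preserve a window. -/
def windowSpan (b t : ℕ) : Submodule ℂ DiagramSpace :=
  Submodule.span ℂ (basisDiagram '' {d | d.Preserves b t})

theorem hookOp_mem_windowSpan (δ : ℂ) {b t : ℕ} {j : ℤ} (hj : -b ≤ j ∧ j + 1 < t) :
    ∀ v ∈ windowSpan b t, hookOp δ j v ∈ windowSpan b t := by
  intro v hv
  unfold windowSpan at hv ⊢
  induction hv using Submodule.span_induction with
  | zero => simp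
  | add x y _ _ h1 h2 => rw [map_add]; exact add_mem h1 h2
  | smul c x _ h => rw [map_smul]; exact Submodule.smul_mem _ _ h
  | mem x h =>
    obtain ⟨d, hd, rfl⟩ := h
    rw [hookOp_basis]
    exact Submodule.smul_mem _ _ (Submodule.subset_span ⟨_, Preserves.hook hd hj, rfl⟩)

theorem diagramColumn_hookOp {a δ : ℂ} (ha : a ≠ 0) (hδ : a ^ 2 + a⁻¹ ^ 2 = δ) {m : ℕ}
    (τ : Fin m → Bool) (i : TLIndex (m : ℕ∞)) : ∀ v ∈ windowSpan m m,
    diagramColumn a τ (hookOp δ i.1 v) = spinRep ha hδ m (TL.gen δ i) (diagramColumn a τ v) := by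
  have hi := i.succ_lt
  intro v hv
  unfold windowSpan at hv
  induction hv using Submodule.span_induction with
  | zero => simp
  | add x y _ _ h1 h2 => simp only [map_add, h1, h2]
  | smul c x _ h => simp only [map_smul, h]
  | mem x h =>
    obtain ⟨d, hd, rfl⟩ := h
    rw [spinRep_gen, hookOp_basis, map_smul, diagramColumn_basis, diagramColumn_basis]
    have h1 : (fun σ => spinGauge a τ * planarWeight a (Finset.Ico (-m : ℤ) m) d (joinSpin σ τ)) =
        spinGauge a τ • fun σ => planarWeight a (Finset.Ico (-m : ℤ) m) d (joinSpin σ τ) := rfl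
    rw [h1, map_smul, spinHook_joinSpin a τ i.1 hi, spinHook_planarWeight ha hδ]
    · funext σ
      simp only [Pi.smul_apply, smul_eq_mul]
      ring
    · intro p hp
      rw [Finset.mem_Ico] at hp ⊢
      exact hd p hp.1 hp.2
    · rw [Finset.mem_Ico]; omega
    · rw [Finset.mem_Ico]; omega

/-- The two claims are proved together because a generator intertwines only on diagrams that
preserve the window, so invariance of `windowSpan` is part of the induction. -/
theorem diagramColumn_leftRep {a δ : ℂ} (ha : a ≠ 0) (hδ : a ^ 2 + a⁻¹ ^ 2 = δ) {m : ℕ}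
    (τ : Fin m → Bool) (x : TL δ (m : ℕ∞)) : ∀ v ∈ windowSpan m m,
    leftRep δ m x v ∈ windowSpan m m ∧
    diagramColumn a τ (leftRep δ m x v) = spinRep ha hδ m x (diagramColumn a τ v) := by
  induction x using TL.induction with
  | hs c =>
    intro v hv
    rw [AlgHom.commutes, AlgHom.commutes]
    exact ⟨Submodule.smul_mem _ c hv, (diagramColumn a τ).map_smul c v⟩
  | hg i =>
    intro v hv
    have hi := i.succ_lt
    rw [leftRep_gen]
    exact ⟨hookOp_mem_windowSpan δ (by omega) v hv, diagramColumn_hookOp ha hδ τ i v hv⟩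
  | hm x y h1 h2 =>
    intro v hv
    rw [map_mul, map_mul]
    obtain ⟨h3, h4⟩ := h2 v hv
    obtain ⟨h5, h6⟩ := h1 _ h3
    exact ⟨h5, by rw [Module.End.mul_apply, h6, h4]; rfl⟩
  | ha x y h1 h2 =>
    intro v hv
    rw [map_add, map_add]
    refine ⟨add_mem (h1 v hv).1 (h2 v hv).1, ?_⟩
    rw [LinearMap.add_apply, map_add, (h1 v hv).2, (h2 v hv).2]; rfl

theorem one_mem_windowSpan (m : ℕ) : basisDiagram one ∈ windowSpan m m :=
  Submodule.subset_span ⟨_, one_preserves m, rfl⟩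

theorem one_hook_neg (k : ℕ) : one.hook (-(k : ℤ) - 2) = one.hook k := by
  ext p
  simp only [PlanarDiagram.hook, hookFun, one]
  split_ifs <;> omega

/-- The diagram arises from the identity by generators on both sides. A generator at the bottom of
the identity is the same as one at the top, so it becomes a right factor after it is commuted past
the left action. Loop factors are divided out, which uses `δ ≠ 0`. -/
theorem ofDiagram_spec {δ : ℂ} (hδ : δ ≠ 0) {m : ℕ} {d : PlanarDiagram}
    (hd : ∀ p : ℤ, (p < -m ∨ m ≤ p) → d.partner p = -1 - p) :
    leftRep δ m (ofDiagram δ m d) (basisDiagram one) = basisDiagram d := by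
  apply Classical.epsilon_spec (p := fun a => leftRep δ m a (basisDiagram one) = basisDiagram d)
  have h := reach_of_vertical hd
  clear hd
  induction h with
  | refl => exact ⟨1, by simp⟩
  | @tail e f _ h ih =>
    obtain ⟨x, hx⟩ := ih
    obtain ⟨i, hi, rfl⟩ := h
    have hne : (if e.partner i = i + 1 then δ else 1) ≠ 0 := by split_ifs <;> simp [hδ]
    have key : basisDiagram (e.hook i) =
        (if e.partner i = i + 1 then δ else 1)⁻¹ • hookOp δ i (basisDiagram e) := by
      rw [hookOp_basis, smul_smul, inv_mul_cancel₀ hne, one_smul]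
    rcases hi with hi | hi
    · obtain ⟨k, rfl⟩ : ∃ k : ℕ, i = -(k : ℤ) - 2 := ⟨(-i - 2).toNat, by omega⟩
      have hk : ((k + 1 : ℕ) : ℕ∞) < (m : ℕ∞) := by
        have : k + 1 < m := by omega
        exact_mod_cast this
      refine ⟨(if e.partner (-(k : ℤ) - 2) = -(k : ℤ) - 2 + 1 then δ else 1)⁻¹ •
        (x * TL.gen δ ⟨k, hk⟩), ?_⟩
      rw [key, ← hx, map_smul, map_mul, LinearMap.smul_apply, Module.End.mul_apply, leftRep_gen]
      congr 1
      have h1 : hookOp δ (k : ℤ) (basisDiagram one) = hookOp δ (-(k : ℤ) - 2) (basisDiagram one) := by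
        rw [hookOp_basis, hookOp_basis, one_hook_neg, if_neg, if_neg] <;> simp only [one] <;> omega
      have h2 := rightRep_gen δ m ⟨k, hk⟩
      rw [h1, ← h2]
      exact LinearMap.congr_fun (leftRep_commute_rightRep δ m m x (TL.gen δ ⟨k, hk⟩)).eq _
    · obtain ⟨k, rfl⟩ := Int.eq_ofNat_of_zero_le hi.1
      have hk : ((k + 1 : ℕ) : ℕ∞) < (m : ℕ∞) := by
        have : k + 1 < m := by omega
        exact_mod_cast this
      refine ⟨(if e.partner (k : ℤ) = (k : ℤ) + 1 then δ else 1)⁻¹ • (TL.gen δ ⟨k, hk⟩ * x), ?_⟩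
      rw [key, ← hx, map_smul, map_mul, LinearMap.smul_apply, Module.End.mul_apply, leftRep_gen]

end

/-! ### The trace pairing of diagrams as a spin pairing -/

noncomputable section

open PlanarDiagram

theorem setPair_eq_iff {ι : Type*} [DecidableEq ι] {j k : ι} (hjk : j ≠ k) (s t : ι → Bool)
    (r : Bool) : setPair s j k r = t ↔
      (∀ p, p ≠ j → p ≠ k → s p = t p) ∧ t j = r ∧ t k = !r := by
  constructor
  · rintro rfl
    refine ⟨fun p h1 h2 => ?_, ?_, ?_⟩ <;> simp [setPair_apply, *]
  · rintro ⟨h1, h2, h3⟩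
    funext p
    rw [setPair_apply]
    split_ifs with h4 h5
    · rw [h4, h3]
    · rw [h5, h2]
    · exact h1 p h5 h4

theorem spinHook_single_symm {ι : Type*} [DecidableEq ι] [Fintype ι] (a : ℂ) {j k : ι}
    (hjk : j ≠ k) (s t : ι → Bool) :
    spinHook a j k (Pi.single t 1) s = spinHook a j k (Pi.single s 1) t := by
  simp only [spinHook_apply, Pi.single_apply, setPair_eq_iff hjk]
  by_cases h : ∀ p, p ≠ j → p ≠ k → s p = t p
  · have h' : ∀ p, p ≠ j → p ≠ k → t p = s p := fun p h1 h2 => (h p h1 h2).symm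
    simp only [eq_true h, eq_true h', true_and]
    cases s j <;> cases s k <;> cases t j <;> cases t k <;> simp [cupWeight, mul_comm]
  · have h' : ¬ ∀ p, p ≠ j → p ≠ k → t p = s p := fun h' => h fun p h1 h2 => (h' p h1 h2).symm
    simp only [eq_false h, eq_false h', false_and, if_false, mul_zero, add_zero]

section Matrices

variable {a δ : ℂ} {m : ℕ}

/-- The matrices of the spin chain representation. -/
def spinMatrix (ha : a ≠ 0) (hδ : a ^ 2 + a⁻¹ ^ 2 = δ) (m : ℕ) (x : TL δ (m : ℕ∞)) :
    Matrix (Fin m → Bool) (Fin m → Bool) ℂ := LinearMap.toMatrix' (spinRep ha hδ m x)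

theorem spinMatrix_mul (ha : a ≠ 0) (hδ : a ^ 2 + a⁻¹ ^ 2 = δ) (x y : TL δ (m : ℕ∞)) :
    spinMatrix ha hδ m (x * y) = spinMatrix ha hδ m x * spinMatrix ha hδ m y := by
  rw [spinMatrix, map_mul]
  exact LinearMap.toMatrix'_mul _ _

theorem spinMatrix_add (ha : a ≠ 0) (hδ : a ^ 2 + a⁻¹ ^ 2 = δ) (x y : TL δ (m : ℕ∞)) :
    spinMatrix ha hδ m (x + y) = spinMatrix ha hδ m x + spinMatrix ha hδ m y := by
  rw [spinMatrix, map_add, map_add]; rfl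

theorem spinMatrix_algebraMap (ha : a ≠ 0) (hδ : a ^ 2 + a⁻¹ ^ 2 = δ) (c : ℂ) :
    spinMatrix ha hδ m (algebraMap ℂ _ c) = c • (1 : Matrix _ _ ℂ) := by
  rw [spinMatrix, AlgHom.commutes, Algebra.algebraMap_eq_smul_one, map_smul]
  congr 1
  exact LinearMap.toMatrix'_one

theorem spinMatrix_dagger (ha : a ≠ 0) (hδ : a ^ 2 + a⁻¹ ^ 2 = δ) (x : TL δ (m : ℕ∞)) :
    spinMatrix ha hδ m (TL.dagger x).unop = (spinMatrix ha hδ m x).transpose := by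
  induction x using TL.induction with
  | hs c =>
    rw [AlgHom.commutes]
    change spinMatrix ha hδ m (algebraMap ℂ _ c) = _
    rw [spinMatrix_algebraMap, Matrix.transpose_smul, Matrix.transpose_one]
  | hg i =>
    have : TL.dagger (TL.gen δ i) = MulOpposite.op (TL.gen δ i) := TL.lift_gen ..
    rw [this, MulOpposite.unop_op]
    ext s t
    rw [Matrix.transpose_apply, spinMatrix, LinearMap.toMatrix'_apply, LinearMap.toMatrix'_apply,
      spinRep_gen]
    exact spinHook_single_symm a (by simp) s t
  | hm x y h1 h2 =>
    rw [map_mul, MulOpposite.unop_mul, spinMatrix_mul, spinMatrix_mul, h1, h2, Matrix.transpose_mul]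
  | ha x y h1 h2 =>
    rw [map_add, MulOpposite.unop_add, spinMatrix_add, spinMatrix_add, h1, h2, Matrix.transpose_add]

/-- The columns of the identity diagram are the standard basis vectors, and the element `ofDiagram`
takes the identity diagram to `d`. -/
theorem spinMatrix_ofDiagram (ha : a ≠ 0) (hδ : a ^ 2 + a⁻¹ ^ 2 = δ) (h0 : δ ≠ 0) {d : PlanarDiagram}
    (hd : ∀ p : ℤ, (p < -m ∨ m ≤ p) → d.partner p = -1 - p) (σ τ : Fin m → Bool) :
    spinMatrix ha hδ m (ofDiagram δ m d) σ τ =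
      spinGauge a τ * planarWeight a (Finset.Ico (-m : ℤ) m) d (joinSpin σ τ) := by
  rw [spinMatrix, LinearMap.toMatrix'_apply, ← diagramColumn_one ha τ,
    ← (diagramColumn_leftRep ha hδ τ _ _ (one_mem_windowSpan m)).2, ofDiagram_spec h0 hd,
    diagramColumn_basis]

theorem spinPower_eq_prod {z : ℂ} (σ : Fin m → Bool) :
    spinPower z m (LinkState.spinCount σ) = ∏ i, if σ i then z else z⁻¹ := by
  have h : LinkState.spinCount σ = (Finset.univ.filter fun i => σ i = true).card := by
    unfold LinkState.spinCount
    symm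
    refine Finset.card_bij (fun i _ => i.1) ?_ ?_ ?_
    · intro i hi
      simp only [Finset.mem_filter, Finset.mem_univ, true_and, Finset.mem_range] at hi ⊢
      exact ⟨i.2, by rw [LinkState.extendSpin_of_lt _ i.2]; exact hi⟩
    · intro i _ j _ h; exact Fin.ext h
    · intro b hb
      simp only [Finset.mem_filter, Finset.mem_range] at hb
      rw [LinkState.extendSpin_of_lt _ hb.1] at hb
      exact ⟨⟨b, hb.1⟩, by simp [hb.2], rfl⟩
  have h2 : m - LinkState.spinCount σ = (Finset.univ.filter fun i => ¬ σ i = true).card := by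
    have := Finset.card_filter_add_card_filter_not (s := (Finset.univ : Finset (Fin m)))
      (fun i => σ i = true)
    rw [Finset.card_univ, Fintype.card_fin] at this
    omega
  rw [spinPower, h2, h, Finset.prod_ite, Finset.prod_const, Finset.prod_const]

theorem twist_joinSpin (a z : ℂ) (σ τ : Fin m → Bool) :
    twist a z (Finset.Ico (-m : ℤ) m) (joinSpin σ τ) =
      spinGauge a τ ^ 2 * ∏ i, if σ i then z else z⁻¹ := by
  rw [twist, prod_window, spinGauge, ← Finset.prod_pow]
  congr 1
  · refine Finset.prod_congr rfl fun i _ => ?_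
    have h : ¬ (0 ≤ -1 - (i.1 : ℤ)) := by omega
    rw [joinSpin_bot, pointTwist, if_neg h]
    cases τ i <;> simp
  · refine Finset.prod_congr rfl fun i _ => ?_
    have h : (0 ≤ (i.1 : ℤ)) := by omega
    rw [joinSpin_top, pointTwist, if_pos h]

theorem extremalTrace_eq_sum (ha : a ≠ 0) (hδ : a ^ 2 + a⁻¹ ^ 2 = δ) {γ g : ℝ} {z : ℂ}
    (hg : g ≠ 0) (hγ : γ = g ^ 2) (hz0 : z ≠ 0) (hz : z + z⁻¹ = (g : ℂ)⁻¹) (x : TL δ m) :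
    extremalTrace δ γ m x = (g : ℂ) ^ m * ∑ σ : Fin m → Bool,
      (∏ i, if σ i then z else z⁻¹) * spinMatrix ha hδ m x σ σ := by
  rw [extremalTrace_eq ha hδ hg hγ hz0 hz]
  congr 1
  refine Finset.sum_congr rfl fun σ _ => ?_
  rw [spinPower_eq_prod, spinMatrix, LinearMap.toMatrix'_apply]

theorem mem_Ico_of_vertical {d : PlanarDiagram}
    (hd : ∀ p : ℤ, (p < -m ∨ m ≤ p) → d.partner p = -1 - p) :
    ∀ p ∈ Finset.Ico (-m : ℤ) m, d.partner p ∈ Finset.Ico (-m : ℤ) m := by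
  intro p hp
  rw [Finset.mem_Ico] at hp ⊢
  by_contra h
  have h1 := hd (d.partner p) (by omega)
  rw [d.partner_partner] at h1
  omega

/-- The weighted trace of a matrix times a transpose is a double sum over top and bottom
configurations of a product of two entries. The square of the gauge factor is the twist of the
bottom points, and the powers of `z` are the twist of the top points. -/
theorem extremalTrace_ofDiagram (ha : a ≠ 0) (hδ : a ^ 2 + a⁻¹ ^ 2 = δ) (h0 : δ ≠ 0) {γ g : ℝ} {z : ℂ}
    (hg : g ≠ 0) (hγ : γ = g ^ 2) (hz0 : z ≠ 0) (hz : z + z⁻¹ = (g : ℂ)⁻¹) {d e : PlanarDiagram}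
    (hd : ∀ p : ℤ, (p < -m ∨ m ≤ p) → d.partner p = -1 - p)
    (he : ∀ p : ℤ, (p < -m ∨ m ≤ p) → e.partner p = -1 - p) :
    extremalTrace δ γ m (ofDiagram δ m d * (TL.dagger (ofDiagram δ m e)).unop) =
      (g : ℂ) ^ m * spinPairing a z (Finset.Ico (-m : ℤ) m) d e := by
  rw [extremalTrace_eq_sum ha hδ hg hγ hz0 hz, spinPairing, sum_joinSpin]
  · congr 1
    refine Finset.sum_congr rfl fun σ _ => ?_
    rw [spinMatrix_mul, Matrix.mul_apply, Finset.mul_sum]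
    refine Finset.sum_congr rfl fun τ _ => ?_
    rw [spinMatrix_dagger, Matrix.transpose_apply, spinMatrix_ofDiagram ha hδ h0 hd,
      spinMatrix_ofDiagram ha hδ h0 he, twist_joinSpin]
    ring
  · exact ((dependsOnSpins_planarWeight a (mem_Ico_of_vertical hd)).mul
      (dependsOnSpins_planarWeight a (mem_Ico_of_vertical he))).mul (dependsOnSpins_twist a z _)

/-- The window contains as many cups at the bottom as at the top, each worth `δ`, and each through
strand is worth `g⁻¹`. At the top, a cup uses two of the `m` points and a through strand one, so `g
^ m` cancels the through strands and leaves `g ^ 2 = γ` for every top cup. -/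
theorem spinPairing_self_vertical (ha : a ≠ 0) (hδ : a ^ 2 + a⁻¹ ^ 2 = δ) {γ g : ℝ} {z : ℂ}
    (hg : g ≠ 0) (hγ : γ = g ^ 2) (hz0 : z ≠ 0) (hz : z + z⁻¹ = (g : ℂ)⁻¹) {d : PlanarDiagram}
    (hd : ∀ p : ℤ, (p < -m ∨ m ≤ p) → d.partner p = -1 - p) :
    (g : ℂ) ^ m * spinPairing a z (Finset.Ico (-m : ℤ) m) d d = (δ ^ 2 * γ) ^ cupNumber d := by
  have e0 := d.partner_partner
  have n0 := d.partner_ne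
  have hJ := mem_Ico_of_vertical hd
  simp only [Finset.mem_Ico] at hJ
  rw [spinPairing_self ha hz0 d _ _ rfl (mem_Ico_of_vertical hd)]
  set J := Finset.Ico (-m : ℤ) m with hJdef
  set C := J.filter (fun p => 0 ≤ p ∧ p < d.partner p) with hC
  set B := J.filter (fun p => p < d.partner p ∧ d.partner p < 0) with hB
  set T := J.filter (fun p => p < 0 ∧ 0 ≤ d.partner p) with hT
  have hsplit : J.filter (fun p => p < d.partner p) = (C ∪ B) ∪ T := by
    ext p
    have := n0 p
    simp only [hC, hB, hT, Finset.mem_union, Finset.mem_filter]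
    constructor
    · rintro ⟨h1, h2⟩; simp only [h1, true_and]; omega
    · rintro ((⟨h1, h2⟩ | ⟨h1, h2⟩) | ⟨h1, h2⟩) <;> exact ⟨h1, by omega⟩
  have d1 : Disjoint (C ∪ B) T := by
    rw [Finset.disjoint_left]; intro p
    simp only [hC, hB, hT, Finset.mem_union, Finset.mem_filter]; omega
  have d2 : Disjoint C B := by
    rw [Finset.disjoint_left]; intro p
    simp only [hC, hB, Finset.mem_filter]; omega
  have c1 : cupNumber d = C.card := by
    rw [cupNumber, ← Set.ncard_coe_finset]
    congr 1
    ext p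
    simp only [hC, Finset.coe_filter, Set.mem_ofPred_eq, hJdef, Finset.mem_Ico]
    constructor
    · rintro ⟨h1, h2⟩
      refine ⟨⟨by omega, ?_⟩, h1, h2⟩
      by_contra h3
      have := hd p (by omega)
      omega
    · rintro ⟨_, h⟩; exact h
  have c2 : 2 * C.card + T.card = m := by
    have e1 : (J.filter (fun p => 0 ≤ d.partner p ∧ d.partner p < p)).card = C.card := by
      refine Finset.card_nbij' d.partner d.partner ?_ ?_ (fun p _ => e0 p) (fun p _ => e0 p) <;>
      · intro p hp
        simp only [hC, hJdef, Finset.coe_filter, Set.mem_ofPred_eq, Finset.mem_Ico, e0] at hp ⊢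
        have := hJ p hp.1
        omega
    have e2 : (J.filter (fun p => 0 ≤ p ∧ d.partner p < 0)).card = T.card := by
      refine Finset.card_nbij' d.partner d.partner ?_ ?_ (fun p _ => e0 p) (fun p _ => e0 p) <;>
      · intro p hp
        simp only [hT, hJdef, Finset.coe_filter, Set.mem_ofPred_eq, Finset.mem_Ico, e0] at hp ⊢
        have := hJ p hp.1
        omega
    have e3 : (Finset.Ico (0 : ℤ) m).card = m := by simp
    have e4 : Finset.Ico (0 : ℤ) m = (C ∪ J.filter (fun p => 0 ≤ d.partner p ∧ d.partner p < p)) ∪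
        J.filter (fun p => 0 ≤ p ∧ d.partner p < 0) := by
      ext p
      have := n0 p
      simp only [hC, hJdef, Finset.mem_union, Finset.mem_filter, Finset.mem_Ico]
      omega
    rw [e4, Finset.card_union_of_disjoint, Finset.card_union_of_disjoint, e1, e2] at e3
    · omega
    · rw [Finset.disjoint_left]; intro p
      simp only [hC, Finset.mem_filter]; omega
    · rw [Finset.disjoint_left]; intro p
      simp only [hC, Finset.mem_filter, Finset.mem_union]; omega
  have c3 : 2 * B.card + T.card = m := by
    have e1 : (J.filter (fun p => p < 0 ∧ d.partner p < p)).card = B.card := by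
      refine Finset.card_nbij' d.partner d.partner ?_ ?_ (fun p _ => e0 p) (fun p _ => e0 p) <;>
      · intro p hp
        simp only [hB, hJdef, Finset.coe_filter, Set.mem_ofPred_eq, Finset.mem_Ico, e0] at hp ⊢
        have := hJ p hp.1
        omega
    have e3 : (Finset.Ico (-m : ℤ) 0).card = m := by simp
    have e4 : Finset.Ico (-m : ℤ) 0 = (B ∪ J.filter (fun p => p < 0 ∧ d.partner p < p)) ∪ T := by
      ext p
      have := n0 p
      simp only [hB, hT, hJdef, Finset.mem_union, Finset.mem_filter, Finset.mem_Ico]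
      omega
    rw [e4, Finset.card_union_of_disjoint, Finset.card_union_of_disjoint, e1] at e3
    · omega
    · rw [Finset.disjoint_left]; intro p
      simp only [hB, Finset.mem_filter]; omega
    · rw [Finset.disjoint_left]; intro p
      simp only [hB, hT, Finset.mem_filter, Finset.mem_union]; omega
  have hCB : C.card = B.card := by omega
  rw [hsplit, Finset.prod_union d1, Finset.prod_union d2, Finset.prod_congr rfl
    (g := fun _ => δ) (s₁ := C), Finset.prod_congr rfl (g := fun _ => δ) (s₁ := B),
    Finset.prod_congr rfl (g := fun _ => (g : ℂ)⁻¹) (s₁ := T), Finset.prod_const, Finset.prod_const,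
    Finset.prod_const, c1, ← hCB, hγ]
  · have hg' : (g : ℂ) ≠ 0 := by exact_mod_cast hg
    have : (g : ℂ) ^ m = (g : ℂ) ^ (2 * C.card) * g ^ T.card := by rw [← pow_add, c2]
    rw [this, inv_pow]
    push_cast
    rw [mul_pow, ← pow_mul, ← pow_mul, two_mul C.card, pow_add, pow_add]
    field_simp
  · intro p hp
    simp only [hT, Finset.mem_filter] at hp
    rw [strandValue, if_pos hp.2, hz]
  · intro p hp
    simp only [hB, Finset.mem_filter] at hp
    rw [strandValue, if_neg (by omega), hδ]
  · intro p hp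
    simp only [hC, Finset.mem_filter] at hp
    rw [strandValue, if_neg (by omega), hδ]

end Matrices

theorem exists_inv_add_eq {c : ℂ} : ∃ z : ℂ, z ≠ 0 ∧ z + z⁻¹ = c := by
  obtain ⟨z, hz⟩ := IsAlgClosed.exists_root (Polynomial.X ^ 2 - Polynomial.C c * Polynomial.X + 1 :
    Polynomial ℂ) (by
      have : (Polynomial.X ^ 2 - Polynomial.C c * Polynomial.X + 1 : Polynomial ℂ).degree = 2 := by
        compute_degree!
      rw [this]; decide)
  simp only [Polynomial.IsRoot, Polynomial.eval_add, Polynomial.eval_sub, Polynomial.eval_pow,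
    Polynomial.eval_X, Polynomial.eval_mul, Polynomial.eval_C, Polynomial.eval_one] at hz
  have h0 : z ≠ 0 := by rintro rfl; simp at hz
  refine ⟨z, h0, ?_⟩
  field_simp
  linear_combination hz

end

/-! ### Windows, and levels where equally many strands are cut at top and bottom -/

noncomputable section

namespace PlanarDiagram

/-- The reflection that exchanges top and bottom. -/
def flip (d : PlanarDiagram) : PlanarDiagram where
  partner p := -1 - d.partner (-1 - p)
  partner_partner p := by
    have : -1 - (-1 - d.partner (-1 - p)) = d.partner (-1 - p) := by ring
    rw [this, d.partner_partner]; ring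
  partner_ne p := by have := d.partner_ne (-1 - p); omega
  noncrossing a b := by
    have := d.noncrossing (d.partner (-1 - b)) (d.partner (-1 - a))
    rw [d.partner_partner, d.partner_partner] at this
    omega

theorem flip_partner (d : PlanarDiagram) (p : ℤ) : d.flip.partner p = -1 - d.partner (-1 - p) := rfl

/-- The diagram that agrees with `x` inside the window `[-b, t)` and with `e` outside of it. -/
def glue (b t : ℕ) (x e : PlanarDiagram) (hx : x.Preserves b t) (he : e.Preserves b t) :
    PlanarDiagram where
  partner p := if -b ≤ p ∧ p < t then x.partner p else e.partner p
  partner_partner p := by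
    by_cases h : -(b : ℤ) ≤ p ∧ p < t
    · have := hx p h.1 h.2
      rw [if_pos h, if_pos this, x.partner_partner]
    · have := he.outside (p := p) (by omega)
      rw [if_neg h, if_neg (by omega), e.partner_partner]
  partner_ne p := by
    split_ifs
    exacts [x.partner_ne p, e.partner_ne p]
  noncrossing p q := by
    have h1 := hx p
    have h2 := hx q
    have h3 := he.outside (p := p)
    have h4 := he.outside (p := q)
    have h5 := x.noncrossing p q
    have h6 := e.noncrossing p q
    split_ifs <;> omega

theorem glue_inside {b t : ℕ} {x e : PlanarDiagram} (hx : x.Preserves b t) (he : e.Preserves b t)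
    {p : ℤ} (hp : -b ≤ p ∧ p < t) : (glue b t x e hx he).partner p = x.partner p := if_pos hp

theorem glue_outside {b t : ℕ} {x e : PlanarDiagram} (hx : x.Preserves b t) (he : e.Preserves b t)
    {p : ℤ} (hp : p < -b ∨ t ≤ p) : (glue b t x e hx he).partner p = e.partner p :=
  if_neg (by omega)

/-- A window that contains all through strands and that no strand leaves. -/
structure IsWindow (w : PlanarDiagram) (b t : ℕ) : Prop where
  preserves : w.Preserves b t
  side : ∀ p : ℤ, (p < -b ∨ t ≤ p) → (0 ≤ p ↔ 0 ≤ w.partner p)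

theorem finite_throughStrands {w : PlanarDiagram} {n : ℕ} (hw : w.numThrough = n) :
    w.throughStrands.Finite := Set.finite_of_encard_eq_coe hw

theorem exists_through_lt {w : PlanarDiagram} (hw : w.throughStrands.Finite) :
    ∃ N : ℕ, ∀ p : ℤ, 0 ≤ p → w.partner p < 0 → p < N ∧ -N ≤ w.partner p := by
  obtain ⟨A, hA⟩ := hw.bddAbove
  obtain ⟨B, hB⟩ := (hw.image w.partner).bddBelow
  refine ⟨(max (A + 1) (-B)).toNat, fun p h1 h2 => ?_⟩
  have h3 := hA (show p ∈ w.throughStrands from ⟨h1, h2⟩)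
  have h4 := hB (Set.mem_image_of_mem w.partner (show p ∈ w.throughStrands from ⟨h1, h2⟩))
  omega

/-- Take `t` just beyond the far ends of all strands that start in `[0, N)`. If `t - 1` is such a
far end, the points from `N` up to it lie below that strand and cannot be joined to points beyond
`t`. -/
theorem exists_top_window (w : PlanarDiagram) (N : ℕ) :
    ∃ t : ℕ, N ≤ t ∧ ∀ p : ℤ, 0 ≤ p → p < t → w.partner p < t := by
  have e0 := w.partner_partner
  have n0 := w.partner_ne
  -- The second clause records where the maximum is attained; without it `t` would only be an upper
  -- bound, and strands in between could leave.
  obtain ⟨t, ht1, ht2⟩ : ∃ t : ℕ, (∀ p : ℤ, 0 ≤ p → p < N → p < t ∧ w.partner p < t) ∧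
      (t = 0 ∨ ∃ p : ℤ, 0 ≤ p ∧ p < N ∧ (t - 1 = p ∨ t - 1 = w.partner p)) := by
    induction N with
    | zero => exact ⟨0, fun p _ _ => by omega, Or.inl rfl⟩
    | succ N ih =>
      obtain ⟨t, h1, h2⟩ := ih
      obtain ⟨s, hs⟩ : ∃ s : ℕ, (s : ℤ) = max (t : ℤ) (max (N + 1) (w.partner N + 1)) :=
        ⟨(max (t : ℤ) (max (N + 1) (w.partner N + 1))).toNat, by omega⟩
      refine ⟨s, fun p hp hpN => ?_, ?_⟩
      · by_cases h : p = N
        · subst h; omega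
        · have := h1 p hp (by omega); omega
      · by_cases h3 : s = t
        · rcases h2 with h2 | ⟨p, hp⟩
          · left; omega
          · right; exact ⟨p, hp.1, by omega, by rw [h3]; exact hp.2.2⟩
        · right; exact ⟨N, by omega, by omega, by omega⟩
  refine ⟨max t N, le_max_right _ _, fun p hp hpt => ?_⟩
  by_contra hcon
  have hpN : (N : ℤ) ≤ p := by
    by_contra h
    have := (ht1 p hp (by omega)).2
    omega
  rcases ht2 with h | ⟨r, h1, h2, h3 | h3⟩
  · omega
  · omega
  · have h4 : p ≠ w.partner r := by
      intro h
      rw [h, e0] at hcon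
      omega
    exact w.noncrossing r p (by omega)

/-- The two boundaries are found separately, the lower one from the reflected diagram. Beyond the
bound `M` for the ends of the through strands, the points outside are joined to points of their own
side. -/
theorem exists_isWindow {w : PlanarDiagram} (hw : w.throughStrands.Finite) (N : ℕ) :
    ∃ b t : ℕ, N ≤ b ∧ N ≤ t ∧ w.IsWindow b t := by
  have e0 := w.partner_partner
  obtain ⟨M, hM⟩ := exists_through_lt hw
  obtain ⟨t, h1, h2⟩ := exists_top_window w (max N M)
  obtain ⟨b, h3, h4⟩ := exists_top_window w.flip (max N M)
  have h5 : ∀ p : ℤ, -b ≤ p → p < 0 → -b ≤ w.partner p := by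
    intro p hp hp'
    have := h4 (-1 - p) (by omega) (by omega)
    rw [flip_partner] at this
    have e : -1 - (-1 - p) = p := by ring
    rw [e] at this
    omega
  have hM' : ∀ p : ℤ, p < 0 → 0 ≤ w.partner p → w.partner p < M ∧ -M ≤ p := by
    intro p hp hp'
    have := hM (w.partner p) hp' (by rwa [e0])
    rwa [e0] at this
  refine ⟨b, t, by omega, by omega, ⟨fun p hp hp' => ?_, fun p hp => ?_⟩⟩
  · have a1 := hM p
    have a2 := hM' p
    have a3 := h2 p
    have a4 := h5 p
    omega
  · have a1 := hM p
    have a2 := hM' p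
    omega

theorem IsWindow.parity {w : PlanarDiagram} {b t : ℕ} (h : w.IsWindow b t) : b % 2 = t % 2 := by
  obtain ⟨r, r', e, _, _, he⟩ := exists_isStandard h.preserves
  have := he.len
  omega

/-- The number of top points below `m` whose strand ends at or above `m`. -/
def openTop (d : PlanarDiagram) (m : ℕ) : ℕ :=
  ((Finset.Ico (0 : ℤ) m).filter fun p => m ≤ d.partner p).card

/-- By `h` the point `m` does not belong to a through strand, so its strand is either newly opened
or one of the open strands that is now closed. -/
theorem openTop_succ (d : PlanarDiagram) (m : ℕ) (h : 0 ≤ d.partner m) :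
    d.openTop (m + 1) = d.openTop m + 1 ∨ d.openTop (m + 1) + 1 = d.openTop m := by
  have e0 := d.partner_partner
  have n0 := d.partner_ne m
  have em := e0 m
  unfold openTop
  by_cases h1 : (m : ℤ) < d.partner m
  · left
    have : (Finset.Ico (0 : ℤ) (m + 1 : ℕ)).filter (fun p => ((m + 1 : ℕ) : ℤ) ≤ d.partner p) =
        insert (m : ℤ) ((Finset.Ico (0 : ℤ) m).filter fun p => m ≤ d.partner p) := by
      ext p
      simp only [Finset.mem_filter, Finset.mem_Ico, Finset.mem_insert]
      have ep := e0 p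
      by_cases hp : p = m
      · subst hp; omega
      · have : p < m → d.partner p ≠ m := by
          intro _ h'; rw [h'] at ep; omega
        omega
    rw [this, Finset.card_insert_of_notMem]
    simp
  · right
    have : (Finset.Ico (0 : ℤ) (m + 1 : ℕ)).filter (fun p => ((m + 1 : ℕ) : ℤ) ≤ d.partner p) =
        ((Finset.Ico (0 : ℤ) m).filter fun p => m ≤ d.partner p).erase (d.partner m) := by
      ext p
      simp only [Finset.mem_filter, Finset.mem_Ico, Finset.mem_erase]
      have ep := e0 p
      by_cases hp : p = m
      · subst hp; omega
      · by_cases hp' : p = d.partner m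
        · subst hp'; omega
        · have : d.partner p ≠ m := by
            intro h'; rw [h'] at ep; omega
          omega
    rw [this, Finset.card_erase_add_one]
    simp only [Finset.mem_filter, Finset.mem_Ico, em]
    omega

/-- Discrete intermediate value theorem: steps up by at most two cannot jump over zero within the
even numbers. -/
theorem exists_zero_of_even_steps {D : ℕ → ℤ} {k l : ℕ} (hkl : k ≤ l) (hk : D k ≤ 0) (hl : 0 ≤ D l)
    (hev : ∀ i, k ≤ i → i ≤ l → D i % 2 = 0) (hst : ∀ i, k ≤ i → i < l → D (i + 1) ≤ D i + 2) :
    ∃ i, k ≤ i ∧ i ≤ l ∧ D i = 0 := by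
  classical
  have hex : ∃ i, k ≤ i ∧ 0 ≤ D i := ⟨l, hkl, hl⟩
  obtain ⟨h1, h2⟩ := Nat.find_spec hex
  have h3 : Nat.find hex ≤ l := Nat.find_min' hex ⟨hkl, hl⟩
  refine ⟨Nat.find hex, h1, h3, ?_⟩
  set i := Nat.find hex with hi
  rcases h1.eq_or_lt with h4 | h4
  · rw [← h4] at h2 ⊢; omega
  · obtain ⟨j, hj⟩ : ∃ j, i = j + 1 := ⟨i - 1, by omega⟩
    have h5 : ¬ (k ≤ j ∧ 0 ≤ D j) := Nat.find_min hex (by omega)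
    have h6 := hev j (by omega) (by omega)
    have h7 := hst j (by omega) (by omega)
    rw [← hj] at h7
    omega

/-- Beyond the through strands both counts change by one at each step, so their difference has
constant parity and moves by at most two. At the boundaries `t` and `b` of a window one count
vanishes and then the other. As `b` and `t` have the same parity, the difference is even, and it
changes sign between them, hence is zero somewhere. -/
theorem exists_openTop_eq {w : PlanarDiagram} (hw : w.throughStrands.Finite) (N : ℕ) :
    ∃ m, N ≤ m ∧ w.openTop m = w.flip.openTop m := by
  have e0 := w.partner_partner
  obtain ⟨M, hM⟩ := exists_through_lt hw
  have hM' : ∀ p : ℤ, p < 0 → 0 ≤ w.partner p → w.partner p < M ∧ -M ≤ p := by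
    intro p hp hp'
    have := hM (w.partner p) hp' (by rwa [e0])
    rwa [e0] at this
  obtain ⟨b, t, hb, ht, hwin⟩ := exists_isWindow hw (max N M)
  have par := hwin.parity
  have s1 : ∀ m : ℕ, M ≤ m → w.openTop (m + 1) = w.openTop m + 1 ∨
      w.openTop (m + 1) + 1 = w.openTop m := fun m hm => openTop_succ w m (by
    have := hM m; omega)
  have s2 : ∀ m : ℕ, M ≤ m → w.flip.openTop (m + 1) = w.flip.openTop m + 1 ∨
      w.flip.openTop (m + 1) + 1 = w.flip.openTop m := fun m hm => openTop_succ w.flip m (by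
    rw [flip_partner]
    have := hM' (-1 - m); omega)
  have z1 : w.openTop t = 0 := by
    rw [openTop, Finset.card_eq_zero, Finset.filter_eq_empty_iff]
    intro p hp
    rw [Finset.mem_Ico] at hp
    have := hwin.preserves p (by omega) (by omega)
    omega
  have z2 : w.flip.openTop b = 0 := by
    rw [openTop, Finset.card_eq_zero, Finset.filter_eq_empty_iff]
    intro p hp
    rw [Finset.mem_Ico] at hp
    have := hwin.preserves (-1 - p) (by omega) (by omega)
    rw [flip_partner]
    omega
  have p1 : ∀ k, (w.openTop (M + k) + k + w.openTop M) % 2 = 0 := by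
    intro k
    induction k with
    | zero => simp only [add_zero]; omega
    | succ k ih => have := s1 (M + k) (by omega); rw [add_assoc M k 1] at this; omega
  have p2 : ∀ k, (w.flip.openTop (M + k) + k + w.flip.openTop M) % 2 = 0 := by
    intro k
    induction k with
    | zero => simp only [add_zero]; omega
    | succ k ih => have := s2 (M + k) (by omega); rw [add_assoc M k 1] at this; omega
  have q1 := p1 (t - M)
  have q2 := p2 (b - M)
  rw [show M + (t - M) = t by omega, z1] at q1
  rw [show M + (b - M) = b by omega, z2] at q2
  have ev : ∀ m, M ≤ m → (w.openTop m + w.flip.openTop m) % 2 = 0 := by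
    intro m hm
    have r1 := p1 (m - M)
    have r2 := p2 (m - M)
    rw [show M + (m - M) = m by omega] at r1 r2
    omega
  rcases le_total t b with h | h
  · obtain ⟨m, h1, _, h2⟩ := exists_zero_of_even_steps
      (D := fun m => (w.openTop m : ℤ) - w.flip.openTop m) h (by simp only [z1]; omega)
      (by simp only [z2]; omega) (fun i h1 _ => by have := ev i (by omega); omega)
      (fun i h1 _ => by
        have := s1 i (by omega); have := s2 i (by omega); omega)
    exact ⟨m, by omega, by omega⟩
  · obtain ⟨m, h1, _, h2⟩ := exists_zero_of_even_steps
      (D := fun m => (w.flip.openTop m : ℤ) - w.openTop m) h (by simp only [z2]; omega)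
      (by simp only [z1]; omega) (fun i h1 _ => by have := ev i (by omega); omega)
      (fun i h1 _ => by
        have := s1 i (by omega); have := s2 i (by omega); omega)
    exact ⟨m, by omega, by omega⟩

theorem exists_antitone_matching (T B : Finset ℤ) (h : T.card = B.card) (hTB : Disjoint T B) :
    ∃ φ : ℤ → ℤ, (∀ p ∈ T, φ p ∈ B) ∧ (∀ p ∈ B, φ p ∈ T) ∧ (∀ p ∈ T ∪ B, φ (φ p) = p) ∧
      ∀ p ∈ T, ∀ q ∈ T, p < q → φ q < φ p := by
  classical
  set eT := T.orderEmbOfFin rfl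
  set eB := B.orderEmbOfFin h.symm
  have rT : ∀ p, p ∈ T ↔ ∃ i, eT i = p := fun p => by
    rw [← Finset.mem_coe, ← Finset.range_orderEmbOfFin T rfl]; rfl
  have rB : ∀ p, p ∈ B ↔ ∃ i, eB i = p := fun p => by
    rw [← Finset.mem_coe, ← Finset.range_orderEmbOfFin B h.symm]; rfl
  obtain ⟨φ, h1, h2⟩ : ∃ φ : ℤ → ℤ, (∀ i, φ (eT i) = eB i.rev) ∧ ∀ i, φ (eB i) = eT i.rev := by
    refine ⟨fun p => if hp : ∃ i, eT i = p then eB hp.choose.rev else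
      if hp : ∃ i, eB i = p then eT hp.choose.rev else p, fun i => ?_, fun i => ?_⟩
    · have hp : ∃ j, eT j = eT i := ⟨i, rfl⟩
      simp only [dif_pos hp]
      rw [eT.injective hp.choose_spec]
    · have hn : ¬ ∃ j, eT j = eB i := fun hj =>
        Finset.disjoint_left.1 hTB ((rT _).2 hj) ((rB _).2 ⟨i, rfl⟩)
      have hp : ∃ j, eB j = eB i := ⟨i, rfl⟩
      simp only [dif_neg hn, dif_pos hp]
      rw [eB.injective hp.choose_spec]
  refine ⟨φ, ?_, ?_, ?_, ?_⟩
  · intro p hp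
    obtain ⟨i, rfl⟩ := (rT p).1 hp
    exact (rB _).2 ⟨_, (h1 i).symm⟩
  · intro p hp
    obtain ⟨i, rfl⟩ := (rB p).1 hp
    exact (rT _).2 ⟨_, (h2 i).symm⟩
  · intro p hp
    rcases Finset.mem_union.1 hp with hp | hp
    · obtain ⟨i, rfl⟩ := (rT p).1 hp
      rw [h1, h2, Fin.rev_rev]
    · obtain ⟨i, rfl⟩ := (rB p).1 hp
      rw [h2, h1, Fin.rev_rev]
  · intro p hp q hq hpq
    obtain ⟨i, rfl⟩ := (rT p).1 hp
    obtain ⟨j, rfl⟩ := (rT q).1 hq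
    rw [h1, h1]
    exact eB.strictMono (Fin.rev_lt_rev.2 (eT.lt_iff_lt.1 hpq))

end PlanarDiagram

end

/-! ### Restrictions of diagrams and the limit of the renormalized pairing -/

noncomputable section

open PlanarDiagram

theorem IsRestriction.mem_cut {m : ℕ} {x y : PlanarDiagram} (h : IsRestriction m x y) {p : ℤ}
    (h1 : -m ≤ p) (h2 : p < m) (h3 : x.partner p < -m ∨ m ≤ x.partner p) :
    (-m ≤ y.partner p ∧ y.partner p < m) ∧
      (x.partner (y.partner p) < -m ∨ m ≤ x.partner (y.partner p)) := by
  have e1 := y.partner_partner p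
  have h4 : -m ≤ y.partner p ∧ y.partner p < m := by
    by_contra hc
    have := h.outside (y.partner p) (by omega)
    omega
  refine ⟨h4, ?_⟩
  by_contra hc
  have := h.inside (y.partner p) h4.1 h4.2 (by omega) (by omega)
  rw [e1] at this
  rw [this, x.partner_partner] at h3
  omega

/-- At the first top cut point `k` where two restrictions differ, one of them encloses the other's
partner of `k` by its strand to `k`. It must then join that bottom point to an earlier top cut
point, where both restrictions agree; so the bottom point would have two partners. -/
theorem IsRestriction.unique {m : ℕ} {x y z : PlanarDiagram} (hy : IsRestriction m x y)
    (hz : IsRestriction m x z) : y = z := by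
  have key : ∀ {y z : PlanarDiagram}, IsRestriction m x y → IsRestriction m x z → ∀ k : ℕ,
      (k : ℤ) < m → (x.partner k < -m ∨ m ≤ x.partner k) →
      (∀ l < k, (x.partner l < -m ∨ m ≤ x.partner l) → y.partner l = z.partner l) →
      ¬ (y.partner k < z.partner k) := by
    intro y z hy hz k hk hcut ih hlt
    have ez := z.partner_partner k
    obtain ⟨c1, c2⟩ := hz.mem_cut (by omega) hk hcut
    have c3 := hz.cut k (by omega) hk hcut
    have c4 := hy.cut _ c1.1 c1.2 c2
    obtain ⟨d1, d2⟩ := hy.mem_cut c1.1 c1.2 c2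
    have c5 := hy.cut k (by omega) hk hcut
    have nc := y.noncrossing (y.partner k) (z.partner k)
    rw [y.partner_partner] at nc
    have ne : y.partner (z.partner k) ≠ k := by
      intro h
      have := y.partner_partner (z.partner k)
      rw [h] at this; omega
    obtain ⟨l, hl⟩ := Int.eq_ofNat_of_zero_le (c4.1 (by omega))
    rw [hl] at d1 d2 nc ne
    have h1 := ih l (by omega) d2
    rw [← hl, y.partner_partner, hl] at h1
    have h2 := z.partner_partner l
    rw [← h1, ez] at h2
    omega
  have top : ∀ k : ℕ, (k : ℤ) < m → (x.partner k < -m ∨ m ≤ x.partner k) →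
      y.partner k = z.partner k := by
    intro k
    induction k using Nat.strong_induction_on with
    | _ k ih =>
    intro hk hcut
    have h1 := key hy hz k hk hcut fun l hl h => ih l hl (by omega) h
    have h2 := key hz hy k hk hcut fun l hl h => (ih l hl (by omega) h).symm
    omega
  ext p
  by_cases h1 : p < -m ∨ m ≤ p
  · rw [hy.outside p h1, hz.outside p h1]
  by_cases h2 : x.partner p < -m ∨ m ≤ x.partner p
  · by_cases h3 : 0 ≤ p
    · obtain ⟨k, rfl⟩ := Int.eq_ofNat_of_zero_le h3
      exact top k (by omega) h2
    · have c1 := hy.cut p (by omega) (by omega) h2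
      obtain ⟨c2, c3⟩ := hy.mem_cut (by omega) (by omega) h2
      obtain ⟨k, hk⟩ := Int.eq_ofNat_of_zero_le (c1.1 (by omega))
      have := top k (by omega) (by rw [← hk]; exact c3)
      rw [← hk, y.partner_partner] at this
      conv_rhs => rw [this]
      rw [z.partner_partner]
  · rw [hy.inside p (by omega) (by omega) (by omega) (by omega),
      hz.inside p (by omega) (by omega) (by omega) (by omega)]

theorem IsRestriction.restriction_eq {m : ℕ} {x y : PlanarDiagram} (h : IsRestriction m x y) :
    restriction m x = y := by
  have hex : ∃ y, IsRestriction m x y := ⟨y, h⟩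
  rw [restriction, dif_pos hex]
  exact hex.choose_spec.unique h

/-- Beyond the through strands, cut strands stay on their side, and by `h` there are equally many
cut points at top and bottom. The order-reversing bijection joins them without crossings. A kept
strand cannot cover a cut point (`below`), because the other end of the cut strand would lie under
it as well. -/
theorem exists_isRestriction {w : PlanarDiagram} {m : ℕ}
    (hm : ∀ p : ℤ, 0 ≤ p → w.partner p < 0 → p < m ∧ -m ≤ w.partner p)
    (h : w.openTop m = w.flip.openTop m) : ∃ y, IsRestriction m w y := by
  have e0 := w.partner_partner
  have n0 := w.partner_ne
  have hm' : ∀ p : ℤ, p < 0 → 0 ≤ w.partner p → w.partner p < m ∧ -m ≤ p := by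
    intro p hp hp'
    have := hm (w.partner p) hp' (by rwa [e0])
    rwa [e0] at this
  set T := (Finset.Ico (0 : ℤ) m).filter fun p => m ≤ w.partner p with hT
  set B := (Finset.Ico (-m : ℤ) 0).filter fun p => w.partner p < -m with hB
  have hcard : T.card = B.card := by
    refine Eq.trans h ?_
    refine Finset.card_nbij' (fun p => -1 - p) (fun p => -1 - p) ?_ ?_ ?_ ?_
    · intro p hp
      rw [Finset.mem_coe, Finset.mem_filter, Finset.mem_Ico, flip_partner] at hp
      rw [Finset.mem_coe, Finset.mem_filter, Finset.mem_Ico]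
      beta_reduce
      omega
    · intro p hp
      rw [Finset.mem_coe, Finset.mem_filter, Finset.mem_Ico] at hp
      rw [Finset.mem_coe, Finset.mem_filter, Finset.mem_Ico, flip_partner]
      have e : -1 - (-1 - p) = p := by ring
      rw [e]; beta_reduce; omega
    · intro p _; simp
    · intro p _; simp
  have mT : ∀ p, p ∈ T ↔ (0 ≤ p ∧ p < m) ∧ m ≤ w.partner p := by
    intro p; simp [hT]
  have mB : ∀ p, p ∈ B ↔ (-m ≤ p ∧ p < 0) ∧ w.partner p < -m := by
    intro p; simp [hB]
  obtain ⟨φ, f1, f2, f3, f4⟩ := exists_antitone_matching T B hcard (by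
    rw [Finset.disjoint_left]; intro p; rw [mT, mB]; omega)
  have hcut : ∀ p, p ∈ T ∪ B ↔ (-m ≤ p ∧ p < m) ∧ (w.partner p < -m ∨ m ≤ w.partner p) := by
    intro p
    rw [Finset.mem_union, mT, mB]
    have := hm p; have := hm' p
    omega
  have f5 : ∀ p ∈ T ∪ B, φ p ∈ T ∪ B := by
    intro p hp
    rcases Finset.mem_union.1 hp with hp | hp
    · exact Finset.mem_union_right _ (f1 p hp)
    · exact Finset.mem_union_left _ (f2 p hp)
  have f6 : ∀ p ∈ T ∪ B, (p < 0 ↔ 0 ≤ φ p) := by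
    intro p hp
    rcases Finset.mem_union.1 hp with hp | hp
    · have := (mB _).1 (f1 p hp); have := (mT _).1 hp; omega
    · have := (mT _).1 (f2 p hp); have := (mB _).1 hp; omega
  set F : ℤ → ℤ := fun p => if p ∈ T ∪ B then φ p else if -m ≤ p ∧ p < m then w.partner p else -1 - p
    with hF
  have F1 : ∀ p, p ∈ T ∪ B → F p = φ p := fun p hp => if_pos hp
  have F2 : ∀ p : ℤ, p ∉ T ∪ B → (-m ≤ p ∧ p < m) → F p = w.partner p ∧
      (-m ≤ w.partner p ∧ w.partner p < m) ∧ w.partner p ∉ T ∪ B := by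
    intro p hp hp'
    have h1 : ¬ (w.partner p < -m ∨ m ≤ w.partner p) := fun h => hp ((hcut p).2 ⟨hp', h⟩)
    refine ⟨by simp only [hF]; rw [if_neg hp, if_pos hp'], by omega, ?_⟩
    rw [hcut, e0]; omega
  have F3 : ∀ p : ℤ, ¬ (-m ≤ p ∧ p < m) → F p = -1 - p := by
    intro p hp
    simp only [hF]; rw [if_neg (by rw [hcut]; exact fun h => hp h.1), if_neg hp]
  have cl : ∀ p : ℤ, (-m ≤ p ∧ p < m) → (-m ≤ F p ∧ F p < m) := by
    intro p hp
    by_cases h : p ∈ T ∪ B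
    · rw [F1 p h]; exact ((hcut _).1 (f5 p h)).1
    · have := F2 p h hp; omega
  have below : ∀ p c : ℤ, p ∉ T ∪ B → (-m ≤ p ∧ p < m) → c ∈ T ∪ B → p < c → c < w.partner p → False := by
    intro p c hp hp' hc h1 h2
    obtain ⟨_, h3, _⟩ := F2 p hp hp'
    have h4 := (hcut c).1 hc
    have := (w.inside_iff p c (by omega) (by omega)).1 ⟨h1, h2⟩
    omega
  have FF : ∀ p, F (F p) = p := by
    intro p
    by_cases h1 : p ∈ T ∪ B
    · rw [F1 p h1, F1 _ (f5 p h1), f3 p h1]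
    by_cases h2 : -m ≤ p ∧ p < m
    · obtain ⟨h3, h4, h5⟩ := F2 p h1 h2
      rw [h3, (F2 _ h5 h4).1, e0]
    · rw [F3 p h2, F3 _ (by omega)]; ring
  have nc : ∀ p q, p < q → q < F p → F p < F q → False := by
    intro p q h1 h2 h3
    by_cases p2 : -m ≤ p ∧ p < m
    · have p3 := cl p p2
      have q3 := cl q (by omega)
      by_cases p1 : p ∈ T ∪ B
      · by_cases q1 : q ∈ T ∪ B
        · have b1 := f6 p p1
          have b2 := f6 q q1
          rw [F1 p p1] at h2 h3
          rw [F1 q q1] at h3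
          have g1 : φ p ∈ T := by
            rcases Finset.mem_union.1 (f5 p p1) with h | h
            · exact h
            · have := (mB _).1 h; have := (mT p); rcases Finset.mem_union.1 p1 with h' | h'
              · have := (mT _).1 h'; omega
              · exact absurd (f2 p h') (by rw [mT]; omega)
          have g2 : φ q ∈ T := by
            rcases Finset.mem_union.1 q1 with h' | h'
            · have := (mT _).1 h'
              rcases Finset.mem_union.1 p1 with h | h
              · have := (mT _).1 h; omega
              · have := (mB _).1 (f1 q h'); have := (mT _).1 g1; omega
            · exact f2 q h'
          have := f4 _ g1 _ g2 h3
          rw [f3 p p1, f3 q q1] at this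
          omega
        · obtain ⟨k1, k2, k3⟩ := F2 q q1 (by omega)
          rw [k1] at h3
          rw [F1 p p1] at h2 h3
          exact below q (φ p) q1 (by omega) (f5 p p1) h2 h3
      · obtain ⟨k1, k2, k3⟩ := F2 p p1 p2
        rw [k1] at h2 h3
        by_cases q1 : q ∈ T ∪ B
        · exact below p q p1 p2 q1 h1 h2
        · obtain ⟨l1, l2, l3⟩ := F2 q q1 (by omega)
          rw [l1] at h3
          exact w.noncrossing p q ⟨h1, h2, h3⟩
    · have p3 := F3 p p2
      by_cases q2 : -m ≤ q ∧ q < m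
      · have := cl q q2
        omega
      · have := F3 q q2
        omega
  refine ⟨⟨F, FF, ?_, fun p q h => nc p q h.1 h.2.1 h.2.2⟩, ⟨?_, ?_, ?_⟩⟩
  · intro p
    by_cases h1 : p ∈ T ∪ B
    · rw [F1 p h1]; have := f6 p h1; omega
    by_cases h2 : -m ≤ p ∧ p < m
    · rw [(F2 p h1 h2).1]; exact n0 p
    · rw [F3 p h2]; omega
  · intro p hp
    exact F3 p (by omega)
  · intro p h1 h2 h3 h4
    exact (F2 p (by rw [hcut]; omega) ⟨h1, h2⟩).1
  · intro p h1 h2 h3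
    have := (hcut p).2 ⟨⟨h1, h2⟩, h3⟩
    change p < 0 ↔ 0 ≤ F p
    rw [F1 p this]
    exact f6 p this

theorem levels_neBot {w : PlanarDiagram} (hw : w.throughStrands.Finite) : (levels w).NeBot := by
  obtain ⟨M, hM⟩ := exists_through_lt hw
  rw [levels, Filter.inf_principal_neBot_iff]
  intro U hU
  obtain ⟨N, hN⟩ := Filter.mem_atTop_sets.1 hU
  obtain ⟨m, h1, h2⟩ := exists_openTop_eq hw (max N M)
  exact ⟨m, hN m (by omega), exists_isRestriction (fun p h3 h4 => by have := hM p h3 h4; omega) h2⟩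

/-- `x` agrees with `w` outside of the window `[-b, t)`. -/
structure AgreesOff (w : PlanarDiagram) (b t : ℕ) (x : PlanarDiagram) : Prop where
  preserves : x.Preserves b t
  outside : ∀ p : ℤ, (p < -b ∨ t ≤ p) → x.partner p = w.partner p

theorem IsRestriction.preserves {w y : PlanarDiagram} {b t m : ℕ} (hw : w.Preserves b t) (hb : b ≤ m)
    (ht : t ≤ m) (hy : IsRestriction m w y) : y.Preserves b t := by
  intro p h1 h2
  have h3 := hw p h1 h2
  rw [hy.inside p (by omega) (by omega) (by omega) (by omega)]
  exact h3

/-- No strand crosses the boundary of `[-b, t)`, so cutting further out does not see what happens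
inside. -/
theorem IsRestriction.glue {w x y : PlanarDiagram} {b t m : ℕ} (hw : w.Preserves b t)
    (hx : AgreesOff w b t x) (hb : b ≤ m) (ht : t ≤ m) (hy : IsRestriction m w y) :
    IsRestriction m x (glue b t x y hx.preserves (hy.preserves hw hb ht)) := by
  refine ⟨fun p hp => ?_, fun p h1 h2 h3 h4 => ?_, fun p h1 h2 h3 => ?_⟩
  · rw [glue_outside _ _ (by omega), hy.outside p hp]
  · by_cases h : -b ≤ p ∧ p < t
    · rw [glue_inside _ _ h]
    · rw [hx.outside p (by omega)] at h3 h4 ⊢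
      rw [glue_outside _ _ (by omega), hy.inside p h1 h2 h3 h4]
  · by_cases h : -b ≤ p ∧ p < t
    · have := hx.preserves p h.1 h.2; omega
    · rw [hx.outside p (by omega)] at h3
      rw [glue_outside _ _ (by omega)]
      exact hy.cut p h1 h2 h3

section Pairing

variable {a z δ : ℂ} {γ g : ℝ} {w x y : PlanarDiagram} {b t m : ℕ}

theorem window_eq_union (hb : b ≤ m) (ht : t ≤ m) : Finset.Ico (-m : ℤ) m =
    Finset.Ico (-b : ℤ) t ∪ (Finset.Ico (-m : ℤ) m \ Finset.Ico (-b : ℤ) t) :=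
  (Finset.union_sdiff_of_subset (Finset.Ico_subset_Ico (by omega) (by omega))).symm

theorem PlanarDiagram.Preserves.mem {d : PlanarDiagram} (h : d.Preserves b t) :
    ∀ p ∈ Finset.Ico (-b : ℤ) t, d.partner p ∈ Finset.Ico (-b : ℤ) t := by
  intro p hp
  rw [Finset.mem_Ico] at hp ⊢
  exact h p hp.1 hp.2

theorem PlanarDiagram.Preserves.mem_sdiff {d : PlanarDiagram} (h : d.Preserves b t) {P : Finset ℤ}
    (hm : ∀ p ∈ P, d.partner p ∈ P) :
    ∀ p ∈ P \ Finset.Ico (-b : ℤ) t, d.partner p ∈ P \ Finset.Ico (-b : ℤ) t := by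
  intro p hp
  rw [Finset.mem_sdiff, Finset.mem_Ico] at hp ⊢
  have := h.outside (p := p) (by omega)
  exact ⟨hm p hp.1, by omega⟩

/-- The trace of diagrams that have a common part outside of a window. -/
theorem extremalTrace_glue (ha : a ≠ 0) (hδ : a ^ 2 + a⁻¹ ^ 2 = δ) (h0 : δ ≠ 0)
    (hg : g ≠ 0) (hγ : γ = g ^ 2) (hz0 : z ≠ 0) (hz : z + z⁻¹ = (g : ℂ)⁻¹)
    (hx : x.Preserves b t) (hy : y.Preserves b t) (hb : b ≤ m) (ht : t ≤ m) {r : PlanarDiagram}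
    (hr : r.Preserves b t) (hout : ∀ p : ℤ, (p < -m ∨ m ≤ p) → r.partner p = -1 - p) :
    extremalTrace δ γ m (ofDiagram δ m (glue b t x r hx hr) *
        (TL.dagger (ofDiagram δ m (glue b t y r hy hr))).unop) =
      g ^ m * (spinPairing a z (Finset.Ico (-b : ℤ) t) x y *
      spinPairing a z (Finset.Ico (-m : ℤ) m \ Finset.Ico (-b : ℤ) t) r r) := by
  have out : ∀ (x : PlanarDiagram) (hx : x.Preserves b t) (p : ℤ), (p < -m ∨ m ≤ p) →
      (glue b t x r hx hr).partner p = -1 - p := fun x hx p hp => by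
    rw [glue_outside _ _ (by omega), hout p hp]
  rw [extremalTrace_ofDiagram ha hδ h0 hg hγ hz0 hz (out x hx) (out y hy)]
  congr 1
  have hr1 := mem_Ico_of_vertical hout
  conv_lhs => rw [window_eq_union hb ht]
  refine spinPairing_union Finset.disjoint_sdiff ?_ ?_ ?_ ?_ hx.mem (hr.mem_sdiff hr1)
    hy.mem (hr.mem_sdiff hr1)
  · intro p hp; rw [Finset.mem_Ico] at hp; exact glue_inside _ _ hp
  · intro p hp; rw [Finset.mem_sdiff, Finset.mem_Ico (a := (-b : ℤ))] at hp
    exact glue_outside _ _ (by omega)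
  · intro p hp; rw [Finset.mem_Ico] at hp; exact glue_inside _ _ hp
  · intro p hp; rw [Finset.mem_sdiff, Finset.mem_Ico (a := (-b : ℤ))] at hp
    exact glue_outside _ _ (by omega)

/-- The pairing inside a window as a quotient of traces. -/
theorem extremalTrace_div_pow (ha : a ≠ 0) (hδ : a ^ 2 + a⁻¹ ^ 2 = δ) (h0 : δ ≠ 0)
    (hg : g ≠ 0) (hγ : γ = g ^ 2) (hz0 : z ≠ 0) (hz : z + z⁻¹ = (g : ℂ)⁻¹)
    (hw : w.Preserves b t) (hx : x.Preserves b t) (hy : y.Preserves b t) (hb : b ≤ m) (ht : t ≤ m)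
    {r : PlanarDiagram}
    (hr : r.Preserves b t) (hout : ∀ p : ℤ, (p < -m ∨ m ≤ p) → r.partner p = -1 - p) :
    extremalTrace δ γ m (ofDiagram δ m (glue b t x r hx hr) *
        (TL.dagger (ofDiagram δ m (glue b t y r hy hr))).unop) /
        (δ ^ 2 * γ) ^ cupNumber (glue b t w r hw hr) =
      spinPairing a z (Finset.Ico (-b : ℤ) t) x y / spinPairing a z (Finset.Ico (-b : ℤ) t) w w := by
  have out : ∀ p : ℤ, (p < -m ∨ m ≤ p) →
      (glue b t w r hw hr).partner p = -1 - p := fun p hp => by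
    rw [glue_outside _ _ (by omega), hout p hp]
  have h2 : (δ ^ 2 * γ) ^ cupNumber (glue b t w r hw hr) ≠ 0 := by
    refine pow_ne_zero _ (mul_ne_zero (pow_ne_zero _ h0) ?_)
    rw [hγ]; exact_mod_cast pow_ne_zero 2 hg
  rw [extremalTrace_glue ha hδ h0 hg hγ hz0 hz hx hy hb ht hr hout]
  -- The normalizing power is itself the pairing of the restricted `w` with itself, so the factor of
  -- the common outside part occurs in numerator and denominator.
  rw [← spinPairing_self_vertical ha hδ hg hγ hz0 hz out,
    ← extremalTrace_ofDiagram ha hδ h0 hg hγ hz0 hz out out,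
    extremalTrace_glue ha hδ h0 hg hγ hz0 hz hw hw hb ht hr hout] at h2 ⊢
  rw [← mul_assoc, ← mul_assoc, mul_comm ((g : ℂ) ^ m), mul_comm ((g : ℂ) ^ m)]
  have h4 := left_ne_zero_of_mul (right_ne_zero_of_mul h2)
  have h5 := right_ne_zero_of_mul (right_ne_zero_of_mul h2)
  have h6 := left_ne_zero_of_mul h2
  field_simp

theorem spinPairing_self_ne_zero (ha : a ≠ 0) (hδ : a ^ 2 + a⁻¹ ^ 2 = δ) (h0 : δ ≠ 0) (hz0 : z ≠ 0)
    (hg : g ≠ 0) (hz : z + z⁻¹ = (g : ℂ)⁻¹) (hw : w.Preserves b t) :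
    spinPairing a z (Finset.Ico (-b : ℤ) t) w w ≠ 0 := by
  rw [spinPairing_self ha hz0 w _ _ rfl hw.mem, Finset.prod_ne_zero_iff]
  intro p _
  rw [strandValue, hδ, hz]
  split_ifs
  · exact inv_ne_zero (by exact_mod_cast hg)
  · exact h0

/-- The right side does not depend on `m`. The sequence is therefore constant along all levels that
contain the window, which is why the limit exists. -/
theorem renormalizedPairing_eq (ha : a ≠ 0) (hδ : a ^ 2 + a⁻¹ ^ 2 = δ) (h0 : δ ≠ 0)
    (hg : g ≠ 0) (hγ : γ = g ^ 2) (hz0 : z ≠ 0) (hz : z + z⁻¹ = (g : ℂ)⁻¹)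
    (hw : w.Preserves b t) (hx : AgreesOff w b t x) (hy : AgreesOff w b t y) (hb : b ≤ m)
    (ht : t ≤ m) (hr : ∃ r, IsRestriction m w r) :
    renormalizedPairing δ γ w x y m = spinPairing a z (Finset.Ico (-b : ℤ) t) x y /
      spinPairing a z (Finset.Ico (-b : ℤ) t) w w := by
  obtain ⟨r, hr⟩ := hr
  have hr2 := hr.preserves hw hb ht
  have hx' := hr.glue hw hx hb ht
  have hy' := hr.glue hw hy hb ht
  have hw' : glue b t w r hw hr2 = r := by
    ext p
    by_cases h : -b ≤ p ∧ p < t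
    · have := hw p h.1 h.2
      rw [glue_inside _ _ h, hr.inside p (by omega) (by omega) (by omega) (by omega)]
    · rw [glue_outside _ _ (by omega)]
  rw [← extremalTrace_div_pow ha hδ h0 hg hγ hz0 hz hw hx.preserves hy.preserves hb ht hr2 hr.outside,
    hw', renormalizedPairing, truncatedPairing, hx'.restriction_eq, hy'.restriction_eq,
    hr.restriction_eq]

theorem eventually_levels (w : PlanarDiagram) (N : ℕ) :
    ∀ᶠ m in levels w, N ≤ m ∧ ∃ r, IsRestriction m w r := by
  rw [levels, Filter.eventually_inf_principal]
  filter_upwards [Filter.eventually_ge_atTop N] with m hm hm'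
  exact ⟨hm, hm'⟩

theorem tendsto_renormalizedPairing (ha : a ≠ 0) (hδ : a ^ 2 + a⁻¹ ^ 2 = δ) (h0 : δ ≠ 0)
    (hg : g ≠ 0) (hγ : γ = g ^ 2) (hz0 : z ≠ 0) (hz : z + z⁻¹ = (g : ℂ)⁻¹)
    (hw : w.Preserves b t) (hx : AgreesOff w b t x) (hy : AgreesOff w b t y) :
    Filter.Tendsto (renormalizedPairing δ γ w x y) (levels w)
      (nhds (spinPairing a z (Finset.Ico (-b : ℤ) t) x y /
        spinPairing a z (Finset.Ico (-b : ℤ) t) w w)) := by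
  refine tendsto_const_nhds.congr' ?_
  filter_upwards [eventually_levels w (max b t)] with m hm
  exact (renormalizedPairing_eq ha hδ h0 hg hγ hz0 hz hw hx hy (by omega) (by omega) hm.2).symm

theorem limitPairing_eq (hfin : w.throughStrands.Finite) (ha : a ≠ 0) (hδ : a ^ 2 + a⁻¹ ^ 2 = δ)
    (h0 : δ ≠ 0) (hg : g ≠ 0) (hγ : γ = g ^ 2) (hz0 : z ≠ 0) (hz : z + z⁻¹ = (g : ℂ)⁻¹)
    (hw : w.Preserves b t) (hx : AgreesOff w b t x) (hy : AgreesOff w b t y) :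
    limitPairing δ γ w x y = spinPairing a z (Finset.Ico (-b : ℤ) t) x y /
      spinPairing a z (Finset.Ico (-b : ℤ) t) w w := by
  have := levels_neBot hfin
  exact (tendsto_renormalizedPairing ha hδ h0 hg hγ hz0 hz hw hx hy).limUnder_eq

end Pairing

/-! ### The diagrams that span V(w) -/

/-- The diagrams of `V(w)`. -/
def diagramsOf (w : PlanarDiagram) : Set PlanarDiagram := {x | Reach {j | j ≠ -1} w x}

/-- Only finitely many generators are used, so they fit into every sufficiently large window. -/
theorem exists_reach_window {w x : PlanarDiagram} (h : x ∈ diagramsOf w) :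
    ∃ N : ℕ, ∀ b t : ℕ, N ≤ b → N ≤ t → Reach (sideIndices b t) w x := by
  induction h with
  | refl => exact ⟨0, fun b t _ _ => Reach.refl w⟩
  | @tail e f _ h ih =>
    obtain ⟨i, hi, rfl⟩ := h
    obtain ⟨N, hN⟩ := ih
    refine ⟨N + i.natAbs + 2, fun b t hb ht => (hN b t (by omega) (by omega)).trans (Reach.hook _ ?_)⟩
    simp only [sideIndices, Set.mem_ofPred_eq] at hi ⊢
    omega

theorem PlanarDiagram.Reach.agreesOff {w x : PlanarDiagram} {b t : ℕ} (hw : w.Preserves b t)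
    (h : Reach (sideIndices b t) w x) : AgreesOff w b t x :=
  ⟨(h.preserves hw).1, (h.preserves hw).2⟩

theorem PlanarDiagram.Reach.mem_diagramsOf {w x : PlanarDiagram} {b t : ℕ} (h : Reach (sideIndices b t) w x) :
    x ∈ diagramsOf w :=
  h.mono fun i hi => by rintro rfl; exact neg_one_notMem_sideIndices b t hi

/-- Two diagrams of `V(w)` have a common window. -/
theorem exists_common_window {w x y : PlanarDiagram} (hw : w.throughStrands.Finite)
    (hx : x ∈ diagramsOf w) (hy : y ∈ diagramsOf w) : ∃ b t : ℕ, w.IsWindow b t ∧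
      Reach (sideIndices b t) w x ∧ Reach (sideIndices b t) w y := by
  obtain ⟨N1, h1⟩ := exists_reach_window hx
  obtain ⟨N2, h2⟩ := exists_reach_window hy
  obtain ⟨b, t, hb, ht, h3⟩ := exists_isWindow hw (max N1 N2)
  exact ⟨b, t, h3, h1 b t (by omega) (by omega), h2 b t (by omega) (by omega)⟩

theorem twoSided_gen_left (δ : ℂ) (i : ℕ) (v : DiagramSpace) :
    (TL.gen δ (⟨i, ENat.natCast_lt_top _⟩ : TLIndex ⊤) ⊗ₜ[ℂ] (1 : TL δ ⊤) : TLTwoSided δ) • v = hookOp δ i v := by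
  rw [twoSided_smul_def, twoSidedRep, Algebra.TensorProduct.lift_tmul, map_one, mul_one, leftRep_gen]

theorem twoSided_gen_right (δ : ℂ) (i : ℕ) (v : DiagramSpace) :
    ((1 : TL δ ⊤) ⊗ₜ[ℂ] TL.gen δ (⟨i, ENat.natCast_lt_top _⟩ : TLIndex ⊤) : TLTwoSided δ) • v =
      hookOp δ (-(i : ℤ) - 2) v := by
  rw [twoSided_smul_def, twoSidedRep, Algebra.TensorProduct.lift_tmul, map_one, one_mul, rightRep_gen]

/-- A module action of `TL ⊗ TL` preserves a subspace that is preserved by the generators. -/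
theorem twoSided_smul_mem {δ : ℂ} {S : Submodule ℂ DiagramSpace}
    (hS : ∀ j : ℤ, j ≠ -1 → ∀ v ∈ S, hookOp δ j v ∈ S) (x : TLTwoSided δ) :
    ∀ v ∈ S, x • v ∈ S := by
  have hrep : ∀ (ρ : TL δ ⊤ →ₐ[ℂ] Module.End ℂ DiagramSpace)
      (_ : ∀ i, ∀ v ∈ S, ρ (TL.gen δ i) v ∈ S) (x : TL δ ⊤), ∀ v ∈ S, ρ x v ∈ S := by
    intro ρ hρ x
    induction x using TL.induction with
    | hs c => intro v hv; rw [AlgHom.commutes]; exact Submodule.smul_mem _ c hv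
    | hg i => exact hρ i
    | hm a b h1 h2 => intro v hv; rw [map_mul]; exact h1 _ (h2 _ hv)
    | ha a b h1 h2 => intro v hv; rw [map_add]; exact add_mem (h1 _ hv) (h2 _ hv)
  intro v hv
  rw [twoSided_smul_def]
  induction x using TensorProduct.induction_on with
  | zero => simp
  | add a b h1 h2 => rw [map_add]; exact add_mem h1 h2
  | tmul x y =>
    rw [twoSidedRep, Algebra.TensorProduct.lift_tmul]
    refine hrep _ (fun i v hv => ?_) x _ (hrep _ (fun i v hv => ?_) y _ hv)
    · rw [leftRep_gen]; exact hS _ (by omega) _ hv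
    · rw [rightRep_gen]; exact hS _ (by omega) _ hv

theorem hookOp_mem_submodule {δ : ℂ} (S : Submodule (TLTwoSided δ) DiagramSpace) {j : ℤ}
    (hj : j ≠ -1) {v : DiagramSpace} (hv : v ∈ S) : hookOp δ j v ∈ S := by
  by_cases h : 0 ≤ j
  · obtain ⟨i, rfl⟩ := Int.eq_ofNat_of_zero_le h
    rw [← twoSided_gen_left]; exact S.smul_mem _ hv
  · obtain ⟨i, rfl⟩ : ∃ i : ℕ, j = -(i : ℤ) - 2 := ⟨(-j - 2).toNat, by omega⟩
    rw [← twoSided_gen_right]; exact S.smul_mem _ hv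

theorem basis_hook_mem {δ : ℂ} (h0 : δ ≠ 0) (S : Submodule (TLTwoSided δ) DiagramSpace) {j : ℤ}
    (hj : j ≠ -1) {d : PlanarDiagram} (hd : basisDiagram d ∈ S) : basisDiagram (d.hook j) ∈ S := by
  have h1 := hookOp_mem_submodule S hj hd
  rw [hookOp_basis] at h1
  have hne : (if d.partner j = j + 1 then δ else 1) ≠ 0 := by split_ifs <;> simp [h0]
  have h2 := S.smul_of_tower_mem (if d.partner j = j + 1 then δ else 1)⁻¹ h1
  rwa [smul_smul, inv_mul_cancel₀ hne, one_smul] at h2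

theorem PlanarDiagram.Reach.basis_mem {δ : ℂ} (h0 : δ ≠ 0) (S : Submodule (TLTwoSided δ) DiagramSpace) {A : Set ℤ}
    (hA : -1 ∉ A) {d e : PlanarDiagram} (h : Reach A d e) (hd : basisDiagram d ∈ S) :
    basisDiagram e ∈ S := by
  induction h with
  | refl => exact hd
  | tail _ h ih =>
    obtain ⟨i, hi, rfl⟩ := h
    exact basis_hook_mem h0 S (fun h => hA (h ▸ hi)) ih

theorem basisDiagram_mem_span {A : Set PlanarDiagram} {d : PlanarDiagram} :
    basisDiagram d ∈ Submodule.span ℂ (basisDiagram '' A) ↔ d ∈ A := by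
  constructor
  · intro h
    have h1 : (Finsupp.single d (1 : ℂ)) ∈ Finsupp.supported ℂ ℂ A := by
      rw [Finsupp.supported_eq_span_single]; exact h
    rw [Finsupp.mem_supported] at h1
    apply h1
    simp
  · intro h
    exact Submodule.subset_span ⟨d, h, rfl⟩

/-- A generator sends a diagram to a multiple of a diagram with the factor `1` or `δ`. This factor
is invertible, so V(w) contains every reachable diagram and not only the products that come with
loop factors. -/
theorem regularRep_toSubmodule {δ : ℂ} (h0 : δ ≠ 0) (w : PlanarDiagram) :
    (regularRep δ w).restrictScalars ℂ = Submodule.span ℂ (basisDiagram '' diagramsOf w) := by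
  apply le_antisymm
  · intro v hv
    rw [Submodule.restrictScalars_mem] at hv
    unfold regularRep at hv
    induction hv using Submodule.span_induction with
    | mem x hx => rw [Set.mem_singleton_iff.1 hx]; exact Submodule.subset_span ⟨w, Reach.refl w, rfl⟩
    | zero => exact zero_mem _
    | add x y _ _ h1 h2 => exact add_mem h1 h2
    | smul c x _ h =>
      refine twoSided_smul_mem (fun j hj v hv => ?_) c x h
      induction hv using Submodule.span_induction with
      | zero => simp
      | add x y _ _ h1 h2 => rw [map_add]; exact add_mem h1 h2
      | smul c x _ h => rw [map_smul]; exact Submodule.smul_mem _ _ h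
      | mem x h =>
        obtain ⟨d, hd, rfl⟩ := h
        rw [hookOp_basis]
        exact Submodule.smul_mem _ _ (Submodule.subset_span ⟨_, Reach.trans hd (Reach.hook d hj), rfl⟩)
  · rw [Submodule.span_le]
    rintro _ ⟨d, hd, rfl⟩
    exact Reach.basis_mem h0 (regularRep δ w) (by simp) hd
      (Submodule.subset_span (Set.mem_singleton _))

theorem basisDiagram_mem_regularRep {δ : ℂ} (h0 : δ ≠ 0) {w x : PlanarDiagram} :
    basisDiagram x ∈ regularRep δ w ↔ x ∈ diagramsOf w := by
  rw [← basisDiagram_mem_span, ← regularRep_toSubmodule h0, Submodule.restrictScalars_mem]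

end

/-! ### Positivity of the standard traces and of their coefficients -/

noncomputable section

open PlanarDiagram

/-- Via `Φ` the space is a subspace of a Euclidean space that is stable under `M` and its adjoint.
There `T'` is the adjoint of `T`, and the trace of `T * T'` is the sum of the squared norms of `T'`
on an orthonormal basis. -/
theorem trace_mul_nonneg {V S : Type*} [AddCommGroup V] [Module ℂ V] [Fintype S] [DecidableEq S]
    (Φ : V →ₗ[ℂ] (S → ℂ)) (hΦ : Function.Injective Φ) (T T' : Module.End ℂ V) (M : Matrix S S ℂ)
    (hT : ∀ v, Φ (T v) = M.mulVec (Φ v)) (hT' : ∀ v, Φ (T' v) = M.conjTranspose.mulVec (Φ v)) :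
    ∃ r : ℝ, 0 ≤ r ∧ LinearMap.trace ℂ V (T * T') = r := by
  set E := (WithLp.linearEquiv 2 ℂ (S → ℂ)).symm with hE
  set Φ' : V →ₗ[ℂ] EuclideanSpace ℂ S := E.toLinearMap ∘ₗ Φ with hΦ'
  have hinj : Function.Injective Φ' := E.injective.comp hΦ
  set e := LinearEquiv.ofInjective Φ' hinj
  set b := stdOrthonormalBasis ℂ (LinearMap.range Φ')
  refine ⟨∑ i, ‖Φ' (T' (e.symm (b i)))‖ ^ 2, Finset.sum_nonneg fun i _ => by positivity, ?_⟩
  rw [← LinearMap.trace_conj' (T * T') e, LinearMap.trace_eq_sum_inner _ b]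
  push_cast
  refine Finset.sum_congr rfl fun i _ => ?_
  refine Eq.trans ?_ ((inner_self_eq_norm_sq_to_K (𝕜 := ℂ) (Φ' (T' (e.symm (b i))))).trans rfl)
  obtain ⟨v, hv⟩ : ∃ v, e.symm (b i) = v := ⟨_, rfl⟩
  have hb : b i = e v := by rw [← hv, LinearEquiv.apply_symm_apply]
  have h1 : e.conj (T * T') (b i) = e (T (T' v)) := by
    rw [LinearEquiv.conj_apply, LinearMap.comp_apply, LinearMap.comp_apply]
    simp [hv]
  rw [h1, hv, hb, Submodule.coe_inner, LinearEquiv.ofInjective_apply, LinearEquiv.ofInjective_apply,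
    EuclideanSpace.inner_eq_star_dotProduct, EuclideanSpace.inner_eq_star_dotProduct]
  change Φ (T (T' v)) ⬝ᵥ star (Φ v) = Φ (T' v) ⬝ᵥ star (Φ (T' v))
  conv_lhs => rw [hT, dotProduct_comm, Matrix.dotProduct_mulVec, dotProduct_comm]
  congr 1
  rw [hT', Matrix.star_mulVec, Matrix.conjTranspose_conjTranspose]

namespace LinkState

variable {n p : ℕ} {a δ : ℂ}

/-- If all through strands carry `+`, no two of them can be joined: the corrections with more cups
disappear and the map is equivariant. -/
theorem spinRep_vecMap_top (ha : a ≠ 0) (hδ : a ^ 2 + a⁻¹ ^ 2 = δ) (x : TL δ n) :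
    ∀ v, vecMap a n p (n - 2 * p) (standardRep δ n p x v) =
      spinRep ha hδ n x (vecMap a n p (n - 2 * p) v) := by
  induction x using TL.induction with
  | hs c => intro v; rw [AlgHom.commutes, AlgHom.commutes]; exact map_smul _ c v
  | hm x y h1 h2 =>
    intro v
    rw [map_mul, map_mul, Module.End.mul_apply, Module.End.mul_apply, h1, h2]
  | ha x y h1 h2 =>
    intro v
    rw [map_add, map_add, LinearMap.add_apply, LinearMap.add_apply, map_add, h1, h2]
  | hg i =>
    have : vecMap a n p (n - 2 * p) ∘ₗ standardRep δ n p (TL.gen δ i) =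
        spinRep ha hδ n (TL.gen δ i) ∘ₗ vecMap a n p (n - 2 * p) := by
      refine Finsupp.lhom_ext' fun u => LinearMap.ext_ring ?_
      simp only [LinearMap.comp_apply, Finsupp.lsingle_apply, vecMap_single]
      have h := spinRep_gen_vec ha hδ i u (n - 2 * p)
      rw [← sub_eq_zero, ← neg_eq_zero, neg_sub, h]
      split_ifs with h1 h2
      · have r1 := u.rank_succ h1.1
        have r2 := u.rank_succ h1.2
        have r3 := u.rank_mono (show i.1 + 1 + 1 ≤ n from i.succ_lt)
        have r4 := u.rank_card
        omega
      · rfl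
      · rfl
    exact fun v => LinearMap.congr_fun this v

theorem vecMap_injective (ha : a ≠ 0) (hp : p ∈ Finset.range (n / 2 + 1)) :
    Function.Injective (vecMap a n p (n - 2 * p)) := by
  have h := (linearIndependent_spinVec (n := n) ha).comp
    (fun u : LinkState n p => (⟨⟨p, Finset.mem_range.1 hp⟩, (u, ⟨n - 2 * p, by simp⟩)⟩ : SpinIndex n))
    (fun u v huv => by simpa using huv)
  exact h

end LinkState

theorem matrixTrace_mul_nonneg {m p : ℕ} {a δ : ℂ} (ha : a ≠ 0) (hδ : a ^ 2 + a⁻¹ ^ 2 = δ)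
    (hp : p ∈ Finset.range (m / 2 + 1)) (A A' : TL δ (m : ℕ∞))
    (hA : spinMatrix ha hδ m A' = (spinMatrix ha hδ m A).conjTranspose) :
    ∃ r : ℝ, 0 ≤ r ∧ matrixTrace δ m p (A * A') = r := by
  rw [matrixTrace, map_mul]
  have h : ∀ x v, LinkState.vecMap a m p (m - 2 * p) (standardRep δ m p x v) =
      (spinMatrix ha hδ m x).mulVec (LinkState.vecMap a m p (m - 2 * p) v) := by
    intro x v
    rw [LinkState.spinRep_vecMap_top ha hδ, spinMatrix, LinearMap.toMatrix'_mulVec]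
  refine trace_mul_nonneg _ (LinkState.vecMap_injective ha hp) _ _ (spinMatrix ha hδ m A)
    (h A) ?_
  rw [← hA]
  exact h A'

/-- For large `γ` write `γ = g ^ 2` and `g = 1 / (2 cos θ)`. The recursion is then solved by c_k sin
θ = g^k sin((k + 1) θ), which is positive while (k + 1) θ < π, and the bound on `γ` says that θ < π
/ (n + 1). -/
theorem coeffZero_pos {γ : ℝ} (hγ : 0 < γ) {n : ℕ}
    (h : 2 ≤ n → γ < 1 / (4 * Real.cos (Real.pi / (n + 1)) ^ 2)) {k : ℕ} (hk : k ≤ n) :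
    0 < coeffZero γ k := by
  by_cases h4 : γ ≤ 1 / 4
  -- Consecutive quotients stay at least 1/2: from c_k ≤ 2 c_{k+1} and γ ≤ 1/4 follows c_{k+2} ≥
  -- c_{k+1} - c_{k+1} / 2.
  · have : ∀ k, 0 < coeffZero γ k ∧ coeffZero γ k / 2 ≤ coeffZero γ (k + 1) := by
      intro k
      induction k with
      | zero => simp only [coeffZero]; norm_num
      | succ k ih =>
        have h1 : 0 < coeffZero γ (k + 1) := by linarith [ih.1, ih.2]
        refine ⟨h1, ?_⟩
        rw [coeffZero]
        nlinarith [ih.1, ih.2]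
    exact (this k).1
  · rw [not_le] at h4
    rcases Nat.lt_or_ge n 2 with hn | hn
    · interval_cases n
      · have : k = 0 := by omega
        subst this; simp [coeffZero]
      · have : k = 0 ∨ k = 1 := by omega
        rcases this with rfl | rfl <;> simp [coeffZero]
    specialize h hn
    set g := Real.sqrt γ with hg
    have hg0 : 0 < g := Real.sqrt_pos.2 hγ
    have hgg : g ^ 2 = γ := Real.sq_sqrt hγ.le
    have hg2 : 1 / 2 < g := by nlinarith
    set θ := Real.arccos (1 / (2 * g)) with hθ
    have hle : 1 / (2 * g) < 1 := by rw [div_lt_one (by positivity)]; linarith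
    have hpos : 0 < 1 / (2 * g) := by positivity
    have hcos : Real.cos θ = 1 / (2 * g) := Real.cos_arccos (by linarith) hle.le
    have hθ0 : 0 < θ := Real.arccos_pos.2 hle
    have hθpi : θ ≤ Real.pi := Real.arccos_le_pi _
    set φ := Real.pi / (n + 1) with hφ
    have hn' : (2 : ℝ) ≤ n := by exact_mod_cast hn
    have hφ0 : 0 < φ := by positivity
    have hφ2 : φ < Real.pi / 2 := by
      rw [hφ]; apply div_lt_div_of_pos_left Real.pi_pos (by norm_num); linarith
    have hcφ : 0 < Real.cos φ := Real.cos_pos_of_mem_Ioo ⟨by linarith, hφ2⟩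
    -- Otherwise cos θ = 1 / (2 g) would be at most cos φ, against the bound on `γ = g ^ 2`.
    have hθφ : θ < φ := by
      by_contra hc
      rw [not_lt] at hc
      have h1 := Real.cos_le_cos_of_nonneg_of_le_pi hφ0.le hθpi hc
      rw [hcos, div_le_iff₀ (by positivity)] at h1
      rw [lt_div_iff₀ (by positivity), ← hgg] at h
      nlinarith [mul_pos hcφ hg0]
    have hsin : ∀ k : ℕ, coeffZero γ k * Real.sin θ = g ^ k * Real.sin ((k + 1) * θ) ∧
        coeffZero γ (k + 1) * Real.sin θ = g ^ (k + 1) * Real.sin ((k + 2) * θ) := by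
      intro k
      induction k with
      | zero =>
        simp only [coeffZero, Nat.cast_zero, zero_add, one_mul, pow_zero, pow_one, true_and]
        rw [Real.sin_two_mul, hcos]
        field_simp
      | succ k ih =>
        refine ⟨by push_cast; rw [show (k : ℝ) + 1 + 1 = k + 2 by ring]; exact ih.2, ?_⟩
        rw [coeffZero, sub_mul, ih.2, mul_assoc, ih.1, ← hgg]
        have e1 : Real.sin (((k + 1 : ℕ) + 2 : ℝ) * θ) =
            2 * Real.cos θ * Real.sin ((k + 2) * θ) - Real.sin ((k + 1) * θ) := by
          have a1 : ((k + 1 : ℕ) + 2 : ℝ) * θ = (k + 2) * θ + θ := by push_cast; ring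
          have a2 : ((k + 1 : ℝ)) * θ = (k + 2) * θ - θ := by ring
          rw [a1, a2, Real.sin_add, Real.sin_sub]; ring
        rw [e1, hcos]
        field_simp
        ring
    have hsθ : 0 < Real.sin θ := Real.sin_pos_of_pos_of_lt_pi hθ0 (by linarith)
    have hk' : (k : ℝ) ≤ n := by exact_mod_cast hk
    have hsk : 0 < Real.sin ((k + 1) * θ) := by
      apply Real.sin_pos_of_pos_of_lt_pi (by positivity)
      calc (k + 1 : ℝ) * θ ≤ (n + 1) * θ := by nlinarith
        _ < (n + 1) * φ := by nlinarith
        _ = Real.pi := by rw [hφ]; field_simp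
    have h5 := (hsin k).1
    have h6 : 0 < coeffZero γ k * Real.sin θ := by rw [h5]; positivity
    exact (pos_iff_pos_of_mul_pos h6).2 hsθ

/-- The adjacent cups on the points of `[-m, m)`; the other strands are vertical. -/
def cupStack (m : ℕ) : PlanarDiagram where
  partner p := if -m ≤ p ∧ p < m then (if (p + m) % 2 = 0 then p + 1 else p - 1) else -1 - p
  partner_partner p := by
    by_cases h : -(m : ℤ) ≤ p ∧ p < m
    · rw [if_pos h]
      by_cases h2 : (p + m) % 2 = 0
      · rw [if_pos h2, if_pos (by omega), if_neg (by omega)]; ring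
      · rw [if_neg h2, if_pos (by omega), if_pos (by omega)]; ring
    · rw [if_neg h, if_neg (by omega)]; ring
  partner_ne p := by split_ifs <;> omega
  noncrossing p q := by split_ifs <;> omega

theorem cupStack_inside {m : ℕ} {p : ℤ} (h : -m ≤ p ∧ p < m) :
    (cupStack m).partner p = if (p + m) % 2 = 0 then p + 1 else p - 1 := if_pos h

theorem cupStack_outside {m : ℕ} {p : ℤ} (h : p < -m ∨ m ≤ p) :
    (cupStack m).partner p = -1 - p := if_neg (by omega)

theorem cupStack_preserves {b t m : ℕ} (hb : b ≤ m) (ht : t ≤ m) (h1 : b % 2 = m % 2)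
    (h2 : t % 2 = m % 2) : (cupStack m).Preserves b t := by
  intro p hp hp'
  rw [cupStack_inside (by omega)]
  split_ifs <;> omega

end

/-! ### Positivity of the extremal trace, and linear independence of diagrams -/

noncomputable section

open PlanarDiagram ComplexConjugate

section TracePositivity

variable {m n : ℕ} {a δ : ℂ} {γ : ℝ}

theorem spinMatrix_mul_diag (ha : a ≠ 0) (hδ : a ^ 2 + a⁻¹ ^ 2 = δ) {A A' : TL δ (m : ℕ∞)}
    (hA : spinMatrix ha hδ m A' = (spinMatrix ha hδ m A).conjTranspose) (σ : Fin m → Bool) :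
    spinRep ha hδ m (A * A') (Pi.single σ 1) σ =
      ((∑ τ, Complex.normSq (spinMatrix ha hδ m A σ τ) : ℝ) : ℂ) := by
  have h : spinRep ha hδ m (A * A') (Pi.single σ 1) σ = spinMatrix ha hδ m (A * A') σ σ := by
    rw [spinMatrix, LinearMap.toMatrix'_apply]
  rw [h, spinMatrix_mul, hA, Matrix.mul_apply]
  push_cast
  refine Finset.sum_congr rfl fun τ _ => ?_
  rw [Matrix.conjTranspose_apply]
  exact Complex.mul_conj _

/-- The extremal trace is positive on `A A*`, when `A` factors through few strands. -/
theorem extremalTrace_mul_nonneg (ha : a ≠ 0) (hδ : a ^ 2 + a⁻¹ ^ 2 = δ) (hγ : 0 < γ)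
    (hc : ∀ k ≤ n, 0 < coeffZero γ k) {A A' : TL δ (m : ℕ∞)}
    (hA : spinMatrix ha hδ m A' = (spinMatrix ha hδ m A).conjTranspose)
    (hsupp : ∀ σ τ, spinMatrix ha hδ m A σ τ ≠ 0 → m ≤ 2 * LinkState.spinCount σ + n) :
    ∃ r : ℝ, 0 ≤ r ∧ extremalTrace δ γ m (A * A') = r ∧
      (spinMatrix ha hδ m A ≠ 0 → 0 < r) := by
  have hr : ∀ p, ∃ r : ℝ, 0 ≤ r ∧ (p ∈ Finset.range (m / 2 + 1) →
      matrixTrace δ m p (A * A') = r) := by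
    intro p
    by_cases hp : p ∈ Finset.range (m / 2 + 1)
    · obtain ⟨r, h1, h2⟩ := matrixTrace_mul_nonneg ha hδ hp A A' hA
      exact ⟨r, h1, fun _ => h2⟩
    · exact ⟨0, le_rfl, fun h => absurd h hp⟩
  choose r hr0 hr using hr
  have hsum : ∀ D : ℕ → ℝ, ∑ σ : Fin m → Bool, D (LinkState.spinCount σ) *
      ∑ τ, Complex.normSq (spinMatrix ha hδ m A σ τ) =
      ∑ p ∈ Finset.range (m / 2 + 1), (∑ κ ∈ Finset.range (m - 2 * p + 1), D (p + κ)) * r p := by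
    intro D
    have h := LinkState.sum_diagonal_spinRep ha hδ (fun k => (D k : ℂ)) (A * A')
    simp only [spinMatrix_mul_diag ha hδ hA] at h
    rw [Finset.sum_congr rfl (s₂ := Finset.range (m / 2 + 1)) (g := fun p =>
      (∑ κ ∈ Finset.range (m - 2 * p + 1), (D (p + κ) : ℂ)) * (r p : ℂ))
      (fun p hp => by rw [hr p hp])] at h
    exact_mod_cast h
  -- Let `D` be the indicator of the spin count `p`. The left side vanishes, because `A` has nonzero
  -- rows only at configurations with enough signs `+`. The right side consists of nonnegative
  -- terms, among them `r p` itself, from `κ = 0`.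
  have hzero : ∀ p ∈ Finset.range (m / 2 + 1), n < m - 2 * p → r p = 0 := by
    intro p hp hn
    have h := hsum fun k => if k = p then 1 else 0
    have h1 : ∑ σ : Fin m → Bool, (if LinkState.spinCount σ = p then (1 : ℝ) else 0) *
        ∑ τ, Complex.normSq (spinMatrix ha hδ m A σ τ) = 0 := by
      refine Finset.sum_eq_zero fun σ _ => ?_
      split_ifs with h2
      · rw [one_mul]
        refine Finset.sum_eq_zero fun τ _ => ?_
        by_contra h3
        have := hsupp σ τ fun h4 => h3 (by rw [h4, map_zero])
        omega
      · rw [zero_mul]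
    rw [h1] at h
    have hnn : ∀ q ∈ Finset.range (m / 2 + 1), 0 ≤
        (∑ κ ∈ Finset.range (m - 2 * q + 1), if q + κ = p then (1 : ℝ) else 0) * r q := by
      intro q _
      refine mul_nonneg (Finset.sum_nonneg fun κ _ => ?_) (hr0 q)
      split_ifs <;> norm_num
    have h4 := (Finset.sum_eq_zero_iff_of_nonneg hnn).1 h.symm p hp
    rw [Finset.sum_eq_single 0] at h4
    · simpa using h4
    · intro κ _ hκ; rw [if_neg (by omega)]
    · intro h5; exact absurd (Finset.mem_range.2 (by omega)) h5
  have hterm : ∀ p ∈ Finset.range (m / 2 + 1), 0 ≤ coeff γ m p * r p := by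
    intro p hp
    rcases Nat.lt_or_ge n (m - 2 * p) with h | h
    · rw [hzero p hp h, mul_zero]
    · exact mul_nonneg (mul_nonneg (pow_nonneg hγ.le _) (hc _ h).le) (hr0 p)
  refine ⟨∑ p ∈ Finset.range (m / 2 + 1), coeff γ m p * r p, Finset.sum_nonneg hterm, ?_, ?_⟩
  · rw [extremalTrace]
    push_cast
    exact Finset.sum_congr rfl fun p hp => by rw [hr p hp]
  · intro hne
    -- With `D = 1` the sum is the squared Hilbert-Schmidt norm of the matrix, a combination of the
    -- `r p` with positive multiplicities. So some `r p` is positive, and by `hzero` its coefficient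
    -- is one of the positive ones.
    have h1 := hsum fun _ => 1
    simp only [one_mul, Finset.sum_const, Finset.card_range, nsmul_eq_mul, mul_one] at h1
    have h2 : 0 < ∑ σ : Fin m → Bool, ∑ τ, Complex.normSq (spinMatrix ha hδ m A σ τ) := by
      obtain ⟨σ, τ, h3⟩ : ∃ σ τ, spinMatrix ha hδ m A σ τ ≠ 0 := by
        by_contra hcon
        push Not at hcon
        exact hne (by ext σ τ; exact hcon σ τ)
      refine Finset.sum_pos' (fun σ _ => Finset.sum_nonneg fun τ _ => Complex.normSq_nonneg _)
        ⟨σ, Finset.mem_univ _, Finset.sum_pos' (fun τ _ => Complex.normSq_nonneg _)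
          ⟨τ, Finset.mem_univ _, Complex.normSq_pos.2 h3⟩⟩
    rw [h1] at h2
    obtain ⟨p, hp, h3⟩ := Finset.exists_lt_of_sum_lt (s := Finset.range (m / 2 + 1))
      (f := fun _ => (0 : ℝ)) (by simpa using h2)
    have h4 : 0 < r p := lt_of_le_of_ne (hr0 p) fun h => by rw [← h, mul_zero] at h3; exact h3.false
    refine Finset.sum_pos' hterm ⟨p, hp, ?_⟩
    rcases Nat.lt_or_ge n (m - 2 * p) with h | h
    · exact absurd (hzero p hp h) h4.ne'
    · exact mul_pos (mul_pos (pow_pos hγ _) (hc _ h)) h4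

end TracePositivity

section WeightSupport

variable {m n : ℕ} {a : ℂ} {d : PlanarDiagram}

theorem spin_ne_of_planarWeight_ne_zero {J : Finset ℤ} (hJ : ∀ p ∈ J, d.partner p ∈ J) {s : ℤ → Bool}
    (h : planarWeight a J d s ≠ 0) : ∀ p ∈ J, s p ≠ s (d.partner p) := by
  have key : ∀ p ∈ J, p < d.partner p → s p ≠ s (d.partner p) := by
    intro p hp hlt heq
    refine h (Finset.prod_eq_zero hp ?_)
    rw [pointWeight, if_pos hlt, cupWeight, if_pos heq]
  intro p hp
  rcases lt_or_gt_of_ne (d.partner_ne p) with h1 | h1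
  · have := key _ (hJ p hp) (by rwa [d.partner_partner])
    rw [d.partner_partner] at this
    exact this.symm
  · exact key p hp h1

/-- A top point with spin `-` either ends a through strand or is joined by a cup to a top point with
spin `+`. So there are at most `n` more signs `-` than signs `+` at the top. -/
theorem spinCount_of_planarWeight_ne_zero
    (hd : ∀ p : ℤ, (p < -m ∨ m ≤ p) → d.partner p = -1 - p)
    (hn : ((Finset.Ico (0 : ℤ) m).filter fun p => d.partner p < 0).card ≤ n) {σ τ : Fin m → Bool}
    (h : planarWeight a (Finset.Ico (-m : ℤ) m) d (joinSpin σ τ) ≠ 0) :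
    m ≤ 2 * LinkState.spinCount σ + n := by
  have e0 := d.partner_partner
  have hJ := mem_Ico_of_vertical hd
  have hs := spin_ne_of_planarWeight_ne_zero hJ h
  simp only [Finset.mem_Ico] at hJ hs
  set s := joinSpin σ τ with hsdef
  set T := (Finset.Ico (0 : ℤ) m).filter fun p => s p = true with hT
  have hcount : LinkState.spinCount σ = T.card := by
    unfold LinkState.spinCount
    refine Finset.card_bij (fun b _ => (b : ℤ)) ?_ ?_ ?_
    · intro b hb
      simp only [hT, Finset.mem_filter, Finset.mem_range, Finset.mem_Ico] at hb ⊢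
      refine ⟨by omega, ?_⟩
      rw [hsdef, joinSpin, if_pos (by omega)]
      exact hb.2
    · intro b _ c _ h; exact_mod_cast h
    · intro p hp
      simp only [hT, Finset.mem_filter, Finset.mem_Ico] at hp
      refine ⟨p.toNat, ?_, by omega⟩
      rw [hsdef, joinSpin, if_pos hp.1.1] at hp
      simp only [Finset.mem_filter, Finset.mem_range]
      exact ⟨by omega, hp.2⟩
  set F := (Finset.Ico (0 : ℤ) m).filter fun p => ¬ s p = true with hF
  have hTF : T.card + F.card = m := by
    rw [hT, hF, Finset.card_filter_add_card_filter_not]; simp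
  set Th := (Finset.Ico (0 : ℤ) m).filter fun p => d.partner p < 0 with hTh
  have hFle : F.card ≤ T.card + Th.card := by
    have h1 : F ⊆ Th ∪ F.filter fun p => 0 ≤ d.partner p := by
      intro p hp
      simp only [hF, hTh, Finset.mem_union, Finset.mem_filter] at hp ⊢
      by_cases h : d.partner p < 0
      · exact Or.inl ⟨hp.1, h⟩
      · exact Or.inr ⟨hp, by omega⟩
    have h2 : (F.filter fun p => 0 ≤ d.partner p).card ≤ T.card := by
      refine Finset.card_le_card_of_injOn d.partner ?_ ?_
      · intro p hp
        simp only [hF, hT, Finset.coe_filter, Finset.mem_filter, Finset.mem_Ico, Set.mem_ofPred_eq] at hp ⊢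
        have h3 := hJ p (by omega)
        have h4 := hs p (by omega)
        refine ⟨by omega, ?_⟩
        have h5 := hp.1.2
        revert h4 h5
        cases s p <;> cases s (d.partner p) <;> simp
      · intro p _ q _ h
        rw [← e0 p, h, e0]
    have := Finset.card_le_card h1
    have := Finset.card_union_le Th (F.filter fun p => 0 ≤ d.partner p)
    omega
  omega

/-- A diagram as a link state on its boundary points. -/
def boundaryState (m : ℕ) (d : PlanarDiagram)
    (hd : ∀ p : ℤ, (p < -m ∨ m ≤ p) → d.partner p = -1 - p) : LinkState (2 * m) m where
  partner b := if b < 2 * m then (d.partner (b - m) + m).toNat else b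
  partner_partner b := by
    have hJ := mem_Ico_of_vertical hd ((b : ℤ) - m)
    rw [Finset.mem_Ico, Finset.mem_Ico] at hJ
    by_cases h : b < 2 * m
    · have h1 := hJ (by omega)
      rw [if_pos h, if_pos (by omega)]
      have : (((d.partner (b - m) + m).toNat : ℤ) - m) = d.partner (b - m) := by omega
      rw [this, d.partner_partner]; omega
    · rw [if_neg h, if_neg h]
  partner_of_le b hb := by rw [if_neg (by omega)]
  noncrossing b c hb hc := by
    have hJ := mem_Ico_of_vertical hd ((b : ℤ) - m)
    have hJ' := mem_Ico_of_vertical hd ((c : ℤ) - m)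
    rw [Finset.mem_Ico, Finset.mem_Ico] at hJ hJ'
    by_cases h : b < 2 * m
    · rw [if_pos h] at hc ⊢
      have h1 := hJ (by omega)
      rw [if_pos (by omega)]
      have h2 := hJ' (by omega)
      have h3 := (d.inside_iff ((b : ℤ) - m) ((c : ℤ) - m) (by omega) (by omega)).1 (by omega)
      have h4 := d.partner_ne ((c : ℤ) - m)
      omega
    · rw [if_neg h] at hc; omega
  card_through := by
    rw [Finset.filter_eq_empty_iff.2, Finset.card_empty, zero_add]
    intro b hb h
    rw [Finset.mem_range] at hb
    rw [if_pos hb] at h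
    have hJ := mem_Ico_of_vertical hd ((b : ℤ) - m)
    rw [Finset.mem_Ico, Finset.mem_Ico] at hJ
    have := d.partner_ne ((b : ℤ) - m)
    omega

theorem boundaryState_partner (hd : ∀ p : ℤ, (p < -m ∨ m ≤ p) → d.partner p = -1 - p) {p : ℤ}
    (hp : -m ≤ p ∧ p < m) :
    ((boundaryState m d hd).partner (p + m).toNat : ℤ) = d.partner p + m := by
  have hJ := mem_Ico_of_vertical hd p
  rw [Finset.mem_Ico, Finset.mem_Ico] at hJ
  have : (((p + m).toNat : ℤ) - m) = p := by omega
  simp only [boundaryState, this]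
  rw [if_pos (by omega)]
  omega

theorem boundaryState_inj {e : PlanarDiagram}
    (hd : ∀ p : ℤ, (p < -m ∨ m ≤ p) → d.partner p = -1 - p)
    (he : ∀ p : ℤ, (p < -m ∨ m ≤ p) → e.partner p = -1 - p)
    (h : boundaryState m d hd = boundaryState m e he) : d = e := by
  ext p
  by_cases hp : p < -m ∨ m ≤ p
  · rw [hd p hp, he p hp]
  · have h1 := boundaryState_partner hd (p := p) (by omega)
    have h2 := boundaryState_partner he (p := p) (by omega)
    rw [h] at h1
    omega

theorem vec_boundaryState (hd : ∀ p : ℤ, (p < -m ∨ m ≤ p) → d.partner p = -1 - p)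
    (s : Fin (2 * m) → Bool) :
    LinkState.vec a (boundaryState m d hd) 0 s =
      planarWeight a (Finset.Ico (-m : ℤ) m) d fun p => extendSpin s (p + m).toNat := by
  rw [LinkState.vec, LinkState.weight, planarWeight, matchWeight, matchWeight]
  symm
  refine Finset.prod_bij (fun p _ => (p + m).toNat) ?_ ?_ ?_ ?_
  · intro p hp; rw [Finset.mem_Ico] at hp; rw [Finset.mem_range]; omega
  · intro p hp q hq h; rw [Finset.mem_Ico] at hp hq; omega
  · intro b hb
    rw [Finset.mem_range] at hb
    exact ⟨(b : ℤ) - m, by rw [Finset.mem_Ico]; omega, by omega⟩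
  · intro p hp
    rw [Finset.mem_Ico] at hp
    have h1 := boundaryState_partner hd hp
    have h2 := d.partner_ne p
    unfold pointWeight
    by_cases h3 : p < d.partner p
    · have h4 : (boundaryState m d hd).partner (p + m).toNat = (d.partner p + m).toNat := by omega
      rw [if_pos h3, if_pos (by omega), h4]
    · rw [if_neg h3, if_neg h2, if_neg (by omega), if_neg (by omega)]

/-- Read along the boundary, distinct diagrams of the window are distinct link states on `2 * m`
points without through strands, and the vectors of link states are linearly independent. -/
theorem eq_zero_of_sum_planarWeight (ha : a ≠ 0) {X : Type*} (S : Finset X) (f : X → PlanarDiagram)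
    (hf : Set.InjOn f S) (hd : ∀ x ∈ S, ∀ p : ℤ, (p < -m ∨ m ≤ p) → (f x).partner p = -1 - p)
    (c : X → ℂ)
    (h : ∀ σ τ : Fin m → Bool,
      ∑ x ∈ S, c x * planarWeight a (Finset.Ico (-m : ℤ) m) (f x) (joinSpin σ τ) = 0) :
    ∀ x ∈ S, c x = 0 := by
  classical
  set u : S → LinkState (2 * m) m := fun x => boundaryState m (f x) (hd x x.2) with hu
  have hli := (LinkState.linearIndependent_spinVec (n := 2 * m) ha).comp
    (fun x : S => (⟨⟨m, by omega⟩, (u x, ⟨0, by omega⟩)⟩ : LinkState.SpinIndex (2 * m)))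
    (fun x y hxy => by
      have h1 : u x = u y := by simpa using hxy
      exact Subtype.ext (hf x.2 y.2 (boundaryState_inj _ _ h1)))
  rw [Fintype.linearIndependent_iff] at hli
  have h0 := hli (fun x => c x) (by
    funext s
    rw [Finset.sum_apply, Pi.zero_apply]
    -- This choice makes `joinSpin` read `s` along the boundary; the bottom points are numbered
    -- backwards and carry reversed spins.
    have h2 := h (fun i => extendSpin s (i.1 + m)) (fun i => !extendSpin s (m - 1 - i.1))
    rw [← Finset.sum_coe_sort] at h2
    rw [← h2]
    refine Finset.sum_congr rfl fun x _ => ?_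
    rw [Pi.smul_apply, smul_eq_mul]
    congr 1
    refine (vec_boundaryState (hd x x.2) s).trans ?_
    refine dependsOnSpins_planarWeight a (mem_Ico_of_vertical (hd x x.2)) _ _ fun p hp => ?_
    rw [Finset.mem_Ico] at hp
    by_cases hp0 : 0 ≤ p
    · obtain ⟨k, rfl⟩ := Int.eq_ofNat_of_zero_le hp0
      have := joinSpin_top (fun i : Fin m => extendSpin s (i.1 + m))
        (fun i => !extendSpin s (m - 1 - i.1)) ⟨k, by omega⟩
      simp only at this
      rw [this]
      congr 1
    · obtain ⟨k, rfl⟩ : ∃ k : ℕ, p = -1 - k := ⟨(-1 - p).toNat, by omega⟩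
      have := joinSpin_bot (fun i : Fin m => extendSpin s (i.1 + m))
        (fun i => !extendSpin s (m - 1 - i.1)) ⟨k, by omega⟩
      simp only [Bool.not_not] at this
      rw [this]
      congr 1
      omega)
  exact fun x hx => h0 ⟨x, hx⟩

end WeightSupport

end

/-! ### Positive definiteness -/

noncomputable section

open PlanarDiagram ComplexConjugate

theorem coord_support_subset {δ : ℂ} (h0 : δ ≠ 0) {w : PlanarDiagram} {x : DiagramSpace}
    (hx : x ∈ regularRep δ w) : ∀ d ∈ (DiagramSpace.coord x).support, d ∈ diagramsOf w := by
  have h1 : x ∈ Submodule.span ℂ (basisDiagram '' diagramsOf w) := by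
    rw [← regularRep_toSubmodule h0]; exact hx
  have h2 : DiagramSpace.coord x ∈ Finsupp.supported ℂ ℂ (diagramsOf w) := by
    rw [Finsupp.supported_eq_span_single]; exact h1
  exact fun d hd => (Finsupp.mem_supported _ _).1 h2 hd

theorem exists_window_of_finset {w : PlanarDiagram} (hw : w.throughStrands.Finite)
    (S : Finset PlanarDiagram) (hS : ∀ d ∈ S, d ∈ diagramsOf w) (N : ℕ) :
    ∃ b t : ℕ, N ≤ b ∧ N ≤ t ∧ w.IsWindow b t ∧ ∀ d ∈ S, Reach (sideIndices b t) w d := by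
  have h : ∀ d, ∃ N : ℕ, d ∈ S → ∀ b t : ℕ, N ≤ b → N ≤ t → Reach (sideIndices b t) w d := by
    intro d
    by_cases hd : d ∈ S
    · obtain ⟨N, hN⟩ := exists_reach_window (hS d hd)
      exact ⟨N, fun _ => hN⟩
    · exact ⟨0, fun h => absurd h hd⟩
  choose M hM using h
  obtain ⟨b, t, hb, ht, h⟩ := exists_isWindow hw (max N (S.sup M))
  refine ⟨b, t, by omega, by omega, h, fun d hd => ?_⟩
  have : M d ≤ S.sup M := Finset.le_sup hd
  exact hM d hd b t (by omega) (by omega)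

section Conj

theorem conj_cupWeight (a : ℂ) (x y : Bool) : conj (cupWeight a x y) = cupWeight (conj a) x y := by
  unfold cupWeight
  split_ifs <;> simp

theorem conj_planarWeight (a : ℂ) (J : Finset ℤ) (d : PlanarDiagram) (s : ℤ → Bool) :
    conj (planarWeight a J d s) = planarWeight (conj a) J d s := by
  unfold planarWeight matchWeight
  rw [map_prod]
  refine Finset.prod_congr rfl fun p _ => ?_
  unfold pointWeight
  split_ifs
  · exact conj_cupWeight _ _ _
  · simp
  · simp

theorem conj_twist (a z : ℂ) (J : Finset ℤ) (s : ℤ → Bool) :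
    conj (twist a z J s) = twist (conj a) (conj z) J s := by
  unfold twist
  rw [map_prod]
  refine Finset.prod_congr rfl fun p _ => ?_
  unfold pointTwist
  split_ifs <;> simp

theorem conj_spinPairing (a z : ℂ) (J : Finset ℤ) (d e : PlanarDiagram) :
    conj (spinPairing a z J d e) = spinPairing (conj a) (conj z) J d e := by
  unfold spinPairing spinSum
  rw [map_sum]
  refine Finset.sum_congr rfl fun A _ => ?_
  rw [map_mul, map_mul, conj_planarWeight, conj_planarWeight, conj_twist]

theorem conj_spinGauge {m : ℕ} (a : ℂ) (τ : Fin m → Bool) :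
    conj (spinGauge a τ) = spinGauge (conj a) τ := by
  unfold spinGauge
  rw [map_prod]
  refine Finset.prod_congr rfl fun p _ => ?_
  split_ifs <;> simp

end Conj

theorem extremalTrace_linear (δ : ℂ) (γ : ℝ) (m : ℕ) :
    ∃ L : TL δ (m : ℕ∞) →ₗ[ℂ] ℂ, ∀ x, extremalTrace δ γ m x = L x := by
  refine ⟨∑ p ∈ Finset.range (m / 2 + 1), (coeff γ m p : ℂ) •
    (LinearMap.trace ℂ (LinkState m p →₀ ℂ) ∘ₗ (standardRep δ m p).toLinearMap), fun x => ?_⟩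
  rw [LinearMap.sum_apply]
  rfl

section PositiveDefinite

variable {a δ : ℝ} {γ : ℝ} {w : PlanarDiagram} {n : ℕ}

/-- Symmetry is that of the spin pairing. Conjugation keeps the real `a` and replaces `z` by its
conjugate, which solves the same equation z + z⁻¹ = γ^{-1/2}. Since the limit is the same for every
solution, it is real. -/
theorem limitPairing_symm (ha : 0 < a) (hδ : a ^ 2 + a⁻¹ ^ 2 = δ) (hγ : 0 < γ)
    (hw : w.throughStrands.Finite) {x y : PlanarDiagram} (hx : x ∈ diagramsOf w)
    (hy : y ∈ diagramsOf w) :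
    limitPairing δ γ w y x = limitPairing δ γ w x y ∧
      conj (limitPairing δ γ w x y) = limitPairing δ γ w x y := by
  have hg : Real.sqrt γ ≠ 0 := (Real.sqrt_pos.2 hγ).ne'
  have hgg : γ = Real.sqrt γ ^ 2 := (Real.sq_sqrt hγ.le).symm
  have ha' : (a : ℂ) ≠ 0 := by exact_mod_cast ha.ne'
  have hδ' : (a : ℂ) ^ 2 + (a : ℂ)⁻¹ ^ 2 = δ := by rw [← hδ]; push_cast; rfl
  have h0 : (δ : ℂ) ≠ 0 := by
    have : 0 < δ := by rw [← hδ]; positivity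
    exact_mod_cast this.ne'
  obtain ⟨z, hz0, hz⟩ := exists_inv_add_eq (c := ((Real.sqrt γ : ℝ) : ℂ)⁻¹)
  obtain ⟨b, t, hwin, h1, h2⟩ := exists_common_window hw hx hy
  have e1 := h1.agreesOff hwin.preserves
  have e2 := h2.agreesOff hwin.preserves
  have key := fun {x y} (z : ℂ) hz0 hz => limitPairing_eq (x := x) (y := y) (z := z) hw ha' hδ' h0 hg
    hgg hz0 hz hwin.preserves
  constructor
  · rw [key z hz0 hz e2 e1, key z hz0 hz e1 e2, spinPairing_comm]
  · have hz' : conj z + (conj z)⁻¹ = ((Real.sqrt γ : ℝ) : ℂ)⁻¹ := by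
      rw [← map_inv₀, ← map_add, hz, map_inv₀, Complex.conj_ofReal]
    rw [key z hz0 hz e1 e2, map_div₀, conj_spinPairing, conj_spinPairing, Complex.conj_ofReal,
      ← key z hz0 hz e1 e2, key (conj z) (by simpa using hz0) hz' e1 e2]

theorem traceForm_conj_symm (ha : 0 < a) (hδ : a ^ 2 + a⁻¹ ^ 2 = δ) (hγ : 0 < γ)
    (hw : w.throughStrands.Finite) {x y : DiagramSpace} (hx : x ∈ regularRep (δ : ℂ) w)
    (hy : y ∈ regularRep (δ : ℂ) w) :
    traceForm δ γ w y x = conj (traceForm δ γ w x y) := by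
  have h0 : (δ : ℂ) ≠ 0 := by
    have : 0 < δ := by rw [← hδ]; positivity
    exact_mod_cast this.ne'
  unfold traceForm Finsupp.sum
  rw [map_sum, Finset.sum_comm]
  refine Finset.sum_congr rfl fun d hd => ?_
  rw [map_sum]
  refine Finset.sum_congr rfl fun e he => ?_
  obtain ⟨h1, h2⟩ := limitPairing_symm ha hδ hγ hw (coord_support_subset h0 hx d hd)
    (coord_support_subset h0 hy e he)
  beta_reduce
  rw [map_mul, map_mul, h2, h1, Complex.conj_conj]
  ring

theorem card_through_glue_le {b t : ℕ} {d : PlanarDiagram} (hd : d.Preserves b t)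
    (hr : (cupStack (max b t)).Preserves b t) (hn : d.numThrough ≤ n) :
    ((Finset.Ico (0 : ℤ) (max b t : ℕ)).filter
      fun p => (glue b t d (cupStack (max b t)) hd hr).partner p < 0).card ≤ n := by
  have h : (((Finset.Ico (0 : ℤ) (max b t : ℕ)).filter
      fun p => (glue b t d (cupStack (max b t)) hd hr).partner p < 0 : Finset ℤ) : Set ℤ) ⊆
      d.throughStrands := by
    intro p hp
    rw [Finset.mem_coe, Finset.mem_filter, Finset.mem_Ico] at hp
    by_cases h : p < t
    · rw [glue_inside _ _ (by omega)] at hp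
      exact ⟨hp.1.1, hp.2⟩
    · have h1 := hr.outside (p := p) (by omega)
      rw [glue_outside _ _ (by omega)] at hp
      rw [cupStack_inside (by omega)] at hp h1
      exfalso
      split_ifs at hp h1 <;> omega
  have h2 := (Set.encard_le_encard h).trans hn
  rw [Set.encard_coe_eq_coe_finsetCard] at h2
  exact_mod_cast h2

/-- All diagrams of `x` live in one window and are completed outside of it by one common diagram.
The resulting element `A` of a finite algebra has t(A A*) equal to a positive multiple of the form,
by `extremalTrace_div_pow`, and the matrix of `A` is nonzero because the completed diagrams are
distinct. -/
theorem traceForm_self_pos (ha : 0 < a) (hδ : a ^ 2 + a⁻¹ ^ 2 = δ) (hγ : 0 < γ)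
    (hw : w.numThrough = n) (hc : ∀ k ≤ n, 0 < coeffZero γ k) {x : DiagramSpace}
    (hx : x ∈ regularRep (δ : ℂ) w) (hx0 : x ≠ 0) : 0 < (traceForm δ γ w x x).re := by
  have hfin := finite_throughStrands hw
  have hg : Real.sqrt γ ≠ 0 := (Real.sqrt_pos.2 hγ).ne'
  have hgg : γ = Real.sqrt γ ^ 2 := (Real.sq_sqrt hγ.le).symm
  have ha' : (a : ℂ) ≠ 0 := by exact_mod_cast ha.ne'
  have hδ' : (a : ℂ) ^ 2 + (a : ℂ)⁻¹ ^ 2 = δ := by rw [← hδ]; push_cast; rfl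
  have hδ0 : 0 < δ := by rw [← hδ]; positivity
  have h0 : (δ : ℂ) ≠ 0 := by exact_mod_cast hδ0.ne'
  obtain ⟨z, hz0, hz⟩ := exists_inv_add_eq (c := ((Real.sqrt γ : ℝ) : ℂ)⁻¹)
  set S := (DiagramSpace.coord x).support with hS
  set c : PlanarDiagram → ℂ := fun d => DiagramSpace.coord x d with hcdef
  have hSd := coord_support_subset h0 hx
  obtain ⟨b, t, -, -, hwin, hreach⟩ := exists_window_of_finset hfin S hSd 0
  have hp : ∀ d ∈ S, d.Preserves b t := fun d hd => ((hreach d hd).agreesOff hwin.preserves).preserves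
  set m := max b t with hm
  have hpar := hwin.parity
  -- The outside part may be chosen freely. Filling it with cups adds no through strands, so that
  -- only the coefficients with `k ≤ n` enter; filling it by vertical strands could spoil the bound.
  have hr : (cupStack m).Preserves b t := cupStack_preserves (by omega) (by omega) (by omega) (by omega)
  have hout : ∀ p : ℤ, (p < -m ∨ m ≤ p) → (cupStack m).partner p = -1 - p := fun p =>
    cupStack_outside
  obtain ⟨f, hf⟩ : ∃ f : PlanarDiagram → PlanarDiagram,
      ∀ (d : PlanarDiagram) (h : d.Preserves b t),
      f d = glue b t d (cupStack m) h hr := by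
    classical
    exact ⟨fun d => if h : d.Preserves b t then glue b t d (cupStack m) h hr else one,
      fun d h => dif_pos h⟩
  have hfout : ∀ d ∈ S, ∀ p : ℤ, (p < -m ∨ m ≤ p) → (f d).partner p = -1 - p := by
    intro d hd p hp'
    rw [hf d (hp d hd), glue_outside _ _ (by omega), hout p hp']
  have hfinj : Set.InjOn f S := by
    intro d hd e he hde
    rw [hf d (hp d hd), hf e (hp e he)] at hde
    ext p
    by_cases h : -b ≤ p ∧ p < t
    · have := congrArg (fun d => d.partner p) hde
      simp only [glue_inside _ _ h] at this
      exact this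
    · rw [((hreach d hd).agreesOff hwin.preserves).outside p (by omega),
        ((hreach e he).agreesOff hwin.preserves).outside p (by omega)]
  set A : TL (δ : ℂ) (m : ℕ∞) := ∑ d ∈ S, c d • ofDiagram δ m (f d) with hA
  set A' : TL (δ : ℂ) (m : ℕ∞) := ∑ d ∈ S, conj (c d) • (TL.dagger (ofDiagram δ m (f d))).unop with hA'
  have hAm : ∀ σ τ, spinMatrix ha' hδ' m A σ τ = spinGauge (a : ℂ) τ * ∑ d ∈ S, c d *
      planarWeight a (Finset.Ico (-m : ℤ) m) (f d) (joinSpin σ τ) := by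
    intro σ τ
    rw [hA, spinMatrix, map_sum, map_sum, Matrix.sum_apply, Finset.mul_sum]
    refine Finset.sum_congr rfl fun d hd => ?_
    have := spinMatrix_ofDiagram ha' hδ' h0 (hfout d hd) σ τ
    rw [map_smul, map_smul, Matrix.smul_apply, smul_eq_mul]
    rw [spinMatrix] at this
    rw [this]; ring
  have hAA : spinMatrix ha' hδ' m A' = (spinMatrix ha' hδ' m A).conjTranspose := by
    ext σ τ
    rw [Matrix.conjTranspose_apply, hAm, hA', spinMatrix, map_sum, map_sum, Matrix.sum_apply,
      Complex.star_def, map_mul, map_sum, conj_spinGauge, Complex.conj_ofReal, Finset.mul_sum]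
    refine Finset.sum_congr rfl fun d hd => ?_
    have h1 := spinMatrix_ofDiagram ha' hδ' h0 (hfout d hd) τ σ
    have h2 := spinMatrix_dagger ha' hδ' (ofDiagram δ m (f d))
    rw [map_smul, map_smul, Matrix.smul_apply, smul_eq_mul]
    rw [spinMatrix] at h2
    rw [h2, Matrix.transpose_apply, h1, map_mul, conj_planarWeight, Complex.conj_ofReal]
    ring
  obtain ⟨L, hL⟩ := extremalTrace_linear (δ : ℂ) γ m
  obtain ⟨r, hr0, hr1, hr2⟩ := extremalTrace_mul_nonneg ha' hδ' hγ hc hAA (by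
    intro σ τ hne
    rw [hAm] at hne
    obtain ⟨d, hd, hd'⟩ := Finset.exists_ne_zero_of_sum_ne_zero (right_ne_zero_of_mul hne)
    refine spinCount_of_planarWeight_ne_zero (hfout d hd) ?_ (right_ne_zero_of_mul hd')
    rw [hf d (hp d hd)]
    refine card_through_glue_le (hp d hd) hr ?_
    rw [← hw]
    exact Reach.numThrough_le (hreach d hd) (neg_one_notMem_sideIndices b t))
  have hAne : spinMatrix ha' hδ' m A ≠ 0 := by
    intro hzero
    have h1 := eq_zero_of_sum_planarWeight ha' S f hfinj hfout c (fun σ τ => by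
      have h2 := hAm σ τ
      rw [hzero, Matrix.zero_apply] at h2
      refine (mul_eq_zero.1 h2.symm).resolve_left ?_
      refine Finset.prod_ne_zero_iff.2 fun i _ => ?_
      split_ifs
      exacts [ha', inv_ne_zero ha'])
    apply hx0
    have : DiagramSpace.coord x = 0 := by
      ext d
      by_cases hd : d ∈ S
      · exact h1 d hd
      · exact Finsupp.notMem_support_iff.1 hd
    exact (LinearEquiv.map_eq_zero_iff _).1 this
  set K : ℝ := (δ ^ 2 * γ) ^ cupNumber (glue b t w (cupStack m) hwin.preserves hr) with hK
  have hKpos : 0 < K := by positivity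
  have htf : traceForm δ γ w x x = (r / K : ℝ) := by
    rw [Complex.ofReal_div, ← hr1, hL, hA, hA', Finset.sum_mul_sum, map_sum, Finset.sum_div]
    unfold traceForm Finsupp.sum
    refine Finset.sum_congr rfl fun d hd => ?_
    rw [map_sum, Finset.sum_div]
    refine Finset.sum_congr rfl fun e he => ?_
    have e1 := (hreach d hd).agreesOff hwin.preserves
    have e2 := (hreach e he).agreesOff hwin.preserves
    have h1 := extremalTrace_div_pow ha' hδ' h0 hg hgg hz0 hz hwin.preserves e1.preserves e2.preserves
      (show b ≤ m by omega) (show t ≤ m by omega) hr hout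
    beta_reduce
    rw [limitPairing_eq hfin ha' hδ' h0 hg hgg hz0 hz hwin.preserves e1 e2, ← h1, hL,
      smul_mul_smul_comm, map_smul, ← hf d (hp d hd), ← hf e (hp e he), smul_eq_mul, hK]
    push_cast
    rw [mul_div_assoc]
  rw [htf, Complex.ofReal_re]
  exact div_pos (hr2 hAne) hKpos

theorem isPositiveDefinite (ha : 0 < a) (hδ : a ^ 2 + a⁻¹ ^ 2 = δ) (hγ : 0 < γ)
    (hw : w.numThrough = n) (hc : ∀ k ≤ n, 0 < coeffZero γ k) : IsPositiveDefinite (δ : ℂ) γ w :=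
  ⟨fun _ hx _ hy => traceForm_conj_symm ha hδ hγ (finite_throughStrands hw) hx hy,
    fun _ hx hx0 => traceForm_self_pos ha hδ hγ hw hc hx hx0⟩

end PositiveDefinite

theorem exists_real_parameter {δ : ℝ} (h : 2 ≤ δ) : ∃ a : ℝ, 0 < a ∧ a ^ 2 + a⁻¹ ^ 2 = δ := by
  set u := (δ + Real.sqrt (δ ^ 2 - 4)) / 2 with hu
  have h1 : Real.sqrt (δ ^ 2 - 4) ^ 2 = δ ^ 2 - 4 := Real.sq_sqrt (by nlinarith)
  have h2 := Real.sqrt_nonneg (δ ^ 2 - 4)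
  have hu0 : 0 < u := by positivity
  refine ⟨Real.sqrt u, Real.sqrt_pos.2 hu0, ?_⟩
  rw [inv_pow, Real.sq_sqrt hu0.le]
  field_simp
  rw [hu]
  nlinarith

end

/-! ### Reachability inside a window, and comparison of windows -/

noncomputable section

open PlanarDiagram

section Windows

variable {w d e : PlanarDiagram} {b t r r' : ℕ}

theorem PlanarDiagram.IsStandard.throughStrands_eq (hwin : w.IsWindow b t) (hd : AgreesOff w b t d)
    (hs : IsStandard b t r r' d) : d.throughStrands = Set.Ico (2 * r : ℤ) t := by
  have l1 := hs.le
  ext p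
  simp only [throughStrands, Set.mem_ofPred_eq, Set.mem_Ico]
  constructor
  · rintro ⟨h1, h2⟩
    by_cases h3 : p < 2 * r
    · have := (hs.top.mem_iff p).1 (by omega)
      omega
    · by_cases h4 : p < t
      · omega
      · rw [hd.outside p (by omega)] at h2
        have := hwin.side p (by omega)
        omega
  · rintro ⟨h1, h2⟩
    have := hs.mid (p - 2 * r).toNat (by omega)
    have e1 : (2 * r : ℤ) + ((p - 2 * r).toNat : ℤ) = p := by omega
    rw [e1] at this
    omega

theorem PlanarDiagram.IsStandard.numThrough_eq (hwin : w.IsWindow b t) (hd : AgreesOff w b t d)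
    (hs : IsStandard b t r r' d) : d.numThrough = ((t - 2 * r : ℕ) : ℕ∞) := by
  have l1 := hs.le
  rw [numThrough, hs.throughStrands_eq hwin hd, ← Finset.coe_Ico, Set.encard_coe_eq_coe_finsetCard,
    Int.card_Ico]
  congr 1
  omega

theorem AgreesOff.exists_isStandard (hwin : w.IsWindow b t) (hd : AgreesOff w b t d) :
    ∃ (r r' : ℕ) (e : PlanarDiagram), Reach (sideIndices b t) d e ∧ Reach (sideIndices b t) e d ∧
      IsStandard b t r r' e ∧ AgreesOff w b t e ∧ d.numThrough = ((t - 2 * r : ℕ) : ℕ∞) ∧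
      e.numThrough = d.numThrough := by
  obtain ⟨r, r', e, h1, h2, h3⟩ := PlanarDiagram.exists_isStandard hd.preserves
  have h4 : AgreesOff w b t e := ⟨(h1.preserves hd.preserves).1, fun p hp => by
    rw [(h1.preserves hd.preserves).2 p hp, hd.outside p hp]⟩
  have h5 : e.numThrough = d.numThrough :=
    le_antisymm (h1.numThrough_le (neg_one_notMem_sideIndices b t))
      (h2.numThrough_le (neg_one_notMem_sideIndices b t))
  exact ⟨r, r', e, h1, h2, h3, h4, by rw [← h5, h3.numThrough_eq hwin h4], h5⟩

theorem PlanarDiagram.IsStandard.exists_add (hs : IsStandard b t r r' d) (j : ℕ) (hj : 2 * (r + j) ≤ t) :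
    ∃ e, Reach (sideIndices b t) d e ∧ IsStandard b t (r + j) (r' + j) e := by
  induction j with
  | zero => exact ⟨d, Reach.refl d, hs⟩
  | succ j ih =>
    obtain ⟨e, h1, h2⟩ := ih (by omega)
    refine ⟨e.hook (2 * (r + j : ℕ)), h1.trans (Reach.hook e ?_), h2.hook (by omega)⟩
    simp only [sideIndices, Set.mem_ofPred_eq]
    omega

/-- Both diagrams have standard forms from which they can be recovered. Generators turn pairs of
through strands of the first standard form into cups until the numbers agree, and a standard form is
determined by these numbers. -/
theorem reach_of_numThrough_le (hwin : w.IsWindow b t) (hd : AgreesOff w b t d)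
    (he : AgreesOff w b t e) (hle : e.numThrough ≤ d.numThrough) : Reach (sideIndices b t) d e := by
  obtain ⟨r1, r1', z1, h1, -, s1, a1, n1, -⟩ := hd.exists_isStandard hwin
  obtain ⟨r2, r2', z2, -, h2, s2, a2, n2, -⟩ := he.exists_isStandard hwin
  have l1 := s1.le; have l2 := s2.le; have l3 := s1.len; have l4 := s2.len
  rw [n1, n2] at hle
  have hle' : t - 2 * r2 ≤ t - 2 * r1 := by exact_mod_cast hle
  obtain ⟨z, h3, h4⟩ := s1.exists_add (r2 - r1) (by omega)
  have e1 : r1 + (r2 - r1) = r2 := by omega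
  have e2 : r1' + (r2 - r1) = r2' := by omega
  rw [e1, e2] at h4
  have h5 : z = z2 := h4.eq s2 fun p hp => by
    rw [(h3.preserves a1.preserves).2 p hp, a1.outside p hp, a2.outside p hp]
  subst h5
  exact (h1.trans h3).trans h2

end Windows

/-- The points of `[l, c)` are matched among themselves. -/
def ClosedOn (d : PlanarDiagram) (l c : ℤ) : Prop :=
  ∀ p, l ≤ p → p < c → l ≤ d.partner p ∧ d.partner p < c

theorem ClosedOn.hook {d : PlanarDiagram} {l c i : ℤ} (h : ClosedOn d l c)
    (hi : (l ≤ i ∧ i + 1 < c) ∨ i + 1 < l ∨ c ≤ i) : ClosedOn (d.hook i) l c := by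
  intro p h1 h2
  have e0 := d.partner_partner
  have a1 := h i
  have a2 := h (i + 1)
  have a3 := h p
  have a4 := h (d.partner i)
  have a5 := h (d.partner (i + 1))
  rw [e0] at a4 a5
  simp only [hook_partner, hookFun]
  split_ifs <;> omega

theorem PlanarDiagram.Reach.closedOn {A : Set ℤ} {d e : PlanarDiagram} {l c : ℤ} (h : Reach A d e)
    (hd : ClosedOn d l c) (hA : ∀ i ∈ A, (l ≤ i ∧ i + 1 < c) ∨ i + 1 < l ∨ c ≤ i) :
    ClosedOn e l c := by
  induction h with
  | refl => exact hd
  | tail _ h ih =>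
    obtain ⟨i, hi, rfl⟩ := h
    exact ih.hook (hA i hi)

section Tail

variable {w : PlanarDiagram} {b t b' t' : ℕ}

/-- The positions between the boundaries of two windows. -/
def tailIndices (b t b' t' : ℕ) : Set ℤ := Set.Ico (t : ℤ) (t' - 1) ∪ Set.Ico (-b' : ℤ) (-b - 1)

/-- No strand crosses either window boundary, and there are no through strands outside the small
window, so each of the two gaps is matched within itself. Its matching is turned into adjacent cups,
and recovered from them, by generators in the gap. -/
theorem exists_standard_tail (hwin : w.IsWindow b t) (hwin' : w.IsWindow b' t') (hb : b ≤ b')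
    (ht : t ≤ t') : ∃ (e : PlanarDiagram) (r r' : ℕ), Reach (tailIndices b t b' t') e w ∧
      e.Preserves b t ∧ e.Preserves b' t' ∧ (t : ℤ) + 2 * r = t' ∧ (-b' : ℤ) + 2 * r' = -b ∧
      e.CupsFrom t r ∧ e.CupsFrom (-b') r' := by
  have c1 : ClosedOn w t t' := by
    intro p h1 h2
    have := hwin'.preserves p (by omega) (by omega)
    have := hwin.preserves.outside (p := p) (by omega)
    have := hwin.side p (by omega)
    omega
  have c2 : ClosedOn w (-b') (-b) := by
    intro p h1 h2
    have := hwin'.preserves p (by omega) (by omega)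
    have := hwin.preserves.outside (p := p) (by omega)
    have := hwin.side p (by omega)
    omega
  obtain ⟨r, e1, f1, g1, l1, cups1, n1⟩ := exists_reach_cupsFrom (t' - t) t t' w (by omega)
  obtain ⟨r', e2, f2, g2, l2, cups2, n2⟩ := exists_reach_cupsFrom (b' - b) (-b') (-b) e1 (by omega)
  have A1 : ∀ i ∈ Set.Ico (t : ℤ) (t' - 1), t ≤ i ∧ i + 1 < t' := by
    intro i hi; rw [Set.mem_Ico] at hi; omega
  have A2 : ∀ i ∈ Set.Ico (-b' : ℤ) (-b - 1), -b' ≤ i ∧ i + 1 < -b := by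
    intro i hi; rw [Set.mem_Ico] at hi; omega
  have d1 : ClosedOn e1 t t' := Reach.closedOn f1 c1 fun i hi => by have := A1 i hi; omega
  have d2 : ClosedOn e1 (-b') (-b) := Reach.closedOn f1 c2 fun i hi => by have := A1 i hi; omega
  have d2' : ClosedOn e2 (-b') (-b) := Reach.closedOn f2 d2 fun i hi => by have := A2 i hi; omega
  have d3 : ClosedOn e1 (-b) t := Reach.closedOn f1 hwin.preserves fun i hi => by
    have := A1 i hi; omega
  have d3' : ClosedOn e2 (-b) t := Reach.closedOn f2 d3 fun i hi => by have := A2 i hi; omega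
  have d4 : ClosedOn e1 (-b') t' := Reach.closedOn f1 hwin'.preserves fun i hi => by
    have := A1 i hi; omega
  have d4' : ClosedOn e2 (-b') t' := Reach.closedOn f2 d4 fun i hi => by have := A2 i hi; omega
  have q1 : (t : ℤ) + 2 * r = t' := by
    by_contra hne
    exact n1 (t + 2 * r) le_rfl (by omega) (d1 _ (by omega) (by omega))
  have q2 : (-b' : ℤ) + 2 * r' = -b := by
    by_contra hne
    exact n2 (-b' + 2 * r') le_rfl (by omega) (d2' _ (by omega) (by omega))
  refine ⟨e2, r, r', ?_, d3', d4', q1, q2, ?_, cups2⟩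
  · exact (g2.mono Set.subset_union_right).trans (g1.mono Set.subset_union_left)
  · intro j hj
    refine f2.partner (cups1 j hj) fun i hi => ?_
    have := A2 i hi
    omega

variable {a z δ : ℂ}

/-- Attaching the cups of `e` to the second diagram of a pairing changes it by a factor. -/
theorem exists_spinPairing_cups (ha : a ≠ 0) (hz : z ≠ 0) (hδ : a ^ 2 + a⁻¹ ^ 2 = δ) (h0 : δ ≠ 0)
    {b t : ℕ} (e : PlanarDiagram) (L : List ℤ)
    (hL : ∀ i ∈ L, e.partner i = i + 1 ∧ i ≠ -1 ∧ -b ≤ i ∧ i + 1 < t)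
    (y : PlanarDiagram) (hy : y.Preserves b t) :
    ∃ (c : ℂ) (y₁ : PlanarDiagram), y₁.Preserves b t ∧ Reach {i | i ∈ L} y y₁ ∧
      (∀ i ∈ L, y₁.partner i = i + 1) ∧
      ∀ x : PlanarDiagram, x.Preserves b t → (∀ i ∈ L, x.partner i = i + 1) →
        spinPairing a z (Finset.Ico (-b : ℤ) t) x y =
          c * spinPairing a z (Finset.Ico (-b : ℤ) t) x y₁ := by
  induction L with
  | nil => exact ⟨1, y, hy, Reach.refl y, by simp, fun x _ _ => (one_mul _).symm⟩
  | cons i L ih =>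
    obtain ⟨c, y₁, h1, h2, h3, h4⟩ := ih fun j hj => hL j (List.mem_cons_of_mem _ hj)
    obtain ⟨k1, k2, k3, k4⟩ := hL i List.mem_cons_self
    refine ⟨c * ((if y₁.partner i = i + 1 then δ else 1) / δ), y₁.hook i, h1.hook ⟨k3, k4⟩,
      (h2.mono fun j hj => List.mem_cons_of_mem _ hj).trans (Reach.hook y₁ List.mem_cons_self), ?_, ?_⟩
    · intro j hj
      by_cases hij : j = i
      · subst hij; exact hook_partner_self _ _
      · have hj' : j ∈ L := by
          rcases List.mem_cons.1 hj with h | h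
          · exact absurd h hij
          · exact h
        have k5 := (hL j hj).1
        have k6 : j + 1 ≠ i := by
          intro h
          have := e.partner_partner j
          rw [k5, h, k1] at this; omega
        have k7 : j ≠ i + 1 := by
          intro h
          have := e.partner_partner i
          rw [k1, ← h, k5] at this; omega
        exact hook_partner_of_ne _ _ (h3 j hj') hij k7 k6 (by omega)
    · intro x hx hxL
      have hxi := hxL i List.mem_cons_self
      have hh := spinPairing_hook ha hz hδ hx.mem h1.mem (j := i) (by rw [Finset.mem_Ico]; omega)
        (by rw [Finset.mem_Ico]; omega) k2
      rw [if_pos hxi, x.hook_of_eq i hxi] at hh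
      rw [h4 x hx fun j hj => hxL j (List.mem_cons_of_mem _ hj), mul_assoc, div_mul_eq_mul_div, ← hh,
        mul_div_cancel_left₀ _ h0]

/-- The pairing with a diagram in a large window, as a functional on a small window, is the pairing
with a diagram in the small window. -/
theorem exists_spinPairing_eq (ha : a ≠ 0) (hz : z ≠ 0) (hδ : a ^ 2 + a⁻¹ ^ 2 = δ) (h0 : δ ≠ 0)
    (hwin : w.IsWindow b t) (hwin' : w.IsWindow b' t') (hb : b ≤ b') (ht : t ≤ t')
    (y : PlanarDiagram) (hy : y.Preserves b' t') :
    ∃ (c : ℂ) (y' : PlanarDiagram), AgreesOff w b t y' ∧ y'.numThrough ≤ y.numThrough ∧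
      ∀ x, AgreesOff w b t x → spinPairing a z (Finset.Ico (-b' : ℤ) t') x y =
        c * spinPairing a z (Finset.Ico (-b : ℤ) t) x y' := by
  obtain ⟨e, r, r', hre, ep, ep', q1, q2, cups1, cups2⟩ := exists_standard_tail hwin hwin' hb ht
  -- Induction along the path from `e` to `w`: the statement is proved for every tail `f` on the
  -- way, with `x'` being `x` inside the window and `f` outside.
  suffices H : ∀ f : PlanarDiagram, Reach (tailIndices b t b' t') e f →
      f.Preserves b t ∧ f.Preserves b' t' ∧
      ∀ y : PlanarDiagram, y.Preserves b' t' → ∃ (c : ℂ) (y' : PlanarDiagram),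
        AgreesOff w b t y' ∧ y'.numThrough ≤ y.numThrough ∧
        ∀ x x' : PlanarDiagram, AgreesOff w b t x →
          (∀ p : ℤ, -b ≤ p → p < t → x'.partner p = x.partner p) →
          (∀ p : ℤ, (p < -b ∨ t ≤ p) → x'.partner p = f.partner p) →
          spinPairing a z (Finset.Ico (-b' : ℤ) t') x' y =
            c * spinPairing a z (Finset.Ico (-b : ℤ) t) x y' by
    obtain ⟨c, y', h1, h2, h3⟩ := (H w hre).2.2 y hy
    exact ⟨c, y', h1, h2, fun x hx => h3 x x hx (fun _ _ _ => rfl) hx.outside⟩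
  have pres : ∀ {x x' f : PlanarDiagram}, AgreesOff w b t x → f.Preserves b t → f.Preserves b' t' →
      (∀ p : ℤ, -b ≤ p → p < t → x'.partner p = x.partner p) →
      (∀ p : ℤ, (p < -b ∨ t ≤ p) → x'.partner p = f.partner p) → x'.Preserves b' t' := by
    intro x x' f hx hf hf' h1 h2 p hp hp'
    by_cases h : -b ≤ p ∧ p < t
    · have := hx.preserves p h.1 h.2
      rw [h1 p h.1 h.2]; omega
    · rw [h2 p (by omega)]; exact hf' p hp hp'
  intro f hf
  induction hf with
  | refl =>
    refine ⟨ep, ep', fun y hy => ?_⟩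
    -- For the tail of adjacent cups, attaching these cups to `y` changes the pairing only by a
    -- factor. The result has the same tail, so it splits at the small window, and its inside part,
    -- continued by `w`, is the required diagram.
    set L : List ℤ := (List.range r).map (fun j => (t : ℤ) + 2 * j) ++
      (List.range r').map (fun j => (-b' : ℤ) + 2 * j) with hL
    have memL : ∀ i, i ∈ L ↔ (∃ j < r, (t : ℤ) + 2 * (j : ℕ) = i) ∨
        ∃ j < r', (-b' : ℤ) + 2 * (j : ℕ) = i := by
      intro i; simp [hL]
    have hLe : ∀ i ∈ L, e.partner i = i + 1 ∧ i ≠ -1 ∧ -b' ≤ i ∧ i + 1 < t' ∧ (i < -b ∨ t ≤ i) := by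
      intro i hi
      rcases (memL i).1 hi with ⟨j, hj, rfl⟩ | ⟨j, hj, rfl⟩
      · exact ⟨cups1 j hj, by omega⟩
      · exact ⟨cups2 j hj, by omega⟩
    obtain ⟨c, y₁, h1, h2, h3, h4⟩ := exists_spinPairing_cups (b := b') (t := t') ha hz hδ h0 e L
      (fun i hi => by have := hLe i hi; tauto) y hy
    have y1cups1 : y₁.CupsFrom t r := fun j hj => h3 _ ((memL _).2 (Or.inl ⟨j, hj, rfl⟩))
    have y1cups2 : y₁.CupsFrom (-b') r' := fun j hj => h3 _ ((memL _).2 (Or.inr ⟨j, hj, rfl⟩))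
    have tail : ∀ p : ℤ, (-b' ≤ p ∧ p < t') → ¬ (-b ≤ p ∧ p < t) → y₁.partner p = e.partner p := by
      intro p h5 h6
      by_cases h7 : t ≤ p
      · rw [y1cups1.mem h7 (by omega), cups1.mem h7 (by omega)]
      · rw [y1cups2.mem h5.1 (by omega), cups2.mem h5.1 (by omega)]
    have y1p : y₁.Preserves b t := by
      intro p h5 h6
      by_contra h7
      have h8 := h1 p (by omega) (by omega)
      have h9 := tail _ h8 h7
      rw [y₁.partner_partner] at h9
      have := ep.outside (p := y₁.partner p) (by omega)
      omega
    have hagree : AgreesOff w b t (glue b t y₁ w y1p hwin.preserves) :=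
      ⟨fun p h5 h6 => by rw [glue_inside _ _ ⟨h5, h6⟩]; exact y1p p h5 h6,
        fun p hp => glue_outside _ _ hp⟩
    refine ⟨c * spinPairing a z (Finset.Ico (-b' : ℤ) t' \ Finset.Ico (-b : ℤ) t) e e,
      glue b t y₁ w y1p hwin.preserves, hagree, ?_, ?_⟩
    · refine le_trans (Set.encard_le_encard ?_) (h2.numThrough_le fun hi => (hLe _ hi).2.1 rfl)
      rintro p ⟨h5, h6⟩
      by_cases h7 : p < t
      · rw [glue_inside _ _ (by omega)] at h6
        exact ⟨h5, h6⟩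
      · rw [glue_outside _ _ (by omega)] at h6
        have := hwin.side p (by omega)
        omega
    · intro x x' hx hin hout
      have x'cups : ∀ i ∈ L, x'.partner i = i + 1 := by
        intro i hi
        have := hLe i hi
        rw [hout i (by omega)]
        exact this.1
      have x'p := pres hx ep ep' hin hout
      rw [h4 x' x'p x'cups, mul_assoc]
      congr 1
      rw [mul_comm]
      have hu : Finset.Ico (-b' : ℤ) t' =
          Finset.Ico (-b : ℤ) t ∪ (Finset.Ico (-b' : ℤ) t' \ Finset.Ico (-b : ℤ) t) :=
        (Finset.union_sdiff_of_subset (Finset.Ico_subset_Ico (by omega) (by omega))).symm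
      conv_lhs => rw [hu]
      refine spinPairing_union Finset.disjoint_sdiff ?_ ?_ ?_ ?_ hx.preserves.mem
        (ep.mem_sdiff ep'.mem) hagree.preserves.mem (ep.mem_sdiff ep'.mem)
      · intro p hp; rw [Finset.mem_Ico] at hp; exact hin p hp.1 hp.2
      · intro p hp; rw [Finset.mem_sdiff, Finset.mem_Ico (a := (-b : ℤ))] at hp
        exact hout p (by omega)
      · intro p hp; rw [Finset.mem_Ico] at hp; exact (glue_inside _ _ hp).symm
      · intro p hp; rw [Finset.mem_sdiff, Finset.mem_Ico, Finset.mem_Ico] at hp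
        exact tail p hp.1 hp.2
  | @tail f f' _ h ih =>
    obtain ⟨i, hi, rfl⟩ := h
    obtain ⟨fp, fp', ih⟩ := ih
    have hi' : (i + 1 < -b ∨ t ≤ i) ∧ -b' ≤ i ∧ i + 1 < t' ∧ i ≠ -1 := by
      rcases hi with hi | hi <;> rw [Set.mem_Ico] at hi <;> omega
    refine ⟨ClosedOn.hook fp (by omega), fp'.hook (by omega), fun y hy => ?_⟩
    obtain ⟨c, y', h1, h2, h3⟩ := ih (y.hook i) (hy.hook (by omega))
    have hne : (if f.partner i = i + 1 then δ else 1) ≠ 0 := by split_ifs <;> simp [h0]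
    refine ⟨(if y.partner i = i + 1 then δ else 1) / (if f.partner i = i + 1 then δ else 1) * c, y', h1,
      h2.trans (numThrough_hook_le y i hi'.2.2.2), fun x x' hx hin hout => ?_⟩
    -- The diagram `x'` arises from `x₀` by the generator at `i`, up to a loop factor. By
    -- self-adjointness this generator is moved to `y`, which cannot gain through strands.
    set x₀ := glue b t x f hx.preserves fp with hx₀
    have g1 : ∀ p : ℤ, -b ≤ p → p < t → x₀.partner p = x.partner p := fun p h5 h6 =>
      glue_inside _ _ ⟨h5, h6⟩
    have g2 : ∀ p : ℤ, (p < -b ∨ t ≤ p) → x₀.partner p = f.partner p := fun p hp =>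
      glue_outside _ _ hp
    have hxx : x₀.hook i = x' := by
      ext p
      by_cases h : -b ≤ p ∧ p < t
      · rw [hin p h.1 h.2]
        have := hx.preserves p h.1 h.2
        exact hook_partner_of_ne _ _ (g1 p h.1 h.2) (by omega) (by omega) (by omega) (by omega)
      · rw [hout p (by omega), hook_partner, hook_partner]
        simp only [hookFun, g2 i (by omega), g2 (i + 1) (by omega), g2 p (by omega)]
    have x₀p := pres hx fp fp' g1 g2
    have hh := spinPairing_hook ha hz hδ x₀p.mem hy.mem (j := i) (by rw [Finset.mem_Ico]; omega)
      (by rw [Finset.mem_Ico]; omega) hi'.2.2.2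
    rw [hxx, g2 i (by omega), h3 x x₀ hx g1 g2] at hh
    field_simp
    linear_combination hh

end Tail

end

/-! ### The limit form on V(w) and orthogonal projections -/

noncomputable section

open PlanarDiagram ComplexConjugate

/-- The limit form of `w` is the spin pairing with parameters `a` and `z` in every window of `w`. -/
structure IsSpinModel (δ : ℂ) (γ : ℝ) (w : PlanarDiagram) (a z : ℂ) : Prop where
  finite : w.throughStrands.Finite
  a_ne : a ≠ 0
  z_ne : z ≠ 0
  loop : a ^ 2 + a⁻¹ ^ 2 = δ
  δ_ne : δ ≠ 0
  conj_δ : conj δ = δ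
  pairing_eq : ∀ {b t : ℕ} {x y : PlanarDiagram}, w.Preserves b t → AgreesOff w b t x →
    AgreesOff w b t y → limitPairing δ γ w x y =
      spinPairing a z (Finset.Ico (-b : ℤ) t) x y / spinPairing a z (Finset.Ico (-b : ℤ) t) w w
  self_ne : ∀ {b t : ℕ}, w.Preserves b t → spinPairing a z (Finset.Ico (-b : ℤ) t) w w ≠ 0

section TraceForm

variable {δ : ℂ} {γ : ℝ} {w : PlanarDiagram}

theorem traceForm_add_right (x y z : DiagramSpace) :
    traceForm δ γ w x (y + z) = traceForm δ γ w x y + traceForm δ γ w x z := by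
  unfold traceForm
  rw [← Finsupp.sum_add]
  refine Finsupp.sum_congr fun d _ => ?_
  rw [map_add, Finsupp.sum_add_index' (by simp)]
  intro e a b
  rw [map_add]; ring

theorem traceForm_smul_right (c : ℂ) (x z : DiagramSpace) :
    traceForm δ γ w x (c • z) = conj c * traceForm δ γ w x z := by
  unfold traceForm
  rw [Finsupp.mul_sum]
  refine Finsupp.sum_congr fun d _ => ?_
  rw [map_smul, Finsupp.sum_smul_index' (by simp), Finsupp.mul_sum]
  refine Finsupp.sum_congr fun e _ => ?_
  rw [smul_eq_mul, map_mul]; ring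

theorem traceForm_zero_right (x : DiagramSpace) : traceForm δ γ w x 0 = 0 := by
  simpa using traceForm_smul_right (δ := δ) (γ := γ) (w := w) 0 x 0

theorem traceForm_basis (d e : PlanarDiagram) :
    traceForm δ γ w (basisDiagram d) (basisDiagram e) = limitPairing δ γ w d e := by
  unfold traceForm basisDiagram
  change (Finsupp.single d (1 : ℂ)).sum _ = _
  rw [Finsupp.sum_single_index]
  · change (Finsupp.single e (1 : ℂ)).sum _ = _
    rw [Finsupp.sum_single_index] <;> simp
  · simp

/-- The diagrams with at most `k` through strands. -/
def atMostThrough (k : ℤ) : Set PlanarDiagram := {d | ∃ m : ℕ, d.numThrough = m ∧ (m : ℤ) ≤ k}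

theorem atMostThrough_of_le {k : ℤ} {d e : PlanarDiagram} (hd : d ∈ atMostThrough k)
    (h : e.numThrough ≤ d.numThrough) : e ∈ atMostThrough k := by
  obtain ⟨m, hm, hk⟩ := hd
  rw [hm] at h
  obtain ⟨l, hl⟩ := ENat.ne_top_iff_exists.mp (ne_top_of_le_ne_top (ENat.natCast_ne_top m) h)
  rw [← hl] at h
  have h' : l ≤ m := by exact_mod_cast h
  exact ⟨l, hl.symm, by omega⟩

theorem atMostThrough_mono {k l : ℤ} (h : k ≤ l) : atMostThrough k ⊆ atMostThrough l :=
  fun _ ⟨m, hm, hk⟩ => ⟨m, hm, hk.trans h⟩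

theorem span_basisDiagram_inf (A B : Set PlanarDiagram) :
    Submodule.span ℂ (basisDiagram '' A) ⊓ Submodule.span ℂ (basisDiagram '' B) =
      Submodule.span ℂ (basisDiagram '' (A ∩ B)) := by
  have key : ∀ A : Set PlanarDiagram,
      Submodule.span ℂ (basisDiagram '' A) = Finsupp.supported ℂ ℂ A := fun A =>
    (Finsupp.supported_eq_span_single ℂ A).symm
  rw [key, key, key]
  exact (Finsupp.supported_inter A B).symm

theorem mem_span_basisDiagram {A : Set PlanarDiagram} {x : DiagramSpace} :
    x ∈ Submodule.span ℂ (basisDiagram '' A) ↔ ∀ d ∈ (DiagramSpace.coord x).support, d ∈ A := by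
  have key : Submodule.span ℂ (basisDiagram '' A) = Finsupp.supported ℂ ℂ A :=
    (Finsupp.supported_eq_span_single ℂ A).symm
  rw [key]
  exact Finsupp.mem_supported ℂ _

theorem strandIdeal_toSubmodule (h0 : δ ≠ 0) (k : ℤ) :
    (strandIdeal δ w k).restrictScalars ℂ =
      Submodule.span ℂ (basisDiagram '' (diagramsOf w ∩ atMostThrough k)) := by
  rw [← span_basisDiagram_inf, ← regularRep_toSubmodule h0]
  rfl

theorem mem_strandIdeal_iff (h0 : δ ≠ 0) {k : ℤ} {x : DiagramSpace} : x ∈ strandIdeal δ w k ↔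
    ∀ d ∈ (DiagramSpace.coord x).support, d ∈ diagramsOf w ∧ d ∈ atMostThrough k := by
  rw [← Submodule.restrictScalars_mem ℂ, strandIdeal_toSubmodule h0, mem_span_basisDiagram]
  rfl

theorem basisDiagram_mem_strandIdeal (h0 : δ ≠ 0) {k : ℤ} {d : PlanarDiagram} :
    basisDiagram d ∈ strandIdeal δ w k ↔ d ∈ diagramsOf w ∧ d ∈ atMostThrough k := by
  rw [← Submodule.restrictScalars_mem ℂ, strandIdeal_toSubmodule h0, basisDiagram_mem_span]
  rfl

theorem strandIdeal_mono {k l : ℤ} (h0 : δ ≠ 0) (h : k ≤ l) :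
    strandIdeal δ w k ≤ strandIdeal δ w l := by
  intro x hx
  rw [mem_strandIdeal_iff h0] at hx ⊢
  exact fun d hd => ⟨(hx d hd).1, atMostThrough_mono h (hx d hd).2⟩

variable {a z : ℂ}

theorem IsSpinModel.limitPairing_hook (H : IsSpinModel δ γ w a z) {d e : PlanarDiagram}
    (hd : d ∈ diagramsOf w) (he : e ∈ diagramsOf w) {j : ℤ} (hj : j ≠ -1) :
    (if d.partner j = j + 1 then δ else 1) * limitPairing δ γ w (d.hook j) e =
      (if e.partner j = j + 1 then δ else 1) * limitPairing δ γ w d (e.hook j) := by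
  classical
  obtain ⟨b, t, hb, ht, hwin, hS⟩ := exists_window_of_finset H.finite {d, e} (by
    intro x hx
    rw [Finset.mem_insert, Finset.mem_singleton] at hx
    rcases hx with rfl | rfl <;> assumption) (j.natAbs + 2)
  have hd' := (hS d (by simp)).agreesOff hwin.preserves
  have he' := (hS e (by simp)).agreesOff hwin.preserves
  have hjs : j ∈ sideIndices b t := by simp only [sideIndices, Set.mem_ofPred_eq]; omega
  have hdh := ((hS d (by simp)).trans (Reach.hook d hjs)).agreesOff hwin.preserves
  have heh := ((hS e (by simp)).trans (Reach.hook e hjs)).agreesOff hwin.preserves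
  rw [H.pairing_eq hwin.preserves hdh he', H.pairing_eq hwin.preserves hd' heh, mul_div, mul_div,
    spinPairing_hook H.a_ne H.z_ne H.loop hd'.preserves.mem he'.preserves.mem
      (by rw [Finset.mem_Ico]; omega) (by rw [Finset.mem_Ico]; omega) hj]

/-- The generators act by self-adjoint operators. -/
theorem IsSpinModel.traceForm_hookOp (H : IsSpinModel δ γ w a z) {x y : DiagramSpace}
    (hx : x ∈ regularRep δ w) (hy : y ∈ regularRep δ w) {j : ℤ} (hj : j ≠ -1) :
    traceForm δ γ w (hookOp δ j x) y = traceForm δ γ w x (hookOp δ j y) := by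
  rw [← Submodule.restrictScalars_mem ℂ, regularRep_toSubmodule H.δ_ne] at hx hy
  induction hx using Submodule.span_induction with
  | zero => rw [map_zero, traceForm_zero_left, traceForm_zero_left]
  | add x x' _ _ h1 h2 => rw [map_add, traceForm_add_left, traceForm_add_left, h1, h2]
  | smul c x _ h1 => rw [map_smul, traceForm_smul_left, traceForm_smul_left, h1]
  | mem x hx =>
    obtain ⟨d, hd, rfl⟩ := hx
    induction hy using Submodule.span_induction with
    | zero => rw [map_zero, traceForm_zero_right, traceForm_zero_right]
    | add x x' _ _ h1 h2 => rw [map_add, traceForm_add_right, traceForm_add_right, h1, h2]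
    | smul c x _ h1 => rw [map_smul, traceForm_smul_right, traceForm_smul_right, h1]
    | mem y hy =>
      obtain ⟨e, he, rfl⟩ := hy
      have hc : conj (if e.partner j = j + 1 then δ else 1) = (if e.partner j = j + 1 then δ else 1) := by
        split_ifs <;> simp [H.conj_δ]
      rw [hookOp_basis, hookOp_basis, traceForm_smul_left, traceForm_smul_right, traceForm_basis,
        traceForm_basis, hc, H.limitPairing_hook hd he hj]

theorem numThrough_le_of_mem_diagramsOf {d : PlanarDiagram} (hd : d ∈ diagramsOf w) :
    d.numThrough ≤ w.numThrough :=
  Reach.numThrough_le hd (by simp)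

theorem agreesOff_self {b t : ℕ} (hwin : w.IsWindow b t) : AgreesOff w b t w :=
  ⟨hwin.preserves, fun _ _ => rfl⟩

theorem AgreesOff.mem_diagramsOf {b t : ℕ} (hwin : w.IsWindow b t) {d : PlanarDiagram}
    (hd : AgreesOff w b t d) (h : d.numThrough ≤ w.numThrough) : d ∈ diagramsOf w :=
  (reach_of_numThrough_le hwin (agreesOff_self hwin) hd h).mem_diagramsOf

/-- The limit form is the spin pairing in any window up to the normalization, and the normalizations
of two windows differ by a factor independent of `x`. This lets finitely many diagrams stand for all
diagrams as functionals on a window. -/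
theorem IsSpinModel.exists_limitPairing_eq (H : IsSpinModel δ γ w a z) {b t : ℕ}
    (hwin : w.IsWindow b t) {y : PlanarDiagram} (hy : y ∈ diagramsOf w) :
    ∃ (c : ℂ) (y' : PlanarDiagram), AgreesOff w b t y' ∧ y' ∈ diagramsOf w ∧
      y'.numThrough ≤ y.numThrough ∧
      ∀ x, AgreesOff w b t x → limitPairing δ γ w x y = c * limitPairing δ γ w x y' := by
  obtain ⟨b', t', hb, ht, hwin', hS⟩ := exists_window_of_finset H.finite {y} (by simpa using hy)
    (max b t)
  have hb' : b ≤ b' := (le_max_left _ _).trans hb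
  have ht' : t ≤ t' := (le_max_right _ _).trans ht
  have hy' := (hS y (by simp)).agreesOff hwin'.preserves
  obtain ⟨c, y', h1, h2, h3⟩ := exists_spinPairing_eq H.a_ne H.z_ne H.loop H.δ_ne hwin hwin' hb' ht' y
    hy'.preserves
  refine ⟨c * spinPairing a z (Finset.Ico (-b : ℤ) t) w w /
    spinPairing a z (Finset.Ico (-b' : ℤ) t') w w, y', h1,
    h1.mem_diagramsOf hwin (h2.trans (numThrough_le_of_mem_diagramsOf hy)), h2, fun x hx => ?_⟩
  have hx' : AgreesOff w b' t' x := by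
    refine ⟨fun p h1 h2 => ?_, fun p hp => hx.outside p (by omega)⟩
    by_cases h : -b ≤ p ∧ p < t
    · have := hx.preserves p h.1 h.2; omega
    · rw [hx.outside p (by omega)]; exact hwin'.preserves p h1 h2
  have n1 := H.self_ne hwin.preserves
  have n2 := H.self_ne hwin'.preserves
  rw [H.pairing_eq hwin'.preserves hx' hy', H.pairing_eq hwin.preserves hx h1, h3 x hx]
  field_simp

theorem finite_agreesOff (w : PlanarDiagram) (b t : ℕ) : {d | AgreesOff w b t d}.Finite := by
  have : Finite ↥(Finset.Ico (-b : ℤ) t) := inferInstance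
  let F : {d | AgreesOff w b t d} → (↥(Finset.Ico (-b : ℤ) t) → ↥(Finset.Ico (-b : ℤ) t)) :=
    fun d p => ⟨d.1.partner p, d.2.preserves.mem p p.2⟩
  refine Set.finite_coe_iff.1 (Finite.of_injective F fun d e h => ?_)
  apply Subtype.ext
  ext p
  by_cases hp : -b ≤ p ∧ p < t
  · exact congrArg Subtype.val (congrFun h ⟨p, Finset.mem_Ico.2 hp⟩)
  · rw [d.2.outside p (by omega), e.2.outside p (by omega)]

/-- The orthogonal projection to `I_k(w)` exists. -/
theorem IsSpinModel.exists_projection (H : IsSpinModel δ γ w a z) (h : IsPositiveDefinite δ γ w) (k : ℤ)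
    {x : DiagramSpace} (hx : x ∈ regularRep δ w) :
    ∃ u ∈ strandIdeal δ w k, ∀ y ∈ strandIdeal δ w k, traceForm δ γ w (x - u) y = 0 := by
  obtain ⟨b, t, -, -, hwin, hS⟩ := exists_window_of_finset H.finite (DiagramSpace.coord x).support
    (coord_support_subset H.δ_ne hx) 0
  -- The candidates inside the window are finite in number, so the projection to their span exists
  -- without completeness.
  set D : Set PlanarDiagram := {d | AgreesOff w b t d} ∩ (diagramsOf w ∩ atMostThrough k) with hD
  have hDfin : D.Finite := (finite_agreesOff w b t).subset Set.inter_subset_left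
  have hDV : ∀ d ∈ D, basisDiagram d ∈ regularRep δ w := fun d hd =>
    (basisDiagram_mem_regularRep H.δ_ne).2 hd.2.1
  let f : D → PreHilbert h := fun d => PreHilbert.of h ⟨basisDiagram d, hDV d d.2⟩
  have : Finite D := hDfin
  let U : Submodule ℂ (PreHilbert h) := Submodule.span ℂ (Set.range f)
  have : FiniteDimensional ℂ U := FiniteDimensional.span_of_finite ℂ (Set.finite_range f)
  let ξ : PreHilbert h := PreHilbert.of h ⟨x, hx⟩
  let u : PreHilbert h := U.starProjection ξ
  have huU : u ∈ U := U.starProjection_apply_mem ξ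
  have hu : ∀ u ∈ U, ((PreHilbert.of h).symm u : DiagramSpace) ∈
      Submodule.span ℂ (basisDiagram '' D) := by
    intro u hu
    induction hu using Submodule.span_induction with
    | mem x hx => obtain ⟨d, rfl⟩ := hx; exact Submodule.subset_span ⟨d, d.2, rfl⟩
    | zero => exact zero_mem _
    | add x y _ _ h1 h2 => exact add_mem h1 h2
    | smul c x _ h1 => exact Submodule.smul_mem _ c h1
  have hu' := hu u huU
  refine ⟨((PreHilbert.of h).symm u : DiagramSpace), ?_, fun y hy => ?_⟩
  · rw [← Submodule.restrictScalars_mem ℂ, strandIdeal_toSubmodule H.δ_ne]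
    exact Submodule.span_mono (Set.image_mono Set.inter_subset_right) hu'
  have horth : ∀ d ∈ D, traceForm δ γ w (x - ((PreHilbert.of h).symm u : DiagramSpace))
      (basisDiagram d) = 0 := fun d hd =>
    (Submodule.mem_orthogonal _ _).1 (U.sub_starProjection_mem_orthogonal ξ) (f ⟨d, hd⟩)
      (Submodule.subset_span ⟨_, rfl⟩)
  have hxu : x - ((PreHilbert.of h).symm u : DiagramSpace) ∈
      Submodule.span ℂ (basisDiagram '' {d | AgreesOff w b t d}) := by
    refine sub_mem (mem_span_basisDiagram.2 fun d hd => (hS d hd).agreesOff hwin.preserves) ?_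
    exact Submodule.span_mono (Set.image_mono Set.inter_subset_left) hu'
  rw [← Submodule.restrictScalars_mem ℂ, strandIdeal_toSubmodule H.δ_ne] at hy
  induction hy using Submodule.span_induction with
  | zero => exact traceForm_zero_right _
  | add x y _ _ h1 h2 => rw [traceForm_add_right, h1, h2, add_zero]
  | smul c x _ h1 => rw [traceForm_smul_right, h1, mul_zero]
  | mem y hy =>
    obtain ⟨d, hd, rfl⟩ := hy
    -- A diagram that does not fit into the window acts on it as a multiple of some `y'` in `D`; it
    -- is essential that `y'` has no more through strands.
    obtain ⟨c, y', h1, h2, h3, h4⟩ := H.exists_limitPairing_eq hwin hd.1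
    have key : ∀ v ∈ Submodule.span ℂ (basisDiagram '' {d | AgreesOff w b t d}),
        traceForm δ γ w v (basisDiagram d) = c * traceForm δ γ w v (basisDiagram y') := by
      intro v hv
      induction hv using Submodule.span_induction with
      | zero => rw [traceForm_zero_left, traceForm_zero_left, mul_zero]
      | add x y _ _ h1 h2 => rw [traceForm_add_left, traceForm_add_left, h1, h2, mul_add]
      | smul c x _ h1 => rw [traceForm_smul_left, traceForm_smul_left, h1]; ring
      | mem v hv =>
        obtain ⟨e, he, rfl⟩ := hv
        rw [traceForm_basis, traceForm_basis, h4 e he]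
    rw [key _ hxu, horth y' ⟨h1, h2, atMostThrough_of_le hd.2 h3⟩, mul_zero]

end TraceForm

end

/-! ### Irreducibility of the subquotients -/

noncomputable section

open PlanarDiagram ComplexConjugate

section Windows

variable {w d : PlanarDiagram} {b t r r' : ℕ}

/-- The cups leave `t - 2 * r` points at the top and equally many at the bottom. With at least that
many through strands, every remaining point must belong to one. -/
theorem isStandard_of_numThrough (hwin : w.IsWindow b t) (hd : AgreesOff w b t d)
    (hlen : t + 2 * r' = b + 2 * r) (hle : 2 * r ≤ t) (top : d.CupsFrom 0 r)
    (bot : d.CupsFrom (-(2 * r' : ℕ)) r') (h : ((t - 2 * r : ℕ) : ℕ∞) ≤ d.numThrough) :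
    IsStandard b t r r' d := by
  have h1 : d.throughStrands = (Finset.Ico (2 * r : ℤ) t : Finset ℤ) := by
    refine (Finset.finite_toSet _).eq_of_subset_of_encard_le' ?_ ?_
    · rintro p ⟨h1, h2⟩
      rw [Finset.mem_coe, Finset.mem_Ico]
      constructor
      · by_contra h3
        have := (top.mem_iff p).1 (by omega)
        omega
      · by_contra h3
        rw [hd.outside p (by omega)] at h2
        have := hwin.side p (by omega)
        omega
    · refine le_trans ?_ h
      rw [Set.encard_coe_eq_coe_finsetCard, Int.card_Ico]
      exact_mod_cast (by omega : ((t : ℤ) - 2 * r).toNat ≤ t - 2 * r)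
  have h2 : {p : ℤ | p < 0 ∧ 0 ≤ d.partner p} = (Finset.Ico (-b : ℤ) (-(2 * r' : ℕ)) : Finset ℤ) := by
    refine (Finset.finite_toSet _).eq_of_subset_of_encard_le' ?_ ?_
    · rintro p ⟨h1, h2⟩
      rw [Finset.mem_coe, Finset.mem_Ico]
      constructor
      · by_contra h3
        rw [hd.outside p (by omega)] at h2
        have := hwin.side p (by omega)
        omega
      · by_contra h3
        have := (bot.mem_iff p).1 (by push_cast at h3 ⊢; omega)
        push_cast at this
        omega
    · rw [← PlanarDiagram.numThrough_eq]
      refine le_trans ?_ h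
      rw [Set.encard_coe_eq_coe_finsetCard, Int.card_Ico]
      exact_mod_cast (by push_cast; omega : (-((2 * r' : ℕ) : ℤ) - (-b)).toNat ≤ t - 2 * r)
  refine isStandard_of_through hd.preserves hle (by omega) top bot (fun p h3 h4 => ?_) fun p h3 h4 => ?_
  · have : p ∈ d.throughStrands := by rw [h1, Finset.mem_coe, Finset.mem_Ico]; exact ⟨h3, h4⟩
    exact this.2
  · have : p ∈ {p : ℤ | p < 0 ∧ 0 ≤ d.partner p} := by
      rw [h2, Finset.mem_coe, Finset.mem_Ico]; exact ⟨h3, h4⟩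
    exact this.2

/-- The number of through strands has a fixed parity on `V(w)`. -/
theorem numThrough_parity {n k : ℕ} (hw : w.numThrough = n) (hd : d ∈ diagramsOf w)
    (hk : d.numThrough = k) : k % 2 = n % 2 := by
  obtain ⟨b, t, hwin, h1, -⟩ := exists_common_window (finite_throughStrands hw) hd hd
  obtain ⟨r, _, _, -, -, s, -, e1, -⟩ := (h1.agreesOff hwin.preserves).exists_isStandard hwin
  obtain ⟨r₀, _, _, -, -, s₀, -, e2, -⟩ := (agreesOff_self hwin).exists_isStandard hwin
  have l1 := s.le
  have l2 := s₀.le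
  rw [hk] at e1
  rw [hw] at e2
  have e1' : k = t - 2 * r := by exact_mod_cast e1
  have e2' : n = t - 2 * r₀ := by exact_mod_cast e2
  omega

theorem exists_numThrough_eq {n k : ℕ} (hw : w.numThrough = n) (hk : k ≤ n) (hkn : k % 2 = n % 2) :
    ∃ d ∈ diagramsOf w, d.numThrough = k := by
  obtain ⟨b, t, -, -, hwin⟩ := exists_isWindow (finite_throughStrands hw) 0
  obtain ⟨r, r', e, h1, -, s, -, e1, -⟩ := (agreesOff_self hwin).exists_isStandard hwin
  have l1 := s.le
  rw [hw] at e1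
  have e1' : n = t - 2 * r := by exact_mod_cast e1
  obtain ⟨f, h2, h3⟩ := s.exists_add ((n - k) / 2) (by omega)
  have h4 := h1.trans h2
  refine ⟨f, h4.mem_diagramsOf, ?_⟩
  rw [h3.numThrough_eq hwin (h4.agreesOff hwin.preserves)]
  congr 1
  omega

theorem mem_atMostThrough_sub_two {n k : ℕ} (hw : w.numThrough = n) (hd : d ∈ diagramsOf w)
    (hkn : k % 2 = n % 2) (hk : d ∈ atMostThrough k) (hne : d.numThrough ≠ k) :
    d ∈ atMostThrough ((k : ℤ) - 2) := by
  obtain ⟨m, hm, hmk⟩ := hk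
  have := numThrough_parity hw hd hm
  have h2 : m ≠ k := by rintro rfl; exact hne hm
  exact ⟨m, hm, by omega⟩

end Windows

section Simple

variable {δ : ℂ} {γ : ℝ} {w : PlanarDiagram} {a z : ℂ}

/-- A submodule that contains `I_{k-2}(w)` and some further vector of `I_k(w)` contains `I_k(w)`. -/
theorem IsSpinModel.strandIdeal_le (H : IsSpinModel δ γ w a z) (h : IsPositiveDefinite δ γ w)
    {n k : ℕ} (hw : w.numThrough = n) (hkn : k % 2 = n % 2) (S : Submodule (TLTwoSided δ) DiagramSpace)
    (hS : strandIdeal δ w ((k : ℤ) - 2) ≤ S) {v : DiagramSpace} (hvS : v ∈ S)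
    (hvk : v ∈ strandIdeal δ w k) (hv : v ∉ strandIdeal δ w ((k : ℤ) - 2)) : strandIdeal δ w k ≤ S := by
  classical
  have hIV : ∀ {l : ℤ} {x : DiagramSpace}, x ∈ strandIdeal δ w l → x ∈ regularRep δ w := fun hx => hx.1
  -- The component of `v` orthogonal to I_{k-2} is still in `S`, because `S` contains I_{k-2}, and
  -- it is nonzero.
  obtain ⟨u, hu, huo⟩ := H.exists_projection h ((k : ℤ) - 2) (hIV hvk)
  set x₀ := v - u with hx₀
  have hx₀S : x₀ ∈ S := sub_mem hvS (hS hu)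
  have hx₀k : x₀ ∈ strandIdeal δ w k := sub_mem hvk (strandIdeal_mono H.δ_ne (by omega) hu)
  have hx₀ne : x₀ ≠ 0 := fun h0 => hv (by rw [sub_eq_zero.1 h0]; exact hu)
  -- a diagram with `k` through strands that is not orthogonal to `x₀`
  obtain ⟨y, hyV, hyk, hy⟩ : ∃ y ∈ diagramsOf w, y ∈ atMostThrough k ∧
      traceForm δ γ w x₀ (basisDiagram y) ≠ 0 := by
    by_contra! hcon
    have h1 : ∀ y ∈ strandIdeal δ w k, traceForm δ γ w x₀ y = 0 := by
      intro y hy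
      rw [← Submodule.restrictScalars_mem ℂ, strandIdeal_toSubmodule H.δ_ne] at hy
      induction hy using Submodule.span_induction with
      | zero => exact traceForm_zero_right _
      | add x y _ _ h1 h2 => rw [traceForm_add_right, h1, h2, add_zero]
      | smul c x _ h1 => rw [traceForm_smul_right, h1, mul_zero]
      | mem y hy => obtain ⟨d, hd, rfl⟩ := hy; exact hcon d hd.1 hd.2
    have := h.pos x₀ (hIV hx₀k) hx₀ne
    rw [h1 x₀ hx₀k] at this
    simp at this
  have hyn : y.numThrough = k := by
    by_contra hne
    exact hy (huo _ ((basisDiagram_mem_strandIdeal H.δ_ne).2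
      ⟨hyV, mem_atMostThrough_sub_two hw hyV hkn hyk hne⟩))
  suffices hall : ∀ d ∈ diagramsOf w, d ∈ atMostThrough k → basisDiagram d ∈ S by
    intro x hx
    rw [← Submodule.restrictScalars_mem ℂ, strandIdeal_toSubmodule H.δ_ne] at hx
    rw [← Submodule.restrictScalars_mem ℂ]
    refine (Submodule.span_le (p := S.restrictScalars ℂ)).2 ?_ hx
    rintro _ ⟨d, hd, rfl⟩
    exact hall d hd.1 hd.2
  intro d hdV hdk
  obtain ⟨b, t, -, -, hwin, hwd⟩ := exists_window_of_finset H.finite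
    ((DiagramSpace.coord x₀).support ∪ {y, d}) (by
      intro e he
      simp only [Finset.mem_union, Finset.mem_insert, Finset.mem_singleton] at he
      rcases he with he | rfl | rfl
      · exact ((mem_strandIdeal_iff H.δ_ne).1 hx₀k e he).1
      · exact hyV
      · exact hdV) 0
  have hyw := (hwd y (by simp)).agreesOff hwin.preserves
  have hdw := (hwd d (by simp)).agreesOff hwin.preserves
  obtain ⟨r, r', s, hys, hsy, hs, hsw, hrk, hsn⟩ := hyw.exists_isStandard hwin
  rw [hyn] at hrk hsn
  have hrk' : k = t - 2 * r := by exact_mod_cast hrk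
  have hsV : s ∈ diagramsOf w := hyV.trans (hys.mono fun i hi => by
    rintro rfl; exact neg_one_notMem_sideIndices b t hi)
  -- the vectors of `S` orthogonal to `I_{k-2}`
  let C : Set DiagramSpace := {x | x ∈ S ∧ x ∈ strandIdeal δ w k ∧
    ∀ y ∈ strandIdeal δ w ((k : ℤ) - 2), traceForm δ γ w x y = 0}
  have hC : ∀ x ∈ C, ∀ j : ℤ, j ≠ -1 → hookOp δ j x ∈ C := by
    rintro x ⟨h1, h2, h3⟩ j hj
    refine ⟨hookOp_mem_submodule S hj h1, hookOp_mem_submodule _ hj h2, fun y hy => ?_⟩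
    rw [H.traceForm_hookOp (hIV h2) (hIV hy) hj]
    exact h3 _ (hookOp_mem_submodule _ hj hy)
  let W : Set PlanarDiagram → Set DiagramSpace := fun A =>
    {x | x ∈ Submodule.span ℂ (basisDiagram '' ({e | AgreesOff w b t e} ∩ A))}
  have hW : ∀ (A B : Set PlanarDiagram) (j : ℤ), j ∈ sideIndices b t →
      (∀ e ∈ A, e.hook j ∈ B) → ∀ x ∈ W A, hookOp δ j x ∈ W B := by
    intro A B j hj hAB x hx
    change x ∈ Submodule.span ℂ _ at hx
    change _ ∈ Submodule.span ℂ _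
    induction hx using Submodule.span_induction with
    | zero => rw [map_zero]; exact zero_mem _
    | add x y _ _ h1 h2 => rw [map_add]; exact add_mem h1 h2
    | smul c x _ h1 => rw [map_smul]; exact Submodule.smul_mem _ _ h1
    | mem y hy =>
      obtain ⟨e, he, rfl⟩ := hy
      rw [hookOp_basis]
      refine Submodule.smul_mem _ _ (Submodule.subset_span ⟨_, ⟨?_, hAB e he.2⟩, rfl⟩)
      have h1 := (Reach.hook e hj).preserves he.1.preserves
      exact ⟨h1.1, fun p hp => by rw [h1.2 p hp, he.1.outside p hp]⟩
  have hside : ∀ j ∈ sideIndices b t, j ≠ -1 := fun j hj => by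
    rintro rfl; exact neg_one_notMem_sideIndices b t hj
  -- Since `y` is reached from `s` by generators, and these are self-adjoint with invertible loop
  -- factors, a vector not orthogonal to `y` is turned by them into one not orthogonal to `s`.
  have pull : ∀ y, Reach (sideIndices b t) s y → ∀ x ∈ C, x ∈ W Set.univ →
      traceForm δ γ w x (basisDiagram y) ≠ 0 →
      ∃ x₁ ∈ C, x₁ ∈ W Set.univ ∧ traceForm δ γ w x₁ (basisDiagram s) ≠ 0 := by
    intro y hy
    induction hy with
    | refl => exact fun x h1 h2 h3 => ⟨x, h1, h2, h3⟩
    | @tail e f hse hef ih =>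
      obtain ⟨j, hj, rfl⟩ := hef
      intro x h1 h2 h3
      refine ih (hookOp δ j x) (hC x h1 j (hside j hj)) (hW _ _ j hj (by simp) x h2) ?_
      have heV : e ∈ diagramsOf w := hsV.trans (Reach.mono (fun i hi => hside i hi) hse)
      rw [H.traceForm_hookOp (hIV h1.2.1) ((basisDiagram_mem_regularRep H.δ_ne).2 heV) (hside j hj),
        hookOp_basis, traceForm_smul_right]
      refine mul_ne_zero ?_ h3
      rw [Ne, map_eq_zero]
      split_ifs
      · exact H.δ_ne
      · exact one_ne_zero
  obtain ⟨x₁, hx₁C, hx₁W, hx₁⟩ := pull y hsy x₀ ⟨hx₀S, hx₀k, huo⟩ (mem_span_basisDiagram.2 fun e he =>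
    ⟨(hwd e (Finset.mem_union_left _ he)).agreesOff hwin.preserves, Set.mem_univ _⟩) hy
  -- attach the cups of the standard diagram
  have attach : ∀ L : List ℤ, (∀ i ∈ L, s.partner i = i + 1 ∧ i ∈ sideIndices b t) →
      ∃ x₂ ∈ C, x₂ ∈ W {e | ∀ i ∈ L, e.partner i = i + 1} ∧
        traceForm δ γ w x₂ (basisDiagram s) ≠ 0 := by
    intro L
    induction L with
    | nil => exact fun _ => ⟨x₁, hx₁C, by simpa using hx₁W, hx₁⟩
    | cons i L ih =>
      intro hL
      obtain ⟨x₂, h1, h2, h3⟩ := ih fun j hj => hL j (List.mem_cons_of_mem _ hj)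
      obtain ⟨k1, k2⟩ := hL i List.mem_cons_self
      refine ⟨hookOp δ i x₂, hC x₂ h1 i (hside i k2), hW {e | ∀ i ∈ L, e.partner i = i + 1}
        {e | ∀ i' ∈ i :: L, e.partner i' = i' + 1} i k2 (fun e (he : ∀ i ∈ L, e.partner i = i + 1) j hj => ?_) x₂ h2, ?_⟩
      · by_cases hij : j = i
        · subst hij; exact hook_partner_self _ _
        · have hj' : j ∈ L := by
            rcases List.mem_cons.1 hj with h | h
            · exact absurd h hij
            · exact h
          have k5 := (hL j hj).1
          have k6 : j + 1 ≠ i := by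
            intro h
            have := s.partner_partner j
            rw [k5, h, k1] at this; omega
          have k7 : j ≠ i + 1 := by
            intro h
            have := s.partner_partner i
            rw [k1, ← h, k5] at this; omega
          exact hook_partner_of_ne _ _ (he j hj') hij k7 k6 (by omega)
      · rw [H.traceForm_hookOp (hIV h1.2.1) ((basisDiagram_mem_regularRep H.δ_ne).2 hsV) (hside i k2),
          hookOp_basis, traceForm_smul_right, if_pos k1, s.hook_of_eq i k1]
        exact mul_ne_zero ((map_ne_zero _).2 H.δ_ne) h3
  have l1 := hs.le
  have l2 := hs.len
  obtain ⟨x₂, ⟨hx₂S, hx₂k, hx₂o⟩, hx₂W, hx₂⟩ := attach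
    ((List.range r).map (fun j : ℕ => (0 : ℤ) + 2 * j) ++
      (List.range r').map (fun j : ℕ => (-(2 * r' : ℕ) : ℤ) + 2 * j)) (by
    intro i hi
    simp only [List.mem_append, List.mem_map, List.mem_range] at hi
    simp only [sideIndices, Set.mem_ofPred_eq]
    rcases hi with ⟨j, hj, rfl⟩ | ⟨j, hj, rfl⟩
    · exact ⟨hs.top j hj, by omega⟩
    · exact ⟨hs.bot j hj, by push_cast; omega⟩)
  set c := DiagramSpace.coord x₂ s with hc
  -- Every diagram of `x₂` contains all the cups of `s`. If it has `k` through strands it is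
  -- standard, hence equal to `s`; all others lie in I_{k-2}.
  have hx₂s : x₂ - c • basisDiagram s ∈ strandIdeal δ w ((k : ℤ) - 2) := by
    rw [mem_strandIdeal_iff H.δ_ne]
    intro e he
    have hcoord : DiagramSpace.coord (x₂ - c • basisDiagram s) =
        DiagramSpace.coord x₂ - Finsupp.single s c := by
      rw [map_sub, map_smul]
      congr 1
      change c • Finsupp.single s (1 : ℂ) = _
      rw [Finsupp.smul_single, smul_eq_mul, mul_one]
    have hes : e ≠ s := by
      rintro rfl
      rw [Finsupp.mem_support_iff, hcoord, Finsupp.sub_apply, Finsupp.single_eq_same, hc, sub_self] at he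
      exact he rfl
    have he2 : e ∈ (DiagramSpace.coord x₂).support := by
      rw [Finsupp.mem_support_iff, hcoord, Finsupp.sub_apply, Finsupp.single_eq_of_ne hes, sub_zero] at he
      exact Finsupp.mem_support_iff.2 he
    obtain ⟨heV, hek⟩ := (mem_strandIdeal_iff H.δ_ne).1 hx₂k e he2
    obtain ⟨hew, hecups⟩ := mem_span_basisDiagram.1 hx₂W e he2
    refine ⟨heV, mem_atMostThrough_sub_two hw heV hkn hek fun hen => hes ?_⟩
    refine IsStandard.eq (isStandard_of_numThrough hwin hew l2 l1 (fun j hj => ?_) (fun j hj => ?_) ?_)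
      hs fun p hp => by rw [hew.outside p hp, hsw.outside p hp]
    · exact hecups _ (by simp only [List.mem_append, List.mem_map, List.mem_range]; exact Or.inl ⟨j, hj, rfl⟩)
    · exact hecups _ (by simp only [List.mem_append, List.mem_map, List.mem_range]; exact Or.inr ⟨j, hj, rfl⟩)
    · rw [hen, hrk]
  -- Otherwise `x₂` would lie in I_{k-2} and be orthogonal to it, hence be zero by definiteness,
  -- although it pairs nontrivially with `s`.
  have hc0 : c ≠ 0 := by
    intro h0
    rw [h0, zero_smul, sub_zero] at hx₂s
    have h1 := hx₂o x₂ hx₂s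
    have h2 : x₂ ≠ 0 := by rintro rfl; exact hx₂ (traceForm_zero_left ..)
    have := h.pos x₂ (hIV hx₂k) h2
    rw [h1] at this
    simp at this
  have hsS : basisDiagram s ∈ S := by
    have h1 := sub_mem hx₂S (hS hx₂s)
    rw [sub_sub_cancel] at h1
    have h2 := S.smul_of_tower_mem c⁻¹ h1
    rwa [smul_smul, inv_mul_cancel₀ hc0, one_smul] at h2
  have hdn : d.numThrough ≤ s.numThrough := by
    obtain ⟨m, hm, hmk⟩ := hdk
    rw [hsn, hm]
    exact_mod_cast (by omega : m ≤ k)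
  exact (reach_of_numThrough_le hwin hsw hdw hdn).basis_mem H.δ_ne S (neg_one_notMem_sideIndices b t) hsS

end Simple

end

/-! ### Invariant complements and bounded extension of the action -/

noncomputable section

open PlanarDiagram ComplexConjugate

open scoped TensorProduct

section Modules

variable {δ : ℂ} {γ : ℝ} {w : PlanarDiagram} {a z : ℂ}

/-- The simplicity of `V_k(w)`. -/
theorem IsSpinModel.isSimpleModule (H : IsSpinModel δ γ w a z) (h : IsPositiveDefinite δ γ w)
    {n k : ℕ} (hw : w.numThrough = n) (hk : k ≤ n) (hkn : k % 2 = n % 2) :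
    IsSimpleModule (TLTwoSided δ) (strandQuotient δ w k) := by
  rw [isSimpleModule_iff_isCoatom]
  refine ⟨fun htop => ?_, fun P hP => ?_⟩
  · obtain ⟨d, hd, hdk⟩ := exists_numThrough_eq hw hk hkn
    have h1 : basisDiagram d ∈ strandIdeal δ w k :=
      (basisDiagram_mem_strandIdeal H.δ_ne).2 ⟨hd, k, hdk, le_rfl⟩
    have h2 : (⟨basisDiagram d, h1⟩ : ↥(strandIdeal δ w k)) ∈
        (strandIdeal δ w ((k : ℤ) - 2)).submoduleOf (strandIdeal δ w k) := by
      rw [htop]; exact Submodule.mem_top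
    obtain ⟨-, m, hm, hmk⟩ := (basisDiagram_mem_strandIdeal H.δ_ne).1 (Submodule.mem_comap.1 h2)
    rw [hdk] at hm
    have : k = m := by exact_mod_cast hm
    omega
  · obtain ⟨hle, v, hvP, hv⟩ := SetLike.lt_iff_le_and_exists.1 hP
    have h1 := H.strandIdeal_le h hw hkn (P.map (strandIdeal δ w k).subtype) (fun x hx => by
      have hxk := strandIdeal_mono H.δ_ne (by omega : (k : ℤ) - 2 ≤ k) hx
      exact ⟨⟨x, hxk⟩, hle (Submodule.mem_comap.2 hx), rfl⟩) ⟨v, hvP, rfl⟩ v.2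
      (fun h => hv (Submodule.mem_comap.2 h))
    rw [eq_top_iff]
    rintro ⟨x, hx⟩ -
    obtain ⟨y, hy, hyx⟩ := h1 hx
    rwa [show (⟨x, hx⟩ : ↥(strandIdeal δ w k)) = y from Subtype.ext hyx.symm]

/-- The orthogonal complement of `I_{k-2}(w)` in `I_k(w)`. -/
def IsSpinModel.complement (H : IsSpinModel δ γ w a z) (k : ℤ) :
    Submodule (TLTwoSided δ) DiagramSpace where
  carrier := {x | x ∈ strandIdeal δ w k ∧ ∀ y ∈ strandIdeal δ w (k - 2), traceForm δ γ w x y = 0}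
  zero_mem' := ⟨zero_mem _, fun _ _ => traceForm_zero_left ..⟩
  add_mem' h1 h2 := ⟨add_mem h1.1 h2.1, fun y hy => by
    rw [traceForm_add_left, h1.2 y hy, h2.2 y hy, add_zero]⟩
  smul_mem' b x hx :=
    let S : Submodule ℂ DiagramSpace :=
      { carrier := {x | x ∈ strandIdeal δ w k ∧
          ∀ y ∈ strandIdeal δ w (k - 2), traceForm δ γ w x y = 0}
        zero_mem' := ⟨zero_mem _, fun _ _ => traceForm_zero_left ..⟩
        add_mem' := fun h1 h2 => ⟨add_mem h1.1 h2.1, fun y hy => by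
          rw [traceForm_add_left, h1.2 y hy, h2.2 y hy, add_zero]⟩
        smul_mem' := fun c x h1 => ⟨Submodule.smul_of_tower_mem _ c h1.1, fun y hy => by
          rw [traceForm_smul_left, h1.2 y hy, mul_zero]⟩ }
    twoSided_smul_mem (S := S) (fun _ hj _ hv => ⟨hookOp_mem_submodule _ hj hv.1, fun _ hy => by
      rw [H.traceForm_hookOp hv.1.1 hy.1 hj]
      exact hv.2 _ (hookOp_mem_submodule _ hj hy)⟩) b x hx

/-- Definiteness of the form gives disjointness, and the algebraic projection to I_{k-2} gives the
sum. -/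
theorem IsSpinModel.isCompl_complement (H : IsSpinModel δ γ w a z) (h : IsPositiveDefinite δ γ w)
    (k : ℤ) : IsCompl ((strandIdeal δ w (k - 2)).submoduleOf (strandIdeal δ w k))
      ((H.complement k).submoduleOf (strandIdeal δ w k)) := by
  refine ⟨Submodule.disjoint_def.2 fun x h1 h2 => ?_, codisjoint_iff_le_sup.2 fun x _ => ?_⟩
  · have h1 : (x : DiagramSpace) ∈ strandIdeal δ w (k - 2) := h1
    have h2 : (x : DiagramSpace) ∈ H.complement k := h2
    by_contra hx
    have := h.pos x x.2.1 fun h0 => hx (Subtype.ext h0)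
    rw [h2.2 x h1] at this
    simp at this
  · obtain ⟨u, hu, huo⟩ := H.exists_projection h (k - 2) x.2.1
    have huk : u ∈ strandIdeal δ w k := strandIdeal_mono H.δ_ne (by omega) hu
    have hxu : (x : DiagramSpace) - u ∈ H.complement k := ⟨sub_mem x.2 huk, huo⟩
    have h1 : (⟨u, huk⟩ : ↥(strandIdeal δ w k)) ∈
        (strandIdeal δ w (k - 2)).submoduleOf (strandIdeal δ w k) := hu
    have h2 : (⟨x - u, hxu.1⟩ : ↥(strandIdeal δ w k)) ∈
        (H.complement k).submoduleOf (strandIdeal δ w k) := hxu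
    exact Submodule.mem_sup.2 ⟨_, h1, _, h2, Subtype.ext (add_sub_cancel _ _)⟩

/-- The equivariant section of the quotient map `I_k(w) → V_k(w)`. -/
def IsSpinModel.strandSection (H : IsSpinModel δ γ w a z) (h : IsPositiveDefinite δ γ w) (k : ℤ) :
    strandQuotient δ w k →ₗ[TLTwoSided δ] ↥(strandIdeal δ w k) :=
  Submodule.subtype _ ∘ₗ
    (Submodule.quotientEquivOfIsCompl _ _ (H.isCompl_complement h k)).toLinearMap

theorem IsSpinModel.mk_strandSection (H : IsSpinModel δ γ w a z) (h : IsPositiveDefinite δ γ w) (k : ℤ)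
    (v : strandQuotient δ w k) : Submodule.Quotient.mk (H.strandSection h k v) = v :=
  Submodule.mk_quotientEquivOfIsCompl_apply (H.isCompl_complement h k) v

theorem IsSpinModel.range_strandSection (H : IsSpinModel δ γ w a z) (h : IsPositiveDefinite δ γ w)
    (k : ℤ) : Set.range (H.strandSection h k) =
      {x : ↥(strandIdeal δ w k) | (x : DiagramSpace) ∈ H.complement k} := by
  ext x
  constructor
  · rintro ⟨v, rfl⟩
    exact (Submodule.quotientEquivOfIsCompl _ _ (H.isCompl_complement h k) v).2
  · intro hx
    obtain ⟨v, hv⟩ := (Submodule.quotientEquivOfIsCompl _ _ (H.isCompl_complement h k)).surjective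
      ⟨x, hx⟩
    exact ⟨v, congrArg Subtype.val hv⟩

end Modules

section Completion

/-- A representation by bounded operators extends to the completion. -/
theorem exists_completion_algHom {A E : Type*} [Ring A] [Algebra ℂ A] [NormedAddCommGroup E]
    [NormedSpace ℂ E] (φ : A →ₐ[ℂ] Module.End ℂ E) (hφ : ∀ a, ∃ C, ∀ x, ‖φ a x‖ ≤ C * ‖x‖) :
    ∃ ρ : A →ₐ[ℂ] (UniformSpace.Completion E →L[ℂ] UniformSpace.Completion E),
      ∀ a (v : E), ρ a v = (φ a v : E) := by
  let f : A → (E →L[ℂ] E) := fun a => (φ a).mkContinuousOfExistsBound (hφ a)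
  have key : ∀ a (v : E), (f a).completion (v : UniformSpace.Completion E) = (φ a v : E) := fun a v =>
    (f a).completion_apply_coe v
  have ext : ∀ {S T : UniformSpace.Completion E →L[ℂ] UniformSpace.Completion E},
      (∀ v : E, S v = T v) → S = T := fun h =>
    ContinuousLinearMap.ext (UniformSpace.Completion.ext' (ContinuousLinearMap.continuous _)
      (ContinuousLinearMap.continuous _) h)
  refine ⟨AlgHom.ofLinearMap ⟨⟨fun a => (f a).completion, fun a b => ext fun v => ?_⟩,
    fun c a => ext fun v => ?_⟩ (ext fun v => ?_) fun a b => ext fun v => ?_, key⟩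
  · rw [add_apply, key, key, key, map_add, LinearMap.add_apply,
      UniformSpace.Completion.coe_add]
  · rw [RingHom.id_apply, smul_apply, key, key, map_smul, LinearMap.smul_apply,
      UniformSpace.Completion.coe_smul]
  · change (f 1).completion (v : UniformSpace.Completion E) = v
    rw [key, map_one]; rfl
  · change (f (a * b)).completion (v : UniformSpace.Completion E) = (f a).completion ((f b).completion v)
    rw [key, key, key, map_mul]; rfl

/-- Finitely many orthogonal closed subspaces with dense sum. -/
theorem isInternal_of_dense {ι E : Type*} [Finite ι] [DecidableEq ι] [NormedAddCommGroup E]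
    [InnerProductSpace ℂ E] [CompleteSpace E] {K : ι → Submodule ℂ E}
    (hclosed : ∀ i, IsClosed (K i : Set E))
    (horth : OrthogonalFamily ℂ (fun i => ↥(K i)) fun i => (K i).subtypeₗᵢ)
    (hdense : ⊤ ≤ (⨆ i, K i).topologicalClosure) : DirectSum.IsInternal K := by
  have := Fintype.ofFinite ι
  rw [DirectSum.isInternal_submodule_iff_iSupIndep_and_iSup_eq_top]
  refine ⟨horth.independent, eq_top_iff.2 fun x _ => ?_⟩
  have : ∀ i, CompleteSpace ↥(K i) := fun i => (hclosed i).completeSpace_coe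
  have hsum := IsHilbertSum.mkInternal K horth hdense
  have h1 := hsum.hasSum_linearIsometryEquiv_symm (hsum.linearIsometryEquiv x)
  rw [LinearIsometryEquiv.symm_apply_apply] at h1
  -- The index set is finite, so the Hilbert sum is a plain sum and closed subspaces with dense sum
  -- exhaust the space.
  rw [h1.unique (hasSum_fintype _)]
  exact sum_mem fun i _ => Submodule.mem_iSup_of_mem i (Subtype.property _)

end Completion

section Bounded

variable {δ : ℂ} {γ : ℝ} {w : PlanarDiagram} {a z : ℂ}

instance (h : IsPositiveDefinite δ γ w) : IsScalarTower ℂ (TLTwoSided δ) (PreHilbert h) :=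
  inferInstanceAs (IsScalarTower ℂ (TLTwoSided δ) ↥(regularRep δ w))

theorem PreHilbert.inner_def (h : IsPositiveDefinite δ γ w) (x y : PreHilbert h) : inner ℂ x y =
    traceForm δ γ w ((of h).symm y : DiagramSpace) ((of h).symm x : DiagramSpace) := rfl

/-- A self-adjoint e with e² = δ e satisfies ‖e x‖² = δ ⟨x, e x⟩, and Cauchy-Schwarz bounds e by
|δ|. -/
theorem IsSpinModel.norm_le_of_eq_hookOp (H : IsSpinModel δ γ w a z) (h : IsPositiveDefinite δ γ w)
    {j : ℤ} (hj : j ≠ -1) (x y : PreHilbert h) (hy : ((PreHilbert.of h).symm y : DiagramSpace) =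
      hookOp δ j ((PreHilbert.of h).symm x : DiagramSpace)) : ‖y‖ ≤ ‖δ‖ * ‖x‖ := by
  have h1 : inner ℂ y y = δ * inner ℂ x y := by
    rw [PreHilbert.inner_def, PreHilbert.inner_def, hy]
    have h2 := ((PreHilbert.of h).symm x).2
    have h3 := hookOp_mem_submodule (regularRep δ w) hj h2
    have h4 : hookOp δ j (hookOp δ j ((PreHilbert.of h).symm x : DiagramSpace)) =
        δ • hookOp δ j ((PreHilbert.of h).symm x : DiagramSpace) :=
      LinearMap.congr_fun (hookOp_sq δ j) _
    rw [← H.traceForm_hookOp h3 h2 hj, h4, traceForm_smul_left]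
  have h2 : ‖y‖ * ‖y‖ ≤ ‖δ‖ * ‖x‖ * ‖y‖ := by
    rw [← inner_self_eq_norm_mul_norm (𝕜 := ℂ)]
    refine (RCLike.re_le_norm _).trans ?_
    rw [h1, norm_mul, mul_assoc]
    exact mul_le_mul_of_nonneg_left (norm_inner_le_norm x y) (norm_nonneg _)
  by_cases h0 : ‖y‖ = 0
  · rw [h0]; positivity
  · exact le_of_mul_le_mul_right h2 (lt_of_le_of_ne (norm_nonneg _) (Ne.symm h0))

/-- The elements that act by bounded operators form a subalgebra, and it contains the generators of
both tensor factors. -/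
theorem IsSpinModel.exists_bound (H : IsSpinModel δ γ w a z) (h : IsPositiveDefinite δ γ w)
    (b : TLTwoSided δ) : ∃ C, ∀ x : PreHilbert h, ‖b • x‖ ≤ C * ‖x‖ := by
  let P : TLTwoSided δ → Prop := fun b => ∃ C, ∀ x : PreHilbert h, ‖b • x‖ ≤ C * ‖x‖
  have hadd : ∀ b c, P b → P c → P (b + c) := by
    rintro b c ⟨C, hC⟩ ⟨D, hD⟩
    refine ⟨C + D, fun x => ?_⟩
    rw [add_smul, add_mul]
    exact (norm_add_le _ _).trans (add_le_add (hC x) (hD x))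
  have hmul : ∀ b c, P b → P c → P (b * c) := by
    rintro b c ⟨C, hC⟩ ⟨D, hD⟩
    refine ⟨|C| * D, fun x => ?_⟩
    rw [mul_smul, mul_assoc]
    exact (hC _).trans ((mul_le_mul_of_nonneg_right (le_abs_self C) (norm_nonneg _)).trans
      (mul_le_mul_of_nonneg_left (hD x) (abs_nonneg C)))
  have hscal : ∀ c : ℂ, P (algebraMap ℂ _ c) := fun c => ⟨‖c‖, fun x => by
    rw [algebraMap_smul, norm_smul]⟩
  have htl : ∀ F : TL δ ⊤ →ₐ[ℂ] TLTwoSided δ, (∀ i, P (F (TL.gen δ i))) → ∀ x, P (F x) := by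
    intro F hF x
    induction x using TL.induction with
    | hs c => rw [AlgHom.commutes]; exact hscal c
    | hg i => exact hF i
    | hm a b h1 h2 => rw [map_mul]; exact hmul _ _ h1 h2
    | ha a b h1 h2 => rw [map_add]; exact hadd _ _ h1 h2
  change P b
  induction b using TensorProduct.induction_on with
  | zero => simpa using hscal 0
  | add b c h1 h2 => exact hadd _ _ h1 h2
  | tmul b c =>
    have h1 := htl Algebra.TensorProduct.includeLeft (fun i => ⟨‖δ‖, fun x =>
      H.norm_le_of_eq_hookOp h (j := i.1) (by omega) x _ (twoSided_gen_left δ i.1 _)⟩) b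
    have h2 := htl Algebra.TensorProduct.includeRight (fun i => ⟨‖δ‖, fun x =>
      H.norm_le_of_eq_hookOp h (j := -(i.1 : ℤ) - 2) (by omega) x _ (twoSided_gen_right δ i.1 _)⟩) c
    have h3 := hmul _ _ h1 h2
    rwa [Algebra.TensorProduct.includeLeft_apply, Algebra.TensorProduct.includeRight_apply,
      Algebra.TensorProduct.tmul_mul_tmul, mul_one, one_mul] at h3

/-- The action on `V(w)` extends to the Hilbert space. -/
theorem IsSpinModel.exists_hilbert_rep (H : IsSpinModel δ γ w a z) (h : IsPositiveDefinite δ γ w) :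
    ∃ ρ : TLTwoSided δ →ₐ[ℂ] (HilbertCompletion h →L[ℂ] HilbertCompletion h),
      ∀ (b : TLTwoSided δ) (v : ↥(regularRep δ w)), ρ b (toHilbert h v) = toHilbert h (b • v) := by
  obtain ⟨ρ, hρ⟩ := exists_completion_algHom (Algebra.lsmul ℂ ℂ (PreHilbert h)) (H.exists_bound h)
  exact ⟨ρ, fun b v => hρ b (PreHilbert.of h v)⟩

end Bounded

end

/-! ### The orthogonal decomposition of the Hilbert space -/

noncomputable section

open PlanarDiagram ComplexConjugate

variable {δ : ℂ} {γ : ℝ} {w : PlanarDiagram} {a z : ℂ}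

/-- The embedding of `V(w)` into the Hilbert space, as a linear map. -/
def toHilbertLinear (h : IsPositiveDefinite δ γ w) : ↥(regularRep δ w) →ₗ[ℂ] HilbertCompletion h where
  toFun := toHilbert h
  map_add' x y := UniformSpace.Completion.coe_add (PreHilbert.of h x) (PreHilbert.of h y)
  map_smul' c x := UniformSpace.Completion.coe_smul c (PreHilbert.of h x)

theorem inner_toHilbert (h : IsPositiveDefinite δ γ w) (x y : ↥(regularRep δ w)) :
    inner ℂ (toHilbert h x) (toHilbert h y) = traceForm δ γ w (y : DiagramSpace) x :=
  UniformSpace.Completion.inner_coe (PreHilbert.of h x) (PreHilbert.of h y)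

/-- The copy of `V_k(w)` in the Hilbert space. -/
def IsSpinModel.hilbertImage (H : IsSpinModel δ γ w a z) (h : IsPositiveDefinite δ γ w) (k : ℤ) :
    Submodule ℂ (HilbertCompletion h) :=
  (((H.complement k).submoduleOf (regularRep δ w)).restrictScalars ℂ).map (toHilbertLinear h)

theorem IsSpinModel.mem_hilbertImage (H : IsSpinModel δ γ w a z) (h : IsPositiveDefinite δ γ w)
    {k : ℤ} {y : HilbertCompletion h} : y ∈ H.hilbertImage h k ↔
      ∃ x : ↥(regularRep δ w), (x : DiagramSpace) ∈ H.complement k ∧ toHilbert h x = y :=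
  Iff.rfl

/-- The subspace `H_k(w)`. -/
def IsSpinModel.hilbertPart (H : IsSpinModel δ γ w a z) (h : IsPositiveDefinite δ γ w) (k : ℤ) :
    Submodule ℂ (HilbertCompletion h) :=
  (H.hilbertImage h k).topologicalClosure

theorem IsSpinModel.mem_hilbertPart (H : IsSpinModel δ γ w a z) (h : IsPositiveDefinite δ γ w)
    {k : ℤ} {x : ↥(regularRep δ w)} (hx : (x : DiagramSpace) ∈ H.complement k) :
    toHilbertLinear h x ∈ H.hilbertPart h k :=
  Submodule.le_topologicalClosure _ ((H.mem_hilbertImage h).2 ⟨x, hx, rfl⟩)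

theorem IsSpinModel.hilbertPart_invariant (H : IsSpinModel δ γ w a z) (h : IsPositiveDefinite δ γ w)
    {ρ : TLTwoSided δ →ₐ[ℂ] (HilbertCompletion h →L[ℂ] HilbertCompletion h)}
    (hρ : ∀ (b : TLTwoSided δ) (v : ↥(regularRep δ w)), ρ b (toHilbert h v) = toHilbert h (b • v))
    (k : ℤ) (b : TLTwoSided δ) : ∀ v ∈ H.hilbertPart h k, ρ b v ∈ H.hilbertPart h k := by
  have h1 : Set.MapsTo (ρ b) (H.hilbertImage h k : Set (HilbertCompletion h)) (H.hilbertImage h k) := by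
    rintro v hv
    obtain ⟨x, hx, rfl⟩ := (H.mem_hilbertImage h).1 hv
    exact (H.mem_hilbertImage h).2 ⟨b • x, (H.complement k).smul_mem b hx, (hρ b x).symm⟩
  exact h1.closure (ρ b).continuous

/-- The part for `k` comes from vectors of I_k, which is contained in I_{l-2}, and the part for `l`
is orthogonal to I_{l-2} by construction. Orthogonality passes to closures. -/
theorem IsSpinModel.hilbertPart_isOrtho (H : IsSpinModel δ γ w a z) (h : IsPositiveDefinite δ γ w)
    {k l : ℤ} (hkl : k ≤ l - 2) : H.hilbertPart h k ⟂ H.hilbertPart h l := by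
  rw [Submodule.isOrtho_iff_le, IsSpinModel.hilbertPart, IsSpinModel.hilbertPart,
    Submodule.orthogonal_closure]
  refine Submodule.topologicalClosure_minimal _ ?_ (Submodule.isClosed_orthogonal _)
  rw [← Submodule.isOrtho_iff_le, Submodule.isOrtho_comm, Submodule.isOrtho_iff_inner_eq]
  intro u hu v hv
  obtain ⟨y, hy, rfl⟩ := (H.mem_hilbertImage h).1 hu
  obtain ⟨x, hx, rfl⟩ := (H.mem_hilbertImage h).1 hv
  rw [← inner_conj_symm, inner_toHilbert, hy.2 _ (strandIdeal_mono H.δ_ne hkl hx.1), map_zero]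

theorem IsSpinModel.orthogonalFamily (H : IsSpinModel δ γ w a z) (h : IsPositiveDefinite δ γ w)
    (n : ℕ) : OrthogonalFamily ℂ (fun k : {k : ℕ // k ≤ n ∧ k % 2 = n % 2} => ↥(H.hilbertPart h k.1))
      fun k => (H.hilbertPart h k.1).subtypeₗᵢ := by
  refine OrthogonalFamily.of_pairwise fun k l hkl => ?_
  have hne : (k : ℕ) ≠ l := fun h => hkl (Subtype.ext h)
  have := k.2
  have := l.2
  rcases lt_or_gt_of_ne hne with hlt | hlt
  · exact H.hilbertPart_isOrtho h (by omega)
  · exact (H.hilbertPart_isOrtho h (by omega)).symm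

/-- Splitting off one complement after another shows that V(w), which is I_n(w), already lies in the
sum of the parts, and V(w) is dense. -/
theorem IsSpinModel.isInternal (H : IsSpinModel δ γ w a z) (h : IsPositiveDefinite δ γ w) {n : ℕ}
    [DecidableEq {k : ℕ // k ≤ n ∧ k % 2 = n % 2}] (hw : w.numThrough = n) :
    DirectSum.IsInternal fun k : {k : ℕ // k ≤ n ∧ k % 2 = n % 2} => H.hilbertPart h k.1 := by
  have : Finite {k : ℕ // k ≤ n ∧ k % 2 = n % 2} :=
    Finite.of_injective (fun k => (⟨k.1, by omega⟩ : Fin (n + 1))) fun k l hkl =>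
      Subtype.ext (by simpa using hkl)
  refine isInternal_of_dense (fun k => Submodule.isClosed_topologicalClosure _)
    (H.orthogonalFamily h n) ?_
  have key : ∀ k : ℕ, k ≤ n → k % 2 = n % 2 → ∀ x : ↥(regularRep δ w),
      (x : DiagramSpace) ∈ strandIdeal δ w k → toHilbertLinear h x ∈
        ⨆ k : {k : ℕ // k ≤ n ∧ k % 2 = n % 2}, H.hilbertPart h k.1 := by
    intro k
    induction k using Nat.strong_induction_on with
    | _ k ih =>
    intro hk hkn x hx
    obtain ⟨u, hu, huo⟩ := H.exists_projection h ((k : ℤ) - 2) x.2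
    have huk := strandIdeal_mono H.δ_ne (by omega : (k : ℤ) - 2 ≤ k) hu
    have h0 : (x : DiagramSpace) - u ∈ H.complement k := ⟨sub_mem hx huk, huo⟩
    obtain ⟨v, hv⟩ : ∃ v : ↥(regularRep δ w), (v : DiagramSpace) = u := ⟨⟨u, hu.1⟩, rfl⟩
    rw [← hv] at h0 hu
    have h1 : toHilbertLinear h (x - v) ∈ H.hilbertPart h k := H.mem_hilbertPart h h0
    rw [← sub_add_cancel x v, map_add]
    refine add_mem (Submodule.mem_iSup_of_mem ⟨k, hk, hkn⟩ h1) ?_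
    by_cases hk2 : 2 ≤ k
    · refine ih (k - 2) (by omega) (by omega) (by omega) v ?_
      rwa [show ((k - 2 : ℕ) : ℤ) = (k : ℤ) - 2 by omega]
    -- For `k < 2` no diagram has at most `k - 2` through strands, so the induction ends.
    · have h2 : v = 0 := by
        by_contra hne
        have h3 : (DiagramSpace.coord (v : DiagramSpace)).support.Nonempty :=
          Finsupp.support_nonempty_iff.2 fun h0 =>
            hne (Subtype.ext (DiagramSpace.coord.map_eq_zero_iff.1 h0))
        obtain ⟨d, hd⟩ := h3
        obtain ⟨-, m, -, hm⟩ := (mem_strandIdeal_iff H.δ_ne).1 hu d hd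
        omega
      rw [h2, map_zero]
      exact zero_mem _
  have hall : ∀ x : ↥(regularRep δ w), toHilbertLinear h x ∈
      ⨆ k : {k : ℕ // k ≤ n ∧ k % 2 = n % 2}, H.hilbertPart h k.1 := fun x =>
    key n le_rfl rfl x ((mem_strandIdeal_iff H.δ_ne).2 fun d hd => by
      have hdV := coord_support_subset H.δ_ne x.2 d hd
      exact ⟨hdV, atMostThrough_of_le (d := w) ⟨n, hw, le_rfl⟩ (numThrough_le_of_mem_diagramsOf hdV)⟩)
  intro y _
  refine closure_mono ?_ (UniformSpace.Completion.denseRange_coe y)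
  rintro _ ⟨x, rfl⟩
  exact hall ((PreHilbert.of h).symm x)

theorem IsSpinModel.hilbertPart_eq_closure (H : IsSpinModel δ γ w a z) (h : IsPositiveDefinite δ γ w)
    (k : ℤ) : (H.hilbertPart h k : Set (HilbertCompletion h)) =
      closure (Set.range fun v => idealToHilbert h k (H.strandSection h k v)) := by
  rw [IsSpinModel.hilbertPart, Submodule.topologicalClosure_coe]
  congr 1
  ext y
  rw [SetLike.mem_coe, H.mem_hilbertImage]
  have hr := H.range_strandSection h k
  constructor
  · rintro ⟨x, hx, rfl⟩
    have h1 : (⟨x, hx.1⟩ : ↥(strandIdeal δ w k)) ∈ Set.range (H.strandSection h k) := by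
      rw [hr]; exact hx
    obtain ⟨v, hv⟩ := h1
    exact ⟨v, by simp only [hv]; rfl⟩
  · rintro ⟨v, rfl⟩
    have h1 : H.strandSection h k v ∈ Set.range (H.strandSection h k) := ⟨v, rfl⟩
    rw [hr] at h1
    exact ⟨Submodule.inclusion inf_le_left (H.strandSection h k v), h1, rfl⟩

end

/-! ### The theorem -/

theorem mainTheorem9 (q : ℂ) (hq0 : q ≠ 0) (hq : ∀ m : ℕ, 0 < m → q ^ m ≠ 1)
    (δ : ℝ) (hδ : (δ : ℂ) = q + q⁻¹) (hδ0 : 0 ≤ δ)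
    (w : PlanarDiagram) (n : ℕ) (hw : w.numThrough = n) (γ : ℝ) (hγ : 0 < γ) :
    -- the limits that define the inner product exist
    ((levels w).NeBot ∧
      ∀ x y : PlanarDiagram,
        basisDiagram x ∈ regularRep (δ : ℂ) w → basisDiagram y ∈ regularRep (δ : ℂ) w →
        (∀ᶠ m in levels w, (∃ z, IsRestriction m x z) ∧ ∃ z, IsRestriction m y z) ∧
        Filter.Tendsto (renormalizedPairing (δ : ℂ) γ w x y) (levels w)
          (nhds (limitPairing (δ : ℂ) γ w x y))) ∧
    -- the range in which it is positive definite
    (2 < δ → (2 ≤ n → γ < 1 / (4 * Real.cos (Real.pi / (n + 1)) ^ 2)) →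
      IsPositiveDefinite (δ : ℂ) γ w) ∧
    -- the decomposition of the completion, whenever it is positive definite
    ∀ h : IsPositiveDefinite (δ : ℂ) γ w,
      ∃ ρ : TLTwoSided (δ : ℂ) →ₐ[ℂ] (HilbertCompletion h →L[ℂ] HilbertCompletion h),
        (∀ (a : TLTwoSided (δ : ℂ)) (v : ↥(regularRep (δ : ℂ) w)),
          ρ a (toHilbert h v) = toHilbert h (a • v)) ∧
        ∃ K : {k : ℕ // k ≤ n ∧ k % 2 = n % 2} → Submodule ℂ (HilbertCompletion h),
          (∀ k, IsClosed (K k : Set (HilbertCompletion h))) ∧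
          (∀ k, ∀ a : TLTwoSided (δ : ℂ), ∀ v ∈ K k, ρ a v ∈ K k) ∧
          OrthogonalFamily ℂ (fun k => ↥(K k)) (fun k => (K k).subtypeₗᵢ) ∧
          DirectSum.IsInternal K ∧
          ∀ k : {k : ℕ // k ≤ n ∧ k % 2 = n % 2},
            IsSimpleModule (TLTwoSided (δ : ℂ)) (strandQuotient (δ : ℂ) w (k : ℕ)) ∧
            ∃ ι : strandQuotient (δ : ℂ) w (k : ℕ) →ₗ[TLTwoSided (δ : ℂ)]
                ↥(strandIdeal (δ : ℂ) w (k : ℕ)),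
              (∀ v, Submodule.Quotient.mk (ι v) = v) ∧
              (K k : Set (HilbertCompletion h)) =
                closure (Set.range fun v => idealToHilbert h (k : ℕ) (ι v)) := by
  -- If `δ` were zero, then `q ^ 2 = -1` and `q` would be a fourth root of unity.
  have hδne : (δ : ℂ) ≠ 0 := by
    rw [hδ]
    intro h
    have h1 : q ^ 2 = -1 := by
      have : q * (q + q⁻¹) = 0 := by rw [h, mul_zero]
      rw [mul_add, mul_inv_cancel₀ hq0] at this
      linear_combination this
    exact hq 4 (by norm_num) (by rw [show q ^ 4 = (q ^ 2) ^ 2 by ring, h1]; norm_num)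
  have hfin := PlanarDiagram.finite_throughStrands hw
  obtain ⟨u, hu0, hu⟩ := exists_inv_add_eq (c := (δ : ℂ))
  obtain ⟨a, hau⟩ := IsAlgClosed.exists_pow_nat_eq u (n := 2) (by norm_num)
  have ha : a ≠ 0 := by rintro rfl; apply hu0; rw [← hau]; norm_num
  have haδ : a ^ 2 + a⁻¹ ^ 2 = (δ : ℂ) := by rw [inv_pow, hau, hu]
  have hg : Real.sqrt γ ≠ 0 := (Real.sqrt_pos.2 hγ).ne'
  have hgg : γ = Real.sqrt γ ^ 2 := (Real.sq_sqrt hγ.le).symm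
  obtain ⟨z, hz0, hz⟩ := exists_inv_add_eq (c := ((Real.sqrt γ : ℝ) : ℂ)⁻¹)
  refine ⟨⟨levels_neBot hfin, fun x y hx hy => ?_⟩, fun hδ2 hγn => ?_, fun h => ?_⟩
  · rw [basisDiagram_mem_regularRep hδne] at hx hy
    obtain ⟨b, t, hwin, h1, h2⟩ := exists_common_window hfin hx hy
    have e1 := h1.agreesOff hwin.preserves
    have e2 := h2.agreesOff hwin.preserves
    constructor
    · filter_upwards [eventually_levels w (max b t)] with m hm
      obtain ⟨hm, r, hr⟩ := hm
      exact ⟨⟨_, hr.glue hwin.preserves e1 (by omega) (by omega)⟩,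
        ⟨_, hr.glue hwin.preserves e2 (by omega) (by omega)⟩⟩
    · rw [limitPairing_eq hfin ha haδ hδne hg hgg hz0 hz hwin.preserves e1 e2]
      exact tendsto_renormalizedPairing ha haδ hδne hg hgg hz0 hz hwin.preserves e1 e2
  -- Positivity needs a real parameter, which `δ > 2` provides; the other claims use the complex `a`
  -- chosen above. The limit form itself involves no such choice.
  · obtain ⟨a, ha, haδ⟩ := exists_real_parameter hδ2.le
    exact isPositiveDefinite ha haδ hγ hw fun k hk => coeffZero_pos hγ hγn hk
  · have H : IsSpinModel (δ : ℂ) γ w a z :=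
      { finite := hfin
        a_ne := ha
        z_ne := hz0
        loop := haδ
        δ_ne := hδne
        conj_δ := Complex.conj_ofReal δ
        pairing_eq := fun hw hx hy => limitPairing_eq hfin ha haδ hδne hg hgg hz0 hz hw hx hy
        self_ne := fun hw => spinPairing_self_ne_zero ha haδ hδne hz0 hg hz hw }
    obtain ⟨ρ, hρ⟩ := H.exists_hilbert_rep h
    exact ⟨ρ, hρ, fun k => H.hilbertPart h k.1, fun k => Submodule.isClosed_topologicalClosure _,
      fun k b v hv => H.hilbertPart_invariant h hρ k.1 b v hv, H.orthogonalFamily h n,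
      H.isInternal h hw, fun k => ⟨H.isSimpleModule h hw k.2.1 k.2.2, H.strandSection h k.1,
        H.mk_strandSection h k.1, H.hilbertPart_eq_closure h k.1⟩⟩
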